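/- **Conventions.** For a field $\mathbb F$ let $W(\mathbb F)$ be the Witt group of finite-rank non-degenerate symmetric bilinear forms over $\mathbb F$: two forms are identified if they become isomorphic after adding metabolic forms (forms with a totally isotropic subspace of half the dimension), and addition is orthogonal sum. For $a\in\mathbb F^{*}$ let $[a]\in W(\mathbb F)$ be the class of the rank-one form $(x,y)\mapsto axy$; $n\cdot[a]$ ($n\in\mathbb Z$) is the $n$-fold multiple, so that $-[a]=[-a]$. For a prime $p$ let $\partial_p:W(\mathbb Q)\to W(\mathbb F_p)$ be the residue homomorphism determined by $\partial_p[u]=0$ and $\partial_p[pu]=[\bar u]$ for rational numbers $u$ that are $p$-adic units. Let $K\subset S^3$ be a (tame) knot, $S$ a Seifert surface of $K$ and $V$ a matrix of its Seifert form $V(\alpha,\beta)=\ell k(a,b^+)$ on $H_1(S;\mathbb Z)$. The symmetric form $V+V^{\tau}$ is non-degenerate; put $$W(K)=[V+V^{\tau}]\in W(\mathbb Q),\qquad \det K=|\det(V+V^{\tau})|,\qquad \sigma(K)=\text{the signature of }V+V^{\tau},$$ and let the Witt span of $K$ be $$ws(K)=\min\{\operatorname{rank}B \;:\; \partial_p[B]=\partial_p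 W(K)\text{ for all primes }p\},$$ where $B$ ranges over all finite-rank non-degenerate symmetric bilinear forms over $\mathbb Q$. **Theorem.** For every knot $K$ one has $ws(K)\le 1$ if and only if $$W(K)=[d]\oplus\bigl(n\cdot[1]\bigr)$$ for some $d\in\{\det K,-\det K\}$, with $n=\sigma(K)-\operatorname{Sign}(d)$. Moreover, for a knot $K$ with $ws(K)\le 1$: if $\det K$ is a square then $ws(K)=0$, and otherwise $ws(K)=1$. -/

import Mathlib

namespace KnotWitt

set_option linter.unusedSectionVars false

section WittGroup

variable {F : Type*} [Field F]

/-- Isomorphism of the bilinear forms with Gram matrices `M` and `N`: congruence through an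
invertible matrix. -/
def MatCongr {ι κ : Type*} [Fintype ι] [Fintype κ] [DecidableEq ι] [DecidableEq κ]
    (M : Matrix ι ι F) (N : Matrix κ κ F) : Prop :=
  ∃ (P : Matrix ι κ F) (Q : Matrix κ ι F), P * Q = 1 ∧ Q * P = 1 ∧ P.transpose * M * P = N

/-- The form with Gram matrix `M` is metabolic: it has a totally isotropic subspace of half the
dimension. -/
def IsMetabolic {ι : Type*} [Fintype ι] (M : Matrix ι ι F) : Prop :=
  ∃ L : Submodule F (ι → F), 2 * Module.finrank F L = Fintype.card ι ∧
    ∀ x ∈ L, ∀ y ∈ L, x ⬝ᵥ M.mulVec y = 0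

/-- The orthogonal direct sum of two forms, in terms of Gram matrices. -/
def dsum {ι κ : Type*} (M : Matrix ι ι F) (N : Matrix κ κ F) : Matrix (ι ⊕ κ) (ι ⊕ κ) F :=
  Matrix.fromBlocks M 0 0 N

section Congr

variable {ι κ μ ν : Type*} [Fintype ι] [Fintype κ] [Fintype μ] [Fintype ν]
  [DecidableEq ι] [DecidableEq κ] [DecidableEq μ] [DecidableEq ν]

theorem MatCongr.refl (M : Matrix ι ι F) : MatCongr M M :=
  ⟨1, 1, by simp, by simp, by simp⟩

theorem MatCongr.symm {M : Matrix ι ι F} {N : Matrix κ κ F} (h : MatCongr M N) :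
    MatCongr N M := by
  obtain ⟨P, Q, h1, h2, h3⟩ := h
  refine ⟨Q, P, h2, h1, ?_⟩
  have h4 : Q.transpose * P.transpose = 1 := by
    rw [← Matrix.transpose_mul, h1, Matrix.transpose_one]
  calc Q.transpose * N * Q = (Q.transpose * P.transpose) * M * (P * Q) := by
        rw [← h3]; simp only [Matrix.mul_assoc]
    _ = M := by rw [h4, h1]; simp

theorem MatCongr.trans {M : Matrix ι ι F} {N : Matrix κ κ F} {R : Matrix μ μ F}
    (h : MatCongr M N) (h' : MatCongr N R) : MatCongr M R := by
  obtain ⟨P, Q, h1, h2, h3⟩ := h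
  obtain ⟨P', Q', h1', h2', h3'⟩ := h'
  refine ⟨P * P', Q' * Q, ?_, ?_, ?_⟩
  · calc P * P' * (Q' * Q) = P * (P' * Q') * Q := by simp only [Matrix.mul_assoc]
      _ = 1 := by rw [h1']; simpa using h1
  · calc Q' * Q * (P * P') = Q' * (Q * P) * P' := by simp only [Matrix.mul_assoc]
      _ = 1 := by rw [h2]; simpa using h2'
  · rw [← h3', ← h3, Matrix.transpose_mul]; simp only [Matrix.mul_assoc]

theorem MatCongr.submatrix (M : Matrix ι ι F) (e : κ ≃ ι) : MatCongr M (M.submatrix e e) := by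
  refine ⟨(1 : Matrix ι ι F).submatrix id e, (1 : Matrix ι ι F).submatrix e id, ?_, ?_, ?_⟩
  · rw [Matrix.submatrix_mul_equiv]; simp
  · rw [← Matrix.submatrix_mul _ _ _ id _ Function.bijective_id]; simp
  · ext i j
    simp [Matrix.mul_apply, Matrix.one_apply]

theorem MatCongr.dsum {M : Matrix ι ι F} {N : Matrix κ κ F} {M' : Matrix μ μ F}
    {N' : Matrix ν ν F} (h : MatCongr M N) (h' : MatCongr M' N') :
    MatCongr (dsum M M') (dsum N N') := by
  obtain ⟨P, Q, h1, h2, h3⟩ := h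
  obtain ⟨P', Q', h1', h2', h3'⟩ := h'
  refine ⟨Matrix.fromBlocks P 0 0 P', Matrix.fromBlocks Q 0 0 Q', ?_, ?_, ?_⟩
  · simp [Matrix.fromBlocks_multiply, h1, h1']
  · simp [Matrix.fromBlocks_multiply, h2, h2']
  · simp [KnotWitt.dsum, Matrix.fromBlocks_transpose, Matrix.fromBlocks_multiply, h3, h3']

theorem MatCongr.comm (M : Matrix ι ι F) (N : Matrix κ κ F) :
    MatCongr (KnotWitt.dsum M N) (KnotWitt.dsum N M) := by
  convert MatCongr.submatrix (KnotWitt.dsum M N) (Equiv.sumComm κ ι) using 1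
  ext (i | i) (j | j) <;> rfl

theorem MatCongr.assoc (M : Matrix ι ι F) (N : Matrix κ κ F) (R : Matrix μ μ F) :
    MatCongr (KnotWitt.dsum (KnotWitt.dsum M N) R) (KnotWitt.dsum M (KnotWitt.dsum N R)) := by
  convert MatCongr.submatrix (KnotWitt.dsum (KnotWitt.dsum M N) R)
    (Equiv.sumAssoc ι κ μ).symm using 1
  ext (i | i | i) (j | j | j) <;> rfl

theorem MatCongr.swap (M : Matrix ι ι F) (N : Matrix κ κ F) (M' : Matrix μ μ F)
    (N' : Matrix ν ν F) :
    MatCongr (KnotWitt.dsum (KnotWitt.dsum M N) (KnotWitt.dsum M' N'))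
      (KnotWitt.dsum (KnotWitt.dsum M M') (KnotWitt.dsum N N')) := by
  convert MatCongr.submatrix (KnotWitt.dsum (KnotWitt.dsum M N) (KnotWitt.dsum M' N'))
    (Equiv.sumSumSumComm ι μ κ ν) using 1
  ext ((i | i) | (i | i)) ((j | j) | (j | j)) <;> rfl

theorem IsMetabolic.congr {M : Matrix ι ι F} {N : Matrix κ κ F} (hM : IsMetabolic M)
    (h : MatCongr M N) : IsMetabolic N := by
  obtain ⟨L, hL, hiso⟩ := hM
  obtain ⟨P, Q, h1, h2, h3⟩ := h.symm
  let e : (ι → F) ≃ₗ[F] (κ → F) := LinearEquiv.ofLinearMap (Matrix.mulVecLin P) (Matrix.mulVecLin Q)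
    (by rw [← Matrix.mulVecLin_mul, h1, Matrix.mulVecLin_one])
    (by rw [← Matrix.mulVecLin_mul, h2, Matrix.mulVecLin_one])
  have hc : Fintype.card κ = Fintype.card ι := by
    have := e.finrank_eq
    simpa using this.symm
  refine ⟨L.map e.toLinearMap, ?_, ?_⟩
  · rw [LinearEquiv.finrank_map_eq, hL, hc]
  · rintro _ ⟨x, hx, rfl⟩ _ ⟨y, hy, rfl⟩
    have := hiso x hx y hy
    rw [← h3] at this
    change P.mulVec x ⬝ᵥ N.mulVec (P.mulVec y) = 0
    rw [← this, Matrix.mul_assoc, ← Matrix.mulVec_mulVec, ← Matrix.mulVec_mulVec,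
      Matrix.dotProduct_mulVec x, Matrix.vecMul_transpose]

theorem IsMetabolic.dsum {M : Matrix ι ι F} {N : Matrix κ κ F} (hM : IsMetabolic M)
    (hN : IsMetabolic N) : IsMetabolic (dsum M N) := by
  obtain ⟨L, hL, hi⟩ := hM
  obtain ⟨L', hL', hi'⟩ := hN
  let e := (LinearEquiv.sumArrowLequivProdArrow ι κ F F).symm
  refine ⟨(L.prod L').map e.toLinearMap, ?_, ?_⟩
  · have : Module.finrank F (L.prod L') = Module.finrank F L + Module.finrank F L' := by
      have hr : L.prod L' = LinearMap.range (L.subtype.prodMap L'.subtype) := by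
        rw [LinearMap.range_prodMap, Submodule.range_subtype, Submodule.range_subtype]
      rw [hr, LinearMap.finrank_range_of_inj
        (Prod.map_injective.2 ⟨L.injective_subtype, L'.injective_subtype⟩), Module.finrank_prod]
    rw [LinearEquiv.finrank_map_eq, this, Fintype.card_sum]
    omega
  · rintro _ ⟨⟨x, x'⟩, ⟨hx, hx'⟩, rfl⟩ _ ⟨⟨y, y'⟩, ⟨hy, hy'⟩, rfl⟩
    have h1 := hi x hx y hy
    have h2 := hi' x' hx' y' hy'
    have ex : e (x, x') = Sum.elim x x' := rfl
    have ey : e (y, y') = Sum.elim y y' := rfl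
    change e (x, x') ⬝ᵥ Matrix.mulVec _ (e (y, y')) = 0
    rw [ex, ey, KnotWitt.dsum, Matrix.fromBlocks_mulVec]
    simp [h1, h2]

theorem IsMetabolic.neg {M : Matrix ι ι F} (hM : IsMetabolic M) : IsMetabolic (-M) := by
  obtain ⟨L, hL, hi⟩ := hM
  exact ⟨L, hL, fun x hx y hy => by rw [Matrix.neg_mulVec, dotProduct_neg, hi x hx y hy, neg_zero]⟩

theorem MatCongr.neg {M : Matrix ι ι F} {N : Matrix κ κ F} (h : MatCongr M N) :
    MatCongr (-M) (-N) := by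
  obtain ⟨P, Q, h1, h2, h3⟩ := h
  exact ⟨P, Q, h1, h2, by rw [← h3]; simp⟩

theorem dsum_neg_neg (M : Matrix ι ι F) (N : Matrix κ κ F) :
    KnotWitt.dsum (-M) (-N) = -KnotWitt.dsum M N := by
  simp [KnotWitt.dsum, Matrix.fromBlocks_neg]

theorem isMetabolic_dsum_neg (M : Matrix ι ι F) : IsMetabolic (dsum M (-M)) := by
  let f : (ι → F) →ₗ[F] (ι ⊕ ι → F) :=
    (LinearEquiv.sumArrowLequivProdArrow ι ι F F).symm.toLinearMap ∘ₗ
      (LinearMap.id.prod LinearMap.id)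
  have hf : ∀ x, f x = Sum.elim x x := fun x => rfl
  have hinj : Function.Injective f := by
    intro x y h
    rw [hf, hf] at h
    ext i
    simpa using congrFun h (Sum.inl i)
  refine ⟨LinearMap.range f, ?_, ?_⟩
  · rw [LinearMap.finrank_range_of_inj hinj]; simp; omega
  · rintro _ ⟨x, rfl⟩ _ ⟨y, rfl⟩
    rw [hf, hf, KnotWitt.dsum, Matrix.fromBlocks_mulVec]
    simp [Matrix.neg_mulVec]

end Congr

/-- A non-degenerate symmetric bilinear form of finite rank over `F`, given by its Gram matrix
on `F ^ rank`. -/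
structure NForm (F : Type*) [Field F] where
  rank : ℕ
  mat : Matrix (Fin rank) (Fin rank) F
  symm : mat.IsSymm
  nondeg : mat.det ≠ 0

namespace NForm

/-- The orthogonal sum of two forms. -/
def add (A B : NForm F) : NForm F where
  rank := A.rank + B.rank
  mat := (dsum A.mat B.mat).submatrix finSumFinEquiv.symm finSumFinEquiv.symm
  symm := by
    refine Matrix.IsSymm.submatrix ?_ _
    exact Matrix.IsSymm.fromBlocks A.symm (by simp) B.symm
  nondeg := by
    rw [Matrix.det_submatrix_equiv_self]
    simpa [dsum] using ⟨A.nondeg, B.nondeg⟩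

/-- The form `(V, -B)`. -/
def neg (A : NForm F) : NForm F where
  rank := A.rank
  mat := -A.mat
  symm := A.symm.neg
  nondeg := by
    rw [Matrix.det_neg]
    exact mul_ne_zero (pow_ne_zero _ (by simp)) A.nondeg

/-- The form of rank zero. -/
def zero (F : Type*) [Field F] : NForm F where
  rank := 0
  mat := 0
  symm := by simp
  nondeg := by simp

theorem add_congr (A B : NForm F) : MatCongr (dsum A.mat B.mat) (A.add B).mat :=
  MatCongr.submatrix _ _

theorem metabolic_zero : IsMetabolic (zero F).mat :=
  ⟨⊥, by rw [finrank_bot]; rfl, by simp⟩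

/-- Witt equivalence: isomorphism after adding metabolic forms. -/
def WittEquiv (A B : NForm F) : Prop :=
  ∃ C D : NForm F, IsMetabolic C.mat ∧ IsMetabolic D.mat ∧
    MatCongr (dsum A.mat C.mat) (dsum B.mat D.mat)

theorem WittEquiv.of_congr {A B : NForm F} (h : MatCongr A.mat B.mat) : WittEquiv A B :=
  ⟨zero F, zero F, metabolic_zero, metabolic_zero, h.dsum (MatCongr.refl _)⟩

theorem WittEquiv.trans {A B C : NForm F} (h : WittEquiv A B) (h' : WittEquiv B C) :
    WittEquiv A C := by
  obtain ⟨M, N, hM, hN, h⟩ := h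
  obtain ⟨M', N', hM', hN', h'⟩ := h'
  refine ⟨M.add M', N.add N', (hM.dsum hM').congr (add_congr _ _),
    (hN.dsum hN').congr (add_congr _ _), ?_⟩
  have s1 : MatCongr (dsum A.mat (M.add M').mat) (dsum (dsum A.mat M.mat) M'.mat) :=
    ((MatCongr.refl _).dsum (add_congr _ _).symm).trans (MatCongr.assoc _ _ _).symm
  have s2 : MatCongr (dsum (dsum A.mat M.mat) M'.mat) (dsum (dsum B.mat N.mat) M'.mat) :=
    h.dsum (MatCongr.refl _)
  have s3 : MatCongr (dsum (dsum B.mat N.mat) M'.mat) (dsum (dsum B.mat M'.mat) N.mat) :=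
    ((MatCongr.assoc _ _ _).trans ((MatCongr.refl _).dsum (MatCongr.comm _ _))).trans
      (MatCongr.assoc _ _ _).symm
  have s4 : MatCongr (dsum (dsum B.mat M'.mat) N.mat) (dsum (dsum C.mat N'.mat) N.mat) :=
    h'.dsum (MatCongr.refl _)
  have s5 : MatCongr (dsum (dsum C.mat N'.mat) N.mat) (dsum C.mat (N.add N').mat) :=
    (MatCongr.assoc _ _ _).trans ((MatCongr.refl _).dsum
      ((MatCongr.comm _ _).trans (add_congr _ _)))
  exact (((s1.trans s2).trans s3).trans s4).trans s5

/-- Witt equivalence as a setoid. -/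
instance wittSetoid (F : Type*) [Field F] : Setoid (NForm F) where
  r := WittEquiv
  iseqv :=
    { refl := fun _ => .of_congr (MatCongr.refl _)
      symm := fun ⟨C, D, hC, hD, h⟩ => ⟨D, C, hD, hC, h.symm⟩
      trans := .trans }

theorem WittEquiv.add {A A' B B' : NForm F} (h : WittEquiv A A') (h' : WittEquiv B B') :
    WittEquiv (A.add B) (A'.add B') := by
  obtain ⟨M, N, hM, hN, h⟩ := h
  obtain ⟨M', N', hM', hN', h'⟩ := h'
  refine ⟨M.add M', N.add N', (hM.dsum hM').congr (add_congr _ _),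
    (hN.dsum hN').congr (add_congr _ _), ?_⟩
  exact (((add_congr _ _).symm.dsum (add_congr _ _).symm).trans (MatCongr.swap _ _ _ _)).trans
    ((h.dsum h').trans ((MatCongr.swap _ _ _ _).trans ((add_congr _ _).dsum (add_congr _ _))))

theorem WittEquiv.of_metabolic {A B : NForm F} (hA : IsMetabolic A.mat) (hB : IsMetabolic B.mat) :
    WittEquiv A B :=
  ⟨B, A, hB, hA, MatCongr.comm _ _⟩

theorem WittEquiv.neg {A B : NForm F} (h : WittEquiv A B) : WittEquiv A.neg B.neg := by
  obtain ⟨M, N, hM, hN, h⟩ := h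
  refine ⟨M.neg, N.neg, hM.neg, hN.neg, ?_⟩
  change MatCongr (dsum (-A.mat) (-M.mat)) (dsum (-B.mat) (-N.mat))
  rw [dsum_neg_neg, dsum_neg_neg]
  exact h.neg

end NForm

/-- The additive group of the Witt ring `W(F)`. -/
def WittGroup (F : Type*) [Field F] : Type _ := Quotient (NForm.wittSetoid F)

/-- The Witt class `[B]` of a form. -/
def NForm.cls (A : NForm F) : WittGroup F := Quotient.mk (NForm.wittSetoid F) A

theorem NForm.cls_eq_of_congr {A B : NForm F} (h : MatCongr A.mat B.mat) : A.cls = B.cls :=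
  Quotient.sound (NForm.WittEquiv.of_congr h)

instance : Zero (WittGroup F) := ⟨(NForm.zero F).cls⟩

instance : Add (WittGroup F) := ⟨Quotient.map₂ NForm.add (fun _ _ h _ _ h' => h.add h')⟩

instance : Neg (WittGroup F) := ⟨Quotient.map NForm.neg (fun _ _ h => h.neg)⟩

theorem WittGroup.add_zero' (a : WittGroup F) : a + 0 = a := by
  obtain ⟨A⟩ := a
  refine NForm.cls_eq_of_congr ((NForm.add_congr A (NForm.zero F)).symm.trans ?_)
  have : IsEmpty (Fin (NForm.zero F).rank) := inferInstanceAs (IsEmpty (Fin 0))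
  convert (MatCongr.submatrix A.mat (Equiv.sumEmpty (Fin A.rank) (Fin (NForm.zero F).rank)))
    |>.symm using 1
  ext (i | i) (j | j)
  · rfl
  · exact j.elim0
  · exact i.elim0
  · exact i.elim0

theorem WittGroup.add_comm' (a b : WittGroup F) : a + b = b + a := by
  obtain ⟨A⟩ := a
  obtain ⟨B⟩ := b
  exact NForm.cls_eq_of_congr <|
    (NForm.add_congr _ _).symm.trans ((MatCongr.comm _ _).trans (NForm.add_congr _ _))

instance : AddCommGroup (WittGroup F) where
  nsmul := nsmulRec
  zsmul := zsmulRec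
  add_assoc := by
    rintro ⟨A⟩ ⟨B⟩ ⟨C⟩
    exact NForm.cls_eq_of_congr <|
      ((NForm.add_congr _ _).symm.trans ((NForm.add_congr _ _).symm.dsum (MatCongr.refl _))).trans
      ((MatCongr.assoc _ _ _).trans
        (((MatCongr.refl _).dsum (NForm.add_congr _ _)).trans (NForm.add_congr _ _)))
  zero_add a := by rw [WittGroup.add_comm', WittGroup.add_zero']
  add_zero := WittGroup.add_zero'
  neg_add_cancel := by
    rintro ⟨A⟩
    refine Quotient.sound (NForm.WittEquiv.of_metabolic ?_ NForm.metabolic_zero)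
    exact (isMetabolic_dsum_neg A.mat).congr ((MatCongr.comm _ _).trans (NForm.add_congr A.neg A))
  add_comm := WittGroup.add_comm'

open scoped Classical in
/-- The Witt class of the form on `F ^ n` with Gram matrix `M`. A matrix that is not symmetric or
is singular has no Witt class and is given the value `0`. -/
noncomputable def wittClass {n : ℕ} (M : Matrix (Fin n) (Fin n) F) : WittGroup F :=
  if h : M.IsSymm ∧ M.det ≠ 0 then (NForm.mk n M h.1 h.2).cls else 0

/-- The class `[a]` of the rank one form `⟨a⟩(x, y) = a x y`, for `a ≠ 0`. -/
noncomputable def rankOne (a : F) : WittGroup F := wittClass !![a]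

theorem wittClass_eq (A : NForm F) : wittClass A.mat = A.cls := by
  rw [wittClass, dif_pos ⟨A.symm, A.nondeg⟩]

/-- The form `⟨w 0⟩ ⊕ ⋯ ⊕ ⟨w (n - 1)⟩`. -/
def diagForm {n : ℕ} (w : Fin n → F) (hw : ∀ i, w i ≠ 0) : NForm F where
  rank := n
  mat := Matrix.diagonal w
  symm := Matrix.isSymm_diagonal w
  nondeg := by
    rw [Matrix.det_diagonal]
    exact Finset.prod_ne_zero_iff.2 fun i _ => hw i

theorem diagonal_eq_single (a : F) : !![a] = Matrix.diagonal ![a] := by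
  ext i j
  fin_cases i; fin_cases j; simp

theorem rankOne_eq (a : F) (ha : a ≠ 0) : rankOne a = (diagForm ![a] (by simpa)).cls := by
  rw [rankOne, diagonal_eq_single]
  exact wittClass_eq (diagForm ![a] (by simpa))

theorem cls_diagForm {n : ℕ} (w : Fin n → F) (hw : ∀ i, w i ≠ 0) :
    (diagForm w hw).cls = ∑ i, rankOne (w i) := by
  induction n with
  | zero =>
    rw [Finset.univ_eq_empty, Finset.sum_empty]
    refine NForm.cls_eq_of_congr (B := NForm.zero F) ?_
    change MatCongr (Matrix.diagonal w) (0 : Matrix (Fin 0) (Fin 0) F)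
    rw [Subsingleton.elim (Matrix.diagonal w) 0]
    exact MatCongr.refl _
  | succ n ih =>
    rw [Fin.sum_univ_castSucc, ← ih (fun i => w i.castSucc) (fun i => hw _),
      rankOne_eq _ (hw _)]
    have hm : MatCongr (Matrix.diagonal w) (dsum (Matrix.diagonal fun i : Fin n => w i.castSucc)
        (Matrix.diagonal ![w (Fin.last n)])) := by
      rw [dsum, Matrix.fromBlocks_diagonal]
      have h := MatCongr.submatrix (Matrix.diagonal w) (finSumFinEquiv (m := n) (n := 1))
      rw [Matrix.submatrix_diagonal_equiv] at h
      convert h using 2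
      ext (i | i)
      · rfl
      · fin_cases i; rfl
    exact NForm.cls_eq_of_congr (MatCongr.trans hm (NForm.add_congr
      (diagForm (fun i : Fin n => w i.castSucc) (fun i => hw _)) (diagForm ![w (Fin.last n)] _)))

theorem rankOne_mul_sq (a c : F) (ha : a ≠ 0) (hc : c ≠ 0) : rankOne (c ^ 2 * a) = rankOne a := by
  rw [rankOne_eq a ha, rankOne_eq _ (mul_ne_zero (pow_ne_zero 2 hc) ha)]
  refine (NForm.cls_eq_of_congr ?_).symm
  change MatCongr (Matrix.diagonal ![a]) (Matrix.diagonal ![c ^ 2 * a])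
  refine ⟨Matrix.diagonal ![c], Matrix.diagonal ![c⁻¹], ?_, ?_, ?_⟩
  · ext i j; fin_cases i; fin_cases j; simp [hc]
  · ext i j; fin_cases i; fin_cases j; simp [hc]
  · ext i j; fin_cases i; fin_cases j; simp; ring

theorem neg_rankOne (a : F) (ha : a ≠ 0) : -rankOne a = rankOne (-a) := by
  rw [rankOne_eq a ha, rankOne_eq _ (neg_ne_zero.2 ha)]
  refine NForm.cls_eq_of_congr (A := (diagForm ![a] (by simpa)).neg) ?_
  have hm : -Matrix.diagonal ![a] = Matrix.diagonal ![-a] := by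
    ext i j
    fin_cases i; fin_cases j; simp
  change MatCongr (-Matrix.diagonal ![a]) (Matrix.diagonal ![-a])
  rw [hm]
  exact MatCongr.refl _

theorem NForm.cls_eq_zero {A : NForm F} (h : IsMetabolic A.mat) : A.cls = 0 :=
  Quotient.sound (NForm.WittEquiv.of_metabolic h NForm.metabolic_zero)

theorem NForm.exists_metabolic_add {A : NForm F} (h : A.cls = 0) :
    ∃ C : NForm F, IsMetabolic C.mat ∧ IsMetabolic (dsum A.mat C.mat) := by
  obtain ⟨C, D, hC, hD, h⟩ : NForm.WittEquiv A (NForm.zero F) := Quotient.exact h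
  exact ⟨C, hC, (NForm.metabolic_zero.dsum hD).congr h.symm⟩

theorem NForm.exists_diag [Invertible (2 : F)] (A : NForm F) :
    ∃ (n : ℕ) (w : Fin n → F), (∀ i, w i ≠ 0) ∧ MatCongr A.mat (Matrix.diagonal w) := by
  have hs : (Matrix.toBilin' A.mat).IsSymm := by
    refine ⟨fun x y => ?_⟩
    simp only [Matrix.toBilin'_apply']
    rw [Matrix.dotProduct_mulVec, dotProduct_comm, ← Matrix.mulVec_transpose, A.symm.eq]
  obtain ⟨v, hv⟩ := LinearMap.BilinForm.exists_orthogonal_basis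
    (LinearMap.BilinForm.isSymm_iff.1 hs)
  have hc : MatCongr A.mat (Matrix.diagonal fun i => Matrix.toBilin' A.mat (v i) (v i)) := by
    refine ⟨(Pi.basisFun F _).toMatrix v, v.toMatrix (Pi.basisFun F _),
      Module.Basis.toMatrix_mul_toMatrix_flip _ _, Module.Basis.toMatrix_mul_toMatrix_flip _ _, ?_⟩
    have h := LinearMap.BilinForm.toMatrix_mul_basis_toMatrix (Pi.basisFun F (Fin A.rank)) v
      (Matrix.toBilin' A.mat)
    rw [LinearMap.BilinForm.toMatrix_basisFun, LinearMap.BilinForm.toMatrix'_toBilin'] at h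
    rw [h]
    ext i j
    rw [LinearMap.BilinForm.toMatrix_apply, Matrix.diagonal_apply]
    split_ifs with hij
    · rw [hij]
    · exact hv hij
  refine ⟨_, _, ?_, hc⟩
  obtain ⟨P, Q, h1, h2, h3⟩ := hc.symm
  intro i hi
  apply A.nondeg
  rw [← h3, ← Matrix.exists_mulVec_eq_zero_iff]
  have hP : P.mulVec (Q.mulVec (Pi.single i 1)) = Pi.single i 1 := by
    rw [Matrix.mulVec_mulVec, h1, Matrix.one_mulVec]
  refine ⟨Q.mulVec (Pi.single i 1), fun h0 => ?_, ?_⟩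
  · rw [h0, Matrix.mulVec_zero] at hP
    simpa using congrFun hP i
  · rw [← Matrix.mulVec_mulVec, hP, ← Matrix.mulVec_mulVec]
    have : (Matrix.diagonal fun i => Matrix.toBilin' A.mat (v i) (v i)).mulVec
        (Pi.single i 1) = 0 := by
      ext k
      rw [Matrix.mulVec_diagonal]
      by_cases hk : k = i
      · subst hk; rw [hi]; simp
      · simp [hk]
    rw [this, Matrix.mulVec_zero]

end WittGroup

section Residue

theorem diag_form_apply {F : Type*} [Field F] {ι : Type*} [Fintype ι] [DecidableEq ι]
    (D x y : ι → F) : x ⬝ᵥ (Matrix.diagonal D).mulVec y = ∑ i, x i * (D i * y i) := by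
  simp [dotProduct, Matrix.mulVec_diagonal]

theorem finrank_orthogonal_toBilin' {F : Type*} [Field F] {ι : Type*} [Fintype ι] [DecidableEq ι]
    (M : Matrix ι ι F) (hM : M.det ≠ 0) (L : Submodule F (ι → F)) :
    Module.finrank F ((Matrix.toBilin' M).orthogonal L) =
      Fintype.card ι - Module.finrank F L := by
  rw [LinearMap.BilinForm.finrank_orthogonal]
  · simp
  · exact LinearMap.BilinForm.nondegenerate_toBilin'_of_det_ne_zero' M hM

/-- If a diagonal form with entries prime to `p` or prime to `p` divided by `p` is metabolic over
`ℚ`, then so is the reduction modulo `p` of the second part. -/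
theorem metabolic_residue (p : ℕ) [hp : Fact p.Prime] {n : ℕ} (u : Fin n → ℤ)
    (hu : ∀ i, ¬ (p : ℤ) ∣ u i) (J : Fin n → Prop) [DecidablePred J]
    (h : IsMetabolic (Matrix.diagonal fun i => if J i then (u i : ℚ) / p else (u i : ℚ))) :
    IsMetabolic (Matrix.diagonal fun i : {i // J i} => (u i : ZMod p)) := by
  obtain ⟨W, hW, hiso⟩ := h
  have hp0 : (p : ℚ) ≠ 0 := by exact_mod_cast hp.out.ne_zero
  have hu0 : ∀ i, (u i : ℚ) ≠ 0 := fun i h0 => hu i (by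
    rw [Int.cast_eq_zero.1 h0]; exact dvd_zero _)
  have hup : ∀ i, (u i : ZMod p) ≠ 0 := fun i h0 => hu i ((ZMod.intCast_zmod_eq_zero_iff_dvd _ _).1 h0)
  set D : Fin n → ℚ := fun i => if J i then (u i : ℚ) / p else (u i : ℚ) with hD
  have hD0 : ∀ i, D i ≠ 0 := by
    intro i
    simp only [hD]
    split_ifs
    · exact div_ne_zero (hu0 i) hp0
    · exact hu0 i
  have hdet : (Matrix.diagonal D).det ≠ 0 := by
    rw [Matrix.det_diagonal]
    exact Finset.prod_ne_zero_iff.2 fun i _ => hD0 i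
  have hmax : ∀ x : Fin n → ℚ, (∀ y ∈ W, ∑ i, y i * (D i * x i) = 0) → x ∈ W := by
    have hle : W ≤ (Matrix.toBilin' (Matrix.diagonal D)).orthogonal W := by
      intro x hx y hy
      change Matrix.toBilin' _ y x = 0
      rw [Matrix.toBilin'_apply']
      exact hiso y hy x hx
    have heq := Submodule.eq_of_le_of_finrank_eq hle (by
      rw [finrank_orthogonal_toBilin' _ hdet]; omega)
    intro x hx
    rw [heq]
    intro y hy
    change Matrix.toBilin' _ y x = 0
    rw [Matrix.toBilin'_apply', diag_form_apply]
    exact hx y hy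
  let cast : (Fin n → ℤ) →+ (Fin n → ℚ) := (Int.castAddHom ℚ).compLeft (Fin n)
  let N : Submodule ℤ (Fin n → ℤ) := (W.toAddSubgroup.comap cast).toIntSubmodule
  have hN : ∀ y : Fin n → ℤ, y ∈ N ↔ (fun i => (y i : ℚ)) ∈ W := fun y => Iff.rfl
  have htf : Module.IsTorsionFree ℤ ((Fin n → ℤ) ⧸ N) := by
    refine Module.IsTorsionFree.of_smul_eq_zero fun r m hrm => ?_
    obtain ⟨m, rfl⟩ := N.mkQ_surjective m
    by_cases hr : r = 0
    · exact Or.inl hr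
    right
    rw [← map_smul, Submodule.mkQ_apply, Submodule.Quotient.mk_eq_zero, hN] at hrm
    rw [Submodule.mkQ_apply, Submodule.Quotient.mk_eq_zero, hN]
    have := W.smul_mem ((r : ℚ)⁻¹) hrm
    convert this using 1
    ext i
    have : (r : ℚ) ≠ 0 := by exact_mod_cast hr
    simp [this]
  obtain ⟨s, hs⟩ := Module.projective_lifting_property N.mkQ LinearMap.id N.mkQ_surjective
  have hs' : ∀ y, y - s (N.mkQ y) ∈ N := by
    intro y
    rw [← Submodule.Quotient.mk_eq_zero, ← Submodule.mkQ_apply, map_sub]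
    have := LinearMap.congr_fun hs (N.mkQ y)
    simp only [LinearMap.comp_apply, LinearMap.id_apply] at this
    rw [this, sub_self]
  let red : (Fin n → ℤ) →+ ({i // J i} → ZMod p) :=
    { toFun := fun y j => (y j : ZMod p)
      map_zero' := by ext; simp
      map_add' := by intros; ext; simp }
  let L : Submodule (ZMod p) ({i // J i} → ZMod p) :=
    AddSubgroup.toZModSubmodule p (N.toAddSubgroup.map red)
  have hL : ∀ z, z ∈ L ↔ ∃ y ∈ N, red y = z := fun z => Iff.rfl
  -- the integral form of the pairing
  have key : ∀ x y : Fin n → ℤ, (p : ℚ) * ∑ i, (x i : ℚ) * (D i * y i) =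
      ((p * ∑ i, (if J i then 0 else x i * (u i * y i)) +
        ∑ i, (if J i then x i * (u i * y i) else 0) : ℤ) : ℚ) := by
    intro x y
    push_cast
    rw [Finset.mul_sum, Finset.mul_sum, ← Finset.sum_add_distrib]
    refine Finset.sum_congr rfl fun i _ => ?_
    simp only [hD]
    split_ifs
    · field_simp; simp
    · simp
  have redsum : ∀ x y : Fin n → ℤ, red x ⬝ᵥ
      (Matrix.diagonal fun i : {i // J i} => (u i : ZMod p)).mulVec (red y) =
      ((∑ i, (if J i then x i * (u i * y i) else 0) : ℤ) : ZMod p) := by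
    intro x y
    rw [diag_form_apply, ← Finset.sum_filter]
    push_cast
    rw [← Finset.sum_subtype_eq_sum_filter]
    simp [red]
  have hLiso : ∀ x ∈ L, ∀ y ∈ L, x ⬝ᵥ
      (Matrix.diagonal fun i : {i // J i} => (u i : ZMod p)).mulVec y = 0 := by
    intro x hx y hy
    obtain ⟨x, hxN, rfl⟩ := (hL _).1 hx
    obtain ⟨y, hyN, rfl⟩ := (hL _).1 hy
    rw [redsum]
    have h0 := hiso _ ((hN x).1 hxN) _ ((hN y).1 hyN)
    rw [diag_form_apply] at h0
    have := key x y
    rw [h0, mul_zero] at this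
    have h1 := Int.cast_eq_zero.1 this.symm
    rw [ZMod.intCast_zmod_eq_zero_iff_dvd]
    exact ⟨-∑ i, (if J i then 0 else x i * (u i * y i)), by linarith⟩
  have hdet' : (Matrix.diagonal fun i : {i // J i} => (u i : ZMod p)).det ≠ 0 := by
    rw [Matrix.det_diagonal]
    exact Finset.prod_ne_zero_iff.2 fun i _ => hup i
  have hLeq : L = (Matrix.toBilin' (Matrix.diagonal fun i : {i // J i} =>
      (u i : ZMod p))).orthogonal L := by
    apply le_antisymm
    · intro x hx y hy
      change Matrix.toBilin' _ y x = 0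
      rw [Matrix.toBilin'_apply']
      exact hLiso y hy x hx
    intro z hz
    -- lift `z` to an integral vector supported on `J`
    let x : Fin n → ℤ := fun i => if hi : J i then ((z ⟨i, hi⟩).val : ℤ) else 0
    have hxz : red x = z := by
      ext ⟨j, hj⟩
      simp [red, x, hj]
    let ψ : (Fin n → ℤ) →ₗ[ℤ] ℤ :=
      ∑ i, (if J i then x i * u i else 0) • LinearMap.proj i
    have hψ : ∀ y, ψ y = ∑ i, (if J i then x i * (u i * y i) else 0) := by
      intro y
      simp only [ψ, LinearMap.sum_apply, LinearMap.smul_apply, LinearMap.proj_apply, smul_eq_mul]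
      refine Finset.sum_congr rfl fun i _ => ?_
      split_ifs <;> ring
    have hψN : ∀ y ∈ N, (p : ℤ) ∣ ψ y := by
      intro y hy
      rw [hψ, ← ZMod.intCast_zmod_eq_zero_iff_dvd, ← redsum, hxz]
      have : Matrix.toBilin' _ (red y) z = 0 := hz (red y) ((hL _).2 ⟨y, hy, rfl⟩)
      rw [Matrix.toBilin'_apply', diag_form_apply] at this
      rw [diag_form_apply, ← this]
      exact Finset.sum_congr rfl fun i _ => by ring
    choose φ hφ using fun i : Fin n => hψN _ (hs' (Pi.single i 1))
    have hψφ : ∀ y ∈ N, ψ y = p * ∑ i, φ i * y i := by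
      intro y hy
      have h1 : ψ y = (ψ ∘ₗ (LinearMap.id - s ∘ₗ N.mkQ)) y := by
        have : N.mkQ y = 0 := by
          rw [Submodule.mkQ_apply, Submodule.Quotient.mk_eq_zero]; exact hy
        simp only [LinearMap.comp_apply, LinearMap.sub_apply, LinearMap.id_apply, this, map_zero,
          sub_zero]
      have h2 : y = ∑ i, y i • (Pi.single i 1 : Fin n → ℤ) := by
        ext k
        simp [Finset.sum_apply, Pi.single_apply]
      rw [h1]
      conv_lhs => rw [h2]
      rw [map_sum, Finset.mul_sum]
      refine Finset.sum_congr rfl fun i _ => ?_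
      rw [map_smul]
      change y i • ψ (Pi.single i 1 - s (N.mkQ (Pi.single i 1))) = _
      rw [hφ, smul_eq_mul]; ring
    let U : ℤ := ∏ i, u i
    have hUi : ∀ i, ∃ c, U = u i * c := fun i => Finset.dvd_prod_of_mem u (Finset.mem_univ i)
    choose V hV using hUi
    have hU : (U : ZMod p) ≠ 0 := by
      simp only [U, Int.cast_prod]
      exact Finset.prod_ne_zero_iff.2 fun i _ => hup i
    let l : Fin n → ℤ := fun i => if J i then p * (V i * φ i) else V i * φ i
    have hmem : (fun i => U * x i - l i) ∈ N := by
      rw [hN]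
      refine hmax _ fun y hy => ?_
      -- clear denominators
      obtain ⟨m, hm0, y', hy'⟩ : ∃ m : ℤ, m ≠ 0 ∧ ∃ y' : Fin n → ℤ, ∀ i, (m : ℚ) * y i = y' i := by
        refine ⟨∏ i, ((y i).den : ℤ), Finset.prod_ne_zero_iff.2 fun i _ => by
          exact_mod_cast (y i).den_ne_zero, ?_⟩
        have : ∀ i, ∃ c : ℤ, ((∏ i, ((y i).den : ℤ) : ℤ) : ℚ) * y i = c := by
          intro i
          obtain ⟨c, hc⟩ := Finset.dvd_prod_of_mem (fun i => ((y i).den : ℤ)) (Finset.mem_univ i)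
          refine ⟨c * (y i).num, ?_⟩
          rw [hc]
          push_cast
          have := Rat.den_mul_eq_num (y i)
          rw [← this]; ring
        choose y' hy' using this
        exact ⟨y', hy'⟩
      have hm0' : (m : ℚ) ≠ 0 := by exact_mod_cast hm0
      have hy'N : y' ∈ N := by
        rw [hN]
        convert W.smul_mem (m : ℚ) hy using 1
        ext i
        rw [Pi.smul_apply, smul_eq_mul, hy']
      have h1 := hψφ y' hy'N
      have h2 : ∑ i, (y' i : ℚ) * (D i * ((U * x i - l i : ℤ) : ℚ)) = 0 := by
        have e : ∀ i, (y' i : ℚ) * (D i * ((U * x i - l i : ℤ) : ℚ)) =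
            (U : ℚ) / p * ((if J i then x i * (u i * y' i) else 0 : ℤ) : ℚ) -
              U * (φ i * y' i) := by
          intro i
          have hVq : (U : ℚ) = u i * V i := by exact_mod_cast hV i
          by_cases hJ : J i
          · simp only [hD, l, hJ, if_true]
            push_cast
            rw [hVq]
            field_simp
          · simp only [hD, l, hJ, if_false]
            have : x i = 0 := by simp [x, hJ]
            rw [this]
            push_cast
            rw [hVq]
            ring
        rw [Finset.sum_congr rfl fun i _ => e i, Finset.sum_sub_distrib, ← Finset.mul_sum,
          ← Finset.mul_sum]
        rw [hψ] at h1
        have h1q : ((∑ i, (if J i then x i * (u i * y' i) else 0) : ℤ) : ℚ) =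
          ((p * ∑ i, φ i * y' i : ℤ) : ℚ) := by rw [h1]
        rw [← Int.cast_sum, h1q]
        push_cast
        field_simp
        ring
      have h3 : (m : ℚ) * ∑ i, y i * (D i * ((U * x i - l i : ℤ) : ℚ)) = 0 := by
        rw [← h2, Finset.mul_sum]
        refine Finset.sum_congr rfl fun i _ => ?_
        rw [← hy']; ring
      exact (mul_eq_zero.1 h3).resolve_left hm0'
    have hr : red (fun i => U * x i - l i) = (U : ZMod p) • z := by
      rw [← hxz]
      ext ⟨j, hj⟩
      simp [red, l, hj]
    have hUz : (U : ZMod p) • z ∈ L := (hL _).2 ⟨_, hmem, hr⟩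
    have := L.smul_mem ((U : ZMod p)⁻¹) hUz
    rwa [smul_smul, inv_mul_cancel₀ hU, one_smul] at this
  refine ⟨L, ?_, hLiso⟩
  have h1 := finrank_orthogonal_toBilin' _ hdet' L
  rw [← hLeq] at h1
  have h2 : Module.finrank (ZMod p) L ≤ Fintype.card {i // J i} := by
    have := L.finrank_le
    simpa using this
  omega

/-- The residue at `p` of the rank one form `⟨a⟩`, `a = p ^ v * u` with `u` a `p`-adic unit: it is
`0` if `v` is even and the class of the reduction of `u` modulo `p` if `v` is odd. -/
noncomputable def residueOne (p : ℕ) [Fact p.Prime] (a : ℚ) : WittGroup (ZMod p) :=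
  if Even (padicValRat p a) then 0
  else rankOne ((a / (p : ℚ) ^ padicValRat p a : ℚ) : ZMod p)

theorem exists_residue_normal_form (p : ℕ) [hp : Fact p.Prime] (a : ℚ) (ha : a ≠ 0) :
    ∃ (u : ℤ) (c : ℚ), ¬ (p : ℤ) ∣ u ∧ c ≠ 0 ∧
      a = c ^ 2 * (if Even (padicValRat p a) then (u : ℚ) else (u : ℚ) / p) ∧
      residueOne p a = if Even (padicValRat p a) then 0 else rankOne (u : ZMod p) := by
  have hp0 : (p : ℚ) ≠ 0 := by exact_mod_cast hp.out.ne_zero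
  set v := padicValRat p a with hv
  set x : ℚ := a / (p : ℚ) ^ v with hx
  have hx0 : x ≠ 0 := div_ne_zero ha (zpow_ne_zero _ hp0)
  have hxv : padicValRat p x = 0 := by
    rw [hx, padicValRat.div ha (zpow_ne_zero _ hp0), padicValRat.zpow, padicValRat.self hp.out.one_lt]
    omega
  have hax : a = x * (p : ℚ) ^ v := by rw [hx]; field_simp
  have hnum : ¬ (p : ℤ) ∣ x.num := by
    intro h
    have hd : ¬ p ∣ x.den := fun h' => by
      have h1 : p ∣ x.num.natAbs := Int.natCast_dvd.1 h
      exact Nat.Prime.not_coprime_iff_dvd.2 ⟨p, hp.out, h1, h'⟩ x.reduced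
    have h1 : padicValInt p x.num ≠ 0 := by
      rw [padicValInt]
      have := (dvd_iff_padicValNat_ne_zero (p := p) (n := x.num.natAbs)
        (by simpa using hx0)).1 (Int.natCast_dvd.1 h)
      exact this
    have h2 : padicValNat p x.den = 0 := padicValNat.eq_zero_of_not_dvd hd
    rw [padicValRat, h2] at hxv
    omega
  have hden : ¬ (p : ℤ) ∣ (x.den : ℤ) := by
    intro h
    have h1 : padicValNat p x.den ≠ 0 :=
      (dvd_iff_padicValNat_ne_zero x.den_ne_zero).1 (Int.natCast_dvd_natCast.1 h)
    have h2 : padicValInt p x.num = 0 := padicValInt.eq_zero_of_not_dvd hnum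
    rw [padicValRat, h2] at hxv
    omega
  have hpp : Prime (p : ℤ) := Nat.prime_iff_prime_int.1 hp.out
  have hdq : (x.den : ℚ) ≠ 0 := by exact_mod_cast x.den_ne_zero
  have hdz : (x.den : ZMod p) ≠ 0 := fun h => hden (by
    rw [← ZMod.intCast_zmod_eq_zero_iff_dvd]; simpa using h)
  have hnz : (x.num : ZMod p) ≠ 0 := fun h => hnum ((ZMod.intCast_zmod_eq_zero_iff_dvd _ _).1 h)
  have hxe : x = x.num * x.den / (x.den : ℚ) ^ 2 := by
    have := Rat.num_div_den x
    conv_lhs => rw [← this]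
    field_simp
  have hres : residueOne p a = if Even v then 0 else rankOne ((x.num * x.den : ℤ) : ZMod p) := by
    rw [residueOne]
    split_ifs with he
    · rfl
    · rw [← hv, ← hx, Rat.cast_def, ← rankOne_mul_sq _ _ (div_ne_zero hnz hdz) hdz]
      congr 1
      push_cast
      field_simp
  rcases Int.even_or_odd v with he | ho
  · obtain ⟨k, hk⟩ := he
    refine ⟨x.num * x.den, (p : ℚ) ^ k / x.den, fun h => (hpp.dvd_or_dvd h).elim hnum hden,
      div_ne_zero (zpow_ne_zero _ hp0) hdq, ?_, hres⟩
    rw [if_pos ⟨k, hk⟩, hax]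
    conv_lhs => rw [hxe, hk, zpow_add₀ hp0]
    push_cast
    field_simp
  · obtain ⟨k, hk⟩ := ho
    refine ⟨x.num * x.den, (p : ℚ) ^ (k + 1) / x.den, fun h => (hpp.dvd_or_dvd h).elim hnum hden,
      div_ne_zero (zpow_ne_zero _ hp0) hdq, ?_, hres⟩
    rw [if_neg (Int.not_even_iff_odd.2 ⟨k, hk⟩), hax]
    have hk' : v = (k + 1) + (k + 1) - 1 := by omega
    conv_lhs => rw [hxe, hk', zpow_sub₀ hp0, zpow_add₀ hp0 (k + 1), zpow_one]
    push_cast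
    field_simp

theorem sum_residueOne_of_metabolic (p : ℕ) [hp : Fact p.Prime] {n : ℕ} (w : Fin n → ℚ)
    (hw : ∀ i, w i ≠ 0) (h : IsMetabolic (Matrix.diagonal w)) :
    ∑ i, residueOne p (w i) = 0 := by
  choose u c hu hc hwe hres using fun i => exists_residue_normal_form p (w i) (hw i)
  have hm : IsMetabolic (Matrix.diagonal fun i =>
      if ¬ Even (padicValRat p (w i)) then (u i : ℚ) / p else (u i : ℚ)) := by
    refine h.congr ⟨Matrix.diagonal fun i => (c i)⁻¹, Matrix.diagonal c, ?_, ?_, ?_⟩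
    · rw [Matrix.diagonal_mul_diagonal, ← Matrix.diagonal_one]
      congr 1; ext i; exact inv_mul_cancel₀ (hc i)
    · rw [Matrix.diagonal_mul_diagonal, ← Matrix.diagonal_one]
      congr 1; ext i; exact mul_inv_cancel₀ (hc i)
    · rw [Matrix.diagonal_transpose, Matrix.diagonal_mul_diagonal, Matrix.diagonal_mul_diagonal]
      congr 1; ext i
      have := hc i
      conv_lhs => rw [hwe i]
      by_cases he : Even (padicValRat p (w i))
      · simp only [he, not_true_eq_false, if_true, if_false]; field_simp
      · simp only [he, not_false_eq_true, if_true, if_false]; field_simp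
  have hr := metabolic_residue p u hu _ hm
  have e1 : ∑ i, residueOne p (w i) =
      ∑ i : {i // ¬ Even (padicValRat p (w i))}, rankOne (u i : ZMod p) := by
    rw [Finset.sum_congr rfl fun i _ => hres i]
    rw [Finset.sum_congr rfl fun i _ => (ite_not (Even (padicValRat p (w i)))
      (rankOne (u i : ZMod p)) 0).symm, ← Finset.sum_filter, ← Finset.sum_subtype_eq_sum_filter]
    simp
  let e := (Fintype.equivFin {i // ¬ Even (padicValRat p (w i))}).symm
  rw [e1, ← e.sum_comp, ← cls_diagForm (fun k => (u (e k) : ZMod p))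
    (fun k h0 => hu _ ((ZMod.intCast_zmod_eq_zero_iff_dvd _ _).1 h0))]
  refine NForm.cls_eq_zero (hr.congr ?_)
  have := MatCongr.submatrix (Matrix.diagonal
    fun i : {i // ¬ Even (padicValRat p (w i))} => (u i : ZMod p)) e
  rw [Matrix.submatrix_diagonal_equiv] at this
  exact this

theorem sum_residueOne_of_cls_eq_zero (p : ℕ) [hp : Fact p.Prime] {n : ℕ} (w : Fin n → ℚ)
    (hw : ∀ i, w i ≠ 0) (h : ∑ i, rankOne (w i) = 0) :
    ∑ i, residueOne p (w i) = 0 := by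
  rw [← cls_diagForm w hw] at h
  obtain ⟨C, hC, hAC⟩ := NForm.exists_metabolic_add h
  obtain ⟨m, w', hw', hcong⟩ := C.exists_diag
  have h1 := sum_residueOne_of_metabolic p w' hw' (hC.congr hcong)
  have h2 : IsMetabolic (Matrix.diagonal (Fin.append w w')) := by
    have h3 : MatCongr (dsum (Matrix.diagonal w) C.mat) (dsum (Matrix.diagonal w)
      (Matrix.diagonal w')) := (MatCongr.refl _).dsum hcong
    have h4 := MatCongr.submatrix (dsum (Matrix.diagonal w) (Matrix.diagonal w'))
      (finSumFinEquiv (m := n) (n := m)).symm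
    rw [dsum, Matrix.fromBlocks_diagonal, Matrix.submatrix_diagonal_equiv] at h4
    have h5 := IsMetabolic.congr (M := dsum (Matrix.diagonal w) C.mat) hAC h3
    rw [dsum, Matrix.fromBlocks_diagonal] at h5
    convert h5.congr h4 using 2
    ext i
    refine Fin.addCases (fun i => ?_) (fun i => ?_) i <;> simp
  have h6 := sum_residueOne_of_metabolic p _ (fun i => by
    refine Fin.addCases (fun i => ?_) (fun i => ?_) i
    · simpa using hw i
    · simpa using hw' i) h2
  rw [Fin.sum_univ_add] at h6
  simpa [h1] using h6

theorem neg_rankOne' {F : Type*} [Field F] (a : F) : -rankOne a = rankOne (-a) := by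
  by_cases ha : a = 0
  · subst ha
    rw [neg_zero, rankOne, wittClass, dif_neg (by simp), neg_zero]
  · exact neg_rankOne a ha

theorem residueOne_neg (p : ℕ) [Fact p.Prime] (a : ℚ) :
    residueOne p (-a) = -residueOne p a := by
  rw [residueOne, residueOne, padicValRat.neg]
  split_ifs
  · rw [neg_zero]
  · rw [neg_rankOne', neg_div, Rat.cast_def, Rat.cast_def, Rat.num_neg_eq_neg_num,
      Rat.den_neg_eq_den, Int.cast_neg, neg_div]

/-- The free abelian group on the rank one forms over `ℚ` maps onto `W(ℚ)`. -/
noncomputable def rankOneHom : FreeAbelianGroup ℚˣ →+ WittGroup ℚ :=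
  FreeAbelianGroup.lift fun a => rankOne (a : ℚ)

/-- The residues of the rank one forms, extended additively. -/
noncomputable def residueOneHom (p : ℕ) [Fact p.Prime] :
    FreeAbelianGroup ℚˣ →+ WittGroup (ZMod p) :=
  FreeAbelianGroup.lift fun a => residueOne p (a : ℚ)

theorem rankOneHom_surjective : Function.Surjective rankOneHom := by
  rintro ⟨A⟩
  obtain ⟨n, w, hw, h⟩ := A.exists_diag
  refine ⟨∑ i, FreeAbelianGroup.of (Units.mk0 (w i) (hw i)), ?_⟩
  have : A.cls = (diagForm w hw).cls := NForm.cls_eq_of_congr h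
  change _ = A.cls
  rw [this, cls_diagForm, map_sum]
  refine Finset.sum_congr rfl fun i _ => ?_
  rw [rankOneHom, FreeAbelianGroup.lift_apply_of, Units.val_mk0]

theorem exists_diag_repr (p : ℕ) [Fact p.Prime] (g : FreeAbelianGroup ℚˣ) :
    ∃ (n : ℕ) (w : Fin n → ℚ), (∀ i, w i ≠ 0) ∧ rankOneHom g = ∑ i, rankOne (w i) ∧
      residueOneHom p g = ∑ i, residueOne p (w i) := by
  induction g using FreeAbelianGroup.induction_on with
  | zero => exact ⟨0, Fin.elim0, fun i => i.elim0, by simp, by simp⟩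
  | of a =>
    refine ⟨1, ![(a : ℚ)], by simp, ?_, ?_⟩
    · simp [rankOneHom]
    · simp [residueOneHom]
  | neg a =>
    refine ⟨1, ![-(a : ℚ)], by simp, ?_, ?_⟩
    · simp [rankOneHom, neg_rankOne']
    · simp [residueOneHom, residueOne_neg]
  | add x y hx hy =>
    obtain ⟨n, w, hw, h1, h2⟩ := hx
    obtain ⟨m, w', hw', h1', h2'⟩ := hy
    refine ⟨n + m, Fin.append w w', fun i => ?_, ?_, ?_⟩
    · refine Fin.addCases (fun i => ?_) (fun i => ?_) i
      · simpa using hw i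
      · simpa using hw' i
    · rw [map_add, h1, h1', Fin.sum_univ_add]; simp
    · rw [map_add, h2, h2', Fin.sum_univ_add]; simp

theorem rankOneHom_ker_le (p : ℕ) [Fact p.Prime] : rankOneHom.ker ≤ (residueOneHom p).ker := by
  intro g hg
  obtain ⟨n, w, hw, h1, h2⟩ := exists_diag_repr p g
  rw [AddMonoidHom.mem_ker] at hg ⊢
  rw [h2]
  exact sum_residueOne_of_cls_eq_zero p w hw (h1 ▸ hg)

/-- The residue homomorphism `∂_p : W(ℚ) → W(𝔽_p)`, determined by its values on the classes of
rank one forms. -/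
noncomputable def residue (p : ℕ) [Fact p.Prime] : WittGroup ℚ →+ WittGroup (ZMod p) :=
  rankOneHom.liftOfSurjective rankOneHom_surjective ⟨residueOneHom p, rankOneHom_ker_le p⟩

theorem residue_rankOne (p : ℕ) [Fact p.Prime] (a : ℚ) (ha : a ≠ 0) :
    residue p (rankOne a) = residueOne p a := by
  have h := AddMonoidHom.liftOfRightInverse_comp_apply rankOneHom _
    (Function.rightInverse_surjInv rankOneHom_surjective)
    ⟨residueOneHom p, rankOneHom_ker_le p⟩ (FreeAbelianGroup.of (Units.mk0 a ha))
  have h1 : rankOneHom (FreeAbelianGroup.of (Units.mk0 a ha)) = rankOne a := by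
    rw [rankOneHom, FreeAbelianGroup.lift_apply_of, Units.val_mk0]
  have h2 : residueOneHom p (FreeAbelianGroup.of (Units.mk0 a ha)) = residueOne p a := by
    rw [residueOneHom, FreeAbelianGroup.lift_apply_of, Units.val_mk0]
  rw [h1] at h
  exact h.trans h2

/-- The Witt span of a class `w` in `W(ℚ)`: the least rank of a form `B` with
`∂_p [B] = ∂_p w` for all primes `p`. -/
noncomputable def wittSpan (w : WittGroup ℚ) : ℕ :=
  sInf {r | ∃ B : NForm ℚ, B.rank = r ∧
    ∀ (p : ℕ) [Fact p.Prime], residue p B.cls = residue p w}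

end Residue

open scoped Topology

section Knots

/-- Affine three-space with its standard orientation. -/
abbrev R3 : Type := Fin 3 → ℝ

/-- The determinant of three vectors. -/
noncomputable def det3 (u v w : R3) : ℝ := (Matrix.of ![u, v, w]).det

/-- A polygonal knot: a closed polygon in three-space that does not meet itself. -/
structure PolygonalKnot where
  n : ℕ
  three_le : 3 ≤ n
  vertex : ZMod n → R3
  simple : ∀ i j : ZMod n, ∀ s ∈ Set.Ico (0 : ℝ) 1, ∀ t ∈ Set.Ico (0 : ℝ) 1,
    AffineMap.lineMap (vertex i) (vertex (i + 1)) s =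
      AffineMap.lineMap (vertex j) (vertex (j + 1)) t → i = j ∧ s = t

/-- The underlying closed curve of a polygonal knot. -/
def PolygonalKnot.carrier (K : PolygonalKnot) : Set R3 :=
  ⋃ i, segment ℝ (K.vertex i) (K.vertex (i + 1))

/-- The triangles of a simplicial complex. -/
def triangles (X : Geometry.SimplicialComplex ℝ R3) : Set (Finset R3) :=
  {t | t ∈ X.faces ∧ t.card = 3}

/-- The edges of a simplicial complex. -/
def edges (X : Geometry.SimplicialComplex ℝ R3) : Set (Finset R3) :=
  {e | e ∈ X.faces ∧ e.card = 2}

/-- `w` is the system of barycentric coordinates of a point of the complex `X`. -/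
def IsPoint (X : Geometry.SimplicialComplex ℝ R3) (w : R3 →₀ ℝ) : Prop :=
  w.support ∈ X.faces ∧ (∀ v, 0 ≤ w v) ∧ w.sum (fun _ a => a) = 1

/-- The point with barycentric coordinates `w`, pushed by `t` times the vector field that is
linear on the simplices and equal to `ν` at the vertices. -/
noncomputable def pushPoint (ν : R3 → R3) (t : ℝ) (w : R3 →₀ ℝ) : R3 :=
  w.sum fun v a => a • (v + t • ν v)

/-- A Seifert surface of `K`: a finite simplicial complex in three-space that is a compact connected
surface with boundary `K`, oriented by a transverse vector field `normal` (given at the vertices and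
extended linearly over the simplices) along which the surface has a bicollar. -/
structure SeifertSurface (K : PolygonalKnot) where
  complex : Geometry.SimplicialComplex ℝ R3
  finite : complex.faces.Finite
  /-- Every simplex is a face of a triangle. -/
  pure : ∀ f ∈ complex.faces, ∃ t ∈ triangles complex, f ⊆ t
  /-- An edge lies in at most two triangles. -/
  edge_le_two : ∀ e ∈ edges complex, {t | t ∈ triangles complex ∧ e ⊆ t}.ncard ≤ 2
  /-- The link of a vertex is connected. -/
  link_connected : ∀ v : R3, ∀ t ∈ triangles complex, ∀ t' ∈ triangles complex, v ∈ t → v ∈ t' →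
    Relation.ReflTransGen (fun a b => b ∈ triangles complex ∧
      ∃ e ∈ edges complex, v ∈ e ∧ e ⊆ a ∧ e ⊆ b) t t'
  /-- The surface is connected. -/
  connected : ∀ t ∈ triangles complex, ∀ t' ∈ triangles complex,
    Relation.ReflTransGen (fun a b => b ∈ triangles complex ∧
      ∃ e ∈ edges complex, e ⊆ a ∧ e ⊆ b) t t'
  /-- The boundary edges, those in exactly one triangle, are the edges of a subdivision of `K`. -/
  boundary : ∃ P : PolygonalKnot, P.carrier = K.carrier ∧ ∀ e : Finset R3,
    (e ∈ edges complex ∧ ∃! t, t ∈ triangles complex ∧ e ⊆ t) ↔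
      ∃ i, (e : Set R3) = {P.vertex i, P.vertex (i + 1)}
  /-- The normal vectors at the vertices. -/
  normal : R3 → R3
  /-- The vector field is transverse to each triangle. -/
  transverse : ∀ t ∈ triangles complex, ∃ p q r : R3, (t : Set R3) = {p, q, r} ∧
    ∀ x ∈ t, 0 < det3 (q - p) (r - p) (normal x)
  /-- Pushing along the vector field embeds the product of the surface with an interval. -/
  collar : ∃ ε > 0, ∀ w w' : R3 →₀ ℝ, IsPoint complex w → IsPoint complex w' →
    ∀ s ∈ Set.Icc (-ε) ε, ∀ t ∈ Set.Icc (-ε) ε,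
      pushPoint normal s w = pushPoint normal t w' → w = w' ∧ s = t

/-- Polygonal 1-chains: integral combinations of oriented segments, `(p, q)` standing for the
segment from `p` to `q`. -/
abbrev Chain1 : Type := (R3 × R3) →₀ ℤ

/-- The boundary of a polygonal 1-chain, `∂ (p, q) = q - p`. -/
noncomputable def bdry1 : Chain1 →ₗ[ℤ] (R3 →₀ ℤ) :=
  Finsupp.linearCombination ℤ fun e => Finsupp.single e.2 1 - Finsupp.single e.1 1

/-- The chain `∂ (p, q, r) = (q, r) - (p, r) + (p, q)`. -/
noncomputable def bdry2 (p q r : R3) : Chain1 :=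
  Finsupp.single (q, r) 1 - Finsupp.single (p, r) 1 + Finsupp.single (p, q) 1

/-- The 1-cycles of a simplicial complex, in its ordered chain complex: the generators in degree `k`
are the `(k + 1)`-tuples of vertices of a common simplex. -/
noncomputable def cycles1 (X : Geometry.SimplicialComplex ℝ R3) : Submodule ℤ Chain1 :=
  Finsupp.supported ℤ ℤ {e : R3 × R3 | ∃ f ∈ X.faces, e.1 ∈ f ∧ e.2 ∈ f} ⊓ LinearMap.ker bdry1

/-- The 1-boundaries of a simplicial complex, in its ordered chain complex. -/
noncomputable def boundaries1 (X : Geometry.SimplicialComplex ℝ R3) : Submodule ℤ Chain1 :=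
  Submodule.span ℤ {c | ∃ f ∈ X.faces, ∃ p ∈ f, ∃ q ∈ f, ∃ r ∈ f, c = bdry2 p q r}

/-- The first homology group with integer coefficients. -/
abbrev H1 (X : Geometry.SimplicialComplex ℝ R3) : Type :=
  cycles1 X ⧸ (boundaries1 X).submoduleOf (cycles1 X)

/-- The direction `u` is regular for the chains `a` and `c`: projecting along `u`, a segment of `a`
and a segment of `c` meet only transversally, in interior points, and the segments themselves are
disjoint. -/
def RegularDirection (u : R3) (a c : Chain1) : Prop :=
  u ≠ 0 ∧ ∀ e ∈ a.support, ∀ f ∈ c.support, ∀ x ∈ Set.Icc (0 : ℝ) 1, ∀ y ∈ Set.Icc (0 : ℝ) 1,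
    ∀ l : ℝ, AffineMap.lineMap e.1 e.2 x = AffineMap.lineMap f.1 f.2 y + l • u →
      x ∈ Set.Ioo (0 : ℝ) 1 ∧ y ∈ Set.Ioo (0 : ℝ) 1 ∧ l ≠ 0 ∧ det3 (e.2 - e.1) (f.2 - f.1) u ≠ 0

open scoped Classical in
/-- The sign of the crossing of the oriented segment `e` over the oriented segment `f`, seen from the
direction `u`; it is `0` if `e` does not cross over `f`. -/
noncomputable def overSign (u : R3) (e f : R3 × R3) : ℤ :=
  if ∃ x ∈ Set.Ioo (0 : ℝ) 1, ∃ y ∈ Set.Ioo (0 : ℝ) 1, ∃ l : ℝ, 0 < l ∧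
      AffineMap.lineMap e.1 e.2 x = AffineMap.lineMap f.1 f.2 y + l • u
  then (SignType.sign (det3 (e.2 - e.1) (f.2 - f.1) u) : ℤ) else 0

/-- `k` is the linking number of the disjoint polygonal 1-cycles `a` and `c`: the sum of the signs
of the crossings of `a` over `c` in a regular projection. -/
def IsLinkingNumber (a c : Chain1) (k : ℤ) : Prop :=
  ∃ u, RegularDirection u a c ∧ (a.sum fun e m => c.sum fun f n => m * n * overSign u e f) = k

namespace SeifertSurface

variable {K : PolygonalKnot} (S : SeifertSurface K)

/-- The push-off of a chain on `S` by `t` times the normal vector field. -/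
noncomputable def pushChain (t : ℝ) (c : Chain1) : Chain1 :=
  c.mapDomain fun e => (e.1 + t • S.normal e.1, e.2 + t • S.normal e.2)

/-- `V` is a matrix of the Seifert form of `S`: there are cycles `a i` on `S` whose classes are a
basis of `H₁(S; ℤ)`, and `V i j` is the linking number of `a i` with the positive push-off of
`a j`. -/
def IsSeifertMatrix {m : ℕ} (V : Matrix (Fin m) (Fin m) ℤ) : Prop :=
  ∃ (a : Fin m → cycles1 S.complex) (b : Module.Basis (Fin m) ℤ (H1 S.complex)),
    (∀ i, b i = Submodule.Quotient.mk (a i)) ∧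
    ∀ i j, ∀ᶠ t in 𝓝[>] (0 : ℝ), IsLinkingNumber (a i) (S.pushChain t (a j)) (V i j)

end SeifertSurface

/-- The symmetrized Seifert form `V + Vᵀ` over `ℚ`. -/
def symSeifert {m : ℕ} (V : Matrix (Fin m) (Fin m) ℤ) : Matrix (Fin m) (Fin m) ℚ :=
  (V + V.transpose).map (Int.cast : ℤ → ℚ)

/-- The determinant of the knot with Seifert matrix `V`. -/
def knotDet {m : ℕ} (V : Matrix (Fin m) (Fin m) ℤ) : ℕ := (V + V.transpose).det.natAbs

/-- The signature of the knot with Seifert matrix `V`. -/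
noncomputable def knotSignature {m : ℕ} (V : Matrix (Fin m) (Fin m) ℤ) : ℤ :=
  (sigPos (symSeifert V).toQuadraticForm' : ℤ) -
    (sigNeg (symSeifert V).toQuadraticForm' : ℤ)

/-- The rational Witt class of the knot with Seifert matrix `V`. -/
noncomputable def knotWittClass {m : ℕ} (V : Matrix (Fin m) (Fin m) ℤ) : WittGroup ℚ :=
  wittClass (symSeifert V)

/-- The rational Witt span of the knot with Seifert matrix `V`. -/
noncomputable def knotWittSpan {m : ℕ} (V : Matrix (Fin m) (Fin m) ℤ) : ℕ :=
  wittSpan (knotWittClass V)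

end Knots

end KnotWitt

namespace KnotWitt

open scoped Topology

/-! ### Discriminants as Witt invariants -/

section Discriminant

variable {F : Type*} [Field F]

/-! The proof has an algebraic half, about W(ℚ), and a topological half, which shows that V + Vᵀ is
non-degenerate.

Algebra. The kernel of all residues ∂_p on W(ℚ) consists of the multiples of [1]
(`exists_zsmul_of_residue_eq_zero`). Hence a form B with the residues of W(K) satisfies W(K) = [B] +
k[1]. If B has rank at most one, this reads W(K) = [b] + k[1], where b = 1 serves when B has rank
zero. Two Witt invariants then determine b and k (`NForm.invariants_of_cls_eq`). The discriminant,
up to sign and squares, gives det K = c²|b|, so [b] = [d] with d = det K or d = -det K according to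
the sign of b; the signature gives k = σ(K) - Sign(d). Conversely [1] has no residues, so ⟨d⟩
competes in the definition of the Witt span. If det K is a square, then [d] = ±[1] and the form of
rank zero already competes; if the Witt span is 0, then W(K) is a multiple of [1] and the
discriminant makes det K a square.

The kernel of the residues is found by descent. W(ℚ) is filtered by the subgroups `smoothGroup k`,
generated by the ⟨n⟩ whose prime factors are at most k, and the task is to pass from p to p - 1.
Repeated use of ⟨a⟩ ⊕ ⟨b⟩ ≅ ⟨a + b⟩ ⊕ ⟨ab(a + b)⟩ shows that modulo the lower subgroup the class of
⟨pn⟩ depends only on the square class of n modulo p (`primeClass_eq_of_sq`). The layer therefore has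
at most two generators, and the relations between them, together with rank and discriminant in
W(𝔽_p), leave no kernel (`mem_smoothGroup_of_residue`).

Topology. The determinant of V + Vᵀ is odd (`det_symSeifert_modTwo_ne_zero`). Modulo two, lk(α, β⁺)
+ lk(β, α⁺) equals lk(α, β⁺) + lk(α, β⁻), because both cycles may be moved together through the
bicollar (`linkTwo_pushTwo_neg`). A kernel vector of V + Vᵀ modulo two gives a cycle α for which
this sum vanishes for every β. On the other hand some coordinate of the homology class of α is 1.
This coordinate is a cocycle; since the boundary of the surface is a single circle, it can be
changed by a coboundary so as to vanish on the boundary, and then it is given by a set E of interior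
edges (`IsCocycle.exists_isDualCycle`). Let β be the dual cycle, which passes from triangle to
triangle through the edges in E. The push-offs β⁺ and β⁻ together decompose into meridians of these
edges, and a meridian links α as often as α runs through its edge (`linkTwo_meridian_edge`). So the
sum for this β is 1, a contradiction (`exists_dual_cycle`).

All of this takes place with a linking number modulo two, `linkTwo`, defined by counting crossings.
Its independence of the direction and its value on the boundary of a triangle come from one parity
statement: a segment in general position meets the boundary of a convex polyhedron an even or odd
number of times according to the positions of its end points (`card_crossings`). Invariance under
deformations (`linkTwo_deform`) is local constancy of the crossings. -/

theorem MatCongr.det_eq {ι κ : Type*} [Fintype ι] [Fintype κ] [DecidableEq ι] [DecidableEq κ]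
    {M : Matrix ι ι F} {N : Matrix κ κ F} (h : MatCongr M N) :
    Fintype.card ι = Fintype.card κ ∧ ∃ c : F, c ≠ 0 ∧ N.det = c ^ 2 * M.det := by
  obtain ⟨P, Q, h1, h2, h3⟩ := h
  have e : (κ → F) ≃ₗ[F] (ι → F) :=
    LinearEquiv.ofLinearMap (Matrix.mulVecLin P) (Matrix.mulVecLin Q)
    (by rw [← Matrix.mulVecLin_mul, h1, Matrix.mulVecLin_one])
    (by rw [← Matrix.mulVecLin_mul, h2, Matrix.mulVecLin_one])
  have hc : Fintype.card κ = Fintype.card ι := by simpa using e.finrank_eq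
  refine ⟨hc.symm, ?_⟩
  -- `P` is square only after its index types are identified. Any bijection will do, since
  -- reindexing both sides of `N` does not change its determinant.
  let f : ι ≃ κ := Fintype.equivOfCardEq hc.symm
  refine ⟨(P.submatrix id f).det, ?_, ?_⟩
  · intro h0
    have h4 : P.submatrix id f * Q.submatrix f id = 1 := by
      rw [Matrix.submatrix_mul_equiv, h1]; simp
    have := congrArg Matrix.det h4
    rw [Matrix.det_mul, h0, zero_mul, Matrix.det_one] at this
    exact zero_ne_one this
  · have h4 : N.submatrix f f = (P.submatrix id f).transpose * M * P.submatrix id f := by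
      rw [← h3]
      ext i j
      simp [Matrix.mul_apply]
    rw [← Matrix.det_submatrix_equiv_self f N, h4, Matrix.det_mul, Matrix.det_mul,
      Matrix.det_transpose]
    ring

/-- Exchanging the two block columns makes the matrix block triangular. The determinant of the
exchange itself is read off after multiplication by a unipotent matrix, which creates an identity
block. -/
theorem det_fromBlocks_zero_left {n : Type*} [Fintype n] [DecidableEq n] (B C D : Matrix n n F) :
    (Matrix.fromBlocks 0 B C D).det = (-1) ^ Fintype.card n * (B.det * C.det) := by
  have hJ : (Matrix.fromBlocks 0 1 1 0 : Matrix (n ⊕ n) (n ⊕ n) F).det =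
      (-1) ^ Fintype.card n := by
    have h : (Matrix.fromBlocks 1 1 0 1 : Matrix (n ⊕ n) (n ⊕ n) F) *
        Matrix.fromBlocks 0 1 1 0 = Matrix.fromBlocks 1 1 1 0 := by
      simp [Matrix.fromBlocks_multiply]
    have := congrArg Matrix.det h
    rw [Matrix.det_mul, Matrix.det_fromBlocks_zero₂₁, Matrix.det_fromBlocks_one₁₁] at this
    simpa [Matrix.det_neg] using this
  have h : Matrix.fromBlocks 0 B C D * Matrix.fromBlocks 0 1 1 0 = Matrix.fromBlocks B 0 D C := by
    simp [Matrix.fromBlocks_multiply]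
  have h' := congrArg Matrix.det h
  rw [Matrix.det_mul, Matrix.det_fromBlocks_zero₁₂, hJ] at h'
  rw [← h', mul_comm, mul_assoc, ← mul_pow]
  simp

/-- In a basis that begins with a basis of the isotropic subspace, the Gram matrix has blocks 0, B,
Bᵀ, D, hence determinant (-1)^k det(B)². The form may be degenerate, so `c` may be zero. -/
theorem IsMetabolic.det_eq {ι : Type*} [Fintype ι] [DecidableEq ι] {M : Matrix ι ι F}
    (hM : IsMetabolic M) (hs : M.IsSymm) :
    ∃ (k : ℕ) (c : F), Fintype.card ι = 2 * k ∧ M.det = (-1) ^ k * c ^ 2 := by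
  obtain ⟨L, hL, hiso⟩ := hM
  set k := Module.finrank F L with hk
  have hq : Module.finrank F ((ι → F) ⧸ L) = k := by
    have := L.finrank_quotient_add_finrank
    rw [Module.finrank_fintype_fun_eq_card] at this
    omega
  let b := Module.Basis.sumQuot (Module.finBasis F L) (Module.finBasisOfFinrankEq F _ hq)
  let P : Matrix ι (Fin k ⊕ Fin k) F := Matrix.of fun i j => b j i
  let Q : Matrix (Fin k ⊕ Fin k) ι F := b.toMatrix (Pi.basisFun F ι)
  have hP : P = (Pi.basisFun F ι).toMatrix b := by
    ext i j
    simp [P, Module.Basis.toMatrix_apply]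
  have hc : MatCongr M (P.transpose * M * P) :=
    ⟨P, Q, by rw [hP]; exact Module.Basis.toMatrix_mul_toMatrix_flip _ _,
      by rw [hP]; exact Module.Basis.toMatrix_mul_toMatrix_flip _ _, rfl⟩
  obtain ⟨-, c, hc0, hc⟩ := hc.det_eq
  have hent : ∀ i j, (P.transpose * M * P) i j = b i ⬝ᵥ M.mulVec (b j) := by
    intro i j
    rw [Matrix.mul_assoc, Matrix.mul_apply]
    refine Finset.sum_congr rfl fun x _ => ?_
    rfl
  have h11 : (P.transpose * M * P).toBlocks₁₁ = 0 := by
    ext i j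
    change (P.transpose * M * P) (Sum.inl i) (Sum.inl j) = 0
    rw [hent]
    refine hiso _ ?_ _ ?_
    · simp [b]
    · simp [b]
  have hsymm : (P.transpose * M * P).transpose = P.transpose * M * P := by
    simp only [Matrix.transpose_mul, Matrix.transpose_transpose, hs.eq, Matrix.mul_assoc]
  have h21 : (P.transpose * M * P).toBlocks₂₁ = (P.transpose * M * P).toBlocks₁₂.transpose := by
    conv_lhs => rw [← hsymm]
    rfl
  rw [← Matrix.fromBlocks_toBlocks (P.transpose * M * P), h11, h21,
    det_fromBlocks_zero_left, Matrix.det_transpose, Fintype.card_fin] at hc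
  refine ⟨k, c⁻¹ * (P.transpose * M * P).toBlocks₁₂.det, hL.symm, ?_⟩
  field_simp
  linear_combination -hc

/-- The rank modulo two and the signed discriminant are invariants of the Witt class. -/
theorem NForm.disc_of_cls_eq_zero {A : NForm F} (h : A.cls = 0) :
    ∃ (k : ℕ) (c : F), A.rank = 2 * k ∧ c ≠ 0 ∧ A.mat.det = (-1) ^ k * c ^ 2 := by
  obtain ⟨C, hC, hAC⟩ := NForm.exists_metabolic_add h
  obtain ⟨k, c, hk, hc⟩ := hC.det_eq C.symm
  obtain ⟨l, d, hl, hd⟩ := hAC.det_eq (Matrix.IsSymm.fromBlocks A.symm (by simp) C.symm)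
  rw [Fintype.card_sum] at hl
  simp only [Fintype.card_fin] at hk hl
  rw [dsum, Matrix.det_fromBlocks_zero₂₁, hc] at hd
  have hc0 : c ≠ 0 := by
    rintro rfl
    exact C.nondeg (by rw [hc]; simp)
  have hA := A.nondeg
  have hd0 : d ≠ 0 := by
    rintro rfl
    have := C.nondeg
    rw [hc] at this
    exact mul_ne_zero hA this (by rw [hd]; simp)
  -- `k` and `l` are half the ranks of C and of A ⊕ C, so `j` is half the rank of A and carries the
  -- quotient of the two signs.
  obtain ⟨j, rfl⟩ : ∃ j, l = j + k := ⟨l - k, by omega⟩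
  refine ⟨j, d / c, by omega, div_ne_zero hd0 hc0, ?_⟩
  have h1 : ((-1 : F) ^ k) ≠ 0 := pow_ne_zero _ (by simp)
  field_simp
  apply mul_left_cancel₀ h1
  rw [pow_add] at hd
  linear_combination hd

theorem disc_of_sum_rankOne_eq_zero {n : ℕ} (w : Fin n → F) (hw : ∀ i, w i ≠ 0)
    (h : ∑ i, rankOne (w i) = 0) :
    ∃ (k : ℕ) (c : F), n = 2 * k ∧ c ≠ 0 ∧ ∏ i, w i = (-1) ^ k * c ^ 2 := by
  rw [← cls_diagForm w hw] at h
  obtain ⟨k, c, hk, hc, hd⟩ := NForm.disc_of_cls_eq_zero h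
  exact ⟨k, c, hk, hc, by rw [← hd]; exact (Matrix.det_diagonal).symm⟩

/-- The form ⟨a⟩ ⊕ ⟨b⟩ takes the value a + b on e₁ + e₂, whose orthogonal complement is spanned by
-b e₁ + a e₂, of value ab(a + b). Apart from changes by squares and signs, this is the only relation
needed to compute the kernel of the residues. -/
theorem rankOne_add_rankOne (a b : F) (ha : a ≠ 0) (hb : b ≠ 0) (hab : a + b ≠ 0) :
    rankOne a + rankOne b = rankOne (a + b) + rankOne (a * b * (a + b)) := by
  have hd : a * b * (a + b) ≠ 0 := mul_ne_zero (mul_ne_zero ha hb) hab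
  have h1 : rankOne a + rankOne b = ∑ i, rankOne (![a, b] i) := by simp [Fin.sum_univ_two]
  have h2 : rankOne (a + b) + rankOne (a * b * (a + b)) =
    ∑ i, rankOne (![a + b, a * b * (a + b)] i) := by simp [Fin.sum_univ_two]
  rw [h1, h2, ← cls_diagForm ![a, b] (by simp [Fin.forall_fin_two, ha, hb]),
    ← cls_diagForm ![a + b, a * b * (a + b)] (by simp [Fin.forall_fin_two, ha, hb, hab])]
  refine NForm.cls_eq_of_congr ?_
  change MatCongr (Matrix.diagonal ![a, b]) (Matrix.diagonal ![a + b, a * b * (a + b)])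
  refine ⟨!![1, -b; 1, a], !![a / (a + b), b / (a + b); -1 / (a + b), 1 / (a + b)], ?_, ?_, ?_⟩
  · ext i j
    fin_cases i <;> fin_cases j <;> simp [Matrix.mul_apply, Fin.sum_univ_two] <;> field_simp <;> ring
  · ext i j
    fin_cases i <;> fin_cases j <;> simp [Matrix.mul_apply, Fin.sum_univ_two] <;> field_simp <;>
      ring
  · ext i j
    fin_cases i <;> fin_cases j <;> simp [Matrix.mul_apply, Fin.sum_univ_two] <;> ring

end Discriminant

/-! ### The signature as a Witt invariant -/

section Signature

theorem diag_toQuadraticForm' {n : ℕ} (w : Fin n → ℚ) :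
    (Matrix.diagonal w).toQuadraticForm' = QuadraticMap.weightedSumSquares ℚ w := by
  ext x
  simp [Matrix.toQuadraticForm', Matrix.toLinearMap₂'_apply', diag_form_apply,
    QuadraticMap.weightedSumSquares_apply]
  exact Finset.sum_congr rfl fun i _ => by ring

theorem MatCongr.equivalent {n m : ℕ} {M : Matrix (Fin n) (Fin n) ℚ} {N : Matrix (Fin m) (Fin m) ℚ}
    (h : MatCongr M N) : M.toQuadraticForm'.Equivalent N.toQuadraticForm' := by
  obtain ⟨P, Q, h1, h2, h3⟩ := h.symm
  refine ⟨⟨LinearEquiv.ofLinearMap (Matrix.mulVecLin P) (Matrix.mulVecLin Q)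
    (by rw [← Matrix.mulVecLin_mul, h1, Matrix.mulVecLin_one])
    (by rw [← Matrix.mulVecLin_mul, h2, Matrix.mulVecLin_one]), fun x => ?_⟩⟩
  rw [← h3]
  simp only [Matrix.toQuadraticForm', LinearMap.BilinMap.toQuadraticMap_apply,
    Matrix.toLinearMap₂'_apply']
  change P.mulVec x ⬝ᵥ N.mulVec (P.mulVec x) = _
  rw [Matrix.mul_assoc, ← Matrix.mulVec_mulVec, ← Matrix.mulVec_mulVec,
      Matrix.dotProduct_mulVec x, Matrix.vecMul_transpose]

open QuadraticForm in
theorem sum_sign_eq {n : ℕ} (w : Fin n → ℚ) :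
    ∑ i, (SignType.sign (w i) : ℤ) =
      (sigPos (Matrix.diagonal w).toQuadraticForm' : ℤ) -
        (sigNeg (Matrix.diagonal w).toQuadraticForm' : ℤ) := by
  rw [diag_toQuadraticForm', sigPos_weightedSumSquares, sigNeg_weightedSumSquares,
    Set.ncard_eq_toFinset_card', Set.ncard_eq_toFinset_card', Set.toFinset_ofPred,
    Set.toFinset_ofPred, Finset.card_filter, Finset.card_filter]
  push_cast
  rw [← Finset.sum_sub_distrib]
  refine Finset.sum_congr rfl fun i _ => ?_
  rcases lt_trichotomy (w i) 0 with h | h | h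
  · simp [sign_neg h, h, h.not_gt]
  · simp [h]
  · simp [sign_pos h, h, h.not_gt]

-- Both Q and -Q are nonpositive on an isotropic subspace of dimension n/2, so neither index of
-- inertia exceeds n/2. Their sum is n, hence they agree.
open QuadraticForm in
theorem sum_sign_of_metabolic {n : ℕ} (w : Fin n → ℚ) (hw : ∀ i, w i ≠ 0)
    (h : IsMetabolic (Matrix.diagonal w)) : ∑ i, (SignType.sign (w i) : ℤ) = 0 := by
  obtain ⟨L, hL, hiso⟩ := h
  have hQ : ∀ x ∈ L, (Matrix.diagonal w).toQuadraticForm' x = 0 := fun x hx => by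
    simpa [Matrix.toQuadraticForm', Matrix.toLinearMap₂'_apply'] using hiso x hx x hx
  have h1 := sigPos_add_finrank_le_of_nonpos (fun x hx => (hQ x hx).le)
  have h2 := sigPos_add_finrank_le_of_nonpos (Q := -(Matrix.diagonal w).toQuadraticForm')
    (V := L) (fun x hx => by simp [hQ x hx])
  have h3 : sigPos (Matrix.diagonal w).toQuadraticForm' +
      sigNeg (Matrix.diagonal w).toQuadraticForm' = n := by
    rw [diag_toQuadraticForm', sigPos_weightedSumSquares, sigNeg_weightedSumSquares,
      Set.ncard_eq_toFinset_card', Set.ncard_eq_toFinset_card', Set.toFinset_ofPred,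
      Set.toFinset_ofPred, Finset.card_filter, Finset.card_filter, ← Finset.sum_add_distrib]
    rw [Finset.sum_congr rfl (g := fun _ => 1)]
    · simp
    · intro i _
      rcases lt_or_gt_of_ne (hw i) with h | h
      · simp [h, h.not_gt]
      · simp [h, h.not_gt]
  rw [sum_sign_eq]
  rw [sigPos_neg] at h2
  simp only [Module.finrank_fintype_fun_eq_card, Fintype.card_fin] at h1 h2 hL
  omega

/-- For some metabolic C the sum of the diagonal form and C is metabolic too. Once C is
diagonalized, both signatures vanish, and signatures add. -/
theorem sum_sign_of_cls_eq_zero {n : ℕ} (w : Fin n → ℚ) (hw : ∀ i, w i ≠ 0)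
    (h : ∑ i, rankOne (w i) = 0) : ∑ i, (SignType.sign (w i) : ℤ) = 0 := by
  rw [← cls_diagForm w hw] at h
  obtain ⟨C, hC, hAC⟩ := NForm.exists_metabolic_add h
  obtain ⟨m, w', hw', hcong⟩ := C.exists_diag
  have h1 := sum_sign_of_metabolic w' hw' (hC.congr hcong)
  have h2 : IsMetabolic (Matrix.diagonal (Fin.append w w')) := by
    have h3 : MatCongr (dsum (Matrix.diagonal w) C.mat) (dsum (Matrix.diagonal w)
      (Matrix.diagonal w')) := (MatCongr.refl _).dsum hcong
    have h4 := MatCongr.submatrix (dsum (Matrix.diagonal w) (Matrix.diagonal w'))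
      (finSumFinEquiv (m := n) (n := m)).symm
    rw [dsum, Matrix.fromBlocks_diagonal, Matrix.submatrix_diagonal_equiv] at h4
    have h5 := IsMetabolic.congr (M := dsum (Matrix.diagonal w) C.mat) hAC h3
    rw [dsum, Matrix.fromBlocks_diagonal] at h5
    convert h5.congr h4 using 2
    ext i
    refine Fin.addCases (fun i => ?_) (fun i => ?_) i <;> simp
  have h6 := sum_sign_of_metabolic _ (fun i => by
    refine Fin.addCases (fun i => ?_) (fun i => ?_) i
    · simpa using hw i
    · simpa using hw' i) h2
  rw [Fin.sum_univ_add] at h6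
  simpa [h1] using h6

end Signature

/-! ### The filtration of W(ℚ) by smooth integers -/

section Kernel

/-- The nonzero integers all of whose prime factors are at most `k`. -/
def IsSmooth (k : ℕ) (n : ℤ) : Prop := n ≠ 0 ∧ ∀ q : ℕ, q.Prime → (q : ℤ) ∣ n → q ≤ k

theorem IsSmooth.mul {k : ℕ} {m n : ℤ} (hm : IsSmooth k m) (hn : IsSmooth k n) :
    IsSmooth k (m * n) :=
  ⟨mul_ne_zero hm.1 hn.1, fun q hq h =>
    ((Nat.prime_iff_prime_int.1 hq).dvd_or_dvd h).elim (hm.2 q hq) (hn.2 q hq)⟩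

theorem IsSmooth.neg {k : ℕ} {n : ℤ} (hn : IsSmooth k n) : IsSmooth k (-n) :=
  ⟨neg_ne_zero.2 hn.1, fun q hq h => hn.2 q hq ((dvd_neg).1 h)⟩

theorem IsSmooth.of_dvd {k : ℕ} {m n : ℤ} (hn : IsSmooth k n) (h : m ∣ n) : IsSmooth k m :=
  ⟨fun h0 => hn.1 (by rw [h0] at h; exact zero_dvd_iff.1 h), fun q hq h' => hn.2 q hq (h'.trans h)⟩

theorem isSmooth_of_le {k n : ℕ} (h0 : n ≠ 0) (h : n ≤ k) : IsSmooth k (n : ℤ) :=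
  ⟨by exact_mod_cast h0, fun _ _ hq =>
    (Nat.le_of_dvd (Nat.pos_of_ne_zero h0) (Int.natCast_dvd_natCast.1 hq)).trans h⟩

/-- The subgroup of `W(ℚ)` generated by the forms `⟨n⟩` with `n` a `k`-smooth integer. -/
def smoothGroup (k : ℕ) : AddSubgroup (WittGroup ℚ) :=
  AddSubgroup.closure {w | ∃ n : ℤ, IsSmooth k n ∧ w = rankOne (n : ℚ)}

theorem IsSmooth.rankOne_mem {k : ℕ} {n : ℤ} (h : IsSmooth k n) :
    rankOne (n : ℚ) ∈ smoothGroup k :=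
  AddSubgroup.subset_closure ⟨n, h, rfl⟩

theorem IsSmooth.rankOne_sq_mem {k : ℕ} {n : ℤ} (h : IsSmooth k n) {c a : ℚ} (hc : c ≠ 0)
    (ha : a = c ^ 2 * n) : rankOne a ∈ smoothGroup k := by
  rw [ha, rankOne_mul_sq _ _ (by exact_mod_cast h.1) hc]
  exact h.rankOne_mem

theorem smoothGroup_le {k l : ℕ} (h : ∀ n, IsSmooth k n → IsSmooth l n) :
    smoothGroup k ≤ smoothGroup l := by
  rw [smoothGroup, AddSubgroup.closure_le]
  rintro _ ⟨n, hn, rfl⟩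
  exact (h n hn).rankOne_mem

/-- A 1-smooth integer has no prime factor at all, so it is 1 or -1: this is the bottom of the
filtration. -/
theorem smoothGroup_one_le : smoothGroup 1 ≤ AddSubgroup.zmultiples (rankOne (1 : ℚ)) := by
  rw [smoothGroup, AddSubgroup.closure_le]
  rintro _ ⟨n, hn, rfl⟩
  have h1 : n.natAbs = 1 := by
    by_contra h
    obtain ⟨q, hq, hqn⟩ := Nat.exists_prime_and_dvd h
    have := hn.2 q hq (Int.natCast_dvd.2 hqn)
    have := hq.two_le
    omega
  rcases Int.natAbs_eq n with h | h
  · rw [h, h1]; simp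
  · rw [h, h1]
    push_cast
    rw [← neg_rankOne 1 one_ne_zero]
    exact neg_mem (AddSubgroup.mem_zmultiples (rankOne (1 : ℚ)))

/-- W(ℚ) is generated by rank one classes, and a rational number has the square class of the integer
num · den, which is smooth for its own absolute value. -/
theorem exists_mem_smoothGroup (w : WittGroup ℚ) : ∃ k, w ∈ smoothGroup k := by
  have hmono : ∀ {k l}, k ≤ l → smoothGroup k ≤ smoothGroup l := fun hkl =>
    smoothGroup_le fun n hn => ⟨hn.1, fun q hq h => (hn.2 q hq h).trans hkl⟩
  obtain ⟨g, rfl⟩ := rankOneHom_surjective w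
  have hof : ∀ a : ℚˣ, ∃ k, rankOneHom (FreeAbelianGroup.of a) ∈ smoothGroup k := by
    intro a
    have hd : ((a : ℚ).den : ℚ) ≠ 0 := by exact_mod_cast (a : ℚ).den_ne_zero
    have hn : (a : ℚ).num * (a : ℚ).den ≠ 0 :=
      mul_ne_zero (by simp) (by exact_mod_cast (a : ℚ).den_ne_zero)
    refine ⟨((a : ℚ).num * (a : ℚ).den).natAbs, ?_⟩
    rw [rankOneHom, FreeAbelianGroup.lift_apply_of]
    refine IsSmooth.rankOne_sq_mem (n := (a : ℚ).num * (a : ℚ).den) (c := ((a : ℚ).den : ℚ)⁻¹)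
      ⟨hn, fun q _ h => ?_⟩ (inv_ne_zero hd) ?_
    · exact Nat.le_of_dvd (Int.natAbs_pos.2 hn) (Int.natCast_dvd.1 h)
    · conv_lhs => rw [← Rat.num_div_den (a : ℚ)]
      push_cast
      field_simp
  induction g using FreeAbelianGroup.induction_on with
  | zero => exact ⟨0, by rw [map_zero]; exact zero_mem _⟩
  | of a => exact hof a
  | neg a =>
    obtain ⟨k, hk⟩ := hof a
    exact ⟨k, by rw [map_neg]; exact neg_mem hk⟩
  | add x y hx hy =>
    obtain ⟨k, hk⟩ := hx
    obtain ⟨l, hl⟩ := hy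
    exact ⟨max k l, by
      rw [map_add]
      exact add_mem (hmono (le_max_left _ _) hk) (hmono (le_max_right _ _) hl)⟩

theorem residue_rankOne_of_not_dvd (p : ℕ) [hp : Fact p.Prime] {n : ℤ} (hn : ¬ (p : ℤ) ∣ n) :
    residue p (rankOne (n : ℚ)) = 0 := by
  have h0 : (n : ℚ) ≠ 0 := by
    intro h
    exact hn (by rw [Int.cast_eq_zero.1 h]; exact dvd_zero _)
  rw [residue_rankOne p _ h0, residueOne, if_pos]
  rw [padicValRat.of_int, padicValInt.eq_zero_of_not_dvd hn]
  simp

theorem residue_rankOne_prime_mul (p : ℕ) [hp : Fact p.Prime] {n : ℤ} (hn : ¬ (p : ℤ) ∣ n) :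
    residue p (rankOne (p * n : ℚ)) = rankOne (n : ZMod p) := by
  have hp0 : (p : ℚ) ≠ 0 := by exact_mod_cast hp.out.ne_zero
  have h0 : (n : ℚ) ≠ 0 := by
    intro h
    exact hn (by rw [Int.cast_eq_zero.1 h]; exact dvd_zero _)
  have hv : padicValRat p (p * n : ℚ) = 1 := by
    rw [padicValRat.mul hp0 h0, padicValRat.self hp.out.one_lt, padicValRat.of_int,
      padicValInt.eq_zero_of_not_dvd hn]
    simp
  rw [residue_rankOne p _ (mul_ne_zero hp0 h0), residueOne, hv, if_neg (by decide), zpow_one,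
    mul_div_cancel_left₀ _ hp0, Rat.cast_intCast]

theorem IsSmooth.not_dvd {p : ℕ} (hp : p.Prime) {n : ℤ} (hn : IsSmooth (p - 1) n) :
    ¬ (p : ℤ) ∣ n := fun h => by
  have := hn.2 p hp h
  have := hp.two_le
  omega

/-- The generators have entries prime to p. So ∂_p is defined on `smoothGroup p` modulo `smoothGroup
(p - 1)`, and the descent amounts to its injectivity there. -/
theorem residue_eq_zero_of_mem (p : ℕ) [hp : Fact p.Prime] {w : WittGroup ℚ}
    (hw : w ∈ smoothGroup (p - 1)) : residue p w = 0 := by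
  have : smoothGroup (p - 1) ≤ (residue p).ker := by
    rw [smoothGroup, AddSubgroup.closure_le]
    rintro _ ⟨n, hn, rfl⟩
    exact residue_rankOne_of_not_dvd p (hn.not_dvd hp.out)
  exact this hw

/-- The class of `⟨p n⟩` modulo the forms with entries composed of primes less than `p`. -/
noncomputable def primeClass (p : ℕ) (n : ℤ) : WittGroup ℚ ⧸ smoothGroup (p - 1) :=
  QuotientAddGroup.mk (rankOne (p * n : ℚ))

theorem primeClass_neg (p : ℕ) (n : ℤ) : primeClass p (-n) = -primeClass p n := by
  rw [primeClass, primeClass, ← QuotientAddGroup.mk_neg, neg_rankOne']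
  congr 2
  push_cast
  ring

theorem primeClass_mul_sq (p : ℕ) (hp : p ≠ 0) {n c : ℤ} (hn : n ≠ 0) (hc : c ≠ 0) :
    primeClass p (c ^ 2 * n) = primeClass p n := by
  rw [primeClass, primeClass, ← rankOne_mul_sq (p * n : ℚ) (c : ℚ) (by positivity)
    (by exact_mod_cast hc)]
  congr 2
  push_cast
  ring

/-- The effect on residue classes of the isomorphism `⟨a⟩ ⊕ ⟨b⟩ ≅ ⟨a + b⟩ ⊕ ⟨a b (a + b)⟩`. -/
theorem primeClass_add {p : ℕ} (hp : p ≠ 0) {m n : ℤ} (hm : m ≠ 0) (hn : n ≠ 0)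
    (hmn : m + n ≠ 0) :
    primeClass p m + primeClass p n = primeClass p (m + n) + primeClass p (m * n * (m + n)) := by
  have hp' : (p : ℚ) ≠ 0 := by exact_mod_cast hp
  have hm' : (m : ℚ) ≠ 0 := by exact_mod_cast hm
  have hn' : (n : ℚ) ≠ 0 := by exact_mod_cast hn
  have hmn' : (m : ℚ) + n ≠ 0 := by exact_mod_cast hmn
  simp only [primeClass, ← QuotientAddGroup.mk_add]
  rw [rankOne_add_rankOne (p * m : ℚ) (p * n) (by positivity) (by positivity)
    (by rw [← mul_add]; positivity)]
  -- The product of pm, pn and p(m + n) is p² · p · mn(m + n); the factor p² is removed as a square.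
  rw [← rankOne_mul_sq (p * (m * n * (m + n) : ℤ) : ℚ) p (by push_cast; positivity) hp']
  congr 3 <;> push_cast <;> ring_nf

/-- Write mn = pl + r. The entries of ⟨prc⟩ ⊕ ⟨p²lc⟩ add up to pmnc. The two other forms in the
relation are ⟨lc⟩ and ⟨rlmnc⟩ up to squares; as m, n < p forces l < p, their entries have no prime
factor from p on, and they vanish in the quotient. -/
theorem primeClass_mod_mul {p : ℕ} (hp : p.Prime) {m n : ℕ} (hm : m ≠ 0) (hmp : m < p)
    (hn : n ≠ 0) (hnp : n < p) {c : ℤ} (hc : IsSmooth (p - 1) c) :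
    primeClass p (m * n * c) = primeClass p ((m * n % p : ℕ) * c) := by
  have hr0 : m * n % p ≠ 0 := by
    intro h
    rcases (Nat.Prime.dvd_mul hp).1 (Nat.dvd_of_mod_eq_zero h) with h | h
    · exact absurd (Nat.le_of_dvd (Nat.pos_of_ne_zero hm) h) (by omega)
    · exact absurd (Nat.le_of_dvd (Nat.pos_of_ne_zero hn) h) (by omega)
  have hrp : m * n % p < p := Nat.mod_lt _ hp.pos
  have hlp : m * n / p < p := by
    rw [Nat.div_lt_iff_lt_mul hp.pos]
    exact Nat.mul_lt_mul'' hmp hnp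
  have hmn : p * (m * n / p) + m * n % p = m * n := Nat.div_add_mod _ _
  set r := m * n % p
  set l := m * n / p
  -- Without a carry mn is its own remainder. The case must be split off because the entry p²lc
  -- would be zero.
  by_cases hl : l = 0
  · rw [hl] at hmn
    have : r = m * n := by omega
    rw [this]; push_cast; rfl
  have hS : ∀ {a : ℕ}, a ≠ 0 → a < p → IsSmooth (p - 1) (a : ℤ) := fun h0 h =>
    isSmooth_of_le h0 (by omega)
  have hp' : (p : ℚ) ≠ 0 := by exact_mod_cast hp.ne_zero
  have hr' : (r : ℚ) ≠ 0 := by exact_mod_cast hr0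
  have hl' : (l : ℚ) ≠ 0 := by exact_mod_cast hl
  have hm' : (m : ℚ) ≠ 0 := by exact_mod_cast hm
  have hn' : (n : ℚ) ≠ 0 := by exact_mod_cast hn
  have hc' : (c : ℚ) ≠ 0 := by exact_mod_cast hc.1
  have hmnq : (p : ℚ) * l + r = m * n := by exact_mod_cast hmn
  have hsum : (p * r * c : ℚ) + p ^ 2 * l * c = p * (m * n) * c := by rw [← hmnq]; ring
  have h := rankOne_add_rankOne (p * r * c : ℚ) (p ^ 2 * l * c) (by positivity) (by positivity)
    (by rw [hsum]; positivity)
  rw [hsum] at h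
  have h1 : rankOne (p ^ 2 * l * c : ℚ) ∈ smoothGroup (p - 1) :=
    IsSmooth.rankOne_sq_mem (n := l * c) ((hS hl hlp).mul hc) hp' (by push_cast; ring)
  have h2 : rankOne (p * r * c * (p ^ 2 * l * c) * (p * (m * n) * c) : ℚ) ∈ smoothGroup (p - 1) :=
    IsSmooth.rankOne_sq_mem (n := r * l * (m * n) * c) (c := (p : ℚ) ^ 2 * c)
      ((((hS hr0 hrp).mul (hS hl hlp)).mul ((hS hm hmp).mul (hS hn hnp))).mul hc)
      (by positivity) (by push_cast; ring)
  have h3 := congrArg (QuotientAddGroup.mk (s := smoothGroup (p - 1))) h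
  rw [QuotientAddGroup.mk_add, QuotientAddGroup.mk_add, (QuotientAddGroup.eq_zero_iff _).2 h1,
    (QuotientAddGroup.eq_zero_iff _).2 h2, add_zero, add_zero] at h3
  simp only [primeClass]
  rw [show (p * ((m * n * c : ℤ) : ℚ) : ℚ) = p * (m * n) * c by push_cast; ring, ← h3]
  congr 2
  push_cast; ring

/-- Induction over the factorization of n, whose prime factors are already less than p. The free
factor c is what allows one factor of a product to be reduced while the other waits. -/
theorem primeClass_mod {p : ℕ} (hp : p.Prime) (n : ℕ) (hn : IsSmooth (p - 1) (n : ℤ)) (c : ℤ)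
    (hc : IsSmooth (p - 1) c) : primeClass p (n * c) = primeClass p ((n % p : ℕ) * c) := by
  induction n using Nat.recOnMul generalizing c with
  | zero => exact absurd rfl hn.1
  | one => rw [Nat.mod_eq_of_lt hp.one_lt]
  | prime q hq =>
    rw [Nat.mod_eq_of_lt]
    have := hn.2 q hq dvd_rfl
    have := hp.two_le
    omega
  | mul a b iha ihb =>
    have ha : IsSmooth (p - 1) (a : ℤ) := hn.of_dvd ⟨b, by push_cast; rfl⟩
    have hb : IsSmooth (p - 1) (b : ℤ) := hn.of_dvd ⟨a, by push_cast; ring⟩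
    have key : ∀ {a : ℕ}, IsSmooth (p - 1) (a : ℤ) → a % p ≠ 0 ∧ a % p < p := fun h =>
      ⟨fun h0 => h.not_dvd hp (by exact_mod_cast Nat.dvd_of_mod_eq_zero h0),
        Nat.mod_lt _ hp.pos⟩
    obtain ⟨ha0, hap⟩ := key ha
    obtain ⟨hb0, hbp⟩ := key hb
    have hS : ∀ {a : ℕ}, a ≠ 0 → a < p → IsSmooth (p - 1) (a : ℤ) := fun h0 h =>
      isSmooth_of_le h0 (by omega)
    have h1 := iha ha (b * c) (hb.mul hc)
    have h2 := ihb hb ((a % p : ℕ) * c) ((hS ha0 hap).mul hc)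
    have h3 := primeClass_mod_mul hp ha0 hap hb0 hbp hc
    rw [← Nat.mul_mod] at h3
    push_cast at *
    rw [mul_assoc, h1, ← h3, mul_left_comm, h2]
    congr 1
    ring

/-- For negative n one must pass from -r to p - r. The entries of ⟨p(p - r)⟩ ⊕ ⟨pr⟩ add up to p², so
this form is equivalent to one with (p - 1)-smooth entries up to squares, and the two classes are
opposite in the quotient. -/
theorem primeClass_eq_val (p : ℕ) [hp : Fact p.Prime] {n : ℤ} (hn : IsSmooth (p - 1) n) :
    primeClass p n = primeClass p ((n : ZMod p).val : ℕ) := by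
  have h1 : IsSmooth (p - 1) (1 : ℤ) := by
    have := isSmooth_of_le (k := p - 1) (n := 1) one_ne_zero (by have := hp.out.two_le; omega)
    simpa using this
  have hnat : ∀ m : ℕ, IsSmooth (p - 1) (m : ℤ) →
      primeClass p m = primeClass p ((m : ZMod p).val : ℕ) := by
    intro m hm
    have := primeClass_mod hp.out m hm 1 h1
    rwa [mul_one, mul_one, ← ZMod.val_natCast] at this
  rcases Int.natAbs_eq n with h | h
  · have := hnat n.natAbs (by rwa [← h])
    rw [← h] at this
    rw [this]
    congr 3
    have := congrArg (Int.cast (R := ZMod p)) h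
    rw [Int.cast_natCast] at this
    exact this.symm
  · set m := n.natAbs
    have hm : IsSmooth (p - 1) (m : ℤ) := by
      have := hn.neg
      rwa [h, neg_neg] at this
    have hz : (m : ZMod p) ≠ 0 := fun h0 => hm.not_dvd hp.out
      (by exact_mod_cast (ZMod.natCast_eq_zero_iff _ _).1 h0)
    rw [h, primeClass_neg, hnat m hm]
    push_cast
    have hv := ZMod.val_lt (m : ZMod p)
    have hv0 : (m : ZMod p).val ≠ 0 := fun h0 => hz ((ZMod.val_eq_zero _).1 h0)
    have : NeZero (m : ZMod p) := ⟨hz⟩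
    rw [ZMod.val_neg_of_ne_zero]
    set r := (m : ZMod p).val
    have hp0 : (p : ℤ) ≠ 0 := by exact_mod_cast hp.out.ne_zero
    have hr : (((p - r : ℕ) : ℕ) : ℤ) = p - r := by push_cast [hv.le]; ring
    have hsm : IsSmooth (p - 1) ((p : ℤ) - r) := by
      rw [← hr]; exact isSmooth_of_le (by omega) (by omega)
    have hsr : IsSmooth (p - 1) (r : ℤ) := isSmooth_of_le hv0 (by omega)
    have hadd := primeClass_add hp.out.ne_zero (m := (p : ℤ) - r) (n := r) hsm.1 hsr.1
      (by simpa using hp0)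
    rw [sub_add_cancel] at hadd
    have hpq : (p : ℚ) ≠ 0 := by exact_mod_cast hp.out.ne_zero
    have e1 : primeClass p p = 0 := (QuotientAddGroup.eq_zero_iff _).2
      (h1.rankOne_sq_mem hpq (by push_cast; ring))
    have e2 : primeClass p ((p - r : ℤ) * r * p) = 0 := (QuotientAddGroup.eq_zero_iff _).2
      ((hsm.mul hsr).rankOne_sq_mem hpq (by push_cast; ring))
    rw [e1, e2, add_zero] at hadd
    rw [hr, eq_comm, eq_neg_iff_add_eq_zero]
    exact hadd

/-- The class of `⟨p n⟩` depends only on the square class of `n` modulo `p`. -/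
theorem primeClass_eq_of_sq (p : ℕ) [hp : Fact p.Prime] {m n : ℤ} (hm : IsSmooth (p - 1) m)
    (hn : IsSmooth (p - 1) n) {s : ZMod p} (hs : (n : ZMod p) = m * s ^ 2) :
    primeClass p n = primeClass p m := by
  have hnz : (n : ZMod p) ≠ 0 := fun h0 => hn.not_dvd hp.out
    ((ZMod.intCast_zmod_eq_zero_iff_dvd _ _).1 h0)
  have hs0 : s ≠ 0 := by
    rintro rfl
    exact hnz (by rw [hs]; simp)
  have hsm : IsSmooth (p - 1) (s.val : ℤ) :=
    isSmooth_of_le (by simpa [ZMod.val_eq_zero] using hs0) (by have := ZMod.val_lt s; omega)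
  have hsq : IsSmooth (p - 1) ((s.val : ℤ) ^ 2) := by rw [pow_two]; exact hsm.mul hsm
  rw [← primeClass_mul_sq p hp.out.ne_zero hm.1 hsm.1, primeClass_eq_val p hn,
    primeClass_eq_val p (hsq.mul hm), hs]
  congr 3
  push_cast
  rw [ZMod.natCast_zmod_val]; ring

end Kernel

/-! ### Injectivity of the residue on each layer -/

section Kernel

/-- Only the parity of the exponent of p in n matters: an even power is a square, an odd one leaves
a single factor p. -/
theorem mk_rankOne_eq_primeClass (p : ℕ) [hp : Fact p.Prime] {n : ℤ} (hn : IsSmooth p n) :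
    (QuotientAddGroup.mk (rankOne (n : ℚ)) : WittGroup ℚ ⧸ smoothGroup (p - 1)) = 0 ∨
      ∃ m : ℤ, IsSmooth (p - 1) m ∧
        (QuotientAddGroup.mk (rankOne (n : ℚ)) : WittGroup ℚ ⧸ smoothGroup (p - 1)) =
          primeClass p m := by
  have hfin : FiniteMultiplicity (p : ℤ) n :=
    Int.finiteMultiplicity_iff.2 ⟨by simpa using hp.out.ne_one, hn.1⟩
  obtain ⟨m, hm, hnm⟩ := hfin.exists_eq_pow_mul_and_not_dvd
  set v := multiplicity (p : ℤ) n
  have hms : IsSmooth (p - 1) m := by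
    have hms' : IsSmooth p m := hn.of_dvd ⟨(p : ℤ) ^ v, hm.trans (mul_comm _ _)⟩
    refine ⟨hms'.1, fun q hq h => ?_⟩
    have := hms'.2 q hq h
    rcases this.lt_or_eq with h' | h'
    · omega
    · exact absurd (h' ▸ h) hnm
  have hpq : (p : ℚ) ≠ 0 := by exact_mod_cast hp.out.ne_zero
  rcases Nat.even_or_odd v with ⟨k, hk⟩ | ⟨k, hk⟩
  · refine Or.inl ((QuotientAddGroup.eq_zero_iff _).2
      (hms.rankOne_sq_mem (c := (p : ℚ) ^ k) (pow_ne_zero _ hpq) ?_))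
    rw [hm, hk]; push_cast; ring
  · refine Or.inr ⟨m, hms, ?_⟩
    have hm0 : (m : ℚ) ≠ 0 := by exact_mod_cast hms.1
    rw [primeClass, ← rankOne_mul_sq (p * m : ℚ) ((p : ℚ) ^ k) (mul_ne_zero hpq hm0)
      (pow_ne_zero _ hpq)]
    rw [hm, hk]
    congr 2
    push_cast; ring

/-- Let X and Y be the classes of ⟨p⟩ and ⟨pe⟩. In the quotient w is aX + bY, so its residue is a[1]
+ b[e]. If this vanishes, the rank a + b is even and the discriminant condition restricts b; no
further knowledge of W(𝔽_p) is needed. -/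
theorem exists_repr_of_residue_eq_zero (p : ℕ) [hp : Fact p.Prime] {e : ℤ}
    (he : IsSmooth (p - 1) e) (h1 : IsSmooth (p - 1) 1)
    (h4 : ∀ m, IsSmooth (p - 1) m → (4 : ℕ) • primeClass p m = 0)
    (hdich : ∀ m, IsSmooth (p - 1) m →
      primeClass p m = primeClass p 1 ∨ primeClass p m = primeClass p e)
    {w : WittGroup ℚ} (hw : w ∈ smoothGroup p) (hres : residue p w = 0) :
    ∃ (a b k : ℕ) (c : ZMod p),
      (QuotientAddGroup.mk w : WittGroup ℚ ⧸ smoothGroup (p - 1)) =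
        a • primeClass p 1 + b • primeClass p e ∧
      a + b = 2 * k ∧ c ≠ 0 ∧ (e : ZMod p) ^ b = (-1) ^ k * c ^ 2 := by
  have hsplit : ∃ a b : ℕ, (QuotientAddGroup.mk w : WittGroup ℚ ⧸ smoothGroup (p - 1)) =
      a • primeClass p 1 + b • primeClass p e := by
    clear hres
    induction hw using AddSubgroup.closure_induction with
    | mem w hw =>
      obtain ⟨n, hn, rfl⟩ := hw
      rcases mk_rankOne_eq_primeClass p hn with h | ⟨m, hm, h⟩
      · exact ⟨0, 0, by simp [h]⟩
      · rcases hdich m hm with h' | h'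
        · exact ⟨1, 0, by simp [h, h']⟩
        · exact ⟨0, 1, by simp [h, h']⟩
    | zero => exact ⟨0, 0, by simp⟩
    | add x y _ _ hx hy =>
      obtain ⟨a, b, hab⟩ := hx
      obtain ⟨a', b', hab'⟩ := hy
      refine ⟨a + a', b + b', ?_⟩
      rw [QuotientAddGroup.mk_add, hab, hab', add_smul, add_smul]
      abel
    -- Since 4X = 4Y = 0, the factor -1 may be replaced by 3. The coefficients thus stay natural
    -- numbers and describe a diagonal form.
    | neg x _ hx =>
      obtain ⟨a, b, hab⟩ := hx
      refine ⟨3 * a, 3 * b, ?_⟩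
      rw [QuotientAddGroup.mk_neg, hab, neg_eq_iff_add_eq_zero]
      have e1 := congrArg (a • ·) (h4 1 h1)
      have e2 := congrArg (b • ·) (h4 e he)
      simp only [smul_smul, smul_zero] at e1 e2
      calc _ = (a * 4) • primeClass p 1 + (b * 4) • primeClass p e := by
            rw [show a * 4 = a + 3 * a by ring, show b * 4 = b + 3 * b by ring, add_smul,
              add_smul]
            abel
        _ = 0 := by rw [e1, e2, add_zero]
  obtain ⟨a, b, hab⟩ := hsplit
  have hmem : w - (a • rankOne (p * (1 : ℤ) : ℚ) + b • rankOne (p * e : ℚ)) ∈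
      smoothGroup (p - 1) := by
    rw [← QuotientAddGroup.eq_zero_iff]
    have : (QuotientAddGroup.mk (w - (a • rankOne (p * (1 : ℤ) : ℚ) + b • rankOne (p * e : ℚ))) :
      WittGroup ℚ ⧸ smoothGroup (p - 1)) = QuotientAddGroup.mk w -
        (a • primeClass p 1 + b • primeClass p e) := rfl
    rw [this, hab, sub_self]
  have hz := residue_eq_zero_of_mem p hmem
  rw [map_sub, hres, map_add, map_nsmul, map_nsmul, residue_rankOne_prime_mul p (h1.not_dvd hp.out),
    residue_rankOne_prime_mul p (he.not_dvd hp.out), zero_sub, neg_eq_zero, Int.cast_one] at hz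
  have he0 : (e : ZMod p) ≠ 0 := fun h0 => he.not_dvd hp.out
    ((ZMod.intCast_zmod_eq_zero_iff_dvd _ _).1 h0)
  obtain ⟨k, c, hk, hc, hd⟩ := disc_of_sum_rankOne_eq_zero
    (Fin.append (fun _ : Fin a => (1 : ZMod p)) (fun _ : Fin b => (e : ZMod p)))
    (fun i => by
      refine Fin.addCases (fun i => ?_) (fun i => ?_) i
      · simp
      · simpa using he0)
    (by rw [Fin.sum_univ_add]; simpa using hz)
  rw [Fin.prod_univ_add] at hd
  exact ⟨a, b, k, c, hab, hk, hc, by simpa using hd⟩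

/-- The relation turns ⟨2⟩ ⊕ ⟨2⟩ into forms with square entries, so 2X = 0. Every odd integer is a
square modulo 2, so X is the only generator, and even rank suffices. -/
theorem mem_smoothGroup_of_residue_two {w : WittGroup ℚ} (hw : w ∈ smoothGroup 2)
    (hres : residue 2 w = 0) : w ∈ smoothGroup 1 := by
  have h1 : IsSmooth (2 - 1) (1 : ℤ) := by simpa using isSmooth_of_le (k := 1) one_ne_zero le_rfl
  have hX : (2 : ℕ) • primeClass 2 1 = 0 := by
    have := primeClass_add (p := 2) two_ne_zero (m := 1) (n := 1) (by simp) (by simp) (by simp)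
    rw [two_nsmul, this]
    have e : primeClass 2 (1 + 1) = 0 := (QuotientAddGroup.eq_zero_iff _).2
      (h1.rankOne_sq_mem (c := 2) two_ne_zero (by push_cast; norm_num))
    have e' : primeClass 2 (1 * 1 * (1 + 1)) = 0 := (QuotientAddGroup.eq_zero_iff _).2
      (h1.rankOne_sq_mem (c := 2) two_ne_zero (by push_cast; norm_num))
    rw [e, e', add_zero]
  have hd : ∀ m, IsSmooth (2 - 1) m → primeClass 2 m = primeClass 2 1 := fun m hm => by
    refine primeClass_eq_of_sq 2 h1 hm (s := 1) ?_
    have h0 : (m : ZMod 2) ≠ 0 := fun h0 => hm.not_dvd Nat.prime_two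
      ((ZMod.intCast_zmod_eq_zero_iff_dvd _ _).1 h0)
    generalize (m : ZMod 2) = x at h0
    revert h0
    revert x
    decide
  have h4 : ∀ m, IsSmooth (2 - 1) m → (4 : ℕ) • primeClass 2 m = 0 := fun m hm => by
    rw [hd m hm, show 4 = 2 * 2 by rfl, mul_smul, hX, smul_zero]
  obtain ⟨a, b, k, c, hab, hk, -, -⟩ := exists_repr_of_residue_eq_zero 2 h1 h1 h4
    (fun m hm => Or.inl (hd m hm)) hw hres
  rw [← add_smul, hk, mul_comm, mul_smul, hX, smul_zero] at hab
  exact (QuotientAddGroup.eq_zero_iff _).1 hab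

/-- Take for e the least nonsquare u; then v = u - 1 is a square modulo p. The relation between ⟨pv⟩
⊕ ⟨p⟩ and ⟨pu⟩ ⊕ ⟨pvu⟩ becomes X + X = Y + Y. -/
theorem exists_primeClass_two_smul_eq (p : ℕ) [hp : Fact p.Prime] (hp2 : p ≠ 2) :
    ∃ e : ℤ, IsSmooth (p - 1) e ∧ ¬ IsSquare (e : ZMod p) ∧
      (2 : ℕ) • primeClass p 1 = (2 : ℕ) • primeClass p e := by
  have hns : ∃ u : ℕ, u < p ∧ ¬ IsSquare (u : ZMod p) := by
    obtain ⟨a, ha⟩ := FiniteField.exists_nonsquare (F := ZMod p) (by rwa [ZMod.ringChar_zmod_n])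
    exact ⟨a.val, ZMod.val_lt a, by rwa [ZMod.natCast_zmod_val]⟩
  classical
  obtain ⟨hup, hu⟩ := Nat.find_spec hns
  set u := Nat.find hns with hudef
  have hu0 : u ≠ 0 := fun h => hu (by rw [h]; simp)
  have hu1 : u ≠ 1 := fun h => hu (by rw [h]; simp)
  obtain ⟨v, hv⟩ : ∃ v, u = v + 1 := ⟨u - 1, by omega⟩
  have hvs : IsSquare (v : ZMod p) := by
    have := Nat.find_min hns (m := v) (by omega)
    by_contra h
    exact this ⟨by omega, h⟩
  have hsu : IsSmooth (p - 1) (u : ℤ) := isSmooth_of_le hu0 (by omega)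
  have hsv : IsSmooth (p - 1) (v : ℤ) := isSmooth_of_le (by omega) (by omega)
  have h1 : IsSmooth (p - 1) (1 : ℤ) := by
    simpa using isSmooth_of_le (k := p - 1) one_ne_zero (by omega)
  obtain ⟨s, hs⟩ := hvs
  have huv : (u : ℤ) = v + 1 := by exact_mod_cast hv
  refine ⟨u, hsu, by simpa using hu, ?_⟩
  have hadd := primeClass_add hp.out.ne_zero (m := (v : ℤ)) (n := 1) hsv.1 one_ne_zero
    (by rw [← huv]; exact hsu.1)
  rw [← huv, mul_one] at hadd
  rw [two_nsmul, two_nsmul]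
  rw [primeClass_eq_of_sq p h1 hsv (s := s) (by push_cast; rw [hs]; ring),
    primeClass_eq_of_sq p hsu (hsv.mul hsu) (s := s) (by push_cast; rw [hs]; ring)] at hadd
  exact hadd

/-- The generators are X and Y, of ⟨p⟩ and ⟨pe⟩ with e a nonsquare. If -1 is a square modulo p, both
have order at most two, and the discriminant makes both coefficients even. Otherwise Y = -X and 4X =
0, and the discriminant makes the coefficients congruent modulo 4. -/
theorem mem_smoothGroup_of_residue (p : ℕ) [hp : Fact p.Prime] {w : WittGroup ℚ}
    (hw : w ∈ smoothGroup p) (hres : residue p w = 0) : w ∈ smoothGroup (p - 1) := by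
  by_cases hp2 : p = 2
  · subst hp2
    have : hp = ⟨Nat.prime_two⟩ := rfl
    exact mem_smoothGroup_of_residue_two hw hres
  obtain ⟨e, he, hens, h2⟩ := exists_primeClass_two_smul_eq p hp2
  have h1 : IsSmooth (p - 1) (1 : ℤ) := by
    simpa using isSmooth_of_le (k := p - 1) one_ne_zero (by have := hp.out.two_le; omega)
  have hnz : ∀ {m}, IsSmooth (p - 1) m → (m : ZMod p) ≠ 0 := fun hm h0 => hm.not_dvd hp.out
    ((ZMod.intCast_zmod_eq_zero_iff_dvd _ _).1 h0)
  have hmulsq : ∀ {x y : ZMod p}, ¬ IsSquare x → ¬ IsSquare y → IsSquare (x * y) := by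
    intro x y hx hy
    have hx' := (quadraticChar_neg_one_iff_not_isSquare (F := ZMod p)).2 hx
    have hy' := (quadraticChar_neg_one_iff_not_isSquare (F := ZMod p)).2 hy
    have hxy : x * y ≠ 0 := mul_ne_zero (fun h => hx (by simp [h])) (fun h => hy (by simp [h]))
    rw [← quadraticChar_one_iff_isSquare hxy, map_mul, hx', hy']
    simp
  have hdich : ∀ m, IsSmooth (p - 1) m →
      primeClass p m = primeClass p 1 ∨ primeClass p m = primeClass p e := by
    intro m hm
    by_cases hsq : IsSquare (m : ZMod p)
    · obtain ⟨s, hs⟩ := hsq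
      exact Or.inl (primeClass_eq_of_sq p h1 hm (s := s) (by push_cast; rw [hs]; ring))
    · obtain ⟨s, hs⟩ := hmulsq hsq hens
      refine Or.inr (primeClass_eq_of_sq p he hm (s := s / e) ?_)
      have := hnz he
      field_simp
      rw [hs]; ring
  by_cases hm1 : IsSquare (-1 : ZMod p)
  · have hX2 : ∀ m, IsSmooth (p - 1) m → (2 : ℕ) • primeClass p m = 0 := by
      intro m hm
      obtain ⟨s, hs⟩ := hm1
      have := primeClass_eq_of_sq p hm hm.neg (s := s) (by push_cast; rw [pow_two, ← hs]; ring)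
      rw [primeClass_neg, neg_eq_iff_add_eq_zero] at this
      rw [two_nsmul, this]
    obtain ⟨a, b, k, c, hab, hk, hc, hd⟩ := exists_repr_of_residue_eq_zero p he h1
      (fun m hm => by rw [show 4 = 2 * 2 by rfl, mul_smul, hX2 m hm, smul_zero]) hdich hw hres
    -- Here (-1)^k c² is a square, so it cannot be an odd power of the nonsquare e.
    have hb : Even b := by
      by_contra hb
      obtain ⟨j, hj⟩ := Nat.not_even_iff_odd.1 hb
      apply hens
      have h3 : IsSquare ((e : ZMod p) ^ b) := by
        rw [hd]; exact (hm1.pow k).mul ⟨c, by ring⟩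
      obtain ⟨s, hs⟩ := h3
      have h0 := hnz he
      refine ⟨s / e ^ j, ?_⟩
      field_simp
      rw [pow_two s, ← hs, hj]
      ring
    obtain ⟨j, hj⟩ := hb
    obtain ⟨i, hi⟩ : ∃ i, a = i + i := ⟨k - j, by omega⟩
    rw [hi, hj, ← two_mul, ← two_mul, mul_comm, mul_smul, hX2 1 h1, smul_zero, mul_comm, mul_smul,
      hX2 e he, smul_zero, add_zero] at hab
    exact (QuotientAddGroup.eq_zero_iff _).1 hab
  · have hY : primeClass p e = -primeClass p 1 := by
      obtain ⟨s, hs⟩ := hmulsq hens hm1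
      rw [← primeClass_neg]
      exact primeClass_eq_of_sq p h1.neg he (s := s) (by
        push_cast; linear_combination -hs)
    rw [hY, smul_neg, eq_neg_iff_add_eq_zero, ← add_smul] at h2
    have h4 : ∀ m, IsSmooth (p - 1) m → (4 : ℕ) • primeClass p m = 0 := by
      intro m hm
      rcases hdich m hm with h | h
      · rw [h]; exact h2
      · rw [h, hY, smul_neg, neg_eq_zero]; exact h2
    obtain ⟨a, b, k, c, hab, hk, hc, hd⟩ := exists_repr_of_residue_eq_zero p he h1 h4 hdich hw hres
    obtain ⟨s, hs⟩ := hmulsq hens hm1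
    have hs0 : s ≠ 0 := by
      rintro rfl
      exact hnz he (by linear_combination -hs)
    have hes : (e : ZMod p) = -s ^ 2 := by linear_combination -hs
    -- With e = -s² the discriminant condition says that (-1)^(k + b) is a square, while -1 is not.
    -- As a - b = 2(k - b), the difference of the coefficients is divisible by 4.
    have hkb : Even (k + b) := by
      by_contra hkb
      apply hm1
      have h5 : (-1 : ZMod p) ^ (k + b) = -1 := (Nat.not_even_iff_odd.1 hkb).neg_one_pow
      refine ⟨c / s ^ b, ?_⟩
      have h6 : ((-1 : ZMod p) ^ k) * (-1) ^ k = 1 := by rw [← mul_pow]; simp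
      rw [hes, neg_pow, ← pow_mul] at hd
      field_simp
      rw [← pow_mul, mul_comm b 2]
      rw [pow_add] at h5
      linear_combination (-s ^ (2 * b)) * h5 + (-1 : ZMod p) ^ k * hd + c ^ 2 * h6
    have hmod : ∃ i : ℤ, (a : ℤ) - b = 4 * i := by
      obtain ⟨i, hi⟩ := hkb
      exact ⟨i - b, by omega⟩
    obtain ⟨i, hi⟩ := hmod
    rw [hY, smul_neg, ← sub_eq_add_neg, ← natCast_zsmul, ← natCast_zsmul, ← sub_smul, hi, mul_comm,
      mul_smul] at hab
    have h44 : (4 : ℤ) • primeClass p 1 = 0 := by exact_mod_cast h4 1 h1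
    rw [h44, smul_zero] at hab
    exact (QuotientAddGroup.eq_zero_iff _).1 hab

/-- A class in `W(ℚ)` with trivial residues at all primes is a multiple of `[1]`. -/
theorem exists_zsmul_of_residue_eq_zero {w : WittGroup ℚ}
    (h : ∀ (p : ℕ) [Fact p.Prime], residue p w = 0) : ∃ n : ℤ, w = n • rankOne (1 : ℚ) := by
  obtain ⟨k, hk⟩ := exists_mem_smoothGroup w
  have h1 : w ∈ smoothGroup 1 := by
    -- The bound is lowered by one at a time: a prime k + 1 is removed by the vanishing of its
    -- residue, and a composite one is not a possible prime factor.
    induction k with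
    | zero => exact smoothGroup_le (fun n hn => ⟨hn.1, fun q hq h => (hn.2 q hq h).trans (by simp)⟩) hk
    | succ k ih =>
      apply ih
      by_cases hp : (k + 1).Prime
      · have : Fact (k + 1).Prime := ⟨hp⟩
        exact mem_smoothGroup_of_residue (k + 1) hk (h _)
      · refine smoothGroup_le (fun n hn => ⟨hn.1, fun q hq h => ?_⟩) hk
        have := hn.2 q hq h
        rcases this.lt_or_eq with h' | h'
        · omega
        · exact absurd (h' ▸ hq) hp
  obtain ⟨n, hn⟩ := AddSubgroup.mem_zmultiples_iff.1 (smoothGroup_one_le h1)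
  exact ⟨n, hn.symm⟩

end Kernel

/-! ### The Witt span of a symmetrized integral matrix -/

section WittSpan

/-- The form w ⊕ -v has Witt class zero, hence trivial signed discriminant and signature. The signs
in the discriminant depend on the ranks, which are not controlled here; this is why the products are
compared only up to sign. -/
theorem invariants_of_sum_rankOne_eq {n l : ℕ} {w : Fin n → ℚ} {v : Fin l → ℚ}
    (hw : ∀ i, w i ≠ 0) (hv : ∀ i, v i ≠ 0) (h : ∑ i, rankOne (w i) = ∑ i, rankOne (v i)) :
    (∃ c : ℚ, c ≠ 0 ∧ (∏ i, w i = c ^ 2 * ∏ i, v i ∨ ∏ i, w i = -(c ^ 2 * ∏ i, v i))) ∧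
      ∑ i, (SignType.sign (w i) : ℤ) = ∑ i, (SignType.sign (v i) : ℤ) := by
  have hne : ∀ i, Fin.append w (fun i => -v i) i ≠ 0 := fun i => by
    refine Fin.addCases (fun i => ?_) (fun i => ?_) i
    · simpa using hw i
    · simpa using hv i
  have h0 : ∑ i, rankOne (Fin.append w (fun i => -v i) i) = 0 := by
    rw [Fin.sum_univ_add]
    simp only [Fin.append_left, Fin.append_right, ← neg_rankOne', Finset.sum_neg_distrib, h]
    abel
  obtain ⟨k, c, -, hc, hd⟩ := disc_of_sum_rankOne_eq_zero _ hne h0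
  have hs := sum_sign_of_cls_eq_zero _ hne h0
  constructor
  · rw [Fin.prod_univ_add] at hd
    simp only [Fin.append_left, Fin.append_right, Finset.prod_neg] at hd
    have hv0 : ∏ i, v i ≠ 0 := Finset.prod_ne_zero_iff.2 fun i _ => hv i
    refine ⟨c / ∏ i, v i, div_ne_zero hc hv0, ?_⟩
    have e : (c / ∏ i, v i) ^ 2 * ∏ i, v i = c ^ 2 / ∏ i, v i := by field_simp
    rw [e]
    rcases neg_one_pow_eq_or ℚ (Finset.univ : Finset (Fin l)).card with h1 | h1 <;>
    rcases neg_one_pow_eq_or ℚ k with h2 | h2 <;> rw [h1, h2] at hd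
    · left; field_simp; linarith
    · right; field_simp; linarith
    · right; field_simp; linarith
    · left; field_simp; linarith
  · rw [Fin.sum_univ_add] at hs
    simp only [Fin.append_left, Fin.append_right, Left.sign_neg, SignType.coe_neg,
      Finset.sum_neg_distrib] at hs
    linarith

theorem zsmul_rankOne_one (k : ℤ) :
    k • rankOne (1 : ℚ) = ∑ _i : Fin k.natAbs, rankOne (k.sign : ℚ) := by
  rw [Finset.sum_const, Finset.card_univ, Fintype.card_fin]
  rcases lt_trichotomy k 0 with h | rfl | h
  · rw [Int.sign_eq_neg_one_of_neg h, Int.cast_neg, Int.cast_one, ← neg_rankOne', smul_neg,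
      ← natCast_zsmul, ← neg_smul]
    congr 1
    omega
  · simp
  · rw [Int.sign_eq_one_of_pos h, Int.cast_one, ← natCast_zsmul]
    congr 1
    omega

/-- A diagonalization of A is compared with ⟨b⟩ and |k| copies of ⟨sign k⟩, so that k of either sign
is represented by a genuine diagonal form. -/
theorem NForm.invariants_of_cls_eq {A : NForm ℚ} {b : ℚ} (hb : b ≠ 0) {k : ℤ}
    (h : A.cls = rankOne b + k • rankOne (1 : ℚ)) :
    (∃ c : ℚ, c ≠ 0 ∧ (A.mat.det = c ^ 2 * b ∨ A.mat.det = -(c ^ 2 * b))) ∧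
      (sigPos A.mat.toQuadraticForm' : ℤ) - (sigNeg A.mat.toQuadraticForm' : ℤ) =
        (SignType.sign b : ℤ) + k := by
  obtain ⟨n, w, hw, hcong⟩ := A.exists_diag
  have hA : A.cls = ∑ i, rankOne (w i) := by
    rw [← cls_diagForm w hw]
    exact NForm.cls_eq_of_congr hcong
  rw [hA, zsmul_rankOne_one] at h
  have hkey := invariants_of_sum_rankOne_eq hw
    (v := Fin.cons b (fun _ : Fin k.natAbs => (k.sign : ℚ)))
    (fun i => by
      refine Fin.cases ?_ (fun i => ?_) i
      · simpa using hb
      · have hk : k ≠ 0 := fun h0 => by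
          subst h0
          exact i.elim0
        simpa using hk)
    (by rw [Fin.sum_univ_succ]; simpa using h)
  rw [Fin.sum_univ_succ, Fin.prod_univ_succ] at hkey
  simp only [Fin.cons_zero, Fin.cons_succ, Finset.prod_const, Finset.sum_const, Finset.card_univ,
    Fintype.card_fin] at hkey
  obtain ⟨⟨c, hc, hd⟩, hs⟩ := hkey
  constructor
  · obtain ⟨-, c', hc', hdet⟩ := hcong.det_eq
    rw [Matrix.det_diagonal] at hdet
    refine ⟨c / c', div_ne_zero hc hc', ?_⟩
    have hpow : (k.sign : ℚ) ^ k.natAbs = 1 ∨ (k.sign : ℚ) ^ k.natAbs = -1 := by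
      rcases lt_trichotomy k 0 with h | rfl | h
      · rw [Int.sign_eq_neg_one_of_neg h]
        simpa using neg_one_pow_eq_or ℚ k.natAbs
      · simp
      · rw [Int.sign_eq_one_of_pos h]; simp
    have e : (c / c') ^ 2 * b = c ^ 2 * b / c' ^ 2 := by field_simp
    rw [e]
    have hc2 : c' ^ 2 ≠ 0 := pow_ne_zero _ hc'
    rcases hpow with h1 | h1 <;> rw [h1, hdet] at hd <;> rcases hd with hd | hd
    · left; field_simp; linarith
    · right; field_simp; linarith
    · right; field_simp; linarith
    · left; field_simp; linarith
  · rw [hcong.equivalent.sigPos_eq, hcong.equivalent.sigNeg_eq, ← sum_sign_eq, hs]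
    congr 1
    rcases lt_trichotomy k 0 with h | rfl | h
    · rw [Int.sign_eq_neg_one_of_neg h, sign_neg (by norm_num)]
      simp [abs_of_neg h]
    · simp
    · rw [Int.sign_eq_one_of_pos h, sign_pos (by norm_num)]
      simp; omega

theorem wittSpan_le {w : WittGroup ℚ} (B : NForm ℚ)
    (h : ∀ (p : ℕ) [Fact p.Prime], residue p B.cls = residue p w) : wittSpan w ≤ B.rank :=
  Nat.sInf_le ⟨B, rfl, h⟩

/-- A form that represents w is itself a competitor, so the infimum is taken over a nonempty set and
is attained. -/
theorem exists_rank_eq_wittSpan (w : WittGroup ℚ) : ∃ B : NForm ℚ, B.rank = wittSpan w ∧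
    ∀ (p : ℕ) [Fact p.Prime], residue p B.cls = residue p w := by
  obtain ⟨A, rfl⟩ := Quotient.exists_rep w
  exact Nat.sInf_mem (s := {r | ∃ B : NForm ℚ, B.rank = r ∧
    ∀ (p : ℕ) [Fact p.Prime], residue p B.cls = residue p _}) ⟨A.rank, A, rfl, fun p _ => rfl⟩

theorem NForm.cls_of_rank_zero {B : NForm ℚ} (h : B.rank = 0) : B.cls = 0 :=
  NForm.cls_eq_zero ⟨⊥, by rw [finrank_bot, Fintype.card_fin, h], by simp⟩

theorem NForm.cls_of_rank_one {B : NForm ℚ} (h : B.rank = 1) :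
    ∃ b : ℚ, b ≠ 0 ∧ B.cls = rankOne b := by
  obtain ⟨n, M, hs, hd⟩ := B
  obtain rfl : n = 1 := h
  have hM : M = !![M 0 0] := by
    ext i j
    fin_cases i; fin_cases j; rfl
  refine ⟨M 0 0, fun h0 => hd (by rw [hM, h0]; simp), ?_⟩
  rw [rankOne, ← hM]
  exact (wittClass_eq _).symm

theorem residue_rankOne_one (p : ℕ) [hp : Fact p.Prime] : residue p (rankOne (1 : ℚ)) = 0 := by
  have := residue_rankOne_of_not_dvd p (n := 1) (fun h => by
    have := Int.natCast_dvd.1 h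
    exact hp.out.one_lt.ne' (by simpa using this))
  simpa using this

theorem symSeifert_det {m : ℕ} (V : Matrix (Fin m) (Fin m) ℤ) :
    (symSeifert V).det = ((V + V.transpose).det : ℤ) := by
  rw [symSeifert, Int.cast_det]

theorem isSymm_symSeifert {m : ℕ} (V : Matrix (Fin m) (Fin m) ℤ) : (symSeifert V).IsSymm := by
  ext i j
  simp [symSeifert, add_comm]

/-- The Witt span of a matrix with non-degenerate symmetrization. -/
theorem knotWittSpan_le_one_iff {m : ℕ} (V : Matrix (Fin m) (Fin m) ℤ)
    (hV : (symSeifert V).det ≠ 0) :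
    (knotWittSpan V ≤ 1 ↔
      ∃ d : ℤ, (d = (knotDet V : ℤ) ∨ d = -(knotDet V : ℤ)) ∧
        knotWittClass V = rankOne (d : ℚ) + (knotSignature V - d.sign) • rankOne (1 : ℚ)) ∧
    (knotWittSpan V ≤ 1 →
      (IsSquare (knotDet V) → knotWittSpan V = 0) ∧
      (¬ IsSquare (knotDet V) → knotWittSpan V = 1)) := by
  let A : NForm ℚ := ⟨m, symSeifert V, isSymm_symSeifert V, hV⟩
  have hA : knotWittClass V = A.cls := wittClass_eq A
  have hdet : A.mat.det = ((V + V.transpose).det : ℤ) := symSeifert_det V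
  have hD0 : (V + V.transpose).det ≠ 0 := fun h0 => hV (by rw [symSeifert_det, h0]; simp)
  have hkD : (knotDet V : ℤ) = |(V + V.transpose).det| := by rw [knotDet]; simp
  have hdet' : ((knotDet V : ℕ) : ℚ) = |A.mat.det| := by
    rw [hdet, ← Int.cast_abs, ← hkD]; simp
  have hk0 : (knotDet V : ℤ) ≠ 0 := by rw [hkD]; simpa using hD0
  -- a form with trivial residues differs by a multiple of `[1]`
  have hrep : ∀ b : ℚ, b ≠ 0 → ∀ k : ℤ, A.cls = rankOne b + k • rankOne (1 : ℚ) →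
      ∃ c : ℚ, c ≠ 0 ∧ ((knotDet V : ℕ) : ℚ) = c ^ 2 * |b| ∧
        knotSignature V = SignType.sign b + k := by
    intro b hb k h
    obtain ⟨⟨c, hc, hd⟩, hs⟩ := NForm.invariants_of_cls_eq hb h
    refine ⟨c, hc, ?_, hs⟩
    rw [hdet']
    rcases hd with hd | hd <;> rw [hd] <;> simp [abs_mul]
  have hker : ∀ B : NForm ℚ, (∀ (p : ℕ) [Fact p.Prime], residue p B.cls = residue p A.cls) →
      ∃ k : ℤ, A.cls = B.cls + k • rankOne (1 : ℚ) := by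
    intro B hB
    obtain ⟨k, hk⟩ := exists_zsmul_of_residue_eq_zero (w := A.cls - B.cls)
      (fun p _ => by rw [map_sub, hB p, sub_self])
    exact ⟨k, by rw [← hk]; abel⟩
  -- Rank zero leaves W(K) = k[1] = [1] + (k - 1)[1]; comparison of the discriminants with b = 1
  -- makes det K a square.
  have hzero : ∀ B : NForm ℚ, (∀ (p : ℕ) [Fact p.Prime], residue p B.cls = residue p A.cls) →
      B.rank = 0 → (∃ k : ℤ, A.cls = rankOne (1 : ℚ) + k • rankOne (1 : ℚ)) ∧
        IsSquare (knotDet V) := by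
    intro B hB h0
    obtain ⟨k, hk⟩ := hker B hB
    rw [NForm.cls_of_rank_zero h0, zero_add] at hk
    have h1 : A.cls = rankOne (1 : ℚ) + (k - 1) • rankOne (1 : ℚ) := by
      rw [hk, sub_smul, one_smul]; abel
    refine ⟨⟨k - 1, h1⟩, ?_⟩
    obtain ⟨c, hc, h, -⟩ := hrep 1 one_ne_zero _ h1
    rw [← Rat.isSquare_natCast_iff]
    exact ⟨c, by rw [h]; simp; ring⟩
  have hfwd : knotWittSpan V ≤ 1 →
      ∃ d : ℤ, (d = (knotDet V : ℤ) ∨ d = -(knotDet V : ℤ)) ∧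
        knotWittClass V = rankOne (d : ℚ) + (knotSignature V - d.sign) • rankOne (1 : ℚ) := by
    intro hle
    obtain ⟨b, hb, k, hbk⟩ : ∃ b : ℚ, b ≠ 0 ∧ ∃ k : ℤ,
        A.cls = rankOne b + k • rankOne (1 : ℚ) := by
      obtain ⟨B, hB, hres⟩ := exists_rank_eq_wittSpan (knotWittClass V)
      rw [hA] at hres
      change B.rank = knotWittSpan V at hB
      rcases Nat.le_one_iff_eq_zero_or_eq_one.1 (hB.trans_le hle) with h0 | h1
      · obtain ⟨⟨k, hk⟩, -⟩ := hzero B hres h0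
        exact ⟨1, one_ne_zero, k, hk⟩
      · obtain ⟨b, hb, hB1⟩ := NForm.cls_of_rank_one h1
        obtain ⟨k, hk⟩ := hker B hres
        exact ⟨b, hb, k, by rw [hk, hB1]⟩
    obtain ⟨c, hc, hd, hs⟩ := hrep b hb k hbk
    rw [hA, hbk, hs]
    -- Since det K = c²|b|, the integer d equals c²b exactly when it has the sign of b.
    rcases lt_or_gt_of_ne hb with hneg | hpos
    · refine ⟨-(knotDet V : ℤ), Or.inr rfl, ?_⟩
      rw [abs_of_neg hneg] at hd
      have : ((-(knotDet V : ℤ) : ℤ) : ℚ) = c ^ 2 * b := by push_cast; rw [hd]; ring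
      rw [this, rankOne_mul_sq b c hb hc, Int.sign_eq_neg_one_of_neg (by omega), sign_neg hneg]
      simp
    · refine ⟨(knotDet V : ℤ), Or.inl rfl, ?_⟩
      rw [abs_of_pos hpos] at hd
      have : (((knotDet V : ℤ) : ℤ) : ℚ) = c ^ 2 * b := by push_cast; rw [hd]
      rw [this, rankOne_mul_sq b c hb hc, Int.sign_eq_one_of_pos (by omega), sign_pos hpos]
      simp
  refine ⟨⟨hfwd, ?_⟩, fun hle => ⟨fun hsq => ?_, fun hns => ?_⟩⟩
  · rintro ⟨d, hd, hW⟩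
    have hd0 : (d : ℚ) ≠ 0 := by
      have : d ≠ 0 := by rcases hd with rfl | rfl <;> simpa using hk0
      exact_mod_cast this
    -- The form ⟨d⟩ competes, because the multiple of [1] has no residues.
    refine wittSpan_le (diagForm ![(d : ℚ)] (by simpa using hd0)) fun p _ => ?_
    rw [← rankOne_eq _ hd0, hW, map_add, map_zsmul, residue_rankOne_one, smul_zero, add_zero]
  · obtain ⟨d, hd, hW⟩ := hfwd hle
    obtain ⟨s, hs⟩ := hsq
    have hs0 : (s : ℚ) ≠ 0 := by
      intro h0
      apply hk0
      have : s = 0 := by exact_mod_cast h0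
      rw [hs, this]; simp
    have hres : ∀ (p : ℕ) [Fact p.Prime], residue p (rankOne (d : ℚ)) = 0 := by
      intro p _
      have h1 : rankOne ((knotDet V : ℤ) : ℚ) = rankOne (1 : ℚ) := by
        rw [← rankOne_mul_sq 1 (s : ℚ) one_ne_zero hs0, hs]
        congr 1
        push_cast; ring
      rcases hd with rfl | rfl
      · rw [h1, residue_rankOne_one]
      · rw [Int.cast_neg, ← neg_rankOne', h1, map_neg, residue_rankOne_one, neg_zero]
    refine Nat.le_zero.1 (wittSpan_le (NForm.zero ℚ) fun p _ => ?_)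
    rw [hW, map_add, map_zsmul, residue_rankOne_one, smul_zero, add_zero, hres p]
    exact map_zero _
  · refine le_antisymm hle (Nat.one_le_iff_ne_zero.2 fun h0 => hns ?_)
    obtain ⟨B, hB, hres⟩ := exists_rank_eq_wittSpan (knotWittClass V)
    rw [hA] at hres
    exact (hzero B hres (hB.trans h0)).2

end WittSpan

/-! ### A parity count for polyhedra -/

section AffineFunctions

variable {ι : Type*} [Fintype ι]

-- The times in [0, 1] at which all functions are nonnegative form a compact set. If it is nonempty,
-- its least element is either the start, with all functions positive there, or a time at which
-- exactly one function vanishes, with positive slope. Two functions cannot both enter in this way,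
-- and none can if the start is inside.
open scoped Classical in
theorem card_entering_add (α β : ι → ℝ)
    (H : ∀ s ∈ Set.Icc (0 : ℝ) 1, (∀ i, 0 ≤ α i + s * β i) → ∀ i, α i + s * β i = 0 →
      s ∈ Set.Ioo (0 : ℝ) 1 ∧ β i ≠ 0 ∧ ∀ j, j ≠ i → 0 < α j + s * β j) :
    (∑ i, if (0 < β i ∧ ∃ s ∈ Set.Ioo (0 : ℝ) 1, α i + s * β i = 0 ∧
        ∀ j, j ≠ i → 0 < α j + s * β j) then (1 : ZMod 2) else 0) +
      (if ∀ i, 0 < α i then 1 else 0) =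
      if ∃ s ∈ Set.Icc (0 : ℝ) 1, ∀ i, 0 ≤ α i + s * β i then 1 else 0 := by
  set E : ι → Prop := fun i => 0 < β i ∧ ∃ s ∈ Set.Ioo (0 : ℝ) 1, α i + s * β i = 0 ∧
        ∀ j, j ≠ i → 0 < α j + s * β j with hE
  have huniq : ∀ i j, E i → E j → i = j := by
    rintro i j ⟨hi, s, hs, hsi, hsj⟩ ⟨hj, t, ht, hti, htj⟩
    by_contra hij
    have h1 := hsj j (Ne.symm hij)
    have h2 := htj i hij
    rcases le_total s t with h | h
    · nlinarith
    · nlinarith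
  have hno : (∀ i, 0 < α i) → ∀ i, ¬ E i := by
    rintro h i ⟨hi, s, hs, hsi, -⟩
    have := h i
    have := mul_pos hs.1 hi
    linarith
  have hsub : ∀ i, E i → ∃ s ∈ Set.Icc (0 : ℝ) 1, ∀ i, 0 ≤ α i + s * β i := by
    rintro i ⟨hi, s, hs, hsi, hsj⟩
    refine ⟨s, ⟨hs.1.le, hs.2.le⟩, fun j => ?_⟩
    by_cases hj : j = i
    · rw [hj, hsi]
    · exact (hsj j hj).le
  have hsub0 : (∀ i, 0 < α i) → ∃ s ∈ Set.Icc (0 : ℝ) 1, ∀ i, 0 ≤ α i + s * β i := fun h =>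
    ⟨0, by simp, fun i => by simpa using (h i).le⟩
  have hex : (∃ s ∈ Set.Icc (0 : ℝ) 1, ∀ i, 0 ≤ α i + s * β i) →
      (∀ i, 0 < α i) ∨ ∃ i, E i := by
    rintro ⟨s₀, hs₀, hs₀'⟩
    let I : Set ℝ := Set.Icc 0 1 ∩ ⋂ i, {s | 0 ≤ α i + s * β i}
    have hI : IsCompact I := isCompact_Icc.inter_right
      (isClosed_iInter fun i => isClosed_le continuous_const (by fun_prop))
    have hmem : ∀ s, s ∈ I ↔ s ∈ Set.Icc (0 : ℝ) 1 ∧ ∀ i, 0 ≤ α i + s * β i := by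
      intro s; simp [I]
    obtain ⟨A, hA, hAmin⟩ := hI.exists_isLeast ⟨s₀, (hmem _).2 ⟨hs₀, hs₀'⟩⟩
    obtain ⟨hA01, hA0⟩ := (hmem A).1 hA
    by_cases hz : ∃ i, α i + A * β i = 0
    · obtain ⟨i, hi⟩ := hz
      obtain ⟨hAo, hβ, hj⟩ := H A hA01 hA0 i hi
      refine Or.inr ⟨i, ?_, A, hAo, hi, hj⟩
      -- With a negative slope the inequalities would also hold shortly before `A`, against
      -- minimality.
      by_contra hneg
      have hneg : β i < 0 := lt_of_le_of_ne (not_lt.1 hneg) hβ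
      have hev : ∀ᶠ s in 𝓝[<] A, s ∈ I := by
        have h1 : ∀ᶠ s in 𝓝[<] A, 0 < s :=
          (eventually_gt_nhds hAo.1).filter_mono nhdsWithin_le_nhds
        have h2 : ∀ᶠ s in 𝓝[<] A, ∀ j, j ≠ i → 0 < α j + s * β j := by
          rw [Filter.eventually_all]
          intro j
          by_cases hji : j = i
          · simp [hji]
          · have : ContinuousAt (fun s => α j + s * β j) A := by fun_prop
            exact ((this.eventually (eventually_gt_nhds (hj j hji))).mono
              fun s hs _ => hs).filter_mono nhdsWithin_le_nhds
        filter_upwards [h1, h2, self_mem_nhdsWithin] with s hs1 hs2 hs3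
        have hs3 : s < A := hs3
        refine (hmem s).2 ⟨⟨hs1.le, (hs3.trans hAo.2).le⟩, fun j => ?_⟩
        by_cases hji : j = i
        · rw [hji]; nlinarith
        · exact (hs2 j hji).le
      obtain ⟨s, hs, hsA⟩ := (hev.and self_mem_nhdsWithin).exists
      exact absurd (hAmin hs) (not_le.2 hsA)
    · push Not at hz
      have hpos : ∀ i, 0 < α i + A * β i := fun i => lt_of_le_of_ne (hA0 i) (hz i).symm
      by_cases hA' : A = 0
      · left; intro i; simpa [hA'] using hpos i
      · exfalso
        have hA'' : 0 < A := lt_of_le_of_ne hA01.1 (Ne.symm hA')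
        have h1 : ∀ᶠ s in 𝓝[<] A, 0 < s :=
          (eventually_gt_nhds hA'').filter_mono nhdsWithin_le_nhds
        have h2 : ∀ᶠ s in 𝓝[<] A, ∀ j, 0 < α j + s * β j := by
          rw [Filter.eventually_all]
          intro j
          have : ContinuousAt (fun s => α j + s * β j) A := by fun_prop
          exact (this.eventually (eventually_gt_nhds (hpos j))).filter_mono nhdsWithin_le_nhds
        obtain ⟨s, ⟨hs1, hs2⟩, hsA⟩ := ((h1.and h2).and self_mem_nhdsWithin).exists
        have hsA : s < A := hsA
        exact absurd (hAmin ((hmem s).2 ⟨⟨hs1.le, (hsA.trans_le hA01.2).le⟩, fun j => (hs2 j).le⟩))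
          (not_le.2 hsA)
  by_cases hI : ∃ s ∈ Set.Icc (0 : ℝ) 1, ∀ i, 0 ≤ α i + s * β i
  · rw [if_pos hI]
    by_cases h0 : ∀ i, 0 < α i
    · rw [if_pos h0, Finset.sum_eq_zero, zero_add]
      intro i _
      rw [if_neg (hno h0 i)]
    · rw [if_neg h0, add_zero]
      obtain ⟨i, hi⟩ := (hex hI).resolve_left h0
      rw [Finset.sum_eq_single i]
      · rw [if_pos hi]
      · intro j _ hj
        rw [if_neg fun h => hj (huniq j i h hi)]
      · simp
  · rw [if_neg hI, if_neg fun h => hI (hsub0 h), add_zero, Finset.sum_eq_zero]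
    intro i _
    rw [if_neg fun h => hI (hsub i h)]

open scoped Classical in
/-- The parity of the number of facets of a polyhedron met by a segment in general position is
determined by the positions of its end points. -/
theorem card_crossings (α β : ι → ℝ)
    (H : ∀ s ∈ Set.Icc (0 : ℝ) 1, (∀ i, 0 ≤ α i + s * β i) → ∀ i, α i + s * β i = 0 →
      s ∈ Set.Ioo (0 : ℝ) 1 ∧ β i ≠ 0 ∧ ∀ j, j ≠ i → 0 < α j + s * β j) :
    (∑ i, if (∃ s ∈ Set.Ioo (0 : ℝ) 1, α i + s * β i = 0 ∧
        ∀ j, j ≠ i → 0 < α j + s * β j) then (1 : ZMod 2) else 0) =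
      (if ∀ i, 0 < α i then 1 else 0) + if ∀ i, 0 < α i + β i then 1 else 0 := by
  have h1 := card_entering_add α β H
  -- The same count on the reversed segment, where exits become entrances. In the sum of both counts
  -- the common right-hand side cancels.
  have h2 := card_entering_add (fun i => α i + β i) (fun i => -β i) (by
    intro s hs h i hi
    have e : ∀ i, α i + β i + s * -β i = α i + (1 - s) * β i := fun i => by ring
    simp only [e] at h hi ⊢
    obtain ⟨h1, h2, h3⟩ := H (1 - s) ⟨by linarith [hs.2], by linarith [hs.1]⟩ h i hi
    exact ⟨⟨by linarith [h1.2], by linarith [h1.1]⟩, neg_ne_zero.2 h2, h3⟩)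
  have e : ∀ i s, α i + β i + s * -β i = α i + (1 - s) * β i := fun i s => by ring
  have e1 : (∃ s ∈ Set.Icc (0 : ℝ) 1, ∀ i, 0 ≤ α i + β i + s * -β i) ↔
      ∃ s ∈ Set.Icc (0 : ℝ) 1, ∀ i, 0 ≤ α i + s * β i := by
    constructor
    · rintro ⟨s, hs, h⟩
      exact ⟨1 - s, ⟨by linarith [hs.2], by linarith [hs.1]⟩, fun i => by rw [← e]; exact h i⟩
    · rintro ⟨s, hs, h⟩
      refine ⟨1 - s, ⟨by linarith [hs.2], by linarith [hs.1]⟩, fun i => ?_⟩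
      rw [e]; simpa using h i
  have e2 : ∀ i, (∃ s ∈ Set.Ioo (0 : ℝ) 1, α i + β i + s * -β i = 0 ∧
      ∀ j, j ≠ i → 0 < α j + β j + s * -β j) ↔
      ∃ s ∈ Set.Ioo (0 : ℝ) 1, α i + s * β i = 0 ∧ ∀ j, j ≠ i → 0 < α j + s * β j := by
    intro i
    constructor
    · rintro ⟨s, hs, h, h'⟩
      simp only [e] at h h'
      exact ⟨1 - s, ⟨by linarith [hs.2], by linarith [hs.1]⟩, h, h'⟩
    · rintro ⟨s, hs, h, h'⟩
      refine ⟨1 - s, ⟨by linarith [hs.2], by linarith [hs.1]⟩, ?_⟩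
      simp only [e]
      simpa using ⟨h, h'⟩
  simp only [e1, e2] at h2
  have hβ : ∀ i, (∃ s ∈ Set.Ioo (0 : ℝ) 1, α i + s * β i = 0 ∧
      ∀ j, j ≠ i → 0 < α j + s * β j) → β i ≠ 0 := by
    rintro i ⟨s, hs, h, h'⟩
    refine (H s ⟨hs.1.le, hs.2.le⟩ (fun j => ?_) i h).2.1
    by_cases hj : j = i
    · rw [hj, h]
    · exact (h' j hj).le
  have hsplit : ∀ i, (if (∃ s ∈ Set.Ioo (0 : ℝ) 1, α i + s * β i = 0 ∧
        ∀ j, j ≠ i → 0 < α j + s * β j) then (1 : ZMod 2) else 0) =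
      (if (0 < β i ∧ ∃ s ∈ Set.Ioo (0 : ℝ) 1, α i + s * β i = 0 ∧
        ∀ j, j ≠ i → 0 < α j + s * β j) then (1 : ZMod 2) else 0) +
      (if (0 < -β i ∧ ∃ s ∈ Set.Ioo (0 : ℝ) 1, α i + s * β i = 0 ∧
        ∀ j, j ≠ i → 0 < α j + s * β j) then (1 : ZMod 2) else 0) := by
    intro i
    by_cases hc : ∃ s ∈ Set.Ioo (0 : ℝ) 1, α i + s * β i = 0 ∧
        ∀ j, j ≠ i → 0 < α j + s * β j
    · rcases lt_or_gt_of_ne (hβ i hc) with h | h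
      · simp only [hc, and_true, if_true, if_neg (not_lt.2 h.le), if_pos (neg_pos.2 h), zero_add]
      · simp only [hc, and_true, if_true, if_pos h,
          if_neg (not_lt.2 (neg_nonpos.2 h.le)), add_zero]
    · simp only [hc, and_false, if_false, add_zero]
  rw [Finset.sum_congr rfl fun i _ => hsplit i, Finset.sum_add_distrib]
  have hchar : ∀ x : ZMod 2, x + x = 0 := by decide
  linear_combination h1 + h2 - hchar (if ∀ i, 0 < α i then 1 else 0) -
    hchar (if ∀ i, 0 < α i + β i then 1 else 0) +
    hchar (if ∃ s ∈ Set.Icc (0 : ℝ) 1, ∀ i, 0 ≤ α i + s * β i then 1 else 0)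

end AffineFunctions

/-! ### Determinants and frames in three-space -/

section Frames

theorem det3_eq (u v w : R3) : det3 u v w =
    u 0 * v 1 * w 2 - u 0 * v 2 * w 1 - u 1 * v 0 * w 2 + u 1 * v 2 * w 0 + u 2 * v 0 * w 1 -
      u 2 * v 1 * w 0 := by
  rw [det3, Matrix.det_fin_three]; rfl

theorem continuous_det3 {X : Type*} [TopologicalSpace X] {f g h : X → R3} (hf : Continuous f)
    (hg : Continuous g) (hh : Continuous h) : Continuous fun x => det3 (f x) (g x) (h x) := by
  simp only [det3_eq]
  fun_prop

/-- Cramer rule. -/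
theorem det3_smul_eq (A B C w : R3) : det3 A B C • w =
    det3 w B C • A + det3 A w C • B + det3 A B w • C := by
  ext i
  fin_cases i <;> simp [det3_eq] <;> ring

theorem eq_of_det3_ne_zero {A B C : R3} (h : det3 A B C ≠ 0) (w : R3) :
    w = (det3 w B C / det3 A B C) • A + (det3 A w C / det3 A B C) • B +
      (det3 A B w / det3 A B C) • C := by
  have := congrArg ((det3 A B C)⁻¹ • ·) (det3_smul_eq A B C w)
  simp only [smul_smul, inv_mul_cancel₀ h, one_smul, smul_add] at this
  simpa only [div_eq_inv_mul] using this

theorem det3_comb_left (A B C : R3) (a b c : ℝ) :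
    det3 (a • A + b • B + c • C) B C = a * det3 A B C := by
  simp [det3_eq]; ring

theorem det3_comb_mid (A B C : R3) (a b c : ℝ) :
    det3 A (a • A + b • B + c • C) C = b * det3 A B C := by
  simp [det3_eq]; ring

theorem det3_comb_right (A B C : R3) (a b c : ℝ) :
    det3 A B (a • A + b • B + c • C) = c * det3 A B C := by
  simp [det3_eq]; ring

/-- The coefficients in a frame are unique. -/
theorem frame_ext {A B C : R3} (h : det3 A B C ≠ 0) {a b c a' b' c' : ℝ}
    (he : a • A + b • B + c • C = a' • A + b' • B + c' • C) : a = a' ∧ b = b' ∧ c = c' := by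
  refine ⟨?_, ?_, ?_⟩
  · have := congrArg (fun w => det3 w B C) he
    simp only [det3_comb_left] at this
    exact mul_right_cancel₀ h this
  · have := congrArg (fun w => det3 A w C) he
    simp only [det3_comb_mid] at this
    exact mul_right_cancel₀ h this
  · have := congrArg (fun w => det3 A B w) he
    simp only [det3_comb_right] at this
    exact mul_right_cancel₀ h this

/-- A linear dependence of a, b, u either involves u, and then u lies in the span of a and b, or it
is a dependence of a and b alone. -/
theorem mem_span_pair_of_det3_eq_zero {a b u : R3} (h : det3 a b u = 0) :
    u ∈ Submodule.span ℝ {a, b} ∨ ∃ s t : ℝ, (s ≠ 0 ∨ t ≠ 0) ∧ s • a + t • b = 0 := by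
  obtain ⟨v, hv, hv0⟩ := Matrix.exists_vecMul_eq_zero_iff.2 h
  have he : v 0 • a + v 1 • b + v 2 • u = 0 := by
    rw [← hv0]
    ext i
    simp [Matrix.vecMul, dotProduct, Fin.sum_univ_three]
  by_cases h2 : v 2 = 0
  · right
    refine ⟨v 0, v 1, ?_, by simpa [h2] using he⟩
    by_contra hc
    push Not at hc
    apply hv
    ext i
    fin_cases i
    · exact hc.1
    · exact hc.2
    · exact h2
  · left
    rw [Submodule.mem_span_pair]
    refine ⟨-(v 0 / v 2), -(v 1 / v 2), ?_⟩
    have : u = (v 2)⁻¹ • (v 2 • u) := by rw [smul_smul, inv_mul_cancel₀ h2, one_smul]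
    rw [this, show v 2 • u = -(v 0 • a + v 1 • b) by rw [eq_neg_iff_add_eq_zero, ← he]; abel]
    simp only [smul_neg, smul_add, smul_smul, div_eq_inv_mul, neg_smul, neg_add]

/-- A nonempty open set is not covered by finitely many planes through the origin. -/
theorem exists_mem_open_notMem_span (T : Finset (R3 × R3)) {O : Set R3} (hO : IsOpen O)
    (hne : O.Nonempty) : ∃ u ∈ O, ∀ q ∈ T, u ∉ Submodule.span ℝ {q.1, q.2} := by
  classical
  induction T using Finset.induction_on generalizing O with
  | empty =>
    obtain ⟨u, hu⟩ := hne
    exact ⟨u, hu, by simp⟩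
  | insert q T _ ih =>
    set W := Submodule.span ℝ {q.1, q.2} with hW
    have hWc : IsClosed (W : Set R3) := Submodule.closed_of_finiteDimensional _
    have hWtop : W ≠ ⊤ := by
      intro h
      have h1 := finrank_span_finset_le_card (R := ℝ) ({q.1, q.2} : Finset R3)
      rw [Set.finrank] at h1
      have h2 : ((({q.1, q.2} : Finset R3)) : Set R3) = {q.1, q.2} := by simp
      rw [h2, ← hW, h, finrank_top] at h1
      have := Finset.card_le_two (a := q.1) (b := q.2)
      simp at h1
      omega
    have hne' : (O \ (W : Set R3)).Nonempty := by
      by_contra h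
      rw [Set.not_nonempty_iff_eq_empty, Set.sdiff_eq_empty] at h
      apply hWtop
      apply Submodule.eq_top_of_nonempty_interior'
      obtain ⟨u, hu⟩ := hne
      exact ⟨u, mem_interior.2 ⟨O, h, hO, hu⟩⟩
    obtain ⟨u, hu, huT⟩ := ih (hO.sdiff hWc) hne'
    refine ⟨u, hu.1, fun r hr => ?_⟩
    rcases Finset.mem_insert.1 hr with rfl | hr
    · exact hu.2
    · exact huT r hr

end Frames

/-! ### Regular directions and the stability of crossings -/

section Crossings

/-- Projected along `u`, the segments `e` and `f` meet only transversally in interior points, and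
they are disjoint. -/
def RegularPair (u : R3) (e f : R3 × R3) : Prop :=
  ∀ x ∈ Set.Icc (0 : ℝ) 1, ∀ y ∈ Set.Icc (0 : ℝ) 1, ∀ l : ℝ,
    AffineMap.lineMap e.1 e.2 x = AffineMap.lineMap f.1 f.2 y + l • u →
      x ∈ Set.Ioo (0 : ℝ) 1 ∧ y ∈ Set.Ioo (0 : ℝ) 1 ∧ l ≠ 0 ∧ det3 (e.2 - e.1) (f.2 - f.1) u ≠ 0

/-- Seen from the direction `u`, the segment `e` crosses over the segment `f`. -/
def CrossesOver (u : R3) (e f : R3 × R3) : Prop :=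
  ∃ x ∈ Set.Ioo (0 : ℝ) 1, ∃ y ∈ Set.Ioo (0 : ℝ) 1, ∃ l : ℝ, 0 < l ∧
    AffineMap.lineMap e.1 e.2 x = AffineMap.lineMap f.1 f.2 y + l • u

open scoped Classical in
/-- The number of crossings of `e` over `f`, modulo two. -/
noncomputable def crossing (u : R3) (e f : R3 × R3) : ZMod 2 := if CrossesOver u e f then 1 else 0

/-- At a crossing the determinant is nonzero by regularity, so its sign is 1 or -1, and both are
odd. -/
theorem overSign_cast {u : R3} {e f : R3 × R3} (h : RegularPair u e f) :
    (overSign u e f : ZMod 2) = crossing u e f := by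
  classical
  rw [overSign, crossing]
  by_cases hc : CrossesOver u e f
  · rw [if_pos hc]
    have hc' := hc
    obtain ⟨x, hx, y, hy, l, hl, he⟩ := hc'
    obtain ⟨-, -, -, hd⟩ := h x ⟨hx.1.le, hx.2.le⟩ y ⟨hy.1.le, hy.2.le⟩ l he
    rw [if_pos (by exact hc)]
    rcases lt_or_gt_of_ne hd with hd | hd
    · rw [sign_neg hd]; decide
    · rw [sign_pos hd]; decide
  · rw [if_neg hc, if_neg (by exact hc), Int.cast_zero]

theorem lineMap_eq_add_smul (p q : R3) (x : ℝ) :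
    AffineMap.lineMap p q x = p + x • (q - p) := by
  rw [AffineMap.lineMap_apply, vsub_eq_sub, vadd_eq_add, add_comm]

theorem norm_lineMap_le (p q : R3) {x : ℝ} (hx : x ∈ Set.Icc (0 : ℝ) 1) :
    ‖(AffineMap.lineMap p q x : R3)‖ ≤ ‖p‖ + ‖q‖ := by
  rw [AffineMap.lineMap_apply_module]
  refine (norm_add_le _ _).trans (add_le_add ?_ ?_)
  · rw [norm_smul, Real.norm_of_nonneg (by linarith [hx.2])]
    exact mul_le_of_le_one_left (norm_nonneg _) (by linarith [hx.1])
  · rw [norm_smul, Real.norm_of_nonneg hx.1]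
    exact mul_le_of_le_one_left (norm_nonneg _) hx.2

/-- A compactness argument. For data near (u, e, f) the parameter l of a meeting is bounded by the
size of the segments divided by ‖u‖, so (x, y, l) stays in a compact set. At a point of this set
where the base data do not meet, nearby data do not meet either; where they meet, `Q` holds nearby
by hypothesis. -/
theorem eventually_forall_meeting {u : R3} {e f : R3 × R3} (hu : u ≠ 0)
    {Q : R3 × (R3 × R3) × (R3 × R3) → ℝ × ℝ × ℝ → Prop}
    (hQ : ∀ x ∈ Set.Icc (0 : ℝ) 1, ∀ y ∈ Set.Icc (0 : ℝ) 1, ∀ l : ℝ,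
      AffineMap.lineMap e.1 e.2 x = AffineMap.lineMap f.1 f.2 y + l • u →
      ∀ᶠ q in 𝓝 ((u, e, f), (x, y, l)), Q q.1 q.2) :
    ∀ᶠ θ in 𝓝 (u, e, f), ∀ x ∈ Set.Icc (0 : ℝ) 1, ∀ y ∈ Set.Icc (0 : ℝ) 1, ∀ l : ℝ,
      AffineMap.lineMap θ.2.1.1 θ.2.1.2 x = AffineMap.lineMap θ.2.2.1 θ.2.2.2 y + l • θ.1 →
      Q θ (x, y, l) := by
  let N : R3 × (R3 × R3) × (R3 × R3) → ℝ := fun θ =>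
    (‖θ.2.1.1‖ + ‖θ.2.1.2‖ + (‖θ.2.2.1‖ + ‖θ.2.2.2‖)) / ‖θ.1‖
  have hN : ContinuousAt N (u, e, f) := by
    refine ContinuousAt.div (by fun_prop) (by fun_prop) ?_
    simpa using hu
  set R := N (u, e, f) + 1 with hR
  have h1 : ∀ᶠ θ in 𝓝 (u, e, f), N θ < R := hN.eventually (eventually_lt_nhds (by linarith))
  have h0 : ∀ᶠ θ : R3 × (R3 × R3) × (R3 × R3) in 𝓝 (u, e, f), θ.1 ≠ 0 :=
    (continuous_fst.continuousAt).eventually_ne hu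
  let C : Set (ℝ × ℝ × ℝ) := Set.Icc 0 1 ×ˢ (Set.Icc 0 1 ×ˢ Set.Icc (-R) R)
  have hC : IsCompact C := isCompact_Icc.prod (isCompact_Icc.prod isCompact_Icc)
  have h2 : ∀ᶠ θ in 𝓝 (u, e, f), ∀ z ∈ C,
      AffineMap.lineMap θ.2.1.1 θ.2.1.2 z.1 =
        AffineMap.lineMap θ.2.2.1 θ.2.2.2 z.2.1 + z.2.2 • θ.1 → Q θ z := by
    refine hC.eventually_forall_of_forall_eventually fun z hz => ?_
    obtain ⟨hx, hy, -⟩ := hz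
    by_cases hmeet : AffineMap.lineMap e.1 e.2 z.1 =
        AffineMap.lineMap f.1 f.2 z.2.1 + z.2.2 • u
    · exact (hQ z.1 hx z.2.1 hy z.2.2 hmeet).mono fun q hq _ => hq
    · have hc1 : Continuous fun q : (R3 × (R3 × R3) × (R3 × R3)) × (ℝ × ℝ × ℝ) =>
          (AffineMap.lineMap q.1.2.1.1 q.1.2.1.2 q.2.1 : R3) := by
        simp only [lineMap_eq_add_smul]; fun_prop
      have hc2 : Continuous fun q : (R3 × (R3 × R3) × (R3 × R3)) × (ℝ × ℝ × ℝ) =>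
          (AffineMap.lineMap q.1.2.2.1 q.1.2.2.2 q.2.2.1 + q.2.2.2 • q.1.1 : R3) := by
        simp only [lineMap_eq_add_smul]; fun_prop
      have : ∀ᶠ q in 𝓝 ((u, e, f), z), (AffineMap.lineMap q.1.2.1.1 q.1.2.1.2 q.2.1 : R3) ≠
          AffineMap.lineMap q.1.2.2.1 q.1.2.2.2 q.2.2.1 + q.2.2.2 • q.1.1 :=
        (isOpen_ne_fun hc1 hc2).mem_nhds hmeet
      exact this.mono fun q hq h => absurd h hq
  filter_upwards [h0, h1, h2] with θ hθ0 hθ1 hθ2 x hx y hy l hl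
  refine hθ2 (x, y, l) ⟨hx, hy, ?_⟩ hl
  rw [Set.mem_Icc, ← abs_le]
  have h3 : |l| * ‖θ.1‖ ≤ ‖θ.2.1.1‖ + ‖θ.2.1.2‖ + (‖θ.2.2.1‖ + ‖θ.2.2.2‖) := by
    have : l • θ.1 = AffineMap.lineMap θ.2.1.1 θ.2.1.2 x - AffineMap.lineMap θ.2.2.1 θ.2.2.2 y := by
      rw [hl]; abel
    rw [← Real.norm_eq_abs, ← norm_smul, this]
    exact (norm_sub_le _ _).trans (add_le_add (norm_lineMap_le _ _ hx) (norm_lineMap_le _ _ hy))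
  exact ((le_div_iff₀ (norm_pos_iff.2 hθ0)).2 h3).trans hθ1.le

/-- Regularity and the crossing number are locally constant. -/
theorem RegularPair.eventually {u : R3} {e f : R3 × R3} (hu : u ≠ 0) (h : RegularPair u e f) :
    ∀ᶠ θ : R3 × (R3 × R3) × (R3 × R3) in 𝓝 (u, e, f),
      RegularPair θ.1 θ.2.1 θ.2.2 ∧ crossing θ.1 θ.2.1 θ.2.2 = crossing u e f := by
  have hdc : Continuous fun θ : R3 × (R3 × R3) × (R3 × R3) =>
      det3 (θ.2.1.2 - θ.2.1.1) (θ.2.2.2 - θ.2.2.1) θ.1 :=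
    continuous_det3 (by fun_prop) (by fun_prop) (by fun_prop)
  have hreg : ∀ᶠ θ : R3 × (R3 × R3) × (R3 × R3) in 𝓝 (u, e, f),
      RegularPair θ.1 θ.2.1 θ.2.2 := by
    refine eventually_forall_meeting hu (Q := fun θ z => z.1 ∈ Set.Ioo (0 : ℝ) 1 ∧
      z.2.1 ∈ Set.Ioo (0 : ℝ) 1 ∧ z.2.2 ≠ 0 ∧
      det3 (θ.2.1.2 - θ.2.1.1) (θ.2.2.2 - θ.2.2.1) θ.1 ≠ 0) fun x hx y hy l hl => ?_
    obtain ⟨h1, h2, h3, h4⟩ := h x hx y hy l hl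
    refine Filter.Eventually.and ?_ (Filter.Eventually.and ?_ (Filter.Eventually.and ?_ ?_))
    · exact (continuous_fst.comp continuous_snd).continuousAt.eventually
        (isOpen_Ioo.mem_nhds h1)
    · exact (continuous_fst.comp (continuous_snd.comp continuous_snd)).continuousAt.eventually
        (isOpen_Ioo.mem_nhds h2)
    · exact (continuous_snd.comp (continuous_snd.comp continuous_snd)).continuousAt.eventually_ne h3
    · exact (hdc.comp continuous_fst).continuousAt.eventually_ne h4
  refine hreg.and ?_
  by_cases hc : CrossesOver u e f
  · obtain ⟨x, hx, y, hy, l, hl, he⟩ := hc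
    obtain ⟨-, -, -, hd⟩ := h x ⟨hx.1.le, hx.2.le⟩ y ⟨hy.1.le, hy.2.le⟩ l he
    -- The parameters of the crossing solve a linear system in the frame E, G, u. Cramer's rule
    -- exhibits them as continuous functions of the data, so the strict inequalities persist.
    let E : R3 × (R3 × R3) × (R3 × R3) → R3 := fun θ => θ.2.1.2 - θ.2.1.1
    let G : R3 × (R3 × R3) × (R3 × R3) → R3 := fun θ => θ.2.2.2 - θ.2.2.1
    let w : R3 × (R3 × R3) × (R3 × R3) → R3 := fun θ => θ.2.2.1 - θ.2.1.1
    have hw : w (u, e, f) = x • E (u, e, f) + (-y) • G (u, e, f) + (-l) • u := by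
      rw [lineMap_eq_add_smul, lineMap_eq_add_smul] at he
      simp only [w, E, G, neg_smul]
      rw [sub_eq_iff_eq_add]
      rw [← sub_eq_zero] at he ⊢
      rw [← neg_eq_zero, ← he]
      abel
    have hD : ContinuousAt (fun θ : R3 × (R3 × R3) × (R3 × R3) => det3 (E θ) (G θ) θ.1) (u, e, f) :=
      hdc.continuousAt
    have hX : ∀ᶠ θ in 𝓝 (u, e, f), det3 (w θ) (G θ) θ.1 / det3 (E θ) (G θ) θ.1 ∈
        Set.Ioo (0 : ℝ) 1 := by
      refine Filter.Tendsto.eventually (ContinuousAt.div ?_ hD hd) (isOpen_Ioo.mem_nhds ?_)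
      · exact (continuous_det3 (by fun_prop) (by fun_prop) (by fun_prop)).continuousAt
      · change det3 (w (u, e, f)) _ _ / _ ∈ _
        rw [hw]
        change det3 _ (G (u, e, f)) u / det3 (E (u, e, f)) (G (u, e, f)) u ∈ _
        rw [det3_comb_left, mul_div_cancel_right₀ _ hd]; exact hx
    have hY : ∀ᶠ θ in 𝓝 (u, e, f), -(det3 (E θ) (w θ) θ.1 / det3 (E θ) (G θ) θ.1) ∈
        Set.Ioo (0 : ℝ) 1 := by
      refine Filter.Tendsto.eventually (ContinuousAt.neg (ContinuousAt.div ?_ hD hd))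
        (isOpen_Ioo.mem_nhds ?_)
      · exact (continuous_det3 (by fun_prop) (by fun_prop) (by fun_prop)).continuousAt
      · change -(det3 _ (w (u, e, f)) _ / _) ∈ _
        rw [hw]
        change -(det3 (E (u, e, f)) _ u / det3 (E (u, e, f)) (G (u, e, f)) u) ∈ _
        rw [det3_comb_mid, mul_div_cancel_right₀ _ hd, neg_neg]; exact hy
    have hL : ∀ᶠ θ in 𝓝 (u, e, f), -(det3 (E θ) (G θ) (w θ) / det3 (E θ) (G θ) θ.1) ∈
        Set.Ioi (0 : ℝ) := by
      refine Filter.Tendsto.eventually (ContinuousAt.neg (ContinuousAt.div ?_ hD hd))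
        (isOpen_Ioi.mem_nhds ?_)
      · exact (continuous_det3 (by fun_prop) (by fun_prop) (by fun_prop)).continuousAt
      · change -(det3 _ _ (w (u, e, f)) / _) ∈ _
        rw [hw]
        change -(det3 (E (u, e, f)) (G (u, e, f)) _ / det3 (E (u, e, f)) (G (u, e, f)) u) ∈ _
        rw [det3_comb_right, mul_div_cancel_right₀ _ hd, neg_neg]; exact hl
    filter_upwards [hX, hY, hL, hD.eventually_ne hd] with θ hX hY hL hD'
    have hc' : CrossesOver θ.1 θ.2.1 θ.2.2 := by
      refine ⟨_, hX, _, hY, _, hL, ?_⟩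
      have hcr := eq_of_det3_ne_zero hD' (w θ)
      rw [lineMap_eq_add_smul, lineMap_eq_add_smul]
      simp only [neg_smul]
      change θ.2.1.1 + (det3 (w θ) (G θ) θ.1 / det3 (E θ) (G θ) θ.1) • E θ =
        θ.2.2.1 + -((det3 (E θ) (w θ) θ.1 / det3 (E θ) (G θ) θ.1) • G θ) +
          -((det3 (E θ) (G θ) (w θ) / det3 (E θ) (G θ) θ.1) • θ.1)
      have : θ.2.2.1 = θ.2.1.1 + w θ := by simp only [w]; abel
      rw [this]
      nth_rewrite 2 [hcr]
      abel
    rw [crossing, crossing, if_pos hc', if_pos ⟨x, hx, y, hy, l, hl, he⟩]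
  -- If e does not cross over f, every meeting has l < 0, and this persists for nearby data.
  · have hno := eventually_forall_meeting hu (e := e) (f := f) (Q := fun _ z => z.2.2 < 0)
      fun x hx y hy l hl => by
        obtain ⟨h1, h2, h3, h4⟩ := h x hx y hy l hl
        have : l < 0 := by
          rcases lt_or_gt_of_ne h3 with h | h
          · exact h
          · exact absurd ⟨x, h1, y, h2, l, h, hl⟩ hc
        exact (continuous_snd.comp (continuous_snd.comp continuous_snd)).continuousAt.eventually
          (eventually_lt_nhds this)
    filter_upwards [hno] with θ hθ
    have hc' : ¬ CrossesOver θ.1 θ.2.1 θ.2.2 := by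
      rintro ⟨x, hx, y, hy, l, hl, he⟩
      exact absurd (hθ x ⟨hx.1.le, hx.2.le⟩ y ⟨hy.1.le, hy.2.le⟩ l he) (not_lt.2 hl.le)
    rw [crossing, crossing, if_neg hc', if_neg hc]

/-- The closed segments `e` and `f` are disjoint. -/
def DisjointSegments (e f : R3 × R3) : Prop :=
  ∀ x ∈ Set.Icc (0 : ℝ) 1, ∀ y ∈ Set.Icc (0 : ℝ) 1,
    (AffineMap.lineMap e.1 e.2 x : R3) ≠ AffineMap.lineMap f.1 f.2 y

theorem lineMap_sub_mem_span (p q r : R3) (y : ℝ) :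
    p - AffineMap.lineMap q r y ∈ Submodule.span ℝ {p - q, p - r} := by
  rw [Submodule.mem_span_pair]
  refine ⟨1 - y, y, ?_⟩
  rw [AffineMap.lineMap_apply_module]
  module

/-- A direction in general position is regular for two disjoint segments. -/
theorem DisjointSegments.regularPair {e f : R3 × R3} (h : DisjointSegments e f) {u : R3}
    (h1 : u ∉ Submodule.span ℝ {e.1 - f.1, e.1 - f.2})
    (h2 : u ∉ Submodule.span ℝ {e.2 - f.1, e.2 - f.2})
    (h3 : u ∉ Submodule.span ℝ {f.1 - e.1, f.1 - e.2})
    (h4 : u ∉ Submodule.span ℝ {f.2 - e.1, f.2 - e.2})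
    (h5 : u ∉ Submodule.span ℝ {e.2 - e.1, f.2 - f.1}) : RegularPair u e f := by
  intro x hx y hy l hl
  have hl0 : l ≠ 0 := by
    rintro rfl
    exact h x hx y hy (by rw [hl, zero_smul, add_zero])
  -- At a meeting u is proportional to the difference of the two points, so a subspace that contains
  -- this difference contains u.
  have hmem : ∀ W : Submodule ℝ R3, AffineMap.lineMap e.1 e.2 x - AffineMap.lineMap f.1 f.2 y ∈ W →
      u ∈ W := by
    intro W hW
    rw [hl, add_sub_cancel_left] at hW
    have := W.smul_mem l⁻¹ hW
    rwa [smul_smul, inv_mul_cancel₀ hl0, one_smul] at this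
  have hneg : ∀ W : Submodule ℝ R3, AffineMap.lineMap f.1 f.2 y - AffineMap.lineMap e.1 e.2 x ∈ W →
      u ∈ W := fun W hW => hmem W (by rw [← neg_sub]; exact W.neg_mem hW)
  refine ⟨⟨lt_of_le_of_ne hx.1 ?_, lt_of_le_of_ne hx.2 ?_⟩,
    ⟨lt_of_le_of_ne hy.1 ?_, lt_of_le_of_ne hy.2 ?_⟩, hl0, ?_⟩
  · rintro rfl
    exact h1 (hmem _ (by rw [AffineMap.lineMap_apply_zero]; exact lineMap_sub_mem_span _ _ _ _))
  · rintro rfl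
    exact h2 (hmem _ (by rw [AffineMap.lineMap_apply_one]; exact lineMap_sub_mem_span _ _ _ _))
  · rintro rfl
    exact h3 (hneg _ (by rw [AffineMap.lineMap_apply_zero]; exact lineMap_sub_mem_span _ _ _ _))
  · rintro rfl
    exact h4 (hneg _ (by rw [AffineMap.lineMap_apply_one]; exact lineMap_sub_mem_span _ _ _ _))
  · intro hd
    -- If the directions of the segments are dependent, either f is a single point or e is parallel
    -- to f. In both cases the difference of the two points lies in one of the spans that u avoids.
    rcases mem_span_pair_of_det3_eq_zero hd with hd | ⟨s, t, hst, h0⟩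
    · exact h5 hd
    by_cases hs : s = 0
    · have ht : t ≠ 0 := by simpa [hs] using hst
      have hf : f.2 - f.1 = 0 := by simpa [hs, ht] using h0
      refine h3 (hneg _ ?_)
      rw [lineMap_eq_add_smul f.1, hf, smul_zero, add_zero]
      exact lineMap_sub_mem_span _ _ _ _
    · have he : e.2 - e.1 = (-(t / s)) • (f.2 - f.1) := by
        have : e.2 - e.1 = s⁻¹ • (s • (e.2 - e.1)) := by
          rw [smul_smul, inv_mul_cancel₀ hs, one_smul]
        rw [this, eq_neg_of_add_eq_zero_left h0, smul_neg, smul_smul, neg_smul, div_eq_inv_mul]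
      refine h1 (hmem _ ?_)
      rw [lineMap_eq_add_smul e.1, he, add_sub_right_comm, Submodule.mem_span_pair]
      refine ⟨1 - y + x * (-(t / s)), y - x * (-(t / s)), ?_⟩
      rw [AffineMap.lineMap_apply_module]
      module

theorem RegularPair.disjoint {u : R3} {e f : R3 × R3} (h : RegularPair u e f) :
    DisjointSegments e f := fun x hx y hy he =>
  (h x hx y hy 0 (by rw [he, zero_smul, add_zero])).2.2.1 rfl

/-- Every nonempty open set contains a direction that is regular for finitely many pairs of
disjoint segments and avoids finitely many planes. -/
theorem exists_regular_direction {O : Set R3} (hO : IsOpen O) (hne : O.Nonempty)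
    (s t : Finset (R3 × R3)) (h : ∀ e ∈ s, ∀ f ∈ t, DisjointSegments e f) (T : Finset (R3 × R3)) :
    ∃ u ∈ O, u ≠ 0 ∧ (∀ e ∈ s, ∀ f ∈ t, RegularPair u e f) ∧
      ∀ q ∈ T, u ∉ Submodule.span ℝ {q.1, q.2} := by
  classical
  let g : Fin 5 → (R3 × R3) × (R3 × R3) → R3 × R3 := fun i q =>
    ![(q.1.1 - q.2.1, q.1.1 - q.2.2), (q.1.2 - q.2.1, q.1.2 - q.2.2),
      (q.2.1 - q.1.1, q.2.1 - q.1.2), (q.2.2 - q.1.1, q.2.2 - q.1.2),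
      (q.1.2 - q.1.1, q.2.2 - q.2.1)] i
  obtain ⟨u, hu, hu'⟩ := exists_mem_open_notMem_span
    -- The pair (0, 0) spans the zero subspace; to avoid it means u ≠ 0.
    (insert (0, 0) (T ∪ Finset.univ.biUnion fun i => (s ×ˢ t).image (g i))) hO hne
  refine ⟨u, hu, ?_, fun e he f hf => ?_, fun q hq => hu' q (by simp [hq])⟩
  · rintro rfl
    exact hu' (0, 0) (by simp) (zero_mem _)
  · have hg : ∀ i, u ∉ Submodule.span ℝ {(g i (e, f)).1, (g i (e, f)).2} := fun i =>
      hu' _ (Finset.mem_insert_of_mem (Finset.mem_union_right _ (Finset.mem_biUnion.2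
        ⟨i, Finset.mem_univ _, Finset.mem_image_of_mem _ (Finset.mk_mem_product he hf)⟩)))
    exact (h e he f hf).regularPair (hg 0) (hg 1) (hg 2) (hg 3) (hg 4)

end Crossings

/-! ### Segments meeting wedges and prisms -/

section Crossings

open scoped Classical in
/-- Whether the segment `e` meets the open planar sector `c + ℝ₊ u + ℝ₊ w`. -/
noncomputable def sectorHit (u w : R3) (e : R3 × R3) (c : R3) : ZMod 2 :=
  if ∃ x ∈ Set.Ioo (0 : ℝ) 1, ∃ l : ℝ, 0 < l ∧ ∃ l' : ℝ, 0 < l' ∧ AffineMap.lineMap e.1 e.2 x = c + l • u + l' • w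
  then 1 else 0

open scoped Classical in
/-- Whether the point `P` lies in the wedge `f + ℝ₊ u + ℝ₊ w` over the segment `f`. -/
noncomputable def inWedge (u w : R3) (f : R3 × R3) (P : R3) : ZMod 2 :=
  if f.1 ≠ f.2 ∧ ∃ y ∈ Set.Ioo (0 : ℝ) 1, ∃ l : ℝ, 0 < l ∧ ∃ l' : ℝ, 0 < l' ∧
    P = f.1 + (y • (f.2 - f.1) + l • u + l' • w) then 1 else 0

theorem exists_frame_coords {A B C : R3} (h : det3 A B C ≠ 0) (o P : R3) :
    ∃ a b c : ℝ, P = o + (a • A + b • B + c • C) :=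
  ⟨_, _, _, by rw [← eq_of_det3_ne_zero h (P - o)]; abel⟩

theorem lineMap_frame {A B C o p q : R3} {a b c a' b' c' : ℝ}
    (hp : p = o + (a • A + b • B + c • C)) (hq : q = o + (a' • A + b' • B + c' • C)) (x : ℝ) :
    AffineMap.lineMap p q x = o + ((a + x * (a' - a)) • A + (b + x * (b' - b)) • B +
      (c + x * (c' - c)) • C) := by
  rw [AffineMap.lineMap_apply_module, hp, hq]
  module

theorem frame_ext' {A B C o : R3} (h : det3 A B C ≠ 0) {a b c a' b' c' : ℝ}
    (he : o + (a • A + b • B + c • C) = o + (a' • A + b' • B + c' • C)) :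
    a = a' ∧ b = b' ∧ c = c' := frame_ext h (add_left_cancel he)

/-- The wedge over f in the directions u and w is a polyhedron with four facets. On two of them e
crosses over f along u or along w, and the other two are the sectors at the ends of f. The parity
count applies; the determinant hypotheses give a frame and keep the ends of e off the planes of the
sectors. -/
theorem crossing_wedge {u w : R3} {e f : R3 × R3} (hu : RegularPair u e f)
    (hw : RegularPair w e f) (hf : det3 (f.2 - f.1) u w ≠ 0) (h11 : det3 (e.1 - f.1) u w ≠ 0)
    (h12 : det3 (e.1 - f.2) u w ≠ 0) (h21 : det3 (e.2 - f.1) u w ≠ 0)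
    (h22 : det3 (e.2 - f.2) u w ≠ 0) :
    crossing u e f + crossing w e f + sectorHit u w e f.1 + sectorHit u w e f.2 =
      inWedge u w f e.1 + inWedge u w f e.2 := by
  classical
  set F := f.2 - f.1 with hF
  obtain ⟨y₀, l₀, k₀, he1⟩ := exists_frame_coords hf f.1 e.1
  obtain ⟨y₁, l₁, k₁, he2⟩ := exists_frame_coords hf f.1 e.2
  have hf2 : f.2 = f.1 + F := by rw [hF]; abel
  have hne : f.1 ≠ f.2 := by
    intro h
    apply hf
    rw [hF, ← h, sub_self]
    simp [det3_eq]
  have hlm : ∀ x : ℝ, AffineMap.lineMap e.1 e.2 x = f.1 + ((y₀ + x * (y₁ - y₀)) • F +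
      (l₀ + x * (l₁ - l₀)) • u + (k₀ + x * (k₁ - k₀)) • w) := fun x => lineMap_frame he1 he2 x
  have hlf : ∀ y : ℝ, AffineMap.lineMap f.1 f.2 y = f.1 + y • F := fun y =>
    lineMap_eq_add_smul _ _ _
  -- values at the end points
  have hz : ∀ {P : R3} {a b c : ℝ}, P = f.1 + (a • F + b • u + c • w) →
      det3 (P - f.1) u w ≠ 0 → det3 (P - f.2) u w ≠ 0 → a ≠ 0 ∧ a ≠ 1 := by
    rintro P a b c rfl h1 h2
    constructor
    · rintro rfl
      apply h1
      rw [add_sub_cancel_left, det3_comb_left, zero_mul]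
    · rintro rfl
      apply h2
      rw [show f.1 + ((1 : ℝ) • F + b • u + c • w) - f.2 = (0 : ℝ) • F + b • u + c • w by
        rw [hf2]; module, det3_comb_left, zero_mul]
  obtain ⟨hy00, hy01⟩ := hz he1 h11 h12
  obtain ⟨hy10, hy11⟩ := hz he2 h21 h22
  have hE : e.2 - e.1 = (y₁ - y₀) • F + (l₁ - l₀) • u + (k₁ - k₀) • w := by
    rw [he1, he2]; module
  have hdu : det3 (e.2 - e.1) F u = (k₁ - k₀) * det3 F u w := by
    rw [hE]; simp [det3_eq]; ring
  have hdw : det3 (e.2 - e.1) F w = -(l₁ - l₀) * det3 F u w := by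
    rw [hE]; simp [det3_eq]; ring
  have hmu : ∀ {s : ℝ}, k₀ + s * (k₁ - k₀) = 0 → AffineMap.lineMap e.1 e.2 s =
      AffineMap.lineMap f.1 f.2 (y₀ + s * (y₁ - y₀)) + (l₀ + s * (l₁ - l₀)) • u := by
    intro s hs
    rw [hlm, hlf, hs]; module
  have hmw : ∀ {s : ℝ}, l₀ + s * (l₁ - l₀) = 0 → AffineMap.lineMap e.1 e.2 s =
      AffineMap.lineMap f.1 f.2 (y₀ + s * (y₁ - y₀)) + (k₀ + s * (k₁ - k₀)) • w := by
    intro s hs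
    rw [hlm, hlf, hs]; module
  -- In coordinates y, l, k for the frame F, u, w at f.1 the wedge is 0 < y < 1, l > 0, k > 0. The
  -- zeros of 1 - y, y, l, k are in turn the sector at f.2, the sector at f.1, the crossings along w
  -- and those along u.
  have key := card_crossings (ι := Fin 4) ![1 - y₀, y₀, l₀, k₀]
    ![-(y₁ - y₀), y₁ - y₀, l₁ - l₀, k₁ - k₀] (by
      intro s hs hall i hi
      have a0 := hall 0
      have a1 := hall 1
      have a2 := hall 2
      have a3 := hall 3
      simp at a0 a1 a2 a3
      have hYI : y₀ + s * (y₁ - y₀) ∈ Set.Icc (0 : ℝ) 1 := ⟨by linarith, by linarith⟩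
      -- A zero of l is a meeting along w. Regularity of w then places it strictly inside the facet,
      -- so that e never meets two facets at once.
      have L : 0 < l₀ + s * (l₁ - l₀) ∨ (s ∈ Set.Ioo (0 : ℝ) 1 ∧ l₁ - l₀ ≠ 0 ∧
          0 < y₀ + s * (y₁ - y₀) ∧ y₀ + s * (y₁ - y₀) < 1 ∧ 0 < k₀ + s * (k₁ - k₀) ∧
          l₀ + s * (l₁ - l₀) = 0) := by
        rcases a2.lt_or_eq with h | h
        · exact Or.inl h
        · obtain ⟨b1, b2, b3, b4⟩ := hw s hs _ hYI _ (hmw h.symm)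
          refine Or.inr ⟨b1, fun h0 => ?_, b2.1, b2.2, lt_of_le_of_ne a3 (Ne.symm b3), h.symm⟩
          rw [hdw, h0, neg_zero, zero_mul] at b4
          exact b4 rfl
      have K : 0 < k₀ + s * (k₁ - k₀) ∨ (s ∈ Set.Ioo (0 : ℝ) 1 ∧ k₁ - k₀ ≠ 0 ∧
          0 < y₀ + s * (y₁ - y₀) ∧ y₀ + s * (y₁ - y₀) < 1 ∧ 0 < l₀ + s * (l₁ - l₀) ∧
          k₀ + s * (k₁ - k₀) = 0) := by
        rcases a3.lt_or_eq with h | h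
        · exact Or.inl h
        · obtain ⟨b1, b2, b3, b4⟩ := hu s hs _ hYI _ (hmu h.symm)
          refine Or.inr ⟨b1, fun h0 => ?_, b2.1, b2.2, lt_of_le_of_ne a2 (Ne.symm b3), h.symm⟩
          rw [hdu, h0, zero_mul] at b4
          exact b4 rfl
      have hsI : (y₀ + s * (y₁ - y₀) = 0 ∨ y₀ + s * (y₁ - y₀) = 1) →
          s ∈ Set.Ioo (0 : ℝ) 1 ∧ y₁ - y₀ ≠ 0 := by
        intro h
        refine ⟨⟨lt_of_le_of_ne hs.1 ?_, lt_of_le_of_ne hs.2 ?_⟩, ?_⟩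
        · rintro rfl
          simp [hy00, hy01] at h
        · rintro rfl
          simp [hy10, hy11] at h
        · intro h0
          simp [h0, hy00, hy01] at h
      fin_cases i
      · simp at hi
        have hY : y₀ + s * (y₁ - y₀) = 1 := by linarith
        obtain ⟨hs', hsl⟩ := hsI (Or.inr hY)
        refine ⟨hs', by simpa using neg_ne_zero.2 hsl, ?_⟩
        have hL : 0 < l₀ + s * (l₁ - l₀) := L.resolve_right fun h => by linarith [h.2.2.2.1]
        have hK : 0 < k₀ + s * (k₁ - k₀) := K.resolve_right fun h => by linarith [h.2.2.2.1]
        intro j hj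
        fin_cases j <;> simp at hj ⊢ <;> linarith
      · simp at hi
        obtain ⟨hs', hsl⟩ := hsI (Or.inl hi)
        refine ⟨hs', by simpa using hsl, ?_⟩
        have hL : 0 < l₀ + s * (l₁ - l₀) := L.resolve_right fun h => by linarith [h.2.2.1]
        have hK : 0 < k₀ + s * (k₁ - k₀) := K.resolve_right fun h => by linarith [h.2.2.1]
        intro j hj
        fin_cases j <;> simp at hj ⊢ <;> linarith
      · simp at hi
        obtain ⟨b1, b2, b3, b4, b5, b6⟩ := L.resolve_left fun h => by linarith
        refine ⟨b1, by simpa using b2, ?_⟩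
        intro j hj
        fin_cases j <;> simp at hj ⊢ <;> linarith
      · simp at hi
        obtain ⟨b1, b2, b3, b4, b5, b6⟩ := K.resolve_left fun h => by linarith
        refine ⟨b1, by simpa using b2, ?_⟩
        intro j hj
        fin_cases j <;> simp at hj ⊢ <;> linarith)
  have all : ∀ P : Fin 4 → Prop, (∀ j, P j) ↔ P 0 ∧ P 1 ∧ P 2 ∧ P 3 := fun P => by
    simp [Fin.forall_fin_succ]
  simp only [Fin.sum_univ_four, all] at key
  simp only [Matrix.cons_val_zero, Matrix.cons_val_one, Matrix.cons_val] at key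
  have i0 : (∃ s ∈ Set.Ioo (0 : ℝ) 1, 1 - y₀ + s * -(y₁ - y₀) = 0 ∧ 0 < y₀ + s * (y₁ - y₀) ∧
      0 < l₀ + s * (l₁ - l₀) ∧ 0 < k₀ + s * (k₁ - k₀)) ↔ ∃ x ∈ Set.Ioo (0 : ℝ) 1, ∃ l : ℝ, 0 < l ∧
        ∃ l' : ℝ, 0 < l' ∧ AffineMap.lineMap e.1 e.2 x = f.2 + l • u + l' • w := by
    constructor
    · rintro ⟨s, hs, h0, -, h2, h3⟩
      refine ⟨s, hs, _, h2, _, h3, ?_⟩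
      rw [hlm, hf2, show y₀ + s * (y₁ - y₀) = 1 by linarith]; module
    · rintro ⟨s, hs, l, hl, k, hk, he⟩
      rw [hlm, hf2, show f.1 + F + l • u + k • w = f.1 + ((1 : ℝ) • F + l • u + k • w) by
        module] at he
      obtain ⟨e1, e2, e3⟩ := frame_ext' hf he
      exact ⟨s, hs, by linarith, by linarith, by rwa [e2], by rwa [e3]⟩
  have i1 : (∃ s ∈ Set.Ioo (0 : ℝ) 1, y₀ + s * (y₁ - y₀) = 0 ∧ 0 < 1 - y₀ + s * -(y₁ - y₀) ∧
      0 < l₀ + s * (l₁ - l₀) ∧ 0 < k₀ + s * (k₁ - k₀)) ↔ ∃ x ∈ Set.Ioo (0 : ℝ) 1, ∃ l : ℝ, 0 < l ∧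
        ∃ l' : ℝ, 0 < l' ∧ AffineMap.lineMap e.1 e.2 x = f.1 + l • u + l' • w := by
    constructor
    · rintro ⟨s, hs, h0, -, h2, h3⟩
      refine ⟨s, hs, _, h2, _, h3, ?_⟩
      rw [hlm, h0]; module
    · rintro ⟨s, hs, l, hl, k, hk, he⟩
      rw [hlm, show f.1 + l • u + k • w = f.1 + ((0 : ℝ) • F + l • u + k • w) by module] at he
      obtain ⟨e1, e2, e3⟩ := frame_ext' hf he
      exact ⟨s, hs, by linarith, by linarith, by rwa [e2], by rwa [e3]⟩
  have i2 : (∃ s ∈ Set.Ioo (0 : ℝ) 1, l₀ + s * (l₁ - l₀) = 0 ∧ 0 < 1 - y₀ + s * -(y₁ - y₀) ∧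
      0 < y₀ + s * (y₁ - y₀) ∧ 0 < k₀ + s * (k₁ - k₀)) ↔ CrossesOver w e f := by
    constructor
    · rintro ⟨s, hs, h0, h1, h2, h3⟩
      exact ⟨s, hs, _, ⟨h2, by linarith⟩, _, h3, hmw h0⟩
    · rintro ⟨s, hs, y, hy, k, hk, he⟩
      rw [hlm, hlf, show f.1 + y • F + k • w = f.1 + (y • F + (0 : ℝ) • u + k • w) by module] at he
      obtain ⟨e1, e2, e3⟩ := frame_ext' hf he
      exact ⟨s, hs, e2, by linarith [hy.2], by linarith [hy.1], by linarith⟩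
  have i3 : (∃ s ∈ Set.Ioo (0 : ℝ) 1, k₀ + s * (k₁ - k₀) = 0 ∧ 0 < 1 - y₀ + s * -(y₁ - y₀) ∧
      0 < y₀ + s * (y₁ - y₀) ∧ 0 < l₀ + s * (l₁ - l₀)) ↔ CrossesOver u e f := by
    constructor
    · rintro ⟨s, hs, h0, h1, h2, h3⟩
      exact ⟨s, hs, _, ⟨h2, by linarith⟩, _, h3, hmu h0⟩
    · rintro ⟨s, hs, y, hy, l, hl, he⟩
      rw [hlm, hlf, show f.1 + y • F + l • u = f.1 + (y • F + l • u + (0 : ℝ) • w) by module] at he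
      obtain ⟨e1, e2, e3⟩ := frame_ext' hf he
      exact ⟨s, hs, e3, by linarith [hy.2], by linarith [hy.1], by linarith⟩
  have iW : ∀ {P : R3} {a b c : ℝ}, P = f.1 + (a • F + b • u + c • w) →
      ((0 < 1 - a ∧ 0 < a ∧ 0 < b ∧ 0 < c) ↔ f.1 ≠ f.2 ∧ ∃ y ∈ Set.Ioo (0 : ℝ) 1, ∃ l : ℝ, 0 < l ∧
        ∃ l' : ℝ, 0 < l' ∧ P = f.1 + (y • (f.2 - f.1) + l • u + l' • w)) := by
    intro P a b c hP
    constructor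
    · rintro ⟨h0, h1, h2, h3⟩
      exact ⟨hne, a, ⟨h1, by linarith⟩, b, h2, c, h3, hP⟩
    · rintro ⟨-, y, hy, l, hl, k, hk, he⟩
      rw [hP] at he
      obtain ⟨e1, e2, e3⟩ := frame_ext' hf he
      exact ⟨by linarith [hy.2], by linarith [hy.1], by linarith, by linarith⟩
  simp only [ne_eq, not_true_eq_false, false_implies, true_and, Fin.reduceEq, not_false_eq_true,
    true_implies, and_true, one_ne_zero, zero_ne_one] at key
  simp only [show (1 - y₀ + -(y₁ - y₀)) = 1 - y₁ by ring, show y₀ + (y₁ - y₀) = y₁ by ring,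
    show l₀ + (l₁ - l₀) = l₁ by ring, show k₀ + (k₁ - k₀) = k₁ by ring] at key
  simp only [i0, i1, i2, i3, iW he1, iW he2] at key
  simp only [crossing, sectorHit, inWedge]
  rw [← key]
  ring

open scoped Classical in
/-- Whether the segment `e` meets the interior of the triangle with vertices `v₀`, `v₁`, `v₂`. -/
noncomputable def triangleHit (e : R3 × R3) (v₀ v₁ v₂ : R3) : ZMod 2 :=
  if ∃ x ∈ Set.Ioo (0 : ℝ) 1, ∃ a b : ℝ, 0 < a ∧ 0 < b ∧ a + b < 1 ∧
    AffineMap.lineMap e.1 e.2 x = v₀ + (a • (v₁ - v₀) + b • (v₂ - v₀)) then 1 else 0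

open scoped Classical in
/-- Whether the point `P` lies in the half-infinite prism over a triangle in the direction `u`. -/
noncomputable def inPrism (u v₀ v₁ v₂ P : R3) : ZMod 2 :=
  if ∃ a b l : ℝ, 0 < a ∧ 0 < b ∧ a + b < 1 ∧ 0 < l ∧
    P = v₀ + (a • (v₁ - v₀) + b • (v₂ - v₀) + l • u) then 1 else 0

/-- The segment `e` meets the closed triangle with vertices `v₀`, `v₁`, `v₂` only transversally and
in interior points. -/
def TransverseTriangle (e : R3 × R3) (v₀ v₁ v₂ : R3) : Prop :=
  ∀ x ∈ Set.Icc (0 : ℝ) 1, ∀ a b : ℝ, 0 ≤ a → 0 ≤ b → a + b ≤ 1 →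
    AffineMap.lineMap e.1 e.2 x = v₀ + (a • (v₁ - v₀) + b • (v₂ - v₀)) →
    x ∈ Set.Ioo (0 : ℝ) 1 ∧ 0 < a ∧ 0 < b ∧ a + b < 1 ∧
      det3 (v₁ - v₀) (v₂ - v₀) (e.2 - e.1) ≠ 0

/-- The half-infinite prism over the triangle in the direction u is bounded by the triangle and
three walls, and e meets a wall exactly when it crosses over the corresponding side along u. -/
theorem crossing_prism {u v₀ v₁ v₂ : R3} {e : R3 × R3} (hd : det3 (v₁ - v₀) (v₂ - v₀) u ≠ 0)
    (h01 : RegularPair u e (v₀, v₁)) (h02 : RegularPair u e (v₀, v₂))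
    (h12 : RegularPair u e (v₁, v₂)) (ht : TransverseTriangle e v₀ v₁ v₂) :
    crossing u e (v₁, v₂) + crossing u e (v₀, v₂) + crossing u e (v₀, v₁) +
      triangleHit e v₀ v₁ v₂ = inPrism u v₀ v₁ v₂ e.1 + inPrism u v₀ v₁ v₂ e.2 := by
  classical
  set A := v₁ - v₀ with hA
  set B := v₂ - v₀ with hB
  obtain ⟨a₀, b₀, l₀, he1⟩ := exists_frame_coords hd v₀ e.1
  obtain ⟨a₁, b₁, l₁, he2⟩ := exists_frame_coords hd v₀ e.2
  have hlm : ∀ x : ℝ, AffineMap.lineMap e.1 e.2 x = v₀ + ((a₀ + x * (a₁ - a₀)) • A +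
      (b₀ + x * (b₁ - b₀)) • B + (l₀ + x * (l₁ - l₀)) • u) := fun x => lineMap_frame he1 he2 x
  have hE : e.2 - e.1 = (a₁ - a₀) • A + (b₁ - b₀) • B + (l₁ - l₀) • u := by
    rw [he1, he2]; module
  have d01 : det3 (e.2 - e.1) (v₁ - v₀) u = -(b₁ - b₀) * det3 A B u := by
    rw [hE, ← hA]; simp [det3_eq]; ring
  have d02 : det3 (e.2 - e.1) (v₂ - v₀) u = (a₁ - a₀) * det3 A B u := by
    rw [hE, ← hB]; simp [det3_eq]; ring
  have d12 : det3 (e.2 - e.1) (v₂ - v₁) u = ((a₁ - a₀) + (b₁ - b₀)) * det3 A B u := by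
    rw [hE, show v₂ - v₁ = B - A by rw [hA, hB]; abel]; simp [det3_eq]; ring
  have dt : det3 A B (e.2 - e.1) = (l₁ - l₀) * det3 A B u := by
    rw [hE, det3_comb_right]
  have m01 : ∀ {s : ℝ}, b₀ + s * (b₁ - b₀) = 0 → AffineMap.lineMap e.1 e.2 s =
      AffineMap.lineMap v₀ v₁ (a₀ + s * (a₁ - a₀)) + (l₀ + s * (l₁ - l₀)) • u := by
    intro s hs
    rw [hlm, lineMap_eq_add_smul, hs]; module
  have m02 : ∀ {s : ℝ}, a₀ + s * (a₁ - a₀) = 0 → AffineMap.lineMap e.1 e.2 s =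
      AffineMap.lineMap v₀ v₂ (b₀ + s * (b₁ - b₀)) + (l₀ + s * (l₁ - l₀)) • u := by
    intro s hs
    rw [hlm, lineMap_eq_add_smul, hs]; module
  have m12 : ∀ {s : ℝ}, (a₀ + s * (a₁ - a₀)) + (b₀ + s * (b₁ - b₀)) = 1 →
      AffineMap.lineMap e.1 e.2 s =
      AffineMap.lineMap v₁ v₂ (b₀ + s * (b₁ - b₀)) + (l₀ + s * (l₁ - l₀)) • u := by
    intro s hs
    rw [hlm, lineMap_eq_add_smul, show a₀ + s * (a₁ - a₀) = 1 - (b₀ + s * (b₁ - b₀)) by linarith,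
      hA, hB]
    module
  have mt : ∀ {s : ℝ}, l₀ + s * (l₁ - l₀) = 0 → AffineMap.lineMap e.1 e.2 s =
      v₀ + ((a₀ + s * (a₁ - a₀)) • A + (b₀ + s * (b₁ - b₀)) • B) := by
    intro s hs
    rw [hlm, hs]; module
  -- With coordinates a, b, l in the frame A, B, u at v₀, the walls over v₁v₂, v₀v₂, v₀v₁ are the
  -- zeros of 1 - a - b, a, b, and the triangle is the zero of l.
  have key := card_crossings (ι := Fin 4) ![1 - a₀ - b₀, a₀, b₀, l₀]
    ![-(a₁ - a₀) - (b₁ - b₀), a₁ - a₀, b₁ - b₀, l₁ - l₀] (by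
      intro s hs hall i hi
      have c0 := hall 0
      have c1 := hall 1
      have c2 := hall 2
      have c3 := hall 3
      simp only [Matrix.cons_val_zero, Matrix.cons_val_one, Matrix.cons_val] at c0 c1 c2 c3
      have hbI : b₀ + s * (b₁ - b₀) ∈ Set.Icc (0 : ℝ) 1 := ⟨by linarith, by linarith⟩
      have haI : a₀ + s * (a₁ - a₀) ∈ Set.Icc (0 : ℝ) 1 := ⟨by linarith, by linarith⟩
      fin_cases i
      · have hi : 1 - a₀ - b₀ + s * (-(a₁ - a₀) - (b₁ - b₀)) = 0 := hi
        obtain ⟨g1, g2, g3, g4⟩ := h12 s hs _ hbI _ (m12 (by linarith))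
        dsimp only at g4
        rw [d12] at g4
        have g5 := left_ne_zero_of_mul g4
        refine ⟨g1, fun h => g5 ?_, ?_⟩
        · have h : -(a₁ - a₀) - (b₁ - b₀) = 0 := h
          linarith
        · have := lt_of_le_of_ne c3 (Ne.symm g3)
          have := g2.1
          have := g2.2
          intro j hj
          fin_cases j <;> simp at hj ⊢ <;> linarith
      · have hi : a₀ + s * (a₁ - a₀) = 0 := hi
        obtain ⟨g1, g2, g3, g4⟩ := h02 s hs _ hbI _ (m02 hi)
        dsimp only at g4
        rw [d02] at g4
        refine ⟨g1, left_ne_zero_of_mul g4, ?_⟩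
        have := lt_of_le_of_ne c3 (Ne.symm g3)
        have := g2.1
        have := g2.2
        intro j hj
        fin_cases j <;> simp at hj ⊢ <;> linarith
      · have hi : b₀ + s * (b₁ - b₀) = 0 := hi
        obtain ⟨g1, g2, g3, g4⟩ := h01 s hs _ haI _ (m01 hi)
        dsimp only at g4
        rw [d01] at g4
        have g5 := left_ne_zero_of_mul g4
        refine ⟨g1, fun h => g5 (by rw [show b₁ - b₀ = 0 from h, neg_zero]), ?_⟩
        have := lt_of_le_of_ne c3 (Ne.symm g3)
        have := g2.1
        have := g2.2
        intro j hj
        fin_cases j <;> simp at hj ⊢ <;> linarith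
      · have hi : l₀ + s * (l₁ - l₀) = 0 := hi
        obtain ⟨g1, g2, g3, g4, g5⟩ := ht s hs _ _ c1 c2 (by linarith) (mt hi)
        rw [← hA, ← hB, dt] at g5
        refine ⟨g1, left_ne_zero_of_mul g5, ?_⟩
        intro j hj
        fin_cases j <;> simp at hj ⊢ <;> linarith)
  have all : ∀ P : Fin 4 → Prop, (∀ j, P j) ↔ P 0 ∧ P 1 ∧ P 2 ∧ P 3 := fun P => by
    simp [Fin.forall_fin_succ]
  simp only [Fin.sum_univ_four, all] at key
  simp only [Matrix.cons_val_zero, Matrix.cons_val_one, Matrix.cons_val] at key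
  simp only [ne_eq, not_true_eq_false, false_implies, true_and, Fin.reduceEq, not_false_eq_true,
    true_implies, and_true, one_ne_zero, zero_ne_one] at key
  have i0 : (∃ s ∈ Set.Ioo (0 : ℝ) 1, 1 - a₀ - b₀ + s * (-(a₁ - a₀) - (b₁ - b₀)) = 0 ∧
      0 < a₀ + s * (a₁ - a₀) ∧ 0 < b₀ + s * (b₁ - b₀) ∧ 0 < l₀ + s * (l₁ - l₀)) ↔
      CrossesOver u e (v₁, v₂) := by
    constructor
    · rintro ⟨s, hs, c0, c1, c2, c3⟩
      exact ⟨s, hs, _, ⟨c2, by linarith⟩, _, c3, m12 (by linarith)⟩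
    · rintro ⟨s, hs, y, hy, l, hl, he⟩
      rw [hlm, lineMap_eq_add_smul, show v₁ + y • (v₂ - v₁) + l • u =
        v₀ + ((1 - y) • A + y • B + l • u) by rw [hA, hB]; module] at he
      obtain ⟨e1, e2, e3⟩ := frame_ext' hd he
      exact ⟨s, hs, by linarith, by linarith [hy.2], by linarith [hy.1], by linarith⟩
  have i1 : (∃ s ∈ Set.Ioo (0 : ℝ) 1, a₀ + s * (a₁ - a₀) = 0 ∧
      0 < 1 - a₀ - b₀ + s * (-(a₁ - a₀) - (b₁ - b₀)) ∧
      0 < b₀ + s * (b₁ - b₀) ∧ 0 < l₀ + s * (l₁ - l₀)) ↔ CrossesOver u e (v₀, v₂) := by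
    constructor
    · rintro ⟨s, hs, c0, c1, c2, c3⟩
      exact ⟨s, hs, _, ⟨c2, by linarith⟩, _, c3, m02 c0⟩
    · rintro ⟨s, hs, y, hy, l, hl, he⟩
      rw [hlm, lineMap_eq_add_smul, show v₀ + y • (v₂ - v₀) + l • u =
        v₀ + ((0 : ℝ) • A + y • B + l • u) by rw [hB]; module] at he
      obtain ⟨e1, e2, e3⟩ := frame_ext' hd he
      exact ⟨s, hs, by linarith, by linarith [hy.2], by linarith [hy.1], by linarith⟩
  have i2 : (∃ s ∈ Set.Ioo (0 : ℝ) 1, b₀ + s * (b₁ - b₀) = 0 ∧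
      0 < 1 - a₀ - b₀ + s * (-(a₁ - a₀) - (b₁ - b₀)) ∧
      0 < a₀ + s * (a₁ - a₀) ∧ 0 < l₀ + s * (l₁ - l₀)) ↔ CrossesOver u e (v₀, v₁) := by
    constructor
    · rintro ⟨s, hs, c0, c1, c2, c3⟩
      exact ⟨s, hs, _, ⟨c2, by linarith⟩, _, c3, m01 c0⟩
    · rintro ⟨s, hs, y, hy, l, hl, he⟩
      rw [hlm, lineMap_eq_add_smul, show v₀ + y • (v₁ - v₀) + l • u =
        v₀ + (y • A + (0 : ℝ) • B + l • u) by rw [hA]; module] at he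
      obtain ⟨e1, e2, e3⟩ := frame_ext' hd he
      exact ⟨s, hs, by linarith, by linarith [hy.2], by linarith [hy.1], by linarith⟩
  have i3 : (∃ s ∈ Set.Ioo (0 : ℝ) 1, l₀ + s * (l₁ - l₀) = 0 ∧
      0 < 1 - a₀ - b₀ + s * (-(a₁ - a₀) - (b₁ - b₀)) ∧
      0 < a₀ + s * (a₁ - a₀) ∧ 0 < b₀ + s * (b₁ - b₀)) ↔
      ∃ x ∈ Set.Ioo (0 : ℝ) 1, ∃ a b : ℝ, 0 < a ∧ 0 < b ∧ a + b < 1 ∧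
        AffineMap.lineMap e.1 e.2 x = v₀ + (a • A + b • B) := by
    constructor
    · rintro ⟨s, hs, c0, c1, c2, c3⟩
      exact ⟨s, hs, _, _, c2, c3, by linarith, mt c0⟩
    · rintro ⟨s, hs, a, b, ha, hb, hab, he⟩
      rw [hlm, show v₀ + (a • A + b • B) = v₀ + (a • A + b • B + (0 : ℝ) • u) by module] at he
      obtain ⟨e1, e2, e3⟩ := frame_ext' hd he
      exact ⟨s, hs, by linarith, by linarith, by linarith, by linarith⟩
  have iP : ∀ {P : R3} {a b l : ℝ}, P = v₀ + (a • A + b • B + l • u) →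
      ((0 < 1 - a - b ∧ 0 < a ∧ 0 < b ∧ 0 < l) ↔ ∃ a b l : ℝ, 0 < a ∧ 0 < b ∧ a + b < 1 ∧ 0 < l ∧
        P = v₀ + (a • A + b • B + l • u)) := by
    intro P a b l hP
    constructor
    · rintro ⟨c0, c1, c2, c3⟩
      exact ⟨a, b, l, c1, c2, by linarith, c3, hP⟩
    · rintro ⟨a', b', l', c1, c2, c0, c3, he⟩
      rw [hP] at he
      obtain ⟨e1, e2, e3⟩ := frame_ext' hd he
      exact ⟨by linarith, by linarith, by linarith, by linarith⟩
  simp only [show (1 - a₀ - b₀ + (-(a₁ - a₀) - (b₁ - b₀))) = 1 - a₁ - b₁ by ring,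
    show a₀ + (a₁ - a₀) = a₁ by ring,
    show b₀ + (b₁ - b₀) = b₁ by ring, show l₀ + (l₁ - l₀) = l₁ by ring] at key
  simp only [i0, i1, i2, i3, iP he1, iP he2] at key
  simp only [crossing, triangleHit, inPrism]
  rw [← key]

end Crossings

/-! ### The linking number modulo two -/

section LinkingModTwo

/-- Polygonal 1-chains modulo two. -/
abbrev ModTwoChain : Type := (R3 × R3) →₀ ZMod 2

variable {ι κ : Type*}

/-- The bilinear extension of a function of pairs of generators. -/
noncomputable def pairing (g : ι → κ → ZMod 2) :
    (ι →₀ ZMod 2) →ₗ[ZMod 2] (κ →₀ ZMod 2) →ₗ[ZMod 2] ZMod 2 :=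
  Finsupp.linearCombination (ZMod 2) fun i => Finsupp.linearCombination (ZMod 2) (g i)

theorem pairing_apply (g : ι → κ → ZMod 2) (a : ι →₀ ZMod 2) (c : κ →₀ ZMod 2) :
    pairing g a c = ∑ i ∈ a.support, ∑ j ∈ c.support, a i * (c j * g i j) := by
  simp [pairing, Finsupp.linearCombination_apply, Finsupp.sum, Finset.mul_sum]

theorem pairing_eq_left (g : ι → κ → ZMod 2) (a : ι →₀ ZMod 2) (c : κ →₀ ZMod 2) :
    pairing g a c = Finsupp.linearCombination (ZMod 2)
      (fun i => Finsupp.linearCombination (ZMod 2) (g i) c) a := by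
  simp [pairing, Finsupp.linearCombination_apply, Finsupp.sum]

theorem pairing_eq_right (g : ι → κ → ZMod 2) (a : ι →₀ ZMod 2) (c : κ →₀ ZMod 2) :
    pairing g a c = Finsupp.linearCombination (ZMod 2)
      (fun j => Finsupp.linearCombination (ZMod 2) (fun i => g i j) a) c := by
  rw [pairing_apply, Finset.sum_comm]
  simp only [Finsupp.linearCombination_apply, Finsupp.sum, smul_eq_mul, Finset.mul_sum]
  exact Finset.sum_congr rfl fun j _ => Finset.sum_congr rfl fun i _ => by ring

theorem pairing_congr {g g' : ι → κ → ZMod 2} {a : ι →₀ ZMod 2} {c : κ →₀ ZMod 2}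
    (h : ∀ i ∈ a.support, ∀ j ∈ c.support, g i j = g' i j) : pairing g a c = pairing g' a c := by
  rw [pairing_apply, pairing_apply]
  exact Finset.sum_congr rfl fun i hi => Finset.sum_congr rfl fun j hj => by rw [h i hi j hj]

theorem pairing_add_fun (g g' : ι → κ → ZMod 2) (a : ι →₀ ZMod 2) (c : κ →₀ ZMod 2) :
    pairing (fun i j => g i j + g' i j) a c = pairing g a c + pairing g' a c := by
  simp only [pairing_apply, mul_add, Finset.sum_add_distrib]

theorem pairing_swap (g : ι → κ → ZMod 2) (a : ι →₀ ZMod 2) (c : κ →₀ ZMod 2) :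
    pairing (fun j i => g i j) c a = pairing g a c := by
  rw [pairing_eq_left, pairing_eq_right]

theorem pairing_mapDomain {ι' κ' : Type*} (g : ι' → κ' → ZMod 2) (s : ι → ι') (t : κ → κ')
    (a : ι →₀ ZMod 2) (c : κ →₀ ZMod 2) :
    pairing g (a.mapDomain s) (c.mapDomain t) = pairing (fun i j => g (s i) (t j)) a c := by
  rw [pairing_eq_left, pairing_eq_left, Finsupp.linearCombination_mapDomain]
  congr 2
  ext i
  simp only [Function.comp, Finsupp.linearCombination_mapDomain]
  rfl

/-- A chain modulo two is a cycle if every function of the vertices sums to zero over the end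
points of its edges. -/
def IsModTwoCycle (a : ModTwoChain) : Prop :=
  ∀ g : R3 → ZMod 2, Finsupp.linearCombination (ZMod 2) (fun e : R3 × R3 => g e.1 + g e.2) a = 0

theorem IsModTwoCycle.add {a b : ModTwoChain} (ha : IsModTwoCycle a) (hb : IsModTwoCycle b) :
    IsModTwoCycle (a + b) := fun g => by rw [map_add, ha g, hb g, add_zero]

theorem isModTwoCycle_zero : IsModTwoCycle 0 := fun _ => map_zero _

theorem IsModTwoCycle.smul {a : ModTwoChain} (ha : IsModTwoCycle a) (x : ZMod 2) :
    IsModTwoCycle (x • a) := fun g => by rw [map_smul, ha g, smul_zero]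

theorem IsModTwoCycle.sum {α : Type*} {s : Finset α} {a : α → ModTwoChain}
    (h : ∀ i ∈ s, IsModTwoCycle (a i)) : IsModTwoCycle (∑ i ∈ s, a i) := fun g => by
  rw [map_sum]
  exact Finset.sum_eq_zero fun i hi => h i hi g

/-- This is the cancellation that turns the local identities for segments into invariance:
contributions of single end points disappear when they are summed over a cycle. -/
theorem IsModTwoCycle.pairing_eq_zero {a : ModTwoChain} (ha : IsModTwoCycle a)
    (k : R3 → κ → ZMod 2) (c : κ →₀ ZMod 2) :
    pairing (fun (e : R3 × R3) j => k e.1 j + k e.2 j) a c = 0 := by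
  rw [pairing_eq_left]
  have := ha fun P => Finsupp.linearCombination (ZMod 2) (k P) c
  rw [← this]
  congr 2
  ext e
  simp only [Finsupp.linearCombination_apply, Finsupp.sum, smul_eq_mul, mul_add,
    Finset.sum_add_distrib]

theorem IsModTwoCycle.pairing_eq_zero' {c : ModTwoChain} (hc : IsModTwoCycle c)
    (k : ι → R3 → ZMod 2) (a : ι →₀ ZMod 2) :
    pairing (fun i (f : R3 × R3) => k i f.1 + k i f.2) a c = 0 := by
  rw [← pairing_swap]
  exact hc.pairing_eq_zero (fun P i => k i P) a

/-- The direction `u` is regular for the chains `a` and `c`. -/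
def IsRegularFor (u : R3) (a c : ModTwoChain) : Prop :=
  u ≠ 0 ∧ ∀ e ∈ a.support, ∀ f ∈ c.support, RegularPair u e f

/-- A degenerate segment has direction zero, so any meeting would contradict the determinant
condition in regularity. -/
theorem crossing_degenerate {u : R3} {e : R3 × R3} {p : R3} (h : RegularPair u e (p, p)) :
    crossing u e (p, p) = 0 := by
  rw [crossing, if_neg]
  rintro ⟨x, hx, y, hy, l, hl, he⟩
  apply (h x ⟨hx.1.le, hx.2.le⟩ y ⟨hy.1.le, hy.2.le⟩ l he).2.2.2
  simp [det3_eq]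

theorem inWedge_degenerate (u w p P : R3) : inWedge u w (p, p) P = 0 := by
  rw [inWedge, if_neg]
  simp

/-- The wedge identity is summed over all pairs of segments. The sector terms depend only on the end
points of f and the wedge terms only on those of e, so they cancel because c and a are cycles. -/
theorem pairing_crossing_eq_of_generic {a c : ModTwoChain} (ha : IsModTwoCycle a)
    (hc : IsModTwoCycle c) {u w : R3} (hu : IsRegularFor u a c) (hw : IsRegularFor w a c)
    (hgen : ∀ e ∈ a.support, ∀ f ∈ c.support, (f.1 = f.2 ∨ det3 (f.2 - f.1) u w ≠ 0) ∧
      det3 (e.1 - f.1) u w ≠ 0 ∧ det3 (e.1 - f.2) u w ≠ 0 ∧ det3 (e.2 - f.1) u w ≠ 0 ∧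
      det3 (e.2 - f.2) u w ≠ 0) :
    pairing (crossing u) a c = pairing (crossing w) a c := by
  have hchar : ∀ x : ZMod 2, x + x = 0 := by decide
  have key : pairing (fun e f => (crossing u e f + crossing w e f) +
      (sectorHit u w e f.1 + sectorHit u w e f.2)) a c =
      pairing (fun (e : R3 × R3) f => inWedge u w f e.1 + inWedge u w f e.2) a c := by
    refine pairing_congr fun e he f hf => ?_
    obtain ⟨h0, h11, h12, h21, h22⟩ := hgen e he f hf
    rcases h0 with h0 | h0
    · obtain ⟨p, q⟩ := f
      obtain rfl : p = q := h0
      rw [crossing_degenerate (hu.2 e he _ hf), crossing_degenerate (hw.2 e he _ hf),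
        inWedge_degenerate, inWedge_degenerate]
      simp [hchar]
    · rw [← crossing_wedge (hu.2 e he f hf) (hw.2 e he f hf) h0 h11 h12 h21 h22]
      ring
  rw [pairing_add_fun, pairing_add_fun, hc.pairing_eq_zero' (sectorHit u w) a, add_zero,
    ha.pairing_eq_zero (fun P f => inWedge u w f P) c] at key
  have := hchar (pairing (crossing w) a c)
  linear_combination key - this

theorem det3_ne_zero_of_notMem {v u w : R3} (hv : v ≠ 0) (hu : u ∉ Submodule.span ℝ {v, v})
    (hw : w ∉ Submodule.span ℝ {v, u}) : det3 v u w ≠ 0 := by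
  intro h
  rcases mem_span_pair_of_det3_eq_zero h with h | ⟨s, t, hst, h⟩
  · exact hw h
  · by_cases ht : t = 0
    · have hs : s ≠ 0 := by simpa [ht] using hst
      exact hv (by simpa [ht, hs] using h)
    · apply hu
      rw [Submodule.mem_span_pair]
      refine ⟨-(s / t), 0, ?_⟩
      have : u = t⁻¹ • (t • u) := by rw [smul_smul, inv_mul_cancel₀ ht, one_smul]
      rw [this, eq_neg_of_add_eq_zero_right h]
      simp [smul_smul, div_eq_inv_mul]

/-- The parity of the number of crossings of `a` over `c` does not depend on the direction. -/
theorem pairing_crossing_eq {a c : ModTwoChain} (ha : IsModTwoCycle a) (hc : IsModTwoCycle c)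
    {u w : R3} (hu : IsRegularFor u a c) (hw : IsRegularFor w a c) :
    pairing (crossing u) a c = pairing (crossing w) a c := by
  classical
  have hdisj : ∀ e ∈ a.support, ∀ f ∈ c.support, DisjointSegments e f := fun e he f hf =>
    (hu.2 e he f hf).disjoint
  -- the vectors to be avoided
  let D : Finset R3 := c.support.image (fun f => f.2 - f.1) ∪
    ((a.support ×ˢ c.support).image (fun q => q.1.1 - q.2.1) ∪
    ((a.support ×ˢ c.support).image (fun q => q.1.1 - q.2.2) ∪
    ((a.support ×ˢ c.support).image (fun q => q.1.2 - q.2.1) ∪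
    (a.support ×ˢ c.support).image (fun q => q.1.2 - q.2.2))))
  -- Each given direction may be perturbed off the lines spanned by the vectors in `D` without
  -- changing the count. A third direction `z`, generic with respect to both perturbed ones, then
  -- connects them.
  have hnear : ∀ {u : R3}, IsRegularFor u a c → ∃ u', IsRegularFor u' a c ∧
      (∀ v ∈ D, u' ∉ Submodule.span ℝ {v, v}) ∧
      pairing (crossing u') a c = pairing (crossing u) a c := by
    intro u hu
    have hev : ∀ᶠ u' in 𝓝 u, ∀ e ∈ a.support, ∀ f ∈ c.support,
        crossing u' e f = crossing u e f := by
      rw [Filter.eventually_all_finset]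
      intro e he
      rw [Filter.eventually_all_finset]
      intro f hf
      have ht : Filter.Tendsto (fun u' : R3 => (u', e, f)) (𝓝 u) (𝓝 (u, e, f)) :=
        Continuous.tendsto (by fun_prop) u
      exact (ht.eventually ((hu.2 e he f hf).eventually hu.1)).mono fun u' h => h.2
    obtain ⟨O, hO, hOo, huO⟩ := eventually_nhds_iff.1 hev
    obtain ⟨u', hu'O, hu'0, hreg, hT⟩ := exists_regular_direction hOo ⟨u, huO⟩ a.support c.support
      hdisj (D.image fun v => (v, v))
    exact ⟨u', ⟨hu'0, hreg⟩, fun v hv => hT (v, v) (Finset.mem_image_of_mem _ hv),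
      pairing_congr (hO u' hu'O)⟩
  obtain ⟨u', hu', huD, hue⟩ := hnear hu
  obtain ⟨w', hw', hwD, hwe⟩ := hnear hw
  obtain ⟨z, -, hz0, hzreg, hzT⟩ := exists_regular_direction isOpen_univ Set.univ_nonempty
    a.support c.support hdisj (D.image (fun v => (v, u')) ∪ D.image fun v => (v, w'))
  have hz : IsRegularFor z a c := ⟨hz0, hzreg⟩
  have hgen : ∀ u' : R3, (∀ v ∈ D, u' ∉ Submodule.span ℝ {v, v}) →
      (∀ v ∈ D, z ∉ Submodule.span ℝ {v, u'}) →
      ∀ e ∈ a.support, ∀ f ∈ c.support, (f.1 = f.2 ∨ det3 (f.2 - f.1) u' z ≠ 0) ∧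
      det3 (e.1 - f.1) u' z ≠ 0 ∧ det3 (e.1 - f.2) u' z ≠ 0 ∧ det3 (e.2 - f.1) u' z ≠ 0 ∧
      det3 (e.2 - f.2) u' z ≠ 0 := by
    intro u' h1 h2 e he f hf
    have hd := hdisj e he f hf
    have h00 := hd 0 (by simp) 0 (by simp)
    have h01 := hd 0 (by simp) 1 (by simp)
    have h10 := hd 1 (by simp) 0 (by simp)
    have h11 := hd 1 (by simp) 1 (by simp)
    simp only [AffineMap.lineMap_apply_zero, AffineMap.lineMap_apply_one] at h00 h01 h10 h11
    have hm := Finset.mk_mem_product he hf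
    have key : ∀ v ∈ D, v ≠ 0 → det3 v u' z ≠ 0 := fun v hv hv0 =>
      det3_ne_zero_of_notMem hv0 (h1 v hv) (h2 v hv)
    refine ⟨?_, key _ ?_ (sub_ne_zero.2 h00), key _ ?_ (sub_ne_zero.2 h01),
      key _ ?_ (sub_ne_zero.2 h10), key _ ?_ (sub_ne_zero.2 h11)⟩
    · by_cases h : f.1 = f.2
      · exact Or.inl h
      · refine Or.inr (key _ ?_ (sub_ne_zero.2 (Ne.symm h)))
        exact Finset.mem_union_left _ (Finset.mem_image_of_mem (fun f : R3 × R3 => f.2 - f.1) hf)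
    · exact Finset.mem_union_right _ (Finset.mem_union_left _
        (Finset.mem_image.2 ⟨(e, f), hm, rfl⟩))
    · exact Finset.mem_union_right _ (Finset.mem_union_right _ (Finset.mem_union_left _
        (Finset.mem_image.2 ⟨(e, f), hm, rfl⟩)))
    · exact Finset.mem_union_right _ (Finset.mem_union_right _ (Finset.mem_union_right _
        (Finset.mem_union_left _ (Finset.mem_image.2 ⟨(e, f), hm, rfl⟩))))
    · exact Finset.mem_union_right _ (Finset.mem_union_right _ (Finset.mem_union_right _
        (Finset.mem_union_right _ (Finset.mem_image.2 ⟨(e, f), hm, rfl⟩))))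
  rw [← hue, ← hwe, pairing_crossing_eq_of_generic ha hc hu' hz (hgen u' huD fun v hv =>
      hzT (v, u') (Finset.mem_union_left _ (Finset.mem_image_of_mem _ hv))),
    pairing_crossing_eq_of_generic ha hc hw' hz (hgen w' hwD fun v hv =>
      hzT (v, w') (Finset.mem_union_right _ (Finset.mem_image_of_mem _ hv)))]

open scoped Classical in
/-- The linking number modulo two of disjoint cycles. -/
noncomputable def linkTwo (a c : ModTwoChain) : ZMod 2 :=
  if h : ∃ u, IsRegularFor u a c then pairing (crossing h.choose) a c else 0

theorem linkTwo_eq {a c : ModTwoChain} (ha : IsModTwoCycle a) (hc : IsModTwoCycle c) {u : R3}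
    (hu : IsRegularFor u a c) : linkTwo a c = pairing (crossing u) a c := by
  have h : ∃ u, IsRegularFor u a c := ⟨u, hu⟩
  rw [linkTwo, dif_pos h]
  exact pairing_crossing_eq ha hc h.choose_spec hu

/-- The carriers of two chains are disjoint. -/
def DisjointChains (a c : ModTwoChain) : Prop :=
  ∀ e ∈ a.support, ∀ f ∈ c.support, DisjointSegments e f

/-- A single direction that is regular for a and both of c and c' computes all three linking
numbers. Disjointness is what provides it. -/
theorem linkTwo_add_right {a c c' : ModTwoChain} (ha : IsModTwoCycle a) (hc : IsModTwoCycle c)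
    (hc' : IsModTwoCycle c') (h : DisjointChains a c) (h' : DisjointChains a c') :
    linkTwo a (c + c') = linkTwo a c + linkTwo a c' := by
  classical
  obtain ⟨u, -, hu0, hu, -⟩ := exists_regular_direction isOpen_univ Set.univ_nonempty a.support
    (c.support ∪ c'.support) (fun e he f hf => (Finset.mem_union.1 hf).elim (h e he f) (h' e he f))
    ∅
  rw [linkTwo_eq ha hc ⟨hu0, fun e he f hf => hu e he f (Finset.mem_union_left _ hf)⟩,
    linkTwo_eq ha hc' ⟨hu0, fun e he f hf => hu e he f (Finset.mem_union_right _ hf)⟩,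
    linkTwo_eq ha (hc.add hc') ⟨hu0, fun e he f hf => hu e he f (Finsupp.support_add hf)⟩,
    map_add]

theorem linkTwo_zero_right (a : ModTwoChain) : linkTwo a 0 = 0 := by
  rw [linkTwo]
  split_ifs <;> simp

theorem linkTwo_sum_right {α : Type*} {s : Finset α} {a : ModTwoChain} {c : α → ModTwoChain}
    (ha : IsModTwoCycle a) (hc : ∀ i ∈ s, IsModTwoCycle (c i))
    (h : ∀ i ∈ s, DisjointChains a (c i)) :
    linkTwo a (∑ i ∈ s, c i) = ∑ i ∈ s, linkTwo a (c i) := by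
  classical
  induction s using Finset.induction_on with
  | empty => simp [linkTwo_zero_right]
  | insert i s hi ih =>
    have hcs : ∀ j ∈ s, IsModTwoCycle (c j) := fun j hj => hc j (Finset.mem_insert_of_mem hj)
    have hds : DisjointChains a (∑ j ∈ s, c j) := by
      intro e he f hf
      obtain ⟨j, hj, hfj⟩ := Finset.mem_biUnion.1 (Finsupp.support_finsetSum hf)
      exact h j (Finset.mem_insert_of_mem hj) e he f hfj
    rw [Finset.sum_insert hi, Finset.sum_insert hi, linkTwo_add_right ha
      (hc i (Finset.mem_insert_self _ _)) (.sum hcs) (h i (Finset.mem_insert_self _ _)) hds,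
      ih hcs fun j hj => h j (Finset.mem_insert_of_mem hj)]

theorem RegularPair.symm {u : R3} {e f : R3 × R3} (h : RegularPair u e f) :
    RegularPair (-u) f e := by
  intro x hx y hy l hl
  obtain ⟨h1, h2, h3, h4⟩ := h y hy x hx l (by rw [hl]; module)
  refine ⟨h2, h1, h3, fun h0 => h4 ?_⟩
  rw [← h0]
  simp [det3_eq]; ring

theorem crossing_symm (u : R3) (e f : R3 × R3) : crossing (-u) f e = crossing u e f := by
  have : CrossesOver (-u) f e ↔ CrossesOver u e f := by
    constructor
    · rintro ⟨x, hx, y, hy, l, hl, he⟩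
      exact ⟨y, hy, x, hx, l, hl, by rw [he]; module⟩
    · rintro ⟨x, hx, y, hy, l, hl, he⟩
      exact ⟨y, hy, x, hx, l, hl, by rw [he]; module⟩
  rw [crossing, crossing]
  by_cases h : CrossesOver u e f
  · rw [if_pos h, if_pos (this.2 h)]
  · rw [if_neg h, if_neg fun h' => h (this.1 h')]

theorem DisjointSegments.symm {e f : R3 × R3} (h : DisjointSegments e f) : DisjointSegments f e :=
  fun x hx y hy he => h y hy x hx he.symm

theorem DisjointChains.symm {a c : ModTwoChain} (h : DisjointChains a c) : DisjointChains c a :=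
  fun e he f hf => (h f hf e he).symm

/-- The crossings of a over c seen from u are the crossings of c over a seen from -u. -/
theorem linkTwo_comm {a c : ModTwoChain} (ha : IsModTwoCycle a) (hc : IsModTwoCycle c)
    (h : DisjointChains a c) : linkTwo a c = linkTwo c a := by
  obtain ⟨u, -, hu0, hu, -⟩ := exists_regular_direction isOpen_univ Set.univ_nonempty a.support
    c.support h ∅
  rw [linkTwo_eq ha hc ⟨hu0, hu⟩, linkTwo_eq hc ha (u := -u)
    ⟨neg_ne_zero.2 hu0, fun f hf e he => (hu e he f hf).symm⟩, ← pairing_swap]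
  exact pairing_congr fun f _ e _ => (crossing_symm u e f).symm

theorem mem_support_mapDomain {α β : Type*} {s : α → β} {a : α →₀ ZMod 2} {b : β}
    (h : b ∈ (a.mapDomain s).support) : ∃ i ∈ a.support, s i = b := by
  classical
  simpa using Finsupp.mapDomain_support h

/-- The linking number modulo two does not change under deformations through disjoint cycles. -/
theorem linkTwo_deform (A : ι →₀ ZMod 2) (B : κ →₀ ZMod 2) (g : ℝ → ι → R3 × R3)
    (h : ℝ → κ → R3 × R3) (hg : ∀ i, Continuous fun s => g s i) (hh : ∀ j, Continuous fun s => h s j)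
    (hA : ∀ s ∈ Set.Icc (0 : ℝ) 1, IsModTwoCycle (A.mapDomain (g s)))
    (hB : ∀ s ∈ Set.Icc (0 : ℝ) 1, IsModTwoCycle (B.mapDomain (h s)))
    (hd : ∀ s ∈ Set.Icc (0 : ℝ) 1, ∀ i ∈ A.support, ∀ j ∈ B.support,
      DisjointSegments (g s i) (h s j)) :
    linkTwo (A.mapDomain (g 0)) (B.mapDomain (h 0)) =
      linkTwo (A.mapDomain (g 1)) (B.mapDomain (h 1)) := by
  classical
  let F : Set.Icc (0 : ℝ) 1 → ZMod 2 := fun s => linkTwo (A.mapDomain (g s)) (B.mapDomain (h s))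
  have hval : ∀ s : Set.Icc (0 : ℝ) 1, ∀ u : R3, u ≠ 0 →
      (∀ i ∈ A.support, ∀ j ∈ B.support, RegularPair u (g s i) (h s j)) →
      F s = pairing (fun i j => crossing u (g s i) (h s j)) A B := by
    intro s u hu0 hu
    rw [← pairing_mapDomain]
    refine linkTwo_eq (hA s s.2) (hB s s.2) ⟨hu0, fun e he f hf => ?_⟩
    obtain ⟨i, hi, rfl⟩ := mem_support_mapDomain he
    obtain ⟨j, hj, rfl⟩ := mem_support_mapDomain hf
    exact hu i hi j hj
  -- A direction that is regular at time s remains regular, with the same crossings, at nearby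
  -- times; the interval is connected.
  have hF : IsLocallyConstant F := by
    rw [IsLocallyConstant.iff_eventually_eq]
    intro s
    obtain ⟨u, -, hu0, hu, -⟩ := exists_regular_direction isOpen_univ Set.univ_nonempty
      (A.support.image (g s)) (B.support.image (h s)) (by
        intro e he f hf
        obtain ⟨i, hi, rfl⟩ := Finset.mem_image.1 he
        obtain ⟨j, hj, rfl⟩ := Finset.mem_image.1 hf
        exact hd s s.2 i hi j hj) ∅
    have hu' : ∀ i ∈ A.support, ∀ j ∈ B.support, RegularPair u (g s i) (h s j) :=
      fun i hi j hj => hu _ (Finset.mem_image_of_mem _ hi) _ (Finset.mem_image_of_mem _ hj)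
    have hev : ∀ᶠ t : Set.Icc (0 : ℝ) 1 in 𝓝 s, ∀ i ∈ A.support, ∀ j ∈ B.support,
        RegularPair u (g t i) (h t j) ∧
          crossing u (g t i) (h t j) = crossing u (g s i) (h s j) := by
      rw [Filter.eventually_all_finset]
      intro i hi
      rw [Filter.eventually_all_finset]
      intro j hj
      have ht : Filter.Tendsto (fun t : Set.Icc (0 : ℝ) 1 => (u, g t i, h t j)) (𝓝 s)
          (𝓝 (u, g s i, h s j)) :=
        Continuous.tendsto (continuous_const.prodMk (((hg i).comp continuous_subtype_val).prodMk
          ((hh j).comp continuous_subtype_val))) s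
      exact ht.eventually ((hu' i hi j hj).eventually hu0)
    filter_upwards [hev] with t ht
    rw [hval t u hu0 fun i hi j hj => (ht i hi j hj).1, hval s u hu0 hu']
    exact pairing_congr fun i hi j hj => (ht i hi j hj).2
  exact hF.apply_eq_of_preconnectedSpace (⟨0, by simp⟩ : Set.Icc (0 : ℝ) 1) ⟨1, by simp⟩

/-- The boundary of the triangle with vertices `p`, `q`, `r`, modulo two. -/
noncomputable def triangleBdry (p q r : R3) : ModTwoChain :=
  Finsupp.single (q, r) 1 + Finsupp.single (p, r) 1 + Finsupp.single (p, q) 1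

theorem isModTwoCycle_triangleBdry (p q r : R3) : IsModTwoCycle (triangleBdry p q r) := by
  intro g
  simp only [triangleBdry, map_add, Finsupp.linearCombination_single, one_smul]
  have hchar : ∀ x : ZMod 2, x + x = 0 := by decide
  linear_combination hchar (g p) + hchar (g q) + hchar (g r)

theorem triangleBdry_eq_mapDomain (p q r : R3) :
    triangleBdry p q r = (∑ j : Fin 3, Finsupp.single j (1 : ZMod 2)).mapDomain
      ![(q, r), (p, r), (p, q)] := by
  simp [triangleBdry, Fin.sum_univ_three, Finsupp.mapDomain_add, Finsupp.mapDomain_single]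

theorem mem_support_triangleBdry {p q r : R3} {f : R3 × R3} (hf : f ∈ (triangleBdry p q r).support) :
    f = (q, r) ∨ f = (p, r) ∨ f = (p, q) := by
  rw [triangleBdry_eq_mapDomain] at hf
  obtain ⟨j, -, rfl⟩ := mem_support_mapDomain hf
  fin_cases j <;> simp

/-- The boundary of a triangle does not link a cycle that does not meet the triangle. -/
theorem linkTwo_triangleBdry_eq_zero {a : ModTwoChain} (ha : IsModTwoCycle a) {p q r : R3}
    (h : ∀ e ∈ a.support, ∀ x ∈ Set.Icc (0 : ℝ) 1, ∀ s t : ℝ, 0 ≤ s → 0 ≤ t → s + t ≤ 1 →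
      AffineMap.lineMap e.1 e.2 x ≠ p + (s • (q - p) + t • (r - p))) :
    linkTwo a (triangleBdry p q r) = 0 := by
  -- The boundary shrinks inside the triangle to the vertex p, where its edges are degenerate and
  -- have no crossings.
  let c : ℝ → R3 → R3 := fun s v => p + (1 - s) • (v - p)
  have hdef := linkTwo_deform a (∑ j : Fin 3, Finsupp.single j (1 : ZMod 2)) (fun _ e => e)
    (fun s => ![(c s q, c s r), (c s p, c s r), (c s p, c s q)]) (fun _ => continuous_const)
    (fun j => by
      have hc : ∀ v, Continuous fun s => c s v := fun v => by simp only [c]; fun_prop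
      fin_cases j
      exacts [(hc q).prodMk (hc r), (hc p).prodMk (hc r), (hc p).prodMk (hc q)])
    (fun s _ => by rw [show (fun e : R3 × R3 => e) = id from rfl, Finsupp.mapDomain_id]; exact ha)
    (fun s _ => by rw [← triangleBdry_eq_mapDomain]; exact isModTwoCycle_triangleBdry _ _ _)
    (fun s hs e he j _ x hx y hy heq => by
      have h0 : 0 ≤ 1 - s := by linarith [hs.2]
      have h1 : 1 - s ≤ 1 := by linarith [hs.1]
      have hy0 : 0 ≤ 1 - y := by linarith [hy.2]
      fin_cases j
      · refine h e he x hx ((1 - s) * (1 - y)) ((1 - s) * y) (by positivity)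
          (mul_nonneg h0 hy.1) (by nlinarith) ?_
        rw [heq, AffineMap.lineMap_apply_module]
        simp only [c]
        simp
        module
      · refine h e he x hx 0 ((1 - s) * y) le_rfl
          (mul_nonneg h0 hy.1) (by nlinarith [hy.2]) ?_
        rw [heq, AffineMap.lineMap_apply_module]
        simp only [c]
        simp
        module
      · refine h e he x hx ((1 - s) * y) 0
          (mul_nonneg h0 hy.1) le_rfl (by nlinarith [hy.2]) ?_
        rw [heq, AffineMap.lineMap_apply_module]
        simp only [c]
        simp
        module)
  rw [← triangleBdry_eq_mapDomain, ← triangleBdry_eq_mapDomain,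
    show (fun e : R3 × R3 => e) = id from rfl, Finsupp.mapDomain_id] at hdef
  simp only [c, sub_zero, one_smul, add_sub_cancel, sub_self, zero_smul, add_zero] at hdef
  rw [hdef]
  have hd : DisjointChains a (triangleBdry p p p) := by
    intro e he f hf x hx y hy heq
    have hf' : f = (p, p) := by
      rcases mem_support_triangleBdry hf with h | h | h <;> exact h
    refine h e he x hx 0 0 le_rfl le_rfl (by simp) ?_
    rw [heq, hf']
    simp
  obtain ⟨u, -, hu0, hu, -⟩ := exists_regular_direction isOpen_univ Set.univ_nonempty a.support
    _ hd ∅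
  rw [linkTwo_eq ha (isModTwoCycle_triangleBdry _ _ _) ⟨hu0, hu⟩, pairing_apply]
  refine Finset.sum_eq_zero fun e he => Finset.sum_eq_zero fun f hf => ?_
  have hf' : f = (p, p) := by
    rcases mem_support_triangleBdry hf with h | h | h <;> exact h
  have := hu e he f hf
  rw [hf'] at this ⊢
  rw [crossing_degenerate this, mul_zero, mul_zero]

/-- The linking number of a cycle with the boundary of a triangle is the number of intersections
with the triangle. -/
theorem linkTwo_triangleBdry {a : ModTwoChain} (ha : IsModTwoCycle a) {p q r w : R3}
    (hw : det3 (q - p) (r - p) w ≠ 0) (h : ∀ e ∈ a.support, TransverseTriangle e p q r) :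
    linkTwo a (triangleBdry p q r) =
      Finsupp.linearCombination (ZMod 2) (fun e => triangleHit e p q r) a := by
  classical
  have hdisj : ∀ e ∈ a.support, ∀ f ∈ ({(q, r), (p, r), (p, q)} : Finset (R3 × R3)),
      DisjointSegments e f := by
    intro e he f hf x hx y hy heq
    have hy0 : 0 ≤ 1 - y := by linarith [hy.2]
    simp only [Finset.mem_insert, Finset.mem_singleton] at hf
    rcases hf with rfl | rfl | rfl
    · have := (h e he x hx (1 - y) y hy0 hy.1 (by linarith) (by
        rw [heq, AffineMap.lineMap_apply_module]; module)).2.2.2.1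
      linarith
    · exact lt_irrefl _ (h e he x hx 0 y le_rfl hy.1 (by linarith [hy.2]) (by
        rw [heq, AffineMap.lineMap_apply_module]; module)).2.1
    · exact lt_irrefl _ (h e he x hx y 0 hy.1 le_rfl (by linarith [hy.2]) (by
        rw [heq, AffineMap.lineMap_apply_module]; module)).2.2.1
  obtain ⟨u, -, hu0, hu, huT⟩ := exists_regular_direction isOpen_univ Set.univ_nonempty a.support
    _ hdisj {(q - p, r - p)}
  -- The hypothesis on w makes q - p and r - p independent, and u was chosen outside their span.
  have hdet : det3 (q - p) (r - p) u ≠ 0 := by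
    intro h0
    rcases mem_span_pair_of_det3_eq_zero h0 with h0 | ⟨s, t, hst, h0⟩
    · exact huT _ (Finset.mem_singleton_self _) h0
    · rcases hst with hs | ht
      · have := det3_comb_left (q - p) (r - p) w s t 0
        rw [h0, zero_smul, add_zero] at this
        exact mul_ne_zero hs hw (this.symm.trans (by simp [det3_eq]))
      · have := det3_comb_mid (q - p) (r - p) w s t 0
        rw [h0, zero_smul, add_zero] at this
        exact mul_ne_zero ht hw (this.symm.trans (by simp [det3_eq]))
  have hreg : IsRegularFor u a (triangleBdry p q r) := ⟨hu0, fun e he f hf => hu e he f (by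
    simpa using mem_support_triangleBdry hf)⟩
  rw [linkTwo_eq ha (isModTwoCycle_triangleBdry _ _ _) hreg, pairing_eq_left]
  have hchar : ∀ x : ZMod 2, x + x = 0 := by decide
  -- Summed over the cycle, the end-point terms of the prism identity cancel. What remains equates
  -- the crossings over the three sides with the hits of the triangle.
  have h1 := ha (inPrism u p q r)
  have hT : ∀ e, Finsupp.linearCombination (ZMod 2) (crossing u e) (triangleBdry p q r) =
      crossing u e (q, r) + crossing u e (p, r) + crossing u e (p, q) := fun e => by
    simp only [triangleBdry, map_add, Finsupp.linearCombination_single, one_smul]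
  simp only [hT]
  rw [← sub_eq_zero, ← h1]
  simp only [Finsupp.linearCombination_apply, Finsupp.sum, smul_eq_mul]
  rw [← Finset.sum_sub_distrib]
  refine Finset.sum_congr rfl fun e he => ?_
  rw [← crossing_prism hdet (hu e he _ (by simp)) (hu e he _ (by simp)) (hu e he _ (by simp))
    (h e he)]
  linear_combination (-a e) * hchar (triangleHit e p q r)

end LinkingModTwo

/-! ### The meridian of an edge -/

section LocalLinking

theorem linearCombination_congr {ι : Type*} {g g' : ι → ZMod 2} {a : ι →₀ ZMod 2}
    (h : ∀ i ∈ a.support, g i = g' i) :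
    Finsupp.linearCombination (ZMod 2) g a = Finsupp.linearCombination (ZMod 2) g' a := by
  simp only [Finsupp.linearCombination_apply, Finsupp.sum]
  exact Finset.sum_congr rfl fun i hi => by rw [h i hi]

/-- The segment `f` is the segment with midpoint `m` and direction `E`, with either orientation. -/
def IsEdgeAt (m E : R3) (f : R3 × R3) : Prop :=
  f = (m - (1 / 2 : ℝ) • E, m + (1 / 2 : ℝ) • E) ∨ f = (m + (1 / 2 : ℝ) • E, m - (1 / 2 : ℝ) • E)

theorem IsEdgeAt.lineMap_eq {m E : R3} {f : R3 × R3} (h : IsEdgeAt m E f) (x : ℝ) :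
    ∃ ξ : ℝ, (ξ = x - 1 / 2 ∨ ξ = 1 / 2 - x) ∧ AffineMap.lineMap f.1 f.2 x = m + ξ • E := by
  rcases h with rfl | rfl
  · exact ⟨x - 1 / 2, Or.inl rfl, by rw [AffineMap.lineMap_apply_module]; module⟩
  · exact ⟨1 / 2 - x, Or.inr rfl, by rw [AffineMap.lineMap_apply_module]; module⟩

theorem IsEdgeAt.exists_lineMap_eq {m E : R3} {f : R3 × R3} (h : IsEdgeAt m E f) {ξ : ℝ}
    (hξ : |ξ| < 1 / 2) : ∃ x ∈ Set.Ioo (0 : ℝ) 1, AffineMap.lineMap f.1 f.2 x = m + ξ • E := by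
  rw [abs_lt] at hξ
  rcases h with rfl | rfl
  · exact ⟨ξ + 1 / 2, ⟨by linarith, by linarith⟩, by rw [AffineMap.lineMap_apply_module]; module⟩
  · exact ⟨1 / 2 - ξ, ⟨by linarith, by linarith⟩, by rw [AffineMap.lineMap_apply_module]; module⟩

/-- The segment `f` stays at distance at least `δ` from the segment from `m` to `m + ρ`. -/
def IsAwayFrom (m ρ : R3) (δ : ℝ) (f : R3 × R3) : Prop :=
  ∀ z ∈ Set.Icc (0 : ℝ) 1, ∀ x ∈ Set.Icc (0 : ℝ) 1, ∀ w : R3, ‖w‖ < δ →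
    AffineMap.lineMap f.1 f.2 x ≠ m + (z • ρ + w)

set_option maxHeartbeats 1600000 in
/-- A meridian of the edge with midpoint `m` links a cycle as often as the cycle runs through that
edge. -/
theorem linkTwo_meridian {α : ModTwoChain} (hα : IsModTwoCycle α) {m E ρ₁ ρ₂ ν : R3}
    {A c n δ t : ℝ} (hD : det3 E ρ₁ ν ≠ 0) (hρ : ρ₂ = A • E + (-c) • ρ₁ + n • ν) (hc : 0 < c)
    (ht : 0 < t) (htδ : 2 * (t * ‖ν‖) < δ) {χ : R3 × R3 → ZMod 2}
    (h : ∀ f ∈ α.support, (IsEdgeAt m E f ∧ χ f = 1) ∨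
      (IsAwayFrom m ρ₁ δ f ∧ IsAwayFrom m ρ₂ δ f ∧ χ f = 0)) :
    linkTwo α (Finsupp.single (m + t • ν, m + ρ₁) 1 + Finsupp.single (m - t • ν, m + ρ₁) 1 +
      (Finsupp.single (m + t • ν, m + ρ₂) 1 + Finsupp.single (m - t • ν, m + ρ₂) 1)) =
      Finsupp.linearCombination (ZMod 2) χ α := by
  have htν : 0 ≤ t * ‖ν‖ := by positivity
  have hδ : 0 < δ := by linarith
  -- a small scale
  obtain ⟨b, hb0, hb1, hbn, hbA, hbρ⟩ : ∃ b : ℝ, 0 < b ∧ b < 1 ∧ b * |n| < t * (1 + c) / 2 ∧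
      b * |A| < 1 / 2 ∧ b * ‖ρ₂‖ < δ / 2 := by
    have hcont : ∀ (M R : ℝ), 0 < R → ∀ᶠ b in 𝓝[>] (0 : ℝ), b * M < R := by
      intro M R hR
      have : Filter.Tendsto (fun b : ℝ => b * M) (𝓝[>] 0) (𝓝 0) := by
        have h1 : Continuous fun b : ℝ => b * M := by fun_prop
        simpa using (h1.tendsto 0).mono_left nhdsWithin_le_nhds
      exact this.eventually (eventually_lt_nhds hR)
    have h1 : ∀ᶠ b in 𝓝[>] (0 : ℝ), b < 1 :=
      (eventually_lt_nhds one_pos).filter_mono nhdsWithin_le_nhds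
    obtain ⟨b, hb⟩ := (((((hcont |n| (t * (1 + c) / 2) (by positivity)).and
      (hcont |A| (1 / 2) (by norm_num))).and (hcont ‖ρ₂‖ (δ / 2) (by positivity))).and
      h1).and self_mem_nhdsWithin).exists
    exact ⟨b, hb.2, hb.1.2, hb.1.1.1.1, hb.1.1.1.2, hb.1.1.2⟩
  -- With this bound the ν-component n of ρ₂, scaled by b, cannot outweigh the heights of order t in
  -- the triangles below.
  have hbn' := abs_lt.1 (show |b * n| < t * (1 + c) / 2 by rw [abs_mul, abs_of_pos hb0]; exact hbn)
  have hdρ₂ : det3 E ρ₂ ν = -c * det3 E ρ₁ ν := by rw [hρ, det3_comb_mid]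
  -- the triangles
  set G : R3 → R3 := fun ρ => m + (b • ρ - (t / 2) • ν) with hG
  -- The outer vertices of the meridian have been drawn in to scale b and lowered by t/2 along ν, so
  -- that the edge passes through the upper triangle and misses the lower one. The common side of
  -- the two triangles cancels modulo two.
  have hsplit : Finsupp.single (m + t • ν, G ρ₁) (1 : ZMod 2) +
      Finsupp.single (m - t • ν, G ρ₁) 1 +
      (Finsupp.single (m + t • ν, G ρ₂) 1 + Finsupp.single (m - t • ν, G ρ₂) 1) =
      triangleBdry (m + t • ν) (G ρ₁) (G ρ₂) + triangleBdry (m - t • ν) (G ρ₁) (G ρ₂) := by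
    have hchar : Finsupp.single (G ρ₁, G ρ₂) (1 : ZMod 2) + Finsupp.single (G ρ₁, G ρ₂) 1 = 0 := by
      rw [← Finsupp.single_add, show (1 : ZMod 2) + 1 = 0 by decide, Finsupp.single_zero]
    rw [triangleBdry, triangleBdry]
    have := congrArg (fun z => Finsupp.single (m + t • ν, G ρ₁) (1 : ZMod 2) +
      Finsupp.single (m - t • ν, G ρ₁) 1 +
      (Finsupp.single (m + t • ν, G ρ₂) 1 + Finsupp.single (m - t • ν, G ρ₂) 1) + z) hchar
    simp only [add_zero] at this
    rw [← this]
    abel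
  -- the deformation
  let P : ℝ → R3 → R3 := fun s ρ => m + ((1 - s + s * b) • ρ - (s * (t / 2)) • ν)
  have hdef := linkTwo_deform α (∑ j : Fin 4, Finsupp.single j (1 : ZMod 2)) (fun _ e => e)
    (fun s => ![(m + t • ν, P s ρ₁), (m - t • ν, P s ρ₁), (m + t • ν, P s ρ₂), (m - t • ν, P s ρ₂)])
    (fun _ => continuous_const)
    (fun j => by
      have hcP : ∀ v, Continuous fun s => P s v := fun v => by simp only [P]; fun_prop
      fin_cases j
      exacts [continuous_const.prodMk (hcP _), continuous_const.prodMk (hcP _),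
        continuous_const.prodMk (hcP _), continuous_const.prodMk (hcP _)])
    (fun s _ => by rw [show (fun e : R3 × R3 => e) = id from rfl, Finsupp.mapDomain_id]; exact hα)
    (fun s _ g => by
      have hchar : ∀ x : ZMod 2, x + x = 0 := by decide
      simp only [Fin.sum_univ_four, Finsupp.mapDomain_add, Finsupp.mapDomain_single, map_add,
        Finsupp.linearCombination_single, one_smul]
      simp only [Matrix.cons_val_zero, Matrix.cons_val_one, Matrix.cons_val]
      linear_combination hchar (g (m + t • ν)) + hchar (g (m - t • ν)) + hchar (g (P s ρ₁)) +
        hchar (g (P s ρ₂)))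
    (fun s hs f hf j _ x hx y hy heq => by
      have hz0 : 0 < 1 - s + s * b := by nlinarith [hs.1, hs.2]
      have hz1 : 1 - s + s * b ≤ 1 := by nlinarith [hs.1, hs.2]
      have hκ0 : 0 ≤ s * (t / 2) := mul_nonneg hs.1 (by positivity)
      have hκ1 : s * (t / 2) ≤ t := by nlinarith [hs.1, hs.2]
      -- On a side of the moving quadrilateral the coefficient of ρ is y times a positive number. On
      -- the line of the edge this forces y = 0, where the coefficient of ν is t or -t and not zero.
      -- The other segments are kept away by the distance δ.
      have main : ∀ (ρ : R3) (σ : ℝ), (σ = 1 ∨ σ = -1) → det3 E ρ ν ≠ 0 →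
          (IsEdgeAt m E f ∨ IsAwayFrom m ρ δ f) →
          AffineMap.lineMap f.1 f.2 x =
            AffineMap.lineMap (m + (σ * t) • ν) (P s ρ) y → False := by
        intro ρ σ hσ hdρ hf' heq
        have heq' : AffineMap.lineMap f.1 f.2 x = m + ((y * (1 - s + s * b)) • ρ +
            (σ * ((1 - y) * t) - y * (s * (t / 2))) • ν) := by
          rw [heq, AffineMap.lineMap_apply_module]
          simp only [P]
          module
        rcases hf' with hf' | hf'
        · obtain ⟨ξ, -, hξ⟩ := hf'.lineMap_eq x
          rw [hξ] at heq'
          have h1 : ξ • E + (0 : ℝ) • ρ + (0 : ℝ) • ν = (0 : ℝ) • E +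
              (y * (1 - s + s * b)) • ρ + (σ * ((1 - y) * t) - y * (s * (t / 2))) • ν := by
            have := add_left_cancel heq'
            rw [zero_smul, zero_smul, zero_smul, zero_add, add_zero, add_zero]
            exact this
          obtain ⟨-, e2, e3⟩ := frame_ext hdρ h1
          have hy0 : y = 0 := by
            rcases mul_eq_zero.1 e2.symm with h | h
            · exact h
            · linarith
          rw [hy0] at e3
          rcases hσ with rfl | rfl <;> linarith
        · refine hf' _ ⟨mul_nonneg hy.1 hz0.le, mul_le_one₀ hy.2 hz0.le hz1⟩ x hx _ ?_ heq'
          rw [norm_smul, Real.norm_eq_abs]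
          have : |σ * ((1 - y) * t) - y * (s * (t / 2))| ≤ t := by
            have hy1 : 0 ≤ 1 - y := by linarith [hy.2]
            have a1 : 0 ≤ (1 - y) * t := by positivity
            have a2 : 0 ≤ y * (s * (t / 2)) := mul_nonneg hy.1 hκ0
            have a3 : y * (s * (t / 2)) ≤ y * t := mul_le_mul_of_nonneg_left hκ1 hy.1
            rw [abs_le]
            rcases hσ with rfl | rfl
            · constructor <;> nlinarith
            · constructor <;> nlinarith
          have := mul_le_mul_of_nonneg_right this (norm_nonneg ν)
          linarith
      have hf1 : IsEdgeAt m E f ∨ IsAwayFrom m ρ₁ δ f := (h f hf).imp (·.1) (·.1)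
      have hf2 : IsEdgeAt m E f ∨ IsAwayFrom m ρ₂ δ f := (h f hf).imp (·.1) (·.2.1)
      have hd2 : det3 E ρ₂ ν ≠ 0 := by
        rw [hdρ₂]; exact mul_ne_zero (neg_ne_zero.2 hc.ne') hD
      have e1 : m + t • ν = m + ((1 : ℝ) * t) • ν := by rw [one_mul]
      have e2 : m - t • ν = m + ((-1 : ℝ) * t) • ν := by module
      fin_cases j
      · exact main ρ₁ 1 (Or.inl rfl) hD hf1 (by rw [heq, ← e1]; rfl)
      · exact main ρ₁ (-1) (Or.inr rfl) hD hf1 (by rw [heq, ← e2]; rfl)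
      · exact main ρ₂ 1 (Or.inl rfl) hd2 hf2 (by rw [heq, ← e1]; rfl)
      · exact main ρ₂ (-1) (Or.inr rfl) hd2 hf2 (by rw [heq, ← e2]; rfl))
  have hmap : ∀ s, (∑ j : Fin 4, Finsupp.single j (1 : ZMod 2)).mapDomain
      ![(m + t • ν, P s ρ₁), (m - t • ν, P s ρ₁), (m + t • ν, P s ρ₂), (m - t • ν, P s ρ₂)] =
      Finsupp.single (m + t • ν, P s ρ₁) 1 + Finsupp.single (m - t • ν, P s ρ₁) 1 +
      (Finsupp.single (m + t • ν, P s ρ₂) 1 + Finsupp.single (m - t • ν, P s ρ₂) 1) := by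
    intro s
    simp only [Fin.sum_univ_four, Finsupp.mapDomain_add, Finsupp.mapDomain_single]
    simp only [Matrix.cons_val_zero, Matrix.cons_val_one, Matrix.cons_val]
    abel
  have hP0 : ∀ ρ, P 0 ρ = m + ρ := fun ρ => by simp only [P]; module
  have hP1 : ∀ ρ, P 1 ρ = G ρ := fun ρ => by simp only [P, G]; module
  rw [hmap, hmap, show (fun e : R3 × R3 => e) = id from rfl, Finsupp.mapDomain_id, hP0, hP0, hP1,
    hP1, hsplit] at hdef
  rw [hdef]
  -- intersection with the two triangles
  have hbρ' : ∀ {a' : ℝ}, 0 ≤ a' → a' ≤ 1 → ‖(a' * b) • ρ₂‖ < δ / 2 := by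
    intro a' h0 h1
    rw [norm_smul, Real.norm_of_nonneg (by positivity), mul_assoc]
    have : 0 ≤ b * ‖ρ₂‖ := by positivity
    nlinarith
  have hpt : ∀ (σ a a' : ℝ), (m + (σ * t) • ν) + (a • (G ρ₁ - (m + (σ * t) • ν)) +
      a' • (G ρ₂ - (m + (σ * t) • ν))) =
      m + ((a * b) • ρ₁ + ((a' * b) • ρ₂ + (σ * t - (a + a') * (t / 2 + σ * t)) • ν)) := by
    intro σ a a'
    simp only [G]; module
  have hpt' : ∀ (a a' k : ℝ), (a * b) • ρ₁ + ((a' * b) • ρ₂ + k • ν) = (a' * b * A) • E +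
      (b * (a - a' * c)) • ρ₁ + (a' * (b * n) + k) • ν := by
    intro a a' k
    rw [hρ]; module
  have haway : ∀ (σ a a' : ℝ), (σ = 1 ∨ σ = -1) → 0 ≤ a → 0 ≤ a' → a + a' ≤ 1 →
      ∀ f, IsAwayFrom m ρ₁ δ f → ∀ x ∈ Set.Icc (0 : ℝ) 1, AffineMap.lineMap f.1 f.2 x ≠
        (m + (σ * t) • ν) + (a • (G ρ₁ - (m + (σ * t) • ν)) +
      a' • (G ρ₂ - (m + (σ * t) • ν))) := by
    intro σ a a' hσ ha ha' haa f hf x hx heq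
    rw [hpt] at heq
    refine hf (a * b) ⟨by positivity, by nlinarith⟩ x hx _ ?_ heq
    refine (norm_add_le _ _).trans_lt ?_
    have h1 := hbρ' ha' (by linarith)
    have h2 : ‖(σ * t - (a + a') * (t / 2 + σ * t)) • ν‖ ≤ t * ‖ν‖ := by
      rw [norm_smul, Real.norm_eq_abs]
      refine mul_le_mul_of_nonneg_right ?_ (norm_nonneg _)
      have : 0 ≤ (a + a') * t := by positivity
      have : (a + a') * t ≤ t := by nlinarith
      rw [abs_le]
      rcases hσ with rfl | rfl <;> constructor <;> nlinarith
    linarith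
  have hdisj : ∀ (σ : ℝ), (σ = 1 ∨ σ = -1) → ∀ f ∈ α.support, ∀ x ∈ Set.Icc (0 : ℝ) 1,
      ∀ a a' : ℝ, 0 ≤ a → 0 ≤ a' → a + a' ≤ 1 → AffineMap.lineMap f.1 f.2 x =
        (m + (σ * t) • ν) + (a • (G ρ₁ - (m + (σ * t) • ν)) + a' • (G ρ₂ - (m + (σ * t) • ν))) →
      IsEdgeAt m E f ∧ ∃ ξ : ℝ, (ξ = x - 1 / 2 ∨ ξ = 1 / 2 - x) ∧ ξ = a' * b * A ∧ a = a' * c ∧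
        a' * (b * n) + (σ * t - (a + a') * (t / 2 + σ * t)) = 0 := by
    intro σ hσ f hf x hx a a' ha ha' haa heq
    rcases h f hf with ⟨hf', -⟩ | ⟨hf', -, -⟩
    · refine ⟨hf', ?_⟩
      obtain ⟨ξ, hξ, hξ'⟩ := hf'.lineMap_eq x
      rw [hξ', hpt, hpt'] at heq
      have h1 : ξ • E + (0 : ℝ) • ρ₁ + (0 : ℝ) • ν = (a' * b * A) • E + (b * (a - a' * c)) • ρ₁ +
          (a' * (b * n) + (σ * t - (a + a') * (t / 2 + σ * t))) • ν := by
        rw [zero_smul, zero_smul, add_zero, add_zero]; exact add_left_cancel heq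
      obtain ⟨e1, e2, e3⟩ := frame_ext hD h1
      refine ⟨ξ, hξ, e1, ?_, e3.symm⟩
      have := (mul_eq_zero.1 e2.symm).resolve_left hb0.ne'
      linarith
    · exact absurd heq (haway σ a a' hσ ha ha' haa f hf' x hx)
  -- In the lower triangle the height above the line of the edge is a'bn - t + (a + a')t/2 with a =
  -- a'c, which is negative.
  have hnegσ : ∀ {a' : ℝ}, 0 ≤ a' → a' * c + a' ≤ 1 →
      a' * (b * n) + (-1 * t - (a' * c + a') * (t / 2 + -1 * t)) = 0 → False := by
    intro a' ha' haa h2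
    have h5 : a' * (b * n) ≤ a' * (t * (1 + c) / 2) := mul_le_mul_of_nonneg_left hbn'.2.le ha'
    have h6 : (a' * c + a') * t ≤ 1 * t := mul_le_mul_of_nonneg_right haa ht.le
    rcases ha'.eq_or_lt with rfl | ha0
    · linarith
    · have h7 : a' * (b * n) < a' * (t * (1 + c) / 2) := mul_lt_mul_of_pos_left hbn'.2 ha0
      linarith
  have hneg : linkTwo α (triangleBdry (m - t • ν) (G ρ₁) (G ρ₂)) = 0 := by
    refine linkTwo_triangleBdry_eq_zero hα fun f hf x hx a a' ha ha' haa heq => ?_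
    rw [show m - t • ν = m + ((-1 : ℝ) * t) • ν by module] at heq
    obtain ⟨-, ξ, -, -, rfl, h2⟩ := hdisj (-1) (Or.inr rfl) f hf x hx a a' ha ha' haa heq
    exact hnegσ ha' haa h2
  -- In the upper triangle this equation has exactly one solution a', and `hrange` places it in the
  -- interior of the triangle.
  have hden : ∀ {a' : ℝ}, a' * (b * n) + ((1 : ℝ) * t - (a' * c + a') * (t / 2 + (1 : ℝ) * t)) = 0 →
      a' * (3 / 2 * t * (1 + c) - b * n) = t := fun h2 => by linear_combination -h2
  have hrange : ∀ {a' : ℝ}, a' * (3 / 2 * t * (1 + c) - b * n) = t →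
      0 < a' ∧ a' * c + a' < 1 := by
    intro a' h3
    have hpos : 0 < t * (1 + c) := by positivity
    have hbr : t * (1 + c) < 3 / 2 * t * (1 + c) - b * n := by nlinarith [hbn'.2]
    have ha' : 0 < a' := by
      by_contra hna
      nlinarith
    refine ⟨ha', ?_⟩
    have : a' * (t * (1 + c)) < t := (mul_lt_mul_of_pos_left hbr ha').trans_eq h3
    have h4 : (a' * c + a') * t < 1 * t := by linarith
    exact lt_of_mul_lt_mul_right h4 ht.le
  have hpos : linkTwo α (triangleBdry (m + t • ν) (G ρ₁) (G ρ₂)) =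
      Finsupp.linearCombination (ZMod 2) χ α := by
    have e1 : m + t • ν = m + ((1 : ℝ) * t) • ν := by rw [one_mul]
    rw [e1]
    have hv1 : G ρ₁ - (m + ((1 : ℝ) * t) • ν) = (0 : ℝ) • E + b • ρ₁ + (-(3 / 2 * t)) • ν := by
      simp only [G]; module
    have hv2 : G ρ₂ - (m + ((1 : ℝ) * t) • ν) =
        (b * A) • E + (-(b * c)) • ρ₁ + (b * n - 3 / 2 * t) • ν := by
      simp only [G]; rw [hρ]; module
    have hdet : ∀ k : ℝ, det3 (G ρ₁ - (m + ((1 : ℝ) * t) • ν)) (G ρ₂ - (m + ((1 : ℝ) * t) • ν))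
        (k • E) = k * (b * (b * n - 3 / 2 * t * (1 + c)) * det3 E ρ₁ ν) := by
      intro k
      rw [hv1, hv2]
      simp [det3_eq]; ring
    have hdet0 : b * (b * n - 3 / 2 * t * (1 + c)) * det3 E ρ₁ ν ≠ 0 := by
      refine mul_ne_zero (mul_ne_zero hb0.ne' ?_) hD
      have : 0 < t * (1 + c) := by positivity
      nlinarith [hbn'.2]
    -- The parameter along the edge runs from -1/2 to 1/2, so the choice b|A| < 1/2 places the
    -- intersection inside the edge.
    have hξA : ∀ {a' : ℝ}, 0 < a' → a' * c + a' < 1 → |a' * b * A| < 1 / 2 := by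
      intro a' h0 h1
      have ha1 : a' ≤ 1 := by linarith [mul_pos h0 hc]
      rw [mul_assoc, abs_mul, abs_mul, abs_of_pos h0, abs_of_pos hb0]
      exact (mul_le_of_le_one_left (by positivity) ha1).trans_lt hbA
    rw [linkTwo_triangleBdry hα (w := (1 : ℝ) • E) (by rw [hdet, one_mul]; exact hdet0)]
    · refine linearCombination_congr fun f hf => ?_
      rcases h f hf with ⟨hf', hχ⟩ | ⟨hf', -, hχ⟩
      · rw [hχ, triangleHit, if_pos]
        set a' := t / (3 / 2 * t * (1 + c) - b * n) with ha'
        have hne : 3 / 2 * t * (1 + c) - b * n ≠ 0 := by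
          have : 0 < t * (1 + c) := by positivity
          nlinarith [hbn'.2]
        have h3 : a' * (3 / 2 * t * (1 + c) - b * n) = t := div_mul_cancel₀ _ hne
        obtain ⟨h0, h1⟩ := hrange h3
        obtain ⟨x, hx, hxe⟩ := hf'.exists_lineMap_eq (hξA h0 h1)
        refine ⟨x, hx, a' * c, a', by positivity, h0, h1, ?_⟩
        rw [hxe, hpt, hpt', show b * (a' * c - a' * c) = 0 by ring,
          show a' * (b * n) + ((1 : ℝ) * t - (a' * c + a') * (t / 2 + 1 * t)) = 0 by
            linear_combination -h3]
        module
      · rw [hχ, triangleHit, if_neg]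
        rintro ⟨x, hx, a, a', ha, ha', haa, heq⟩
        exact haway 1 a a' (Or.inl rfl) ha.le ha'.le haa.le f hf' x ⟨hx.1.le, hx.2.le⟩ heq
    · intro f hf x hx a a' ha ha' haa heq
      obtain ⟨hf', ξ, hξ, hξ', rfl, h2⟩ := hdisj 1 (Or.inl rfl) f hf x hx a a' ha ha' haa heq
      obtain ⟨h0, h1⟩ := hrange (hden h2)
      have h4 := abs_lt.1 (hξA h0 h1)
      refine ⟨?_, by positivity, h0, h1, ?_⟩
      · rw [← hξ'] at h4
        rcases hξ with hξ | hξ <;> rw [hξ] at h4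
        · exact ⟨by linarith [h4.1], by linarith [h4.2]⟩
        · exact ⟨by linarith [h4.2], by linarith [h4.1]⟩
      · have : ∃ k : ℝ, k ≠ 0 ∧ f.2 - f.1 = k • E := by
          rcases hf' with rfl | rfl
          · exact ⟨1, one_ne_zero, by module⟩
          · exact ⟨-1, by norm_num, by module⟩
        obtain ⟨k, hk, hke⟩ := this
        rw [hke, hdet]
        exact mul_ne_zero hk hdet0
  -- Additivity of the linking number requires α to miss the boundaries of both triangles. It does,
  -- because every intersection with a triangle is interior.
  have hds : ∀ (σ : ℝ), (σ = 1 ∨ σ = -1) →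
      DisjointChains α (triangleBdry (m + (σ * t) • ν) (G ρ₁) (G ρ₂)) := by
    intro σ hσ f hf k hk x hx y hy heq
    have hin : ∀ a a' : ℝ, 0 ≤ a → 0 ≤ a' → a + a' ≤ 1 → AffineMap.lineMap f.1 f.2 x =
        (m + (σ * t) • ν) + (a • (G ρ₁ - (m + (σ * t) • ν)) + a' • (G ρ₂ - (m + (σ * t) • ν))) →
        0 < a ∧ 0 < a' ∧ a + a' < 1 := by
      intro a a' ha ha' haa heq
      obtain ⟨-, ξ, -, -, rfl, h2⟩ := hdisj σ hσ f hf x hx a a' ha ha' haa heq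
      rcases hσ with rfl | rfl
      · obtain ⟨h0, h1⟩ := hrange (hden h2)
        exact ⟨by positivity, h0, h1⟩
      · exact (hnegσ ha' haa h2).elim
    rcases mem_support_triangleBdry hk with rfl | rfl | rfl
    · have := hin (1 - y) y (by linarith [hy.2]) hy.1 (by linarith)
        (by rw [heq, AffineMap.lineMap_apply_module]; module)
      linarith
    · have := hin 0 y le_rfl hy.1 (by linarith [hy.2])
        (by rw [heq, AffineMap.lineMap_apply_module]; module)
      linarith
    · have := hin y 0 hy.1 le_rfl (by linarith [hy.2])
        (by rw [heq, AffineMap.lineMap_apply_module]; module)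
      linarith
  rw [linkTwo_add_right hα (isModTwoCycle_triangleBdry _ _ _) (isModTwoCycle_triangleBdry _ _ _)
    (by simpa using hds 1 (Or.inl rfl))
    (by rw [show m - t • ν = m + ((-1 : ℝ) * t) • ν by module]; exact hds (-1) (Or.inr rfl)),
    hpos, hneg, add_zero]

end LocalLinking

/-! ### The bicollar and push-offs -/

section Collar

/-- The barycentric coordinates of the points of the simplex with vertex set `f`. -/
def weights (f : Finset R3) : Set (R3 →₀ ℝ) :=
  {w | w.support ⊆ f ∧ (∀ v, 0 ≤ w v) ∧ w.sum (fun _ a => a) = 1}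

theorem pushPoint_eq (ν : R3 → R3) (t : ℝ) (w : R3 →₀ ℝ) :
    pushPoint ν t w = Finsupp.linearCombination ℝ (fun v => v + t • ν v) w := rfl

theorem convex_weights (f : Finset R3) : Convex ℝ (weights f) := by
  rintro w ⟨h1, h2, h3⟩ w' ⟨h1', h2', h3'⟩ a b ha hb hab
  refine ⟨fun v hv => ?_, fun v => ?_, ?_⟩
  · by_contra hf
    have e1 : w v = 0 := Finsupp.notMem_support_iff.1 fun h => hf (h1 h)
    have e2 : w' v = 0 := Finsupp.notMem_support_iff.1 fun h => hf (h1' h)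
    rw [Finsupp.mem_support_iff] at hv
    apply hv
    simp [e1, e2]
  · exact add_nonneg (mul_nonneg ha (h2 v)) (mul_nonneg hb (h2' v))
  · have key : ∀ u : R3 →₀ ℝ, u.sum (fun _ a => a) =
        Finsupp.linearCombination ℝ (fun _ => (1 : ℝ)) u := fun u => by
      simp [Finsupp.linearCombination_apply]
    rw [key] at *
    rw [map_add, map_smul, map_smul, h3, h3', smul_eq_mul, smul_eq_mul, mul_one, mul_one, hab]

theorem single_mem_weights {f : Finset R3} {p : R3} (hp : p ∈ f) :
    Finsupp.single p (1 : ℝ) ∈ weights f := by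
  classical
  refine ⟨fun v hv => ?_, fun v => ?_, by simp⟩
  · rw [Finsupp.mem_support_iff, Finsupp.single_apply] at hv
    by_cases h : p = v
    · rwa [← h]
    · simp [h] at hv
  · rw [Finsupp.single_apply]; split_ifs <;> norm_num

theorem comb_mem_weights {f : Finset R3} {w₀ w₁ w₂ : R3 →₀ ℝ} (h₀ : w₀ ∈ weights f)
    (h₁ : w₁ ∈ weights f) (h₂ : w₂ ∈ weights f) {a b c : ℝ} (ha : 0 ≤ a) (hb : 0 ≤ b) (hc : 0 ≤ c)
    (h : a + b + c = 1) : a • w₀ + b • w₁ + c • w₂ ∈ weights f := by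
  have := (convex_weights f).sum_mem (t := Finset.univ) (w := ![a, b, c])
    (z := ![w₀, w₁, w₂]) (fun i _ => by fin_cases i <;> simpa)
    (by simpa [Fin.sum_univ_three] using h) (fun i _ => by fin_cases i <;> simpa)
  simpa [Fin.sum_univ_three] using this

theorem weights_mono {f f' : Finset R3} (h : f ⊆ f') : weights f ⊆ weights f' :=
  fun _ hw => ⟨hw.1.trans h, hw.2⟩

theorem lineMap_mem_weights {f : Finset R3} {w w' : R3 →₀ ℝ} (hw : w ∈ weights f)
    (hw' : w' ∈ weights f) {x : ℝ} (hx : x ∈ Set.Icc (0 : ℝ) 1) :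
    AffineMap.lineMap w w' x ∈ weights f := by
  rw [AffineMap.lineMap_apply_module]
  exact convex_weights f hw hw' (by linarith [hx.2]) hx.1 (by ring)

theorem lineMap_pushPoint (ν : R3 → R3) (t : ℝ) (w w' : R3 →₀ ℝ) (x : ℝ) :
    AffineMap.lineMap (pushPoint ν t w) (pushPoint ν t w') x =
      pushPoint ν t (AffineMap.lineMap w w' x) := by
  simp only [pushPoint_eq, AffineMap.lineMap_apply_module, map_add, map_smul]

theorem pushPoint_single (ν : R3 → R3) (t : ℝ) (p : R3) :
    pushPoint ν t (Finsupp.single p 1) = p + t • ν p := by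
  simp [pushPoint_eq]

variable {K : PolygonalKnot} (S : SeifertSurface K)

theorem isPoint_of_mem_weights {X : Geometry.SimplicialComplex ℝ R3} {f : Finset R3}
    (hf : f ∈ X.faces) {w : R3 →₀ ℝ} (hw : w ∈ weights f) : IsPoint X w := by
  refine ⟨X.down_closed hf hw.1 ?_, hw.2⟩
  rw [Finset.nonempty_iff_ne_empty]
  intro h
  have := hw.2.2
  rw [Finsupp.sum, h] at this
  simp at this

/-- `ε` is the width of a bicollar of the surface. -/
def IsCollarWidth (ε : ℝ) : Prop :=
  ∀ f ∈ S.complex.faces, ∀ f' ∈ S.complex.faces, ∀ w ∈ weights f, ∀ w' ∈ weights f',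
    ∀ s ∈ Set.Icc (-ε) ε, ∀ t ∈ Set.Icc (-ε) ε,
      pushPoint S.normal s w = pushPoint S.normal t w' → w = w' ∧ s = t

theorem exists_isCollarWidth : ∃ ε > 0, IsCollarWidth S ε := by
  obtain ⟨ε, hε, h⟩ := S.collar
  exact ⟨ε, hε, fun f hf f' hf' w hw w' hw' => h w w' (isPoint_of_mem_weights hf hw)
    (isPoint_of_mem_weights hf' hw')⟩

/-- The pair of vertices lies on a common simplex of the surface. -/
def IsSimplicialEdge (e : R3 × R3) : Prop := ∃ f ∈ S.complex.faces, e.1 ∈ f ∧ e.2 ∈ f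

/-- The edges of the chain lie on the surface. -/
def IsSimplicialChain (c : ModTwoChain) : Prop := ∀ e ∈ c.support, IsSimplicialEdge S e

/-- The push-off of a pair of vertices. -/
noncomputable def pushEdge (t : ℝ) (e : R3 × R3) : R3 × R3 :=
  (e.1 + t • S.normal e.1, e.2 + t • S.normal e.2)

/-- The push-off of a chain modulo two. -/
noncomputable def pushTwo (t : ℝ) (c : ModTwoChain) : ModTwoChain := c.mapDomain (pushEdge S t)

/-- The push-off is linear in barycentric coordinates, so a pushed segment consists of pushed points
of the surface. In this form the injectivity of the collar applies to it. -/
theorem lineMap_pushEdge (t : ℝ) (e : R3 × R3) (x : ℝ) :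
    AffineMap.lineMap (pushEdge S t e).1 (pushEdge S t e).2 x = pushPoint S.normal t
      (AffineMap.lineMap (Finsupp.single e.1 1) (Finsupp.single e.2 1) x) := by
  rw [← lineMap_pushPoint, pushPoint_single, pushPoint_single]
  rfl

theorem pushEdge_zero (e : R3 × R3) : pushEdge S 0 e = e := by simp [pushEdge]

theorem pushTwo_zero (c : ModTwoChain) : pushTwo S 0 c = c := by
  have : pushEdge S 0 = id := funext (pushEdge_zero S)
  rw [pushTwo, this, Finsupp.mapDomain_id]

theorem lineMap_edge (e : R3 × R3) (x : ℝ) :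
    AffineMap.lineMap e.1 e.2 x = pushPoint S.normal 0
      (AffineMap.lineMap (Finsupp.single e.1 1) (Finsupp.single e.2 1) x) := by
  rw [← lineMap_pushEdge, pushEdge_zero]

theorem IsModTwoCycle.pushTwo {c : ModTwoChain} (hc : IsModTwoCycle c) (t : ℝ) :
    IsModTwoCycle (pushTwo S t c) := fun g => by
  rw [KnotWitt.pushTwo, Finsupp.linearCombination_mapDomain]
  exact hc fun p => g (p + t • S.normal p)

variable {S} {ε : ℝ}

theorem IsSimplicialChain.add {c c' : ModTwoChain} (h : IsSimplicialChain S c)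
    (h' : IsSimplicialChain S c') : IsSimplicialChain S (c + c') := by
  classical
  exact fun e he => (Finset.mem_union.1 (Finsupp.support_add he)).elim (h e) (h' e)

theorem IsSimplicialChain.sum {α : Type*} {s : Finset α} {c : α → ModTwoChain}
    (h : ∀ i ∈ s, IsSimplicialChain S (c i)) : IsSimplicialChain S (∑ i ∈ s, c i) := by
  classical
  intro e he
  obtain ⟨i, hi, hi'⟩ := Finset.mem_biUnion.1 (Finsupp.support_finsetSum he)
  exact h i hi e hi'

theorem IsSimplicialChain.smul {c : ModTwoChain} (h : IsSimplicialChain S c) (x : ZMod 2) :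
    IsSimplicialChain S (x • c) := fun e he => h e (Finsupp.support_smul he)

/-- By injectivity of the collar, points at different heights never coincide. -/
theorem disjointSegments_pushEdge (hε : IsCollarWidth S ε) {e e' : R3 × R3}
    (he : IsSimplicialEdge S e) (he' : IsSimplicialEdge S e') {s t : ℝ} (hs : s ∈ Set.Icc (-ε) ε)
    (ht : t ∈ Set.Icc (-ε) ε) (hst : s ≠ t) :
    DisjointSegments (pushEdge S s e) (pushEdge S t e') := by
  intro x hx y hy h
  obtain ⟨f, hf, hp, hq⟩ := he
  obtain ⟨f', hf', hp', hq'⟩ := he'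
  rw [lineMap_pushEdge, lineMap_pushEdge] at h
  exact hst (hε f hf f' hf' _ (lineMap_mem_weights (single_mem_weights hp) (single_mem_weights hq) hx)
    _ (lineMap_mem_weights (single_mem_weights hp') (single_mem_weights hq') hy) s hs t ht h).2

theorem disjointChains_pushTwo (hε : IsCollarWidth S ε) {c c' : ModTwoChain}
    (hc : IsSimplicialChain S c) (hc' : IsSimplicialChain S c') {s t : ℝ} (hs : s ∈ Set.Icc (-ε) ε)
    (ht : t ∈ Set.Icc (-ε) ε) (hst : s ≠ t) : DisjointChains (pushTwo S s c) (pushTwo S t c') := by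
  intro e he f hf
  obtain ⟨e, he', rfl⟩ := mem_support_mapDomain he
  obtain ⟨f, hf', rfl⟩ := mem_support_mapDomain hf
  exact disjointSegments_pushEdge hε (hc e he') (hc' f hf') hs ht hst

/-- Linking with a push-off to one side is linking of the push-off to the other side. -/
theorem linkTwo_pushTwo_neg (hε : IsCollarWidth S ε) {c c' : ModTwoChain} (hc : IsModTwoCycle c)
    (hc' : IsModTwoCycle c') (hcS : IsSimplicialChain S c) (hcS' : IsSimplicialChain S c') {t : ℝ}
    (ht : 0 < t) (htε : t ≤ ε) :
    linkTwo c (pushTwo S t c') = linkTwo c' (pushTwo S (-t) c) := by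
  -- Both cycles sink together through the collar, from heights 0 and t to heights -t and 0; the
  -- difference of the heights is always t.
  have key := linkTwo_deform c c' (fun s => pushEdge S (-(s * t))) (fun s => pushEdge S ((1 - s) * t))
    (fun e => by simp only [pushEdge]; fun_prop) (fun e => by simp only [pushEdge]; fun_prop)
    (fun s _ => hc.pushTwo S _) (fun s _ => hc'.pushTwo S _)
    (fun s hs e he f hf => disjointSegments_pushEdge hε (hcS e he) (hcS' f hf)
      ⟨by nlinarith [hs.1, hs.2], by nlinarith [hs.1, hs.2]⟩
      ⟨by nlinarith [hs.1, hs.2], by nlinarith [hs.1, hs.2]⟩ (by intro h; nlinarith))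
  change linkTwo (pushTwo S _ c) (pushTwo S _ c') =
    linkTwo (pushTwo S _ c) (pushTwo S _ c') at key
  rw [zero_mul, neg_zero, sub_zero, one_mul, sub_self, zero_mul, pushTwo_zero,
    pushTwo_zero] at key
  rw [key, linkTwo_comm (hc.pushTwo S _) hc']
  rw [← pushTwo_zero S c']
  have hε0 : 0 ≤ ε := by linarith
  exact disjointChains_pushTwo hε hcS hcS' ⟨by linarith, by linarith⟩ ⟨by linarith, by linarith⟩
    (by linarith)

/-- A pushed triangle in a simplex of the surface does not meet the surface. -/
theorem pushed_triangle_disjoint (hε : IsCollarWidth S ε) {c : ModTwoChain}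
    (hcS : IsSimplicialChain S c) {t : ℝ} (ht : t ∈ Set.Icc (-ε) ε) (ht0 : t ≠ 0) {f : Finset R3}
    (hf : f ∈ S.complex.faces) {w₀ w₁ w₂ : R3 →₀ ℝ} (h₀ : w₀ ∈ weights f) (h₁ : w₁ ∈ weights f)
    (h₂ : w₂ ∈ weights f) {e : R3 × R3} (he : e ∈ c.support) {x : ℝ} (hx : x ∈ Set.Icc (0 : ℝ) 1)
    {a b : ℝ} (ha : 0 ≤ a) (hb : 0 ≤ b) (hab : a + b ≤ 1) :
    AffineMap.lineMap e.1 e.2 x ≠ pushPoint S.normal t w₀ +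
      (a • (pushPoint S.normal t w₁ - pushPoint S.normal t w₀) +
        b • (pushPoint S.normal t w₂ - pushPoint S.normal t w₀)) := by
  intro h
  obtain ⟨f', hf', hp', hq'⟩ := hcS e he
  have hw : (1 - a - b) • w₀ + a • w₁ + b • w₂ ∈ weights f :=
    comb_mem_weights h₀ h₁ h₂ (by linarith) ha hb (by ring)
  have h' : pushPoint S.normal 0 (AffineMap.lineMap (Finsupp.single e.1 1)
      (Finsupp.single e.2 1) x) = pushPoint S.normal t ((1 - a - b) • w₀ + a • w₁ + b • w₂) := by
    rw [← lineMap_edge, h]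
    simp only [pushPoint_eq, map_add, map_smul]
    module
  have hε0 : 0 ≤ ε := by linarith [ht.1, ht.2]
  exact ht0 (hε f' hf' f hf _ (lineMap_mem_weights (single_mem_weights hp')
    (single_mem_weights hq') hx) _ hw 0 ⟨by linarith, hε0⟩ t ht h').2.symm

theorem linkTwo_pushed_triangle (hε : IsCollarWidth S ε) {c : ModTwoChain} (hc : IsModTwoCycle c)
    (hcS : IsSimplicialChain S c) {t : ℝ} (ht : t ∈ Set.Icc (-ε) ε) (ht0 : t ≠ 0) {f : Finset R3}
    (hf : f ∈ S.complex.faces) {w₀ w₁ w₂ : R3 →₀ ℝ} (h₀ : w₀ ∈ weights f) (h₁ : w₁ ∈ weights f)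
    (h₂ : w₂ ∈ weights f) :
    linkTwo c (triangleBdry (pushPoint S.normal t w₀) (pushPoint S.normal t w₁)
      (pushPoint S.normal t w₂)) = 0 :=
  linkTwo_triangleBdry_eq_zero hc fun _ he _ hx _ _ ha hb hab =>
    pushed_triangle_disjoint hε hcS ht ht0 hf h₀ h₁ h₂ he hx ha hb hab

theorem disjointChains_pushed_triangle (hε : IsCollarWidth S ε) {c : ModTwoChain}
    (hcS : IsSimplicialChain S c) {t : ℝ} (ht : t ∈ Set.Icc (-ε) ε) (ht0 : t ≠ 0) {f : Finset R3}
    (hf : f ∈ S.complex.faces) {w₀ w₁ w₂ : R3 →₀ ℝ} (h₀ : w₀ ∈ weights f) (h₁ : w₁ ∈ weights f)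
    (h₂ : w₂ ∈ weights f) :
    DisjointChains c (triangleBdry (pushPoint S.normal t w₀) (pushPoint S.normal t w₁)
      (pushPoint S.normal t w₂)) := by
  intro e he k hk x hx y hy heq
  have key := fun a b ha hb hab =>
    pushed_triangle_disjoint hε hcS ht ht0 hf h₀ h₁ h₂ he hx (a := a) (b := b) ha hb hab
  rcases mem_support_triangleBdry hk with rfl | rfl | rfl
  · exact key (1 - y) y (by linarith [hy.2]) hy.1 (by linarith)
      (by rw [heq, AffineMap.lineMap_apply_module]; module)
  · exact key 0 y le_rfl hy.1 (by linarith [hy.2])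
      (by rw [heq, AffineMap.lineMap_apply_module]; module)
  · exact key y 0 hy.1 le_rfl (by linarith [hy.2])
      (by rw [heq, AffineMap.lineMap_apply_module]; module)

end Collar

/-! ### Barycenters and the geometry at an edge -/

section FlagGeometry

/-- The barycenter of a simplex, in barycentric coordinates. -/
noncomputable def bary (s : Finset R3) : R3 →₀ ℝ := ∑ v ∈ s, Finsupp.single v (s.card : ℝ)⁻¹

open scoped Classical in
theorem bary_apply (s : Finset R3) (v : R3) : bary s v = if v ∈ s then (s.card : ℝ)⁻¹ else 0 := by
  simp [bary, Finsupp.finsetSum_apply, Finsupp.single_apply]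

theorem bary_mem_weights {s : Finset R3} (hs : s.Nonempty) : bary s ∈ weights s := by
  classical
  have hsub : (bary s).support ⊆ s := fun v hv => by
    by_contra h
    rw [Finsupp.mem_support_iff, bary_apply, if_neg h] at hv
    exact hv rfl
  refine ⟨hsub, fun v => ?_, ?_⟩
  · rw [bary_apply]; split_ifs <;> positivity
  · rw [Finsupp.sum_of_support_subset _ hsub _ (by simp)]
    rw [Finset.sum_congr rfl fun v hv => (by rw [bary_apply, if_pos hv] :
      bary s v = (s.card : ℝ)⁻¹)]
    have : (s.card : ℝ) ≠ 0 := by exact_mod_cast hs.card_ne_zero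
    simp [this]

variable {K : PolygonalKnot} (S : SeifertSurface K)

/-- The pushed barycenter of a simplex. -/
noncomputable def center (t : ℝ) (s : Finset R3) : R3 := pushPoint S.normal t (bary s)

/-- The normal vector at the barycenter of a simplex. -/
noncomputable def centerNormal (s : Finset R3) : R3 :=
  Finsupp.linearCombination ℝ S.normal (bary s)

theorem center_eq (t : ℝ) (s : Finset R3) : center S t s = center S 0 s + t • centerNormal S s := by
  simp only [center, centerNormal, pushPoint_eq, Finsupp.linearCombination_apply, Finsupp.sum,
    Finset.smul_sum, ← Finset.sum_add_distrib]
  exact Finset.sum_congr rfl fun v _ => by module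

theorem linearCombination_bary_pair (g : R3 → R3) {p q : R3} (h : p ≠ q) [DecidableEq R3] :
    Finsupp.linearCombination ℝ g (bary {p, q}) = (1 / 2 : ℝ) • (g p + g q) := by
  rw [bary, Finset.card_pair h, Finset.sum_pair h, map_add, Finsupp.linearCombination_single,
    Finsupp.linearCombination_single]
  norm_num

theorem linearCombination_bary_triple (g : R3 → R3) {p q r : R3} (hpq : p ≠ q) (hpr : p ≠ r)
    (hqr : q ≠ r) [DecidableEq R3] :
    Finsupp.linearCombination ℝ g (bary {p, q, r}) = (1 / 3 : ℝ) • (g p + g q + g r) := by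
  rw [bary, Finset.card_eq_three.2 ⟨p, q, r, hpq, hpr, hqr, rfl⟩,
    Finset.sum_insert (by simp [hpq, hpr]), Finset.sum_pair hqr, map_add, map_add,
    Finsupp.linearCombination_single, Finsupp.linearCombination_single,
    Finsupp.linearCombination_single]
  norm_num
  module

variable {S}

/-- An edge of a triangle of the surface, with the orientation determined by the normal field. -/
theorem exists_flag_frame [DecidableEq R3] {e t : Finset R3} (he : e ∈ edges S.complex)
    (ht : t ∈ triangles S.complex) (het : e ⊆ t) : ∃ p q r : R3, p ≠ q ∧ p ≠ r ∧ q ≠ r ∧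
      e = {p, q} ∧ t = {p, q, r} ∧ ∀ x ∈ t, 0 < det3 (q - p) (r - p) (S.normal x) := by
  obtain ⟨p, q, r, hset, hdet⟩ := S.transverse t ht
  have htf : t = {p, q, r} := by
    apply Finset.coe_injective; rw [hset]; simp
  have hcard := ht.2
  have hpq : p ≠ q := by
    rintro rfl
    rw [htf] at hcard
    have := Finset.card_le_two (a := p) (b := r)
    simp at hcard; omega
  have hpr : p ≠ r := by
    rintro rfl
    rw [htf] at hcard
    have := Finset.card_le_two (a := q) (b := p)
    rw [Finset.insert_eq_of_mem (by simp)] at hcard; omega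
  have hqr : q ≠ r := by
    rintro rfl
    rw [htf] at hcard
    have := Finset.card_le_two (a := p) (b := q)
    simp at hcard; omega
  obtain ⟨x, hx, hxe⟩ : ∃ x ∈ t, x ∉ e := by
    by_contra! h
    have := Finset.card_le_card (show t ⊆ e from h)
    rw [hcard, he.2] at this; omega
  have hee : e = t.erase x := by
    apply Finset.eq_of_subset_of_card_le
    · intro y hy
      exact Finset.mem_erase.2 ⟨fun h => hxe (h ▸ hy), het hy⟩
    · rw [Finset.card_erase_of_mem hx, hcard, he.2]
  rw [htf] at hx
  simp only [Finset.mem_insert, Finset.mem_singleton] at hx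
  -- A cyclic rotation of the vertices preserves the orientation, so the vertex opposite to e can be
  -- put last.
  have hcyc : ∀ a b c w : R3, det3 (c - b) (a - b) w = det3 (b - a) (c - a) w := by
    intro a b c w
    simp [det3_eq]; ring
  rcases hx with rfl | rfl | rfl
  · refine ⟨q, r, x, hqr, hpq.symm, hpr.symm, ?_, ?_, fun y hy => ?_⟩
    · rw [hee, htf]; ext y; simp only [Finset.mem_erase, Finset.mem_insert, Finset.mem_singleton]
      constructor
      · tauto
      · rintro (rfl | rfl) <;> simp [hpq.symm, hpr.symm]
    · rw [htf]; ext y; simp only [Finset.mem_insert, Finset.mem_singleton]; tauto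
    · rw [hcyc]; exact hdet y hy
  · refine ⟨r, p, x, hpr.symm, hqr.symm, hpq, ?_, ?_, fun y hy => ?_⟩
    · rw [hee, htf]; ext y; simp only [Finset.mem_erase, Finset.mem_insert, Finset.mem_singleton]
      constructor
      · tauto
      · rintro (rfl | rfl) <;> simp [hpq, hqr.symm]
    · rw [htf]; ext y; simp only [Finset.mem_insert, Finset.mem_singleton]; tauto
    · rw [hcyc, hcyc]; exact hdet y hy
  · refine ⟨p, q, x, hpq, hpr, hqr, ?_, htf, hdet⟩
    rw [hee, htf]; ext y; simp only [Finset.mem_erase, Finset.mem_insert, Finset.mem_singleton]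
    constructor
    · tauto
    · rintro (rfl | rfl) <;> simp [hpr, hqr]

theorem det3_add_right (a b c c' : R3) : det3 a b (c + c') = det3 a b c + det3 a b c' := by
  simp [det3_eq]; ring

theorem det3_smul_right (a b c : R3) (x : ℝ) : det3 a b (x • c) = x * det3 a b c := by
  simp [det3_eq]; ring

/-- Two triangles with a common edge lie on different sides of it. -/
theorem not_same_side [DecidableEq R3] {ε : ℝ} (hε : IsCollarWidth S ε) (hε0 : 0 < ε)
    {p q r₁ r₂ : R3} (h₁ : {p, q, r₁} ∈ S.complex.faces) (h₂ : {p, q, r₂} ∈ S.complex.faces)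
    (hp : r₁ ≠ p) (hq : r₁ ≠ q) (hr : r₁ ≠ r₂)
    (hD₁ : 0 < det3 (q - p) (r₁ - p) (S.normal p + S.normal q))
    (hD₂ : 0 < det3 (q - p) (r₂ - p) (S.normal p + S.normal q)) : False := by
  -- Suppose both triangles lie on the same side of the edge. Then a point of the first triangle
  -- near the midpoint m can be moved along its normal into the second triangle, against the
  -- injectivity of the collar.
  set m : R3 := (1 / 2 : ℝ) • (p + q) with hm
  set ν : R3 := (1 / 2 : ℝ) • (S.normal p + S.normal q) with hν
  set N : ℝ → R3 := fun δ => ν + δ • (S.normal r₁ - ν) with hN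
  have hNc : Continuous N := by simp only [hN]; fun_prop
  have hd : ∀ r : R3, det3 (q - p) (r - m) ν = 1 / 2 * det3 (q - p) (r - p)
      (S.normal p + S.normal q) := by
    intro r
    rw [hν, det3_smul_right, hm]
    simp [det3_eq]; ring
  have hN0 : N 0 = ν := by simp [hN]
  have hd1 : 0 < det3 (q - p) (r₁ - m) (N 0) := by rw [hN0, hd]; linarith
  have hd2 : 0 < det3 (q - p) (r₂ - m) (N 0) := by rw [hN0, hd]; linarith
  have hc1 : Continuous fun δ => det3 (q - p) (r₁ - m) (N δ) :=
    continuous_det3 continuous_const continuous_const hNc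
  have hc2 : Continuous fun δ => det3 (q - p) (r₂ - m) (N δ) :=
    continuous_det3 continuous_const continuous_const hNc
  have hc3 : Continuous fun δ => det3 (r₁ - m) (r₂ - m) (N δ) :=
    continuous_det3 continuous_const continuous_const hNc
  have hsmall : ∀ {g : ℝ → ℝ} {R : ℝ}, Continuous g → 0 < R →
      ∀ᶠ δ in 𝓝[>] (0 : ℝ), |δ * (g δ / det3 (q - p) (r₂ - m) (N δ))| < R := by
    intro g R hg hR
    have hct : ContinuousAt (fun δ => |δ * (g δ / det3 (q - p) (r₂ - m) (N δ))|) 0 :=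
      (continuousAt_id.mul (hg.continuousAt.div hc2.continuousAt hd2.ne')).abs
    have : Filter.Tendsto (fun δ => |δ * (g δ / det3 (q - p) (r₂ - m) (N δ))|) (𝓝[>] 0) (𝓝 0) := by
      have := hct.tendsto.mono_left (nhdsWithin_le_nhds (s := Set.Ioi (0 : ℝ)))
      simpa using this
    exact this.eventually (eventually_lt_nhds hR)
  have ev1 : ∀ᶠ δ in 𝓝[>] (0 : ℝ), 0 < det3 (q - p) (r₁ - m) (N δ) :=
    (hc1.continuousAt.eventually (eventually_gt_nhds hd1)).filter_mono nhdsWithin_le_nhds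
  have ev2 : ∀ᶠ δ in 𝓝[>] (0 : ℝ), 0 < det3 (q - p) (r₂ - m) (N δ) :=
    (hc2.continuousAt.eventually (eventually_gt_nhds hd2)).filter_mono nhdsWithin_le_nhds
  have ev3 : ∀ᶠ δ in 𝓝[>] (0 : ℝ), δ < 1 :=
    (eventually_lt_nhds one_pos).filter_mono nhdsWithin_le_nhds
  obtain ⟨δ, ⟨⟨⟨⟨⟨h1, h2⟩, h3⟩, ha⟩, hb⟩, hκ⟩, hδ⟩ := ((((((ev1.and ev2).and ev3).and
    (hsmall hc3 (R := 1 / 4) (by norm_num))).and (hsmall hc1 (R := 1 / 4) (by norm_num))).and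
    (hsmall (g := fun _ => det3 (q - p) (r₂ - m) (r₁ - m)) continuous_const hε0)).and
    self_mem_nhdsWithin).exists
  have hδ0 : (0 : ℝ) < δ := hδ
  have hcr := eq_of_det3_ne_zero h2.ne' (r₁ - m)
  set a := δ * (det3 (r₁ - m) (r₂ - m) (N δ) / det3 (q - p) (r₂ - m) (N δ)) with hadef
  set b := δ * (det3 (q - p) (r₁ - m) (N δ) / det3 (q - p) (r₂ - m) (N δ)) with hbdef
  set κ := δ * (det3 (q - p) (r₂ - m) (r₁ - m) / det3 (q - p) (r₂ - m) (N δ)) with hκdef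
  have hb0 : 0 < b := by positivity
  -- The frame contains N δ, the normal at the point m + δ(r₁ - m) itself. Hence the push-off of
  -- this point by -κ is exactly a point of the second triangle.
  have hrel : δ • (r₁ - m) = a • (q - p) + b • (r₂ - m) + κ • N δ := by
    have := congrArg (δ • ·) hcr
    simpa only [smul_add, smul_smul] using this
  rw [abs_lt] at ha hb hκ
  have hw1 := comb_mem_weights (f := {p, q, r₁}) (single_mem_weights (p := p) (by simp))
    (single_mem_weights (p := q) (by simp)) (single_mem_weights (p := r₁) (by simp))
    (a := (1 - δ) / 2) (b := (1 - δ) / 2) (c := δ) (by linarith) (by linarith) hδ0.le (by ring)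
  have hw2 := comb_mem_weights (f := {p, q, r₂}) (single_mem_weights (p := p) (by simp))
    (single_mem_weights (p := q) (by simp)) (single_mem_weights (p := r₂) (by simp))
    (a := (1 - b) / 2 - a) (b := (1 - b) / 2 + a) (c := b) (by linarith) (by linarith) hb0.le
    (by ring)
  have heq := hε _ h₁ _ h₂ _ hw1 _ hw2 (-κ) ⟨by linarith, by linarith⟩ 0 ⟨by linarith, hε0.le⟩ (by
    simp only [pushPoint_eq, map_add, map_smul, Finsupp.linearCombination_single, one_smul, zero_smul,
      add_zero]
    have e1 : ((1 - δ) / 2) • (p + -κ • S.normal p) + ((1 - δ) / 2) • (q + -κ • S.normal q) +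
        δ • (r₁ + -κ • S.normal r₁) = m + δ • (r₁ - m) - κ • N δ := by
      simp only [hN, hν, hm]; module
    rw [e1, hrel, hm]; module)
  -- The vertex r₁ has weight δ > 0 in the first point and weight 0 in the second.
  have := DFunLike.congr_fun heq.1 r₁
  simp [hp.symm, hq.symm, hr.symm] at this
  linarith

theorem eq_or_eq_of_pair_eq [DecidableEq R3] {f : R3 × R3} {p q : R3} (hpq : p ≠ q)
    (h : ({f.1, f.2} : Finset R3) = {p, q}) : f = (p, q) ∨ f = (q, p) := by
  obtain ⟨f1, f2⟩ := f
  simp only at h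
  have h1 : p ∈ ({f1, f2} : Finset R3) := by rw [h]; simp
  have h2 : q ∈ ({f1, f2} : Finset R3) := by rw [h]; simp
  simp only [Finset.mem_insert, Finset.mem_singleton] at h1 h2
  rcases h1 with rfl | rfl <;> rcases h2 with rfl | rfl
  · exact absurd rfl hpq
  · exact Or.inl rfl
  · exact Or.inr rfl
  · exact absurd rfl hpq

/-- A segment of the surface other than `e` misses the segment between the barycenters of `e` and a
triangle at `e`. -/
theorem eventually_isAwayFrom [DecidableEq R3] {ε : ℝ} (hε : IsCollarWidth S ε) (hε0 : 0 ≤ ε)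
    {e t : Finset R3} (he : e ∈ edges S.complex) (ht : t ∈ triangles S.complex) (het : e ⊆ t)
    {f : R3 × R3} (hf : IsSimplicialEdge S f) (hfe : {f.1, f.2} ≠ e) :
    ∀ᶠ δ in 𝓝[>] (0 : ℝ), IsAwayFrom (center S 0 e) (center S 0 t - center S 0 e) δ f := by
  have hpt : ∀ z : ℝ, center S 0 e + z • (center S 0 t - center S 0 e) =
      pushPoint S.normal 0 (AffineMap.lineMap (bary e) (bary t) z) := by
    intro z
    rw [← lineMap_pushPoint, lineMap_eq_add_smul]
    rfl
  have hne : ∀ z ∈ Set.Icc (0 : ℝ) 1, ∀ x ∈ Set.Icc (0 : ℝ) 1,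
      AffineMap.lineMap f.1 f.2 x ≠ center S 0 e + z • (center S 0 t - center S 0 e) := by
    intro z hz x hx heq
    obtain ⟨f', hf', h1, h2⟩ := hf
    have hene : e.Nonempty := Finset.card_pos.1 (by rw [he.2]; norm_num)
    rw [hpt, lineMap_edge S] at heq
    have hw := (hε f' hf' t ht.1 _ (lineMap_mem_weights (single_mem_weights h1)
      (single_mem_weights h2) hx) _ (lineMap_mem_weights
        (weights_mono het (bary_mem_weights hene)) (bary_mem_weights (hene.mono het)) hz) 0
      ⟨by linarith, hε0⟩ 0 ⟨by linarith, hε0⟩ heq).1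
    apply hfe
    symm
    refine Finset.eq_of_subset_of_card_le (fun v hv => ?_) (by rw [he.2]; exact Finset.card_le_two)
    by_contra hvf
    simp only [Finset.mem_insert, Finset.mem_singleton, not_or] at hvf
    -- A vertex v of e that is not an end of f has coordinate 0 on f, but coordinate (1 - z)/2 + z/3
    -- > 0 on the segment between the barycenters.
    have hv' := DFunLike.congr_fun hw v
    rw [AffineMap.lineMap_apply_module, AffineMap.lineMap_apply_module] at hv'
    simp only [Finsupp.add_apply, Finsupp.smul_apply, bary_apply, hv, het hv, if_true, he.2, ht.2,
      smul_eq_mul] at hv'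
    rw [Finsupp.single_eq_of_ne hvf.1, Finsupp.single_eq_of_ne hvf.2] at hv'
    norm_num at hv'
    linarith [hz.1, hz.2]
  have hcont : Continuous fun y : ℝ × ℝ => ‖AffineMap.lineMap f.1 f.2 y.2 -
      (center S 0 e + y.1 • (center S 0 t - center S 0 e))‖ := by
    simp only [AffineMap.lineMap_apply_module]
    fun_prop
  -- The two segments are compact and disjoint, so their distance has a positive minimum, and every
  -- smaller δ will do.
  obtain ⟨y, hy, hmin⟩ := (isCompact_Icc.prod isCompact_Icc).exists_isMinOn
    (s := Set.Icc (0 : ℝ) 1 ×ˢ Set.Icc (0 : ℝ) 1) ⟨(0, 0), by simp⟩ hcont.continuousOn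
  have hpos : 0 < ‖AffineMap.lineMap f.1 f.2 y.2 -
      (center S 0 e + y.1 • (center S 0 t - center S 0 e))‖ :=
    norm_pos_iff.2 (sub_ne_zero.2 (hne y.1 hy.1 y.2 hy.2))
  filter_upwards [(eventually_lt_nhds hpos).filter_mono nhdsWithin_le_nhds] with δ hδ
  intro z hz x hx w hw heq
  have h1 : ‖_‖ ≤ ‖_‖ := hmin (show (z, x) ∈ Set.Icc (0 : ℝ) 1 ×ˢ Set.Icc (0 : ℝ) 1 from ⟨hz, hx⟩)
  rw [heq] at h1
  have : center S 0 e + (z • (center S 0 t - center S 0 e) + w) -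
      (center S 0 e + z • (center S 0 t - center S 0 e)) = w := by abel
  rw [this] at h1
  linarith

/-- Moving the barycenter of a triangle from its push-off back to the surface, the segment to the
pushed barycenter of an edge stays away from the segments of the surface. -/
theorem disjointSegments_center [DecidableEq R3] {e t : Finset R3} (he : e ∈ edges S.complex)
    (ht : t ∈ triangles S.complex) (het : e ⊆ t) {f : R3 × R3} {δ τ : ℝ} (hτ : τ ≠ 0)
    (hδ : |τ| * ‖centerNormal S e‖ + |τ| * ‖centerNormal S t‖ < δ)
    (hf : {f.1, f.2} = e ∨ IsAwayFrom (center S 0 e) (center S 0 t - center S 0 e) δ f) {s : ℝ}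
    (hs : s ∈ Set.Icc (0 : ℝ) 1) :
    DisjointSegments f (center S τ e, center S ((1 - s) * τ) t) := by
  intro x hx y hy heq
  have heq' : AffineMap.lineMap f.1 f.2 x = center S 0 e + (y • (center S 0 t - center S 0 e) +
      τ • ((1 - y) • centerNormal S e + (y * (1 - s)) • centerNormal S t)) := by
    rw [heq, AffineMap.lineMap_apply_module]
    simp only
    rw [center_eq S τ, center_eq S ((1 - s) * τ)]
    module
  rcases hf with hf | hf
  · obtain ⟨p, q, r, hpq, hpr, hqr, rfl, rfl, hdet⟩ := exists_flag_frame he ht het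
    have hm : center S 0 {p, q} = (1 / 2 : ℝ) • (p + q) := by
      simp [center, pushPoint_eq, linearCombination_bary_pair _ hpq]
    have hg : center S 0 {p, q, r} = (1 / 3 : ℝ) • (p + q + r) := by
      simp [center, pushPoint_eq, linearCombination_bary_triple _ hpq hpr hqr]
    have hξ : ∃ ξ : ℝ, AffineMap.lineMap f.1 f.2 x = center S 0 {p, q} + ξ • (q - p) := by
      have hx' : ∀ a b : R3, AffineMap.lineMap a b x = a + x • (b - a) := fun a b =>
        lineMap_eq_add_smul a b x
      have := eq_or_eq_of_pair_eq hpq hf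
      rcases this with rfl | rfl
      · exact ⟨x - 1 / 2, by rw [hx', hm]; module⟩
      · exact ⟨1 / 2 - x, by rw [hx', hm]; module⟩
    obtain ⟨ξ, hξ⟩ := hξ
    rw [hξ] at heq'
    have heq2 := add_left_cancel heq'
    have hn1 : centerNormal S {p, q} = (1 / 2 : ℝ) • (S.normal p + S.normal q) :=
      linearCombination_bary_pair _ hpq
    have hn2 : centerNormal S {p, q, r} = (1 / 3 : ℝ) • (S.normal p + S.normal q + S.normal r) :=
      linearCombination_bary_triple _ hpq hpr hqr
    have hDx : ∀ w, det3 (q - p) (center S 0 {p, q, r} - center S 0 {p, q}) w =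
        1 / 3 * det3 (q - p) (r - p) w := by
      intro w
      rw [hm, hg]; simp [det3_eq]; ring
    have hp := hdet p (by simp)
    have hq := hdet q (by simp)
    have hr := hdet r (by simp)
    have hD1 : 0 < det3 (q - p) (r - p) (centerNormal S {p, q}) := by
      rw [hn1, det3_smul_right, det3_add_right]; positivity
    have hD2 : 0 < det3 (q - p) (r - p) (centerNormal S {p, q, r}) := by
      rw [hn2, det3_smul_right, det3_add_right, det3_add_right]; positivity
    -- The edge and the vector between the barycenters lie in the plane of the triangle.
    -- Transversely to this plane only the normal terms remain, with nonnegative coefficients, so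
    -- both must vanish.
    have h0 : τ * ((1 - y) * det3 (q - p) (r - p) (centerNormal S {p, q}) +
        (y * (1 - s)) * det3 (q - p) (r - p) (centerNormal S {p, q, r})) = 0 := by
      have h1 : det3 (q - p) (center S 0 {p, q, r} - center S 0 {p, q}) (ξ • (q - p)) = 0 := by
        simp [det3_eq]; ring
      rw [heq2, hDx, det3_add_right, det3_smul_right, det3_smul_right, det3_add_right,
        det3_smul_right, det3_smul_right] at h1
      have h2 : det3 (q - p) (center S 0 {p, q, r} - center S 0 {p, q})
        (center S 0 {p, q, r} - center S 0 {p, q}) = 0 := by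
        simp [det3_eq]; ring
      rw [hDx] at h2
      linear_combination 3 * h1 - 3 * y * h2
    have h1 := (mul_eq_zero.1 h0).resolve_left hτ
    have hy1 : 0 ≤ 1 - y := by linarith [hy.2]
    have hs1 : 0 ≤ y * (1 - s) := mul_nonneg hy.1 (by linarith [hs.2])
    have hA : (1 - y) * det3 (q - p) (r - p) (centerNormal S {p, q}) = 0 := by
      have := mul_nonneg hy1 hD1.le
      have := mul_nonneg hs1 hD2.le
      linarith
    have hB : (y * (1 - s)) * det3 (q - p) (r - p) (centerNormal S {p, q, r}) = 0 := by linarith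
    have hy' := (mul_eq_zero.1 hA).resolve_right hD1.ne'
    have hs' := (mul_eq_zero.1 hB).resolve_right hD2.ne'
    -- Only y = s = 1 is left, which is the barycenter of the triangle on the surface; it does not
    -- lie on the line of the edge.
    have hyy : y = 1 := by linarith
    rw [hy', hs', hyy, zero_smul, zero_smul, add_zero, smul_zero, add_zero, one_smul] at heq2
    have h3 := hDx (centerNormal S {p, q})
    rw [← heq2] at h3
    have h4 : det3 (q - p) (ξ • (q - p)) (centerNormal S {p, q}) = 0 := by
      simp [det3_eq]; ring
    linarith
  · refine hf y hy x hx _ ?_ heq'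
    rw [norm_smul, Real.norm_eq_abs]
    refine lt_of_le_of_lt ?_ hδ
    rw [← mul_add]
    refine mul_le_mul_of_nonneg_left ((norm_add_le _ _).trans ?_) (abs_nonneg _)
    rw [norm_smul, norm_smul, Real.norm_of_nonneg (by linarith [hy.2]),
      Real.norm_of_nonneg (mul_nonneg hy.1 (by linarith [hs.2]))]
    have h1 : 1 - y ≤ 1 := by linarith [hy.1]
    have h2 : y * (1 - s) ≤ 1 := mul_le_one₀ hy.2 (by linarith [hs.2]) (by linarith [hs.1])
    exact add_le_add (mul_le_of_le_one_left (norm_nonneg _) h1)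
      (mul_le_of_le_one_left (norm_nonneg _) h2)

/-- The meridian of an interior edge: the four segments between the push-offs of its barycenter to
the two sides and the barycenters of the two triangles at the edge. -/
noncomputable def meridian (S : SeifertSurface K) (τ : ℝ) (e t₁ t₂ : Finset R3) : ModTwoChain :=
  Finsupp.single (center S τ e, center S 0 t₁) 1 + Finsupp.single (center S (-τ) e, center S 0 t₁) 1 +
    (Finsupp.single (center S τ e, center S 0 t₂) 1 +
      Finsupp.single (center S (-τ) e, center S 0 t₂) 1)

theorem isModTwoCycle_meridian (τ : ℝ) (e t₁ t₂ : Finset R3) :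
    IsModTwoCycle (meridian S τ e t₁ t₂) := by
  intro g
  simp only [meridian, map_add, Finsupp.linearCombination_single, one_smul]
  have hchar : ∀ x : ZMod 2, x + x = 0 := by decide
  linear_combination hchar (g (center S τ e)) + hchar (g (center S (-τ) e)) +
    hchar (g (center S 0 t₁)) + hchar (g (center S 0 t₂))

/-- The meridian of an interior edge links a cycle on the surface as often as the cycle runs through
the edge. -/
theorem linkTwo_meridian_edge [DecidableEq R3] {ε : ℝ} (hε : IsCollarWidth S ε) (hε0 : 0 < ε)
    {α : ModTwoChain} (hα : IsModTwoCycle α) {e t₁ t₂ : Finset R3} (he : e ∈ edges S.complex)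
    (ht₁ : t₁ ∈ triangles S.complex) (ht₂ : t₂ ∈ triangles S.complex) (het₁ : e ⊆ t₁)
    (het₂ : e ⊆ t₂) (hne : t₁ ≠ t₂) {δ τ : ℝ} (hτ : 0 < τ)
    (hτδ : 2 * (τ * ‖centerNormal S e‖) < δ)
    (hf : ∀ f ∈ α.support, {f.1, f.2} ≠ e →
      IsAwayFrom (center S 0 e) (center S 0 t₁ - center S 0 e) δ f ∧
      IsAwayFrom (center S 0 e) (center S 0 t₂ - center S 0 e) δ f) :
    linkTwo α (meridian S τ e t₁ t₂) = Finsupp.linearCombination (ZMod 2)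
      (fun f : R3 × R3 => if {f.1, f.2} = e then (1 : ZMod 2) else 0) α := by
  obtain ⟨p, q, r₁, hpq, hpr, hqr, rfl, rfl, hdet₁⟩ := exists_flag_frame he ht₁ het₁
  obtain ⟨p', q', r₂, hpq', hpr', hqr', he', rfl, hdet₂⟩ := exists_flag_frame he ht₂ het₂
  have hm : center S 0 {p, q} = (1 / 2 : ℝ) • (p + q) := by
    simp [center, pushPoint_eq, linearCombination_bary_pair _ hpq]
  have hn : centerNormal S {p, q} = (1 / 2 : ℝ) • (S.normal p + S.normal q) :=
    linearCombination_bary_pair _ hpq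
  have hcase : (p' = p ∧ q' = q) ∨ (p' = q ∧ q' = p) := by
    have := eq_or_eq_of_pair_eq (f := (p', q')) hpq he'.symm
    simpa only [Prod.mk.injEq] using this
  have hpos : ∀ {a b r : R3} {t : Finset R3}, a ∈ t → b ∈ t →
      (∀ x ∈ t, 0 < det3 (b - a) (r - a) (S.normal x)) →
      0 < det3 (b - a) (r - a) (S.normal a + S.normal b) := by
    intro a b r t ha hb h
    rw [det3_add_right]
    exact add_pos (h a ha) (h b hb)
  have hD₁ := hpos (by simp) (by simp) hdet₁
  have hD₂ := hpos (by simp) (by simp) hdet₂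
  -- If both triangles induced the same orientation on the edge, they would lie on the same side of
  -- it.
  rcases hcase with ⟨rfl, rfl⟩ | ⟨rfl, rfl⟩
  · exact (not_same_side hε hε0 ht₁.1 ht₂.1 hpr.symm hqr.symm
      (fun h => hne (by rw [h])) hD₁ hD₂).elim
  have hg₁ : center S 0 {q', p', r₁} = (1 / 3 : ℝ) • (q' + p' + r₁) := by
    simp [center, pushPoint_eq, linearCombination_bary_triple _ hpq hpr hqr]
  have hg₂ : center S 0 {p', q', r₂} = (1 / 3 : ℝ) • (p' + q' + r₂) := by
    simp [center, pushPoint_eq, linearCombination_bary_triple _ hpq' hpr' hqr']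
  set ρ₁ := center S 0 {q', p', r₁} - center S 0 {q', p'} with hρ₁
  set ρ₂ := center S 0 {p', q', r₂} - center S 0 {q', p'} with hρ₂
  have hd₁ : det3 (p' - q') ρ₁ (centerNormal S {q', p'}) =
      1 / 6 * det3 (p' - q') (r₁ - q') (S.normal q' + S.normal p') := by
    rw [hρ₁, hg₁, hm, hn, det3_smul_right]; simp [det3_eq]; ring
  have hd₂ : det3 (p' - q') ρ₂ (centerNormal S {q', p'}) =
      -(1 / 6) * det3 (q' - p') (r₂ - p') (S.normal p' + S.normal q') := by
    rw [hρ₂, hg₂, hm, hn, det3_smul_right]; simp [det3_eq]; ring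
  have hd₁0 : 0 < det3 (p' - q') ρ₁ (centerNormal S {q', p'}) := by rw [hd₁]; positivity
  have hd₂0 : det3 (p' - q') ρ₂ (centerNormal S {q', p'}) < 0 := by rw [hd₂]; linarith
  -- The two determinants have opposite signs, so the ρ₁-coefficient of ρ₂ is negative; its negative
  -- is the positive constant c of `linkTwo_meridian`.
  have hcr := eq_of_det3_ne_zero hd₁0.ne' ρ₂
  have key := linkTwo_meridian hα (m := center S 0 {q', p'}) (c := -(det3 (p' - q') ρ₂
    (centerNormal S {q', p'}) / det3 (p' - q') ρ₁ (centerNormal S {q', p'}))) hd₁0.ne'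
    (by rw [neg_neg]; exact hcr :
      ρ₂ = (det3 ρ₂ ρ₁ (centerNormal S {q', p'}) /
        det3 (p' - q') ρ₁ (centerNormal S {q', p'})) • (p' - q') + _ • ρ₁ +
        (det3 (p' - q') ρ₁ ρ₂ / det3 (p' - q') ρ₁ (centerNormal S {q', p'})) •
        centerNormal S {q', p'}) (neg_pos.2 (div_neg_of_neg_of_pos hd₂0 hd₁0)) hτ hτδ
    (χ := fun f : R3 × R3 => if {f.1, f.2} = ({q', p'} : Finset R3) then (1 : ZMod 2) else 0)
    (fun f hfα => by
      by_cases h : {f.1, f.2} = ({q', p'} : Finset R3)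
      · left
        refine ⟨?_, if_pos h⟩
        rw [hm]
        have e1 : (1 / 2 : ℝ) • (q' + p') - (1 / 2 : ℝ) • (p' - q') = q' := by module
        have e2 : (1 / 2 : ℝ) • (q' + p') + (1 / 2 : ℝ) • (p' - q') = p' := by module
        rw [IsEdgeAt, e1, e2]
        exact eq_or_eq_of_pair_eq hpq h
      · right
        exact ⟨(hf f hfα h).1, (hf f hfα h).2, if_neg h⟩)
  rw [← key, meridian, hρ₁, hρ₂, add_sub_cancel, add_sub_cancel, center_eq S τ, center_eq S (-τ),
    neg_smul, ← sub_eq_add_neg]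

end FlagGeometry

/-! ### Cycles dual to sets of interior edges -/

section DualCycles

variable {K : PolygonalKnot} (S : SeifertSurface K)

theorem finite_triangles : (triangles S.complex).Finite := S.finite.subset fun _ h => h.1

theorem finite_edges : (edges S.complex).Finite := S.finite.subset fun _ h => h.1

open scoped Classical in
/-- The triangles of the surface that contain `e`. -/
noncomputable def trianglesAt (e : Finset R3) : Finset (Finset R3) :=
  (finite_triangles S).toFinset.filter (e ⊆ ·)

theorem mem_trianglesAt {e t : Finset R3} :
    t ∈ trianglesAt S e ↔ t ∈ triangles S.complex ∧ e ⊆ t := by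
  simp [trianglesAt]

open scoped Classical in
/-- A set `E` of interior edges that is dual to a cycle modulo two: every triangle has an even number
of edges in `E`. -/
structure IsDualCycle (E : Finset (Finset R3)) : Prop where
  edge : ∀ e ∈ E, e ∈ edges S.complex
  card_eq_two : ∀ e ∈ E, (trianglesAt S e).card = 2
  even : ∀ t ∈ triangles S.complex, Even (E.filter (· ⊆ t)).card

open scoped Classical in
/-- The pairs of an edge in `E` and a triangle at this edge. -/
noncomputable def flags (E : Finset (Finset R3)) : Finset (Finset R3 × Finset R3) :=
  (E ×ˢ (finite_triangles S).toFinset).filter fun k => k.1 ⊆ k.2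

/-- The chain of segments from `P e` to `Q t` over the flags `(e, t)`. -/
noncomputable def flagChain (E : Finset (Finset R3)) (P Q : Finset R3 → R3) : ModTwoChain :=
  ∑ k ∈ flags S E, Finsupp.single (P k.1, Q k.2) 1

variable {S} {E : Finset (Finset R3)} {M : Type*} [AddCommGroup M] [Module (ZMod 2) M]

theorem mem_flags {k : Finset R3 × Finset R3} :
    k ∈ flags S E ↔ k.1 ∈ E ∧ k.2 ∈ triangles S.complex ∧ k.1 ⊆ k.2 := by
  simp [flags, and_assoc]

theorem sum_flags {N : Type*} [AddCommMonoid N] (G : Finset R3 → Finset R3 → N) :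
    ∑ k ∈ flags S E, G k.1 k.2 = ∑ e ∈ E, ∑ t ∈ trianglesAt S e, G e t := by
  classical
  rw [flags, Finset.sum_filter, Finset.sum_product]
  exact Finset.sum_congr rfl fun e _ => by rw [trianglesAt, Finset.sum_filter]

theorem even_nsmul_eq_zero {n : ℕ} (h : Even n) (x : M) : n • x = 0 := by
  obtain ⟨k, rfl⟩ := h
  rw [← Nat.cast_smul_eq_nsmul (ZMod 2), Nat.cast_add,
    (by decide : ∀ y : ZMod 2, y + y = 0), zero_smul]

/-- An edge in E lies in exactly two triangles, so a function of the edge alone cancels; in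
`IsDualCycle.sum_right` the triangles have evenly many edges in E. The two cancellations together
make the chains over the flags cycles. -/
theorem IsDualCycle.sum_left (hE : IsDualCycle S E) (G : Finset R3 → M) :
    ∑ k ∈ flags S E, G k.1 = 0 := by
  rw [sum_flags fun e _ => G e]
  refine Finset.sum_eq_zero fun e he => ?_
  rw [Finset.sum_const, hE.card_eq_two e he]
  exact even_nsmul_eq_zero even_two _

theorem IsDualCycle.sum_right (hE : IsDualCycle S E) (G : Finset R3 → M) :
    ∑ k ∈ flags S E, G k.2 = 0 := by
  classical
  rw [flags, Finset.sum_filter, Finset.sum_product_right]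
  refine Finset.sum_eq_zero fun t ht => ?_
  rw [← Finset.sum_filter]
  simp only [Finset.sum_const]
  exact even_nsmul_eq_zero (hE.even t (by simpa using ht)) _

theorem IsDualCycle.isModTwoCycle (hE : IsDualCycle S E) (P Q : Finset R3 → R3) :
    IsModTwoCycle (flagChain S E P Q) := by
  intro g
  simp only [flagChain, map_sum, Finsupp.linearCombination_single, one_smul,
    Finset.sum_add_distrib]
  rw [hE.sum_left fun e => g (P e), hE.sum_right fun t => g (Q t), add_zero]

theorem flagChain_eq_mapDomain (P Q : Finset R3 → R3) :
    flagChain S E P Q = (∑ k ∈ flags S E, Finsupp.single k (1 : ZMod 2)).mapDomain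
      fun k => (P k.1, Q k.2) := by
  rw [Finsupp.mapDomain_finsetSum]
  simp [flagChain, Finsupp.mapDomain_single]

theorem mem_support_sum_single {ι : Type*} {s : Finset ι} {k : ι}
    (hk : k ∈ (∑ i ∈ s, Finsupp.single i (1 : ZMod 2)).support) : k ∈ s := by
  classical
  obtain ⟨i, hi, hi'⟩ := Finset.mem_biUnion.1 (Finsupp.support_finsetSum hk)
  rw [Finsupp.support_single _ one_ne_zero, Finset.mem_singleton] at hi'
  rwa [hi']

theorem mem_support_flagChain {P Q : Finset R3 → R3} {f : R3 × R3}
    (hf : f ∈ (flagChain S E P Q).support) : ∃ k ∈ flags S E, f = (P k.1, Q k.2) := by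
  rw [flagChain_eq_mapDomain] at hf
  obtain ⟨k, hk, rfl⟩ := mem_support_mapDomain hf
  exact ⟨k, mem_support_sum_single hk, rfl⟩

theorem DisjointChains.sum {ι : Type*} {s : Finset ι} {a : ModTwoChain} {c : ι → ModTwoChain}
    (h : ∀ i ∈ s, DisjointChains a (c i)) : DisjointChains a (∑ i ∈ s, c i) := by
  classical
  intro e he f hf
  obtain ⟨i, hi, hi'⟩ := Finset.mem_biUnion.1 (Finsupp.support_finsetSum hf)
  exact h i hi e he f hi'

/-- Moving the vertices of a dual cycle inside the simplices does not change its linking with cycles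
on the surface. -/
theorem linkTwo_flagChain_congr (hE : IsDualCycle S E) {ε : ℝ} (hε : IsCollarWidth S ε)
    {α : ModTwoChain} (hα : IsModTwoCycle α) (hαS : IsSimplicialChain S α) {τ : ℝ}
    (hτ : τ ∈ Set.Icc (-ε) ε) (hτ0 : τ ≠ 0) {w w' : Finset R3 → R3 →₀ ℝ}
    (hw : ∀ s : Finset R3, s.Nonempty → w s ∈ weights s)
    (hw' : ∀ s : Finset R3, s.Nonempty → w' s ∈ weights s) :
    linkTwo α (flagChain S E (fun s => pushPoint S.normal τ (w s))
      (fun s => pushPoint S.normal τ (w s))) =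
    linkTwo α (flagChain S E (fun s => pushPoint S.normal τ (w' s))
      (fun s => pushPoint S.normal τ (w' s))) := by
  have hne : ∀ k ∈ flags S E, k.2 ∈ S.complex.faces ∧ k.1.Nonempty ∧ k.2.Nonempty ∧ k.1 ⊆ k.2 := by
    intro k hk
    obtain ⟨h1, h2, h3⟩ := mem_flags.1 hk
    have hn : k.1.Nonempty := Finset.card_pos.1 (by rw [(hE.edge _ h1).2]; norm_num)
    exact ⟨h2.1, hn, hn.mono h3, h3⟩
  have hdisj : ∀ {w : Finset R3 → R3 →₀ ℝ}, (∀ s : Finset R3, s.Nonempty → w s ∈ weights s) →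
      DisjointChains α (flagChain S E (fun s => pushPoint S.normal τ (w s))
        (fun s => pushPoint S.normal τ (w s))) := by
    intro w hw e he f hf x hx y hy heq
    obtain ⟨k, hk, rfl⟩ := mem_support_flagChain hf
    obtain ⟨h1, h2, h3, h4⟩ := hne k hk
    refine pushed_triangle_disjoint hε hαS hτ hτ0 h1 (weights_mono h4 (hw _ h2)) (hw _ h3) (hw _ h3)
      he hx hy.1 le_rfl (by linarith [hy.2]) ?_
    rw [heq, lineMap_eq_add_smul]
    simp
  have hchar : ∀ x y : ZMod 2, x + y = 0 → x = y := by decide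
  apply hchar
  rw [← linkTwo_add_right hα (hE.isModTwoCycle _ _) (hE.isModTwoCycle _ _) (hdisj hw) (hdisj hw')]
  set c := fun s => pushPoint S.normal τ (w s) with hc
  set c' := fun s => pushPoint S.normal τ (w' s) with hc'
  -- Over each flag the passage from w to w' sweeps a quadrilateral, cut into two triangles. The
  -- diagonal cancels at once, and the sides belonging to a single edge or a single triangle cancel
  -- in the sum over all flags.
  have hsum : flagChain S E c c + flagChain S E c' c' =
      ∑ k ∈ flags S E, (triangleBdry (c k.1) (c k.2) (c' k.2) +
        triangleBdry (c k.1) (c' k.1) (c' k.2)) := by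
    have h1 : ∀ k : Finset R3 × Finset R3, triangleBdry (c k.1) (c k.2) (c' k.2) +
        triangleBdry (c k.1) (c' k.1) (c' k.2) =
        (Finsupp.single (c k.1, c k.2) (1 : ZMod 2) + Finsupp.single (c' k.1, c' k.2) 1) +
        Finsupp.single (c k.2, c' k.2) 1 + Finsupp.single (c k.1, c' k.1) 1 := by
      intro k
      have hchar : Finsupp.single (c k.1, c' k.2) (1 : ZMod 2) +
          Finsupp.single (c k.1, c' k.2) 1 = 0 := by
        rw [← Finsupp.single_add, show (1 : ZMod 2) + 1 = 0 by decide, Finsupp.single_zero]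
      rw [triangleBdry, triangleBdry]
      calc _ = (Finsupp.single (c k.1, c k.2) (1 : ZMod 2) + Finsupp.single (c' k.1, c' k.2) 1) +
        Finsupp.single (c k.2, c' k.2) 1 + Finsupp.single (c k.1, c' k.1) 1 +
          (Finsupp.single (c k.1, c' k.2) (1 : ZMod 2) + Finsupp.single (c k.1, c' k.2) 1) := by abel
        _ = _ := by rw [hchar, add_zero]
    rw [Finset.sum_congr rfl fun k _ => h1 k, Finset.sum_add_distrib, Finset.sum_add_distrib,
      Finset.sum_add_distrib, hE.sum_right fun t => Finsupp.single (c t, c' t) (1 : ZMod 2),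
      hE.sum_left fun e => Finsupp.single (c e, c' e) (1 : ZMod 2), add_zero, add_zero]
    rfl
  rw [hsum]
  have htri : ∀ k ∈ flags S E, w k.1 ∈ weights k.2 ∧ w k.2 ∈ weights k.2 ∧ w' k.1 ∈ weights k.2 ∧
      w' k.2 ∈ weights k.2 := fun k hk => by
    obtain ⟨-, h2, h3, h4⟩ := hne k hk
    exact ⟨weights_mono h4 (hw _ h2), hw _ h3, weights_mono h4 (hw' _ h2), hw' _ h3⟩
  have hd1 : ∀ k ∈ flags S E, DisjointChains α (triangleBdry (c k.1) (c k.2) (c' k.2)) :=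
    fun k hk => disjointChains_pushed_triangle hε hαS hτ hτ0 (hne k hk).1 (htri k hk).1
      (htri k hk).2.1 (htri k hk).2.2.2
  have hd2 : ∀ k ∈ flags S E, DisjointChains α (triangleBdry (c k.1) (c' k.1) (c' k.2)) :=
    fun k hk => disjointChains_pushed_triangle hε hαS hτ hτ0 (hne k hk).1 (htri k hk).1
      (htri k hk).2.2.1 (htri k hk).2.2.2
  have hcyc := isModTwoCycle_triangleBdry
  rw [Finset.sum_add_distrib, linkTwo_add_right hα (.sum fun _ _ => hcyc _ _ _)
    (.sum fun _ _ => hcyc _ _ _) (.sum hd1) (.sum hd2),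
    linkTwo_sum_right hα (fun _ _ => hcyc _ _ _) hd1,
    linkTwo_sum_right hα (fun _ _ => hcyc _ _ _) hd2,
    Finset.sum_eq_zero, Finset.sum_eq_zero, add_zero]
  · exact fun k hk => linkTwo_pushed_triangle hε hα hαS hτ hτ0 (hne k hk).1 (htri k hk).1
      (htri k hk).2.2.1 (htri k hk).2.2.2
  · exact fun k hk => linkTwo_pushed_triangle hε hα hαS hτ hτ0 (hne k hk).1 (htri k hk).1
      (htri k hk).2.1 (htri k hk).2.2.2

theorem DisjointChains.add {a c c' : ModTwoChain} (h : DisjointChains a c)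
    (h' : DisjointChains a c') : DisjointChains a (c + c') := by
  classical
  exact fun e he f hf => (Finset.mem_union.1 (Finsupp.support_add hf)).elim (h e he f) (h' e he f)

/-- Symmetrized linking with a dual cycle computes the number of passages through its edges. -/
theorem exists_dual_cycle (hE : IsDualCycle S E) {α : ModTwoChain} (hα : IsModTwoCycle α)
    (hαS : IsSimplicialChain S α) [DecidableEq R3] :
    ∃ β : ModTwoChain, IsModTwoCycle β ∧ IsSimplicialChain S β ∧ ∀ᶠ τ in 𝓝[>] (0 : ℝ),
      linkTwo α (pushTwo S τ β) + linkTwo β (pushTwo S τ α) = Finsupp.linearCombination (ZMod 2)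
        (fun f : R3 × R3 => if {f.1, f.2} ∈ E then (1 : ZMod 2) else 0) α := by
  obtain ⟨ε, hε0, hε⟩ := exists_isCollarWidth S
  -- A vertex of each simplex takes the place of its barycenter, so that β is a simplicial chain of
  -- the surface.
  have hv : ∀ s : Finset R3, ∃ v : R3, s.Nonempty → v ∈ s := fun s => by
    by_cases h : s.Nonempty
    · exact ⟨h.choose, fun _ => h.choose_spec⟩
    · exact ⟨0, fun h' => absurd h' h⟩
  choose v hv using hv
  have hne : ∀ k ∈ flags S E, k.1 ∈ edges S.complex ∧ k.2 ∈ triangles S.complex ∧ k.1.Nonempty ∧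
      k.2.Nonempty ∧ k.1 ⊆ k.2 := by
    intro k hk
    obtain ⟨h1, h2, h3⟩ := mem_flags.1 hk
    have hn : k.1.Nonempty := Finset.card_pos.1 (by rw [(hE.edge _ h1).2]; norm_num)
    exact ⟨hE.edge _ h1, h2, hn, hn.mono h3, h3⟩
  set β := flagChain S E v v with hβ
  have hβc : IsModTwoCycle β := hE.isModTwoCycle v v
  have hβS : IsSimplicialChain S β := by
    intro f hf
    obtain ⟨k, hk, rfl⟩ := mem_support_flagChain hf
    obtain ⟨h1, h2, h3, h4, h5⟩ := hne k hk
    exact ⟨k.2, h2.1, h5 (hv _ h3), hv _ h4⟩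
  refine ⟨β, hβc, hβS, ?_⟩
  obtain ⟨δ, hδ, hδ0⟩ : ∃ δ : ℝ, (∀ k ∈ flags S E, ∀ f ∈ α.support, {f.1, f.2} ≠ k.1 →
      IsAwayFrom (center S 0 k.1) (center S 0 k.2 - center S 0 k.1) δ f) ∧ 0 < δ := by
    have : ∀ᶠ δ in 𝓝[>] (0 : ℝ), ∀ k ∈ flags S E, ∀ f ∈ α.support, {f.1, f.2} ≠ k.1 →
        IsAwayFrom (center S 0 k.1) (center S 0 k.2 - center S 0 k.1) δ f := by
      rw [Filter.eventually_all_finset]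
      intro k hk
      rw [Filter.eventually_all_finset]
      intro f hf
      rw [Filter.eventually_imp_distrib_left]
      intro hfk
      obtain ⟨h1, h2, -, -, h5⟩ := hne k hk
      exact eventually_isAwayFrom hε hε0.le h1 h2 h5 (hαS f hf) hfk
    exact (this.and self_mem_nhdsWithin).exists
  have hsmall : ∀ R : ℝ, ∀ᶠ τ in 𝓝[>] (0 : ℝ), τ * R < δ := by
    intro R
    have : Filter.Tendsto (fun b : ℝ => b * R) (𝓝[>] 0) (𝓝 0) := by
      have h1 : Continuous fun b : ℝ => b * R := by fun_prop
      simpa using (h1.tendsto 0).mono_left nhdsWithin_le_nhds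
    exact this.eventually (eventually_lt_nhds hδ0)
  have ev : ∀ᶠ τ in 𝓝[>] (0 : ℝ), ∀ k ∈ flags S E,
      τ * (2 * ‖centerNormal S k.1‖) < δ ∧
      τ * (‖centerNormal S k.1‖ + ‖centerNormal S k.2‖) < δ := by
    rw [Filter.eventually_all_finset]
    exact fun k _ => (hsmall _).and (hsmall _)
  filter_upwards [ev, self_mem_nhdsWithin,
    (eventually_le_nhds hε0).filter_mono nhdsWithin_le_nhds] with τ hτ (hτ0 : 0 < τ) hτε
  -- The sum becomes the linking of α with the push-offs of β to both sides.
  rw [linkTwo_pushTwo_neg hε hβc hα hβS hαS hτ0 hτε]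
  -- disjointness of the deformed chains
  have hdis : ∀ σ : ℝ, |σ| = τ → ∀ s ∈ Set.Icc (0 : ℝ) 1, ∀ k ∈ flags S E, ∀ f ∈ α.support,
      DisjointSegments f (center S σ k.1, center S ((1 - s) * σ) k.2) := by
    intro σ hσ s hs k hk f hf
    obtain ⟨h1, h2, -, -, h5⟩ := hne k hk
    refine disjointSegments_center h1 h2 h5 (δ := δ) ?_ ?_ ?_ hs
    · rintro rfl; rw [abs_zero] at hσ; linarith
    · rw [hσ, ← mul_add]; exact (hτ k hk).2
    · by_cases h : {f.1, f.2} = k.1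
      · exact Or.inl h
      · exact Or.inr (hδ k hk f hf h)
  -- The pushed vertices are moved to pushed barycenters, and then those of the triangles return to
  -- the surface. Those of the edges stay at height σ, which keeps the chain clear of α.
  have hside : ∀ σ : ℝ, |σ| = τ → linkTwo α (pushTwo S σ β) =
      linkTwo α (flagChain S E (center S σ) (center S 0)) := by
    intro σ hσ
    have hσ0 : σ ≠ 0 := by rintro rfl; rw [abs_zero] at hσ; linarith
    have hσε : σ ∈ Set.Icc (-ε) ε := abs_le.1 (by rw [hσ]; exact hτε)
    have h1 : pushTwo S σ β = flagChain S E
        (fun s => pushPoint S.normal σ (Finsupp.single (v s) 1))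
        (fun s => pushPoint S.normal σ (Finsupp.single (v s) 1)) := by
      rw [hβ, flagChain, pushTwo, Finsupp.mapDomain_finsetSum, flagChain]
      simp only [Finsupp.mapDomain_single, pushPoint_single]
      rfl
    rw [h1, linkTwo_flagChain_congr hE hε hα hαS hσε hσ0 (w' := bary)
      (fun s hs => single_mem_weights (hv s hs)) (fun s hs => bary_mem_weights hs)]
    have key := linkTwo_deform α (∑ k ∈ flags S E, Finsupp.single k (1 : ZMod 2)) (fun _ => id)
      (fun s k => (center S σ k.1, center S ((1 - s) * σ) k.2)) (fun _ => continuous_const)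
      (fun k => by simp only [center_eq S ((1 - _) * σ)]; fun_prop)
      (fun _ _ => by rw [Finsupp.mapDomain_id]; exact hα)
      (fun s _ => by
        rw [← flagChain_eq_mapDomain (center S σ) (center S ((1 - s) * σ))]
        exact hE.isModTwoCycle _ _)
      (fun s hs f hf k hk => hdis σ hσ s hs k (mem_support_sum_single hk) f hf)
    rw [← flagChain_eq_mapDomain (center S σ) (center S ((1 - 0) * σ)),
      ← flagChain_eq_mapDomain (center S σ) (center S ((1 - 1) * σ)), Finsupp.mapDomain_id,
      sub_zero, one_mul, sub_self, zero_mul] at key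
    exact key
  have habs : |-τ| = τ := by rw [abs_neg, abs_of_pos hτ0]
  have hflat : ∀ σ : ℝ, |σ| = τ → ∀ k ∈ flags S E, ∀ f ∈ α.support,
      DisjointSegments f (center S σ k.1, center S 0 k.2) := by
    intro σ hσ k hk f hf
    have := hdis σ hσ 1 ⟨zero_le_one, le_rfl⟩ k hk f hf
    rwa [sub_self, zero_mul] at this
  have hflat' : ∀ σ : ℝ, |σ| = τ → DisjointChains α (flagChain S E (center S σ) (center S 0)) := by
    intro σ hσ f hf f' hf'
    obtain ⟨k, hk, rfl⟩ := mem_support_flagChain hf'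
    exact hflat σ hσ k hk f hf
  rw [hside τ (abs_of_pos hτ0), hside (-τ) habs, ← linkTwo_add_right hα (hE.isModTwoCycle _ _)
    (hE.isModTwoCycle _ _) (hflat' _ (abs_of_pos hτ0)) (hflat' _ habs)]
  -- decomposition into meridians
  have htwo : ∀ e ∈ E, ∃ t₁ t₂, t₁ ≠ t₂ ∧ trianglesAt S e = {t₁, t₂} := fun e he =>
    Finset.card_eq_two.1 (hE.card_eq_two e he)
  choose! t₁ t₂ hne₁₂ htri using htwo
  -- Over an edge with its two triangles, the two sides contribute the four segments of a meridian.
  have hmer : flagChain S E (center S τ) (center S 0) + flagChain S E (center S (-τ)) (center S 0) =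
      ∑ e ∈ E, meridian S τ e (t₁ e) (t₂ e) := by
    rw [flagChain, flagChain, ← Finset.sum_add_distrib,
      sum_flags fun e t => Finsupp.single (center S τ e, center S 0 t) (1 : ZMod 2) +
        Finsupp.single (center S (-τ) e, center S 0 t) 1]
    refine Finset.sum_congr rfl fun e he => ?_
    rw [htri e he, Finset.sum_pair (hne₁₂ e he), meridian]
  have hfl : ∀ e ∈ E, (e, t₁ e) ∈ flags S E ∧ (e, t₂ e) ∈ flags S E := by
    intro e he
    have h1 : t₁ e ∈ trianglesAt S e := by rw [htri e he]; simp
    have h2 : t₂ e ∈ trianglesAt S e := by rw [htri e he]; simp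
    rw [mem_trianglesAt] at h1 h2
    exact ⟨mem_flags.2 ⟨he, h1⟩, mem_flags.2 ⟨he, h2⟩⟩
  have hdm : ∀ e ∈ E, DisjointChains α (meridian S τ e (t₁ e) (t₂ e)) := by
    intro e he
    have hs : ∀ σ : ℝ, |σ| = τ → ∀ t, (e, t) ∈ flags S E →
        DisjointChains α (Finsupp.single (center S σ e, center S 0 t) 1) := by
      intro σ hσ t hk f hf f' hf'
      rw [Finsupp.support_single _ one_ne_zero, Finset.mem_singleton] at hf'
      rw [hf']
      exact hflat σ hσ (e, t) hk f hf
    rw [meridian]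
    exact ((hs τ (abs_of_pos hτ0) _ (hfl e he).1).add (hs (-τ) habs _ (hfl e he).1)).add
      ((hs τ (abs_of_pos hτ0) _ (hfl e he).2).add (hs (-τ) habs _ (hfl e he).2))
  rw [hmer, linkTwo_sum_right hα (fun _ _ => isModTwoCycle_meridian _ _ _ _) hdm]
  have hlink : ∀ e ∈ E, linkTwo α (meridian S τ e (t₁ e) (t₂ e)) = Finsupp.linearCombination (ZMod 2)
      (fun f : R3 × R3 => if {f.1, f.2} = e then (1 : ZMod 2) else 0) α := by
    intro e he
    obtain ⟨h1, h2, -, -, h5⟩ := hne _ (hfl e he).1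
    obtain ⟨-, h2', -, -, h5'⟩ := hne _ (hfl e he).2
    exact linkTwo_meridian_edge hε hε0 hα h1 h2 h2' h5 h5' (hne₁₂ e he) hτ0
      (by have := (hτ _ (hfl e he).1).1; simp only at this; linarith)
      fun f hf hfe => ⟨hδ _ (hfl e he).1 f hf hfe, hδ _ (hfl e he).2 f hf hfe⟩
  rw [Finset.sum_congr rfl hlink]
  simp only [Finsupp.linearCombination_apply, Finsupp.sum]
  rw [Finset.sum_comm]
  refine Finset.sum_congr rfl fun f _ => ?_
  rw [← Finset.smul_sum, Finset.sum_ite_eq]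

end DualCycles

/-! ### Reduction of integral chains modulo two -/

section ReductionModTwo

/-- Reduction of an integral chain modulo two. -/
noncomputable def modTwo : Chain1 →+ ModTwoChain :=
  Finsupp.mapRange.addMonoidHom (Int.castAddHom (ZMod 2))

theorem modTwo_apply (c : Chain1) (e : R3 × R3) : modTwo c e = (c e : ZMod 2) := rfl

theorem modTwo_single (e : R3 × R3) (n : ℤ) :
    modTwo (Finsupp.single e n) = Finsupp.single e (n : ZMod 2) := by
  simp [modTwo]

theorem support_modTwo_subset (c : Chain1) : (modTwo c).support ⊆ c.support := by
  intro e he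
  rw [Finsupp.mem_support_iff, modTwo_apply] at he
  rw [Finsupp.mem_support_iff]
  intro h
  exact he (by rw [h, Int.cast_zero])

theorem modTwo_zsmul (n : ℤ) (c : Chain1) : modTwo (n • c) = (n : ZMod 2) • modTwo c := by
  ext e
  simp [modTwo_apply]

theorem linearCombination_modTwo {φ : Chain1 →+ ℤ} (c : Chain1) :
    Finsupp.linearCombination (ZMod 2) (fun e => (φ (Finsupp.single e 1) : ZMod 2)) (modTwo c) =
      (φ c : ZMod 2) := by
  have : ((Finsupp.linearCombination (ZMod 2)
      (fun e => (φ (Finsupp.single e 1) : ZMod 2))).toAddMonoidHom.comp modTwo) =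
      (Int.castAddHom (ZMod 2)).comp φ := by
    refine Finsupp.addHom_ext fun e n => ?_
    have h : Finsupp.single e n = n • Finsupp.single e (1 : ℤ) := by simp
    simp only [AddMonoidHom.comp_apply, LinearMap.toAddMonoidHom_coe, modTwo_single,
      Finsupp.linearCombination_single, Int.coe_castAddHom]
    rw [h, map_zsmul]
    simp
  exact DFunLike.congr_fun this c

theorem isModTwoCycle_modTwo {c : Chain1} (hc : bdry1 c = 0) : IsModTwoCycle (modTwo c) := by
  intro g
  have : (Finsupp.linearCombination (ZMod 2) (fun e : R3 × R3 => g e.1 + g e.2)).toAddMonoidHom.comp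
      modTwo = ((Finsupp.liftAddHom fun v => (AddMonoidHom.mulRight (g v)).comp
        (Int.castAddHom (ZMod 2)) : (R3 →₀ ℤ) →+ ZMod 2)).comp bdry1.toAddMonoidHom := by
    refine Finsupp.addHom_ext fun e n => ?_
    simp only [AddMonoidHom.comp_apply, LinearMap.toAddMonoidHom_coe, modTwo_single,
      Finsupp.linearCombination_single, bdry1, map_sub, smul_sub, Finsupp.smul_single,
      Finsupp.liftAddHom_apply_single, AddMonoidHom.mulRight_apply, Int.coe_castAddHom, smul_eq_mul,
      mul_one]
    have hchar : ∀ x : ZMod 2, x + x = 0 := by decide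
    linear_combination hchar ((n : ZMod 2) * g e.1)
  have h := DFunLike.congr_fun this c
  simp only [AddMonoidHom.comp_apply, LinearMap.toAddMonoidHom_coe, hc, map_zero] at h
  exact h

theorem modTwo_bdry2 (p q r : R3) : modTwo (bdry2 p q r) = triangleBdry p q r := by
  have hneg : ∀ x : ModTwoChain, -x = x := fun x => by
    refine Finsupp.ext fun e => ?_
    exact (by decide : ∀ y : ZMod 2, -y = y) (x e)
  rw [bdry2, map_add, map_sub, modTwo_single, modTwo_single, modTwo_single, sub_eq_add_neg, hneg]
  simp [triangleBdry]

variable {K : PolygonalKnot} {S : SeifertSurface K}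

theorem isSimplicialChain_modTwo {c : Chain1} (hc : c ∈ Finsupp.supported ℤ ℤ
    {e : R3 × R3 | ∃ f ∈ S.complex.faces, e.1 ∈ f ∧ e.2 ∈ f}) : IsSimplicialChain S (modTwo c) :=
  fun _ he => (Finsupp.mem_supported _ _).1 hc (support_modTwo_subset c he)

theorem modTwo_pushChain (t : ℝ) (c : Chain1) :
    modTwo (S.pushChain t c) = pushTwo S t (modTwo c) := by
  rw [SeifertSurface.pushChain, pushTwo]
  exact (Finsupp.mapDomain_mapRange (pushEdge S t) c (Int.castAddHom (ZMod 2)) (map_zero _)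
    (map_add _)).symm

/-- The linking number of integral cycles, reduced modulo two. -/
theorem IsLinkingNumber.linkTwo_eq {a c : Chain1} {k : ℤ} (h : IsLinkingNumber a c k)
    (ha : bdry1 a = 0) (hc : bdry1 c = 0) : linkTwo (modTwo a) (modTwo c) = (k : ZMod 2) := by
  obtain ⟨u, ⟨hu0, hu⟩, hk⟩ := h
  rw [KnotWitt.linkTwo_eq (isModTwoCycle_modTwo ha) (isModTwoCycle_modTwo hc) (u := u)
    ⟨hu0, fun e he f hf => hu e (support_modTwo_subset a he) f (support_modTwo_subset c hf)⟩]
  have hlc : ∀ (g : R3 × R3 → ZMod 2) (x : Chain1), Finsupp.linearCombination (ZMod 2) g (modTwo x) =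
      x.sum fun e n => (n : ZMod 2) * g e := by
    intro g x
    rw [Finsupp.linearCombination_apply, modTwo]
    exact Finsupp.sum_mapRange_index (hf := map_zero _) fun e => by simp
  rw [pairing_eq_left, hlc, ← hk]
  simp only [hlc]
  simp only [Finsupp.sum, Int.cast_sum, Finset.mul_sum]
  refine Finset.sum_congr rfl fun e he => Finset.sum_congr rfl fun f hf => ?_
  rw [← overSign_cast (hu e he f hf)]
  push_cast
  ring

theorem bdry1_pushChain {c : Chain1} (hc : bdry1 c = 0) (t : ℝ) : bdry1 (S.pushChain t c) = 0 := by
  have : bdry1 ∘ₗ Finsupp.lmapDomain ℤ ℤ (pushEdge S t) =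
      Finsupp.lmapDomain ℤ ℤ (fun v : R3 => v + t • S.normal v) ∘ₗ bdry1 := by
    ext e : 2
    simp [bdry1, pushEdge, Finsupp.mapDomain_single, Finsupp.mapDomain_sub]
  have h := DFunLike.congr_fun this c
  simp only [LinearMap.comp_apply, hc, map_zero] at h
  exact h

end ReductionModTwo

/-! ### Homology of the surface, cocycles and integral lifts -/

section Homology

variable {K : PolygonalKnot} {S : SeifertSurface K}

/-- The 1-chains of a simplicial complex. -/
noncomputable def chains1 (X : Geometry.SimplicialComplex ℝ R3) : Submodule ℤ Chain1 :=
  Finsupp.supported ℤ ℤ {e : R3 × R3 | ∃ f ∈ X.faces, e.1 ∈ f ∧ e.2 ∈ f}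

theorem single_mem_chains1 {X : Geometry.SimplicialComplex ℝ R3} {f : Finset R3} (hf : f ∈ X.faces)
    {p q : R3} (hp : p ∈ f) (hq : q ∈ f) (n : ℤ) : Finsupp.single (p, q) n ∈ chains1 X :=
  Finsupp.single_mem_supported ℤ n ⟨f, hf, hp, hq⟩

theorem bdry1_single (p q : R3) :
    bdry1 (Finsupp.single (p, q) 1) = Finsupp.single q 1 - Finsupp.single p 1 := by
  simp [bdry1]

theorem bdry2_mem_cycles1 {X : Geometry.SimplicialComplex ℝ R3} {f : Finset R3} (hf : f ∈ X.faces)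
    {p q r : R3} (hp : p ∈ f) (hq : q ∈ f) (hr : r ∈ f) : bdry2 p q r ∈ cycles1 X := by
  refine ⟨add_mem (sub_mem (single_mem_chains1 hf hq hr 1) (single_mem_chains1 hf hp hr 1))
    (single_mem_chains1 hf hp hq 1), ?_⟩
  change bdry1 _ = 0
  rw [bdry2, map_add, map_sub, bdry1_single, bdry1_single, bdry1_single]
  abel

/-- The surface is connected: any two vertices are joined by a chain of edges. -/
theorem exists_path {v₀ p : R3} {f₀ f : Finset R3} (hf₀ : f₀ ∈ S.complex.faces) (hv₀ : v₀ ∈ f₀)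
    (hf : f ∈ S.complex.faces) (hp : p ∈ f) :
    ∃ γ ∈ chains1 S.complex, bdry1 γ = Finsupp.single p 1 - Finsupp.single v₀ 1 := by
  obtain ⟨t₀, ht₀, h₀⟩ := S.pure f₀ hf₀
  obtain ⟨t, ht, h⟩ := S.pure f hf
  have key : ∀ p ∈ t, ∃ γ ∈ chains1 S.complex,
      bdry1 γ = Finsupp.single p 1 - Finsupp.single v₀ 1 := by
    have := S.connected t₀ ht₀ t ht
    clear hp h ht
    induction this with
    | refl => exact fun p hp => ⟨_, single_mem_chains1 ht₀.1 (h₀ hv₀) hp 1, bdry1_single _ _⟩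
    | tail _ hab ih =>
      intro p hp
      obtain ⟨hb, e, he, hea, heb⟩ := hab
      obtain ⟨q, hq⟩ : e.Nonempty := Finset.card_pos.1 (by rw [he.2]; norm_num)
      obtain ⟨γ, hγ, hγ'⟩ := ih q (hea hq)
      refine ⟨γ + Finsupp.single (q, p) 1, add_mem hγ (single_mem_chains1 hb.1 (heb hq) hp 1), ?_⟩
      rw [map_add, hγ', bdry1_single]
      abel
  exact key p (h hp)

/-- The set of vertices of a complex. -/
def vertexSet (X : Geometry.SimplicialComplex ℝ R3) : Set R3 := {p | ∃ f ∈ X.faces, p ∈ f}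

/-- The sum of the coefficients of a 0-chain. -/
noncomputable def augmentation : (R3 →₀ ℤ) →ₗ[ℤ] ℤ := Finsupp.linearCombination ℤ fun _ => (1 : ℤ)

theorem augmentation_bdry1 (c : Chain1) : augmentation (bdry1 c) = 0 := by
  have : augmentation ∘ₗ bdry1 = 0 := by
    ext e
    simp [augmentation, bdry1]
  exact DFunLike.congr_fun this c

theorem bdry1_mem_supported {X : Geometry.SimplicialComplex ℝ R3} {c : Chain1} (hc : c ∈ chains1 X) :
    bdry1 c ∈ Finsupp.supported ℤ ℤ (vertexSet X) := by
  rw [bdry1, Finsupp.linearCombination_apply]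
  refine Submodule.sum_mem _ fun e he => Submodule.smul_mem _ _ ?_
  obtain ⟨f, hf, h1, h2⟩ := (Finsupp.mem_supported _ _).1 hc he
  exact sub_mem (Finsupp.single_mem_supported ℤ 1 ⟨f, hf, h2⟩)
    (Finsupp.single_mem_supported ℤ 1 ⟨f, hf, h1⟩)

variable (S)

/-- A section of the boundary map of a connected surface on the 0-chains of augmentation zero. -/
theorem exists_cone : ∃ Γ : (R3 →₀ ℤ) →ₗ[ℤ] Chain1,
    (∀ d ∈ Finsupp.supported ℤ ℤ (vertexSet S.complex), Γ d ∈ chains1 S.complex) ∧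
    ∀ d ∈ Finsupp.supported ℤ ℤ (vertexSet S.complex), augmentation d = 0 → bdry1 (Γ d) = d := by
  classical
  by_cases hne : (vertexSet S.complex).Nonempty
  · obtain ⟨v₀, f₀, hf₀, hv₀⟩ := hne
    -- Γ sends a vertex p to a path from the base point v₀. The contributions of v₀ to the boundary
    -- add up to the augmentation.
    have : ∀ p, ∃ γ, p ∈ vertexSet S.complex →
        (γ ∈ chains1 S.complex ∧ bdry1 γ = Finsupp.single p 1 - Finsupp.single v₀ 1) := by
      intro p
      by_cases hp : p ∈ vertexSet S.complex
      · obtain ⟨f, hf, hpf⟩ := hp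
        obtain ⟨γ, h1, h2⟩ := exists_path hf₀ hv₀ hf hpf
        exact ⟨γ, fun _ => ⟨h1, h2⟩⟩
      · exact ⟨0, fun h => absurd h hp⟩
    choose γ hγ using this
    refine ⟨Finsupp.linearCombination ℤ γ, fun d hd => ?_, fun d hd h0 => ?_⟩
    · rw [Finsupp.linearCombination_apply]
      exact Submodule.sum_mem _ fun p hp =>
        Submodule.smul_mem _ _ (hγ p ((Finsupp.mem_supported _ _).1 hd hp)).1
    · have h1 : bdry1 (Finsupp.linearCombination ℤ γ d) =
          d - augmentation d • Finsupp.single v₀ 1 := by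
        rw [Finsupp.linearCombination_apply, Finsupp.sum, map_sum]
        have : ∀ p ∈ d.support, bdry1 (d p • γ p) =
            Finsupp.single p (d p) - d p • Finsupp.single v₀ 1 := by
          intro p hp
          rw [map_smul, (hγ p ((Finsupp.mem_supported _ _).1 hd hp)).2, smul_sub,
            Finsupp.smul_single, smul_eq_mul, mul_one]
        rw [Finset.sum_congr rfl this, Finset.sum_sub_distrib, ← Finset.sum_smul]
        congr 1
        · exact d.sum_single
        · simp [augmentation, Finsupp.linearCombination_apply, Finsupp.sum]
      rw [h1, h0, zero_smul, sub_zero]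
  · rw [Set.not_nonempty_iff_eq_empty] at hne
    rw [hne]
    refine ⟨0, fun d _ => zero_mem _, fun d hd _ => ?_⟩
    rw [Finsupp.supported_empty, Submodule.mem_bot] at hd
    rw [hd]; simp

/-- A homomorphism on homology extends to a cocycle. -/
theorem exists_cocycle (l : H1 S.complex →ₗ[ℤ] ℤ) : ∃ φ : Chain1 →ₗ[ℤ] ℤ,
    (∀ z (hz : z ∈ cycles1 S.complex), φ z = l (Submodule.Quotient.mk ⟨z, hz⟩)) ∧
    ∀ f ∈ S.complex.faces, ∀ p ∈ f, ∀ q ∈ f, ∀ r ∈ f, φ (bdry2 p q r) = 0 := by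
  classical
  obtain ⟨Γ, hΓ, hΓ'⟩ := exists_cone S
  -- The map c ↦ c - Γ∂c is a projection of the chains onto the cycles. Composition with it extends
  -- l to all chains.
  have hT : ∀ c : chains1 S.complex, (LinearMap.id - Γ ∘ₗ bdry1 : Chain1 →ₗ[ℤ] Chain1) c.1 ∈ cycles1 S.complex := by
    intro c
    refine ⟨sub_mem c.2 (hΓ _ (bdry1_mem_supported c.2)), ?_⟩
    change bdry1 _ = 0
    rw [LinearMap.sub_apply, map_sub, LinearMap.comp_apply,
      hΓ' _ (bdry1_mem_supported c.2) (augmentation_bdry1 _), LinearMap.id_apply, sub_self]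
  let T : chains1 S.complex →ₗ[ℤ] cycles1 S.complex :=
    LinearMap.codRestrict _ ((LinearMap.id - Γ ∘ₗ bdry1 : Chain1 →ₗ[ℤ] Chain1) ∘ₗ (chains1 S.complex).subtype) hT
  let R : Chain1 →ₗ[ℤ] chains1 S.complex := Finsupp.restrictDom ℤ ℤ _
  have hφ : ∀ z (hz : z ∈ cycles1 S.complex),
      (l ∘ₗ Submodule.mkQ _ ∘ₗ T ∘ₗ R) z = l (Submodule.Quotient.mk ⟨z, hz⟩) := by
    intro z hz
    have h1 : R z = ⟨z, hz.1⟩ :=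
      DFunLike.congr_fun (Finsupp.restrictDom_comp_subtype (M := ℤ) (R := ℤ) _) (⟨z, hz.1⟩ :
        chains1 S.complex)
    have h2 : T ⟨z, hz.1⟩ = ⟨z, hz⟩ := by
      apply Subtype.ext
      change z - Γ (bdry1 z) = z
      rw [LinearMap.mem_ker.1 hz.2, map_zero, sub_zero]
    simp only [LinearMap.comp_apply, h1, h2, Submodule.mkQ_apply]
  refine ⟨_, hφ, fun f hf p hp q hq r hr => ?_⟩
  rw [hφ _ (bdry2_mem_cycles1 hf hp hq hr), (Submodule.Quotient.mk_eq_zero _).2, map_zero]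
  exact Submodule.mem_comap.2 (Submodule.subset_span ⟨f, hf, p, hp, q, hq, r, hr, rfl⟩)

variable {S}

/-- A cycle modulo two is the reduction of an integral cycle. -/
theorem exists_integral_lift {β : ModTwoChain} (hβ : IsModTwoCycle β) (hβS : IsSimplicialChain S β) :
    ∃ z ∈ cycles1 S.complex, modTwo z = β := by
  classical
  obtain ⟨Γ, hΓ, hΓ'⟩ := exists_cone S
  have hlift : ∀ x : ZMod 2, ((x.val : ℤ) : ZMod 2) = x := by decide
  let β' : Chain1 := Finsupp.mapRange (fun x : ZMod 2 => (x.val : ℤ)) (by simp) β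
  have hβ' : modTwo β' = β := by
    ext e
    rw [modTwo_apply, Finsupp.mapRange_apply, hlift]
  have hβC : β' ∈ chains1 S.complex := (Finsupp.mem_supported _ _).2 fun e he =>
    hβS e (Finsupp.support_mapRange he)
  -- An arbitrary integral lift has boundary 2D. Here D has augmentation zero, so D = ∂ΓD, and
  -- subtracting 2ΓD gives a cycle with the same reduction.
  have hev : ∀ v, Even (bdry1 β' v) := by
    intro v
    have h := hβ (Pi.single v 1)
    have h2 : Finsupp.linearCombination (ZMod 2)
        (fun e : R3 × R3 => ((bdry1 (Finsupp.single e 1) v : ℤ) : ZMod 2)) (modTwo β') =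
        (bdry1 β' v : ZMod 2) :=
      linearCombination_modTwo (φ := ((Finsupp.lapply v : (R3 →₀ ℤ) →ₗ[ℤ] ℤ) ∘ₗ
        bdry1).toAddMonoidHom) β'
    rw [← ZMod.intCast_eq_zero_iff_even, ← h2, hβ', ← h]
    refine linearCombination_congr fun e _ => ?_
    rw [bdry1_single]
    have hneg : ∀ y : ZMod 2, -y = y := by decide
    rw [Finsupp.sub_apply, Int.cast_sub, sub_eq_add_neg, hneg, add_comm]
    simp only [Finsupp.single_apply, Pi.single_apply, Int.cast_ite, Int.cast_one, Int.cast_zero,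
      eq_comm]
  choose d hd using fun v => (even_iff_exists_two_mul.1 (hev v))
  let D : R3 →₀ ℤ := Finsupp.onFinset (bdry1 β').support d fun v hv => by
    rw [Finsupp.mem_support_iff, hd v]; exact mul_ne_zero two_ne_zero hv
  have hD : bdry1 β' = (2 : ℤ) • D := by
    ext v
    rw [hd v]; rfl
  have hDs : D ∈ Finsupp.supported ℤ ℤ (vertexSet S.complex) :=
    (Finsupp.mem_supported _ _).2 fun v hv =>
      (Finsupp.mem_supported _ _).1 (bdry1_mem_supported hβC) (Finsupp.support_onFinset_subset hv)
  have hD0 : augmentation D = 0 := by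
    have := augmentation_bdry1 β'
    rw [hD, map_smul, smul_eq_mul] at this
    exact (mul_eq_zero.1 this).resolve_left two_ne_zero
  refine ⟨β' - (2 : ℤ) • Γ D, ⟨sub_mem hβC (Submodule.smul_mem _ _ (hΓ D hDs)), ?_⟩, ?_⟩
  · change bdry1 _ = 0
    rw [map_sub, map_smul, hΓ' D hDs hD0, hD, sub_self]
  · rw [map_sub, modTwo_zsmul, hβ', show ((2 : ℤ) : ZMod 2) = 0 by decide, zero_smul, sub_zero]

end Homology

/-! ### Cocycles modulo two as sets of interior edges -/

section Cocycles

variable {K : PolygonalKnot} {S : SeifertSurface K} {ψ : R3 → R3 → ZMod 2}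

variable (S ψ) in
/-- A simplicial 1-cocycle modulo two. -/
def IsCocycle : Prop :=
  ∀ f ∈ S.complex.faces, ∀ p ∈ f, ∀ q ∈ f, ∀ r ∈ f, ψ q r + ψ p r + ψ p q = 0

theorem IsCocycle.self (h : IsCocycle S ψ) {f : Finset R3} (hf : f ∈ S.complex.faces) {p : R3}
    (hp : p ∈ f) : ψ p p = 0 := by
  have := h f hf p hp p hp p hp
  revert this
  generalize ψ p p = x
  revert x
  decide

theorem IsCocycle.symm (h : IsCocycle S ψ) {f : Finset R3} (hf : f ∈ S.complex.faces) {p q : R3}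
    (hp : p ∈ f) (hq : q ∈ f) : ψ p q = ψ q p := by
  have h1 := h f hf p hp q hq p hp
  rw [h.self hf hp] at h1
  revert h1
  generalize ψ p q = x
  generalize ψ q p = y
  revert x y
  decide

theorem IsCocycle.add_coboundary (h : IsCocycle S ψ) (g : R3 → ZMod 2) :
    IsCocycle S fun p q => ψ p q + (g p + g q) := by
  intro f hf p hp q hq r hr
  have hchar : ∀ x : ZMod 2, x + x = 0 := by decide
  linear_combination h f hf p hp q hq r hr + hchar (g p) + hchar (g q) + hchar (g r)

open scoped Classical in
/-- The value of a symmetric function of pairs on a two-element set. -/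
noncomputable def edgeValue (ψ : R3 → R3 → ZMod 2) (e : Finset R3) : ZMod 2 :=
  if ∃ p q, p ≠ q ∧ e = {p, q} ∧ ψ p q = 1 then 1 else 0

theorem edgeValue_pair {p q : R3} (hpq : p ≠ q) (h : ψ p q = ψ q p) :
    edgeValue ψ {p, q} = ψ p q := by
  have h01 : ∀ x : ZMod 2, x = 0 ∨ x = 1 := by decide
  rw [edgeValue]
  split_ifs with hex
  · obtain ⟨p', q', -, he, h1⟩ := hex
    rcases eq_or_eq_of_pair_eq (f := (p', q')) hpq he.symm with h2 | h2
    · rw [Prod.mk.injEq] at h2; rw [← h2.1, ← h2.2, h1]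
    · rw [Prod.mk.injEq] at h2; rw [h, ← h2.1, ← h2.2, h1]
  · rcases h01 (ψ p q) with h1 | h1
    · exact h1.symm
    · exact (hex ⟨p, q, hpq, rfl, h1⟩).elim

theorem IsCocycle.edgeValue_eq (h : IsCocycle S ψ) {f : Finset R3}
    (hf : f ∈ S.complex.faces) {p q : R3} (hp : p ∈ f) (hq : q ∈ f) (hpq : p ≠ q) :
    edgeValue ψ {p, q} = ψ p q := edgeValue_pair hpq (h.symm hf hp hq)

variable (S) in
/-- The edges of the surface, as a finite set. -/
noncomputable def edgeFinset : Finset (Finset R3) := (finite_edges S).toFinset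

theorem mem_edgeFinset {e : Finset R3} : e ∈ edgeFinset S ↔ e ∈ edges S.complex := by
  simp [edgeFinset]

open scoped Classical in
theorem filter_edgeFinset_subset {t : Finset R3} (ht : t ∈ triangles S.complex) :
    (edgeFinset S).filter (· ⊆ t) = t.powersetCard 2 := by
  ext e
  rw [Finset.mem_filter, mem_edgeFinset, Finset.mem_powersetCard]
  constructor
  · rintro ⟨⟨-, h⟩, h'⟩
    exact ⟨h', h⟩
  · rintro ⟨h', h⟩
    exact ⟨⟨S.complex.down_closed ht.1 h' (Finset.card_pos.1 (by rw [h]; norm_num)), h⟩, h'⟩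

theorem IsCocycle.sum_triangle (h : IsCocycle S ψ) {t : Finset R3} (ht : t ∈ triangles S.complex) :
    ∑ e ∈ t.powersetCard 2, edgeValue ψ e = 0 := by
  classical
  obtain ⟨p, q, r, hpq, hpr, hqr, rfl⟩ := Finset.card_eq_three.1 ht.2
  have h1 : ({p, q} : Finset R3) ≠ {p, r} := fun h => by
    have : q ∈ ({p, r} : Finset R3) := by rw [← h]; simp
    simp [hpq.symm, hqr] at this
  have h2 : ({p, q} : Finset R3) ≠ {q, r} := fun h => by
    have : p ∈ ({q, r} : Finset R3) := by rw [← h]; simp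
    simp [hpq, hpr] at this
  have h3 : ({p, r} : Finset R3) ≠ {q, r} := fun h => by
    have : p ∈ ({q, r} : Finset R3) := by rw [← h]; simp
    simp [hpq, hpr] at this
  have hset : Finset.powersetCard 2 ({p, q, r} : Finset R3) = {{p, q}, {p, r}, {q, r}} := by
    symm
    apply Finset.eq_of_subset_of_card_le
    · intro e he
      simp only [Finset.mem_insert, Finset.mem_singleton] at he
      rw [Finset.mem_powersetCard]
      rcases he with rfl | rfl | rfl
      · exact ⟨by intro x; simp; tauto, Finset.card_pair hpq⟩
      · exact ⟨by intro x; simp; tauto, Finset.card_pair hpr⟩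
      · exact ⟨by intro x; simp; tauto, Finset.card_pair hqr⟩
    · rw [Finset.card_powersetCard, ht.2]
      exact (Finset.card_eq_three.2 ⟨_, _, _, h1, h2, h3, rfl⟩).ge
  rw [hset, Finset.sum_insert, Finset.sum_insert, Finset.sum_singleton,
    h.edgeValue_eq ht.1 (by simp) (by simp) hpq, h.edgeValue_eq ht.1 (by simp) (by simp) hpr,
    h.edgeValue_eq ht.1 (by simp) (by simp) hqr]
  · rw [← h _ ht.1 p (by simp) q (by simp) r (by simp)]; ring
  · simpa using h3
  · simp [h1, h2]

theorem card_trianglesAt {e : Finset R3} (he : e ∈ edges S.complex) :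
    (trianglesAt S e).card = 1 ∨ (trianglesAt S e).card = 2 := by
  have h1 : (trianglesAt S e).card ≤ 2 := by
    have := S.edge_le_two e he
    rwa [show {t | t ∈ triangles S.complex ∧ e ⊆ t} = (trianglesAt S e : Set (Finset R3)) by
      ext t; simp [mem_trianglesAt], Set.ncard_coe_finset] at this
  obtain ⟨t, ht, het⟩ := S.pure e he.1
  have : 0 < (trianglesAt S e).card := Finset.card_pos.2 ⟨t, mem_trianglesAt S |>.2 ⟨ht, het⟩⟩
  omega

theorem card_trianglesAt_eq_one {e : Finset R3} :
    (trianglesAt S e).card = 1 ↔ ∃! t, t ∈ triangles S.complex ∧ e ⊆ t := by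
  rw [Finset.card_eq_one]
  constructor
  · rintro ⟨t, ht⟩
    refine ⟨t, mem_trianglesAt S |>.1 (by rw [ht]; simp), fun t' ht' => ?_⟩
    have := (mem_trianglesAt S).2 ht'
    rwa [ht, Finset.mem_singleton] at this
  · rintro ⟨t, ht, hu⟩
    refine ⟨t, Finset.ext fun t' => ?_⟩
    rw [mem_trianglesAt, Finset.mem_singleton]
    exact ⟨fun h => hu t' h, fun h => h ▸ ht⟩

open scoped Classical in
/-- The values of a cocycle on the boundary edges add up to zero. -/
theorem IsCocycle.sum_boundary (h : IsCocycle S ψ) :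
    ∑ e ∈ (edgeFinset S).filter (fun e => (trianglesAt S e).card = 1), edgeValue ψ e = 0 := by
  -- In the sum over all triangles a boundary edge occurs once and an interior edge twice.
  have h1 : ∑ t ∈ (finite_triangles S).toFinset, ∑ e ∈ (edgeFinset S).filter (· ⊆ t),
      edgeValue ψ e = 0 := Finset.sum_eq_zero fun t ht => by
    have ht' : t ∈ triangles S.complex := by simpa using ht
    rw [filter_edgeFinset_subset ht', h.sum_triangle ht']
  simp only [Finset.sum_filter] at h1 ⊢
  rw [Finset.sum_comm] at h1
  refine Eq.trans ?_ h1
  refine Finset.sum_congr rfl fun e he => ?_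
  rw [← Finset.sum_filter, Finset.sum_const]
  change _ = (trianglesAt S e).card • _
  rcases card_trianglesAt (mem_edgeFinset.1 he) with hc | hc
  · rw [if_pos hc, hc, one_smul]
  · rw [if_neg (by omega), hc]
    exact (even_nsmul_eq_zero (M := ZMod 2) even_two _).symm

theorem lineMap_half_comm (p q : R3) :
    AffineMap.lineMap p q (1 / 2 : ℝ) = AffineMap.lineMap q p (1 / 2 : ℝ) := by
  rw [AffineMap.lineMap_apply_module, AffineMap.lineMap_apply_module]
  module

/-- A function on the vertices of a closed polygon with prescribed differences of sum zero. -/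
theorem exists_primitive (P : PolygonalKnot) (h : ZMod P.n → ZMod 2)
    (hsum : ∀ _ : Fintype (ZMod P.n), ∑ i, h i = 0) :
    ∃ g : R3 → ZMod 2, ∀ i, g (P.vertex i) + g (P.vertex (i + 1)) = h i := by
  classical
  obtain ⟨n, h3, vertex, simple⟩ := P
  obtain ⟨k, rfl⟩ : ∃ k, n = k + 1 := ⟨n - 1, by omega⟩
  have hinj : Function.Injective vertex := fun i j hij =>
    (simple i j 0 ⟨le_rfl, one_pos⟩ 0 ⟨le_rfl, one_pos⟩ (by simpa using hij)).1
  change ZMod (k + 1) → ZMod 2 at h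
  have hs : ∑ j ∈ Finset.range (k + 1), h (j : ZMod (k + 1)) = 0 := by
    rw [← hsum (inferInstanceAs (Fintype (Fin (k + 1))))]
    change _ = ∑ i : Fin (k + 1), h i
    rw [← Fin.sum_univ_eq_sum_range (fun j => h (j : ZMod (k + 1)))]
    refine Finset.sum_congr rfl fun i _ => congrArg h ?_
    exact Fin.cast_val_eq_self i
  -- The primitive is given by partial sums along the polygon; they close up at the last edge
  -- because the total is zero.
  let F : ℕ → ZMod 2 := fun N => ∑ j ∈ Finset.range N, h (j : ZMod (k + 1))
  have hF : ∀ i : ZMod (k + 1), F i.val + F (i + 1).val = h i := by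
    intro i
    have hchar : ∀ x : ZMod 2, x + x = 0 := by decide
    have hFs : F (i.val + 1) = F i.val + h i := by
      simp only [F]
      rw [Finset.sum_range_succ, ZMod.natCast_zmod_val]
    have hlt := ZMod.val_lt i
    have hv : F (i + 1).val = F (i.val + 1) := by
      rcases Nat.lt_or_ge (i.val + 1) (k + 1) with hlt' | hge
      · rw [ZMod.val_add_of_lt, ZMod.val_one'']
        · omega
        · rw [ZMod.val_one'']
          · exact hlt'
          · omega
      · have e1 : i.val + 1 = k + 1 := by omega
        have e2 : i + 1 = 0 := by
          have := congrArg (Nat.cast : ℕ → ZMod (k + 1)) e1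
          rw [ZMod.natCast_self] at this
          rw [← this]; push_cast; rw [ZMod.natCast_zmod_val]
        rw [e2, e1, ZMod.val_zero]
        simp only [F]
        rw [hs, Finset.sum_range_zero]
    rw [hv, hFs]
    linear_combination hchar (F i.val)
  refine ⟨fun p => F (Function.invFun vertex p).val, fun i => ?_⟩
  simp only [Function.leftInverse_invFun hinj _]
  exact hF i

open scoped Classical in
/-- Every cocycle is cohomologous to one given by a set of interior edges. -/
theorem IsCocycle.exists_isDualCycle (h : IsCocycle S ψ) : ∃ E, IsDualCycle S E ∧
    ∀ α : ModTwoChain, IsModTwoCycle α → IsSimplicialChain S α → Finsupp.linearCombination (ZMod 2)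
      (fun f : R3 × R3 => if {f.1, f.2} ∈ E then (1 : ZMod 2) else 0) α =
      Finsupp.linearCombination (ZMod 2) (fun f : R3 × R3 => ψ f.1 f.2) α := by
  obtain ⟨P, -, hP⟩ := S.boundary
  have hPe : ∀ i, {P.vertex i, P.vertex (i + 1)} ∈ edges S.complex ∧
      (trianglesAt S {P.vertex i, P.vertex (i + 1)}).card = 1 := by
    intro i
    obtain ⟨h1, h2⟩ := (hP {P.vertex i, P.vertex (i + 1)}).2 ⟨i, by simp⟩
    exact ⟨h1, card_trianglesAt_eq_one.2 h2⟩
  have hPne : ∀ i, P.vertex i ≠ P.vertex (i + 1) := by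
    intro i hi
    have := (hPe i).1.2
    rw [← hi] at this
    simp at this
  have hn : NeZero P.n := ⟨by have := P.three_le; omega⟩
  -- The boundary is one closed polygon on which ψ adds up to zero, so ψ is a coboundary there, and
  -- adding this coboundary makes it vanish on every boundary edge. It is essential that the
  -- boundary is a knot and not a link with several components.
  obtain ⟨g, hg⟩ := exists_primitive P (fun i => ψ (P.vertex i) (P.vertex (i + 1))) (by
    intro _
    rw [← h.sum_boundary]
    have himg : (edgeFinset S).filter (fun e => (trianglesAt S e).card = 1) =
        Finset.univ.image fun i => {P.vertex i, P.vertex (i + 1)} := by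
      ext e
      rw [Finset.mem_filter, mem_edgeFinset, card_trianglesAt_eq_one, hP e, Finset.mem_image]
      constructor
      · rintro ⟨i, hi⟩
        exact ⟨i, Finset.mem_univ _, Finset.coe_injective (by rw [hi]; simp)⟩
      · rintro ⟨i, -, hi⟩
        exact ⟨i, by rw [← hi]; simp⟩
    rw [himg, Finset.sum_image]
    · exact Finset.sum_congr rfl fun i _ =>
        (h.edgeValue_eq (hPe i).1.1 (by simp) (by simp) (hPne i)).symm
    -- Different edges of the polygon have different midpoints, and the midpoint does not depend on
    -- the order of the end points.
    · intro i _ j _ hij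
      have hhalf : (1 / 2 : ℝ) ∈ Set.Ico (0 : ℝ) 1 := ⟨by norm_num, by norm_num⟩
      refine (P.simple i j (1 / 2) hhalf (1 / 2) hhalf ?_).1
      rcases eq_or_eq_of_pair_eq (f := (P.vertex i, P.vertex (i + 1))) (hPne j) hij with h2 | h2
      · rw [Prod.mk.injEq] at h2; rw [h2.1, h2.2]
      · rw [Prod.mk.injEq] at h2; rw [h2.1, h2.2, lineMap_half_comm])
  have h' := h.add_coboundary g
  set ψ' : R3 → R3 → ZMod 2 := fun p q => ψ p q + (g p + g q) with hψ'
  have h01 : ∀ x : ZMod 2, x = 0 ∨ x = 1 := by decide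
  refine ⟨(edgeFinset S).filter fun e => edgeValue ψ' e = 1, ⟨fun e he => ?_, fun e he => ?_,
    fun t ht => ?_⟩, fun α hα hαS => ?_⟩
  · exact mem_edgeFinset.1 (Finset.mem_filter.1 he).1
  · obtain ⟨h1, h2⟩ := Finset.mem_filter.1 he
    rw [mem_edgeFinset] at h1
    refine (card_trianglesAt h1).resolve_left fun hc => ?_
    obtain ⟨i, hi⟩ := (hP e).1 ⟨h1, card_trianglesAt_eq_one.1 hc⟩
    have hi' : e = {P.vertex i, P.vertex (i + 1)} := Finset.coe_injective (by rw [hi]; simp)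
    rw [hi', h'.edgeValue_eq (hPe i).1.1 (by simp) (by simp) (hPne i)] at h2
    simp only [hψ', hg i] at h2
    rw [(by decide : ∀ x : ZMod 2, x + x = 0)] at h2
    exact zero_ne_one h2
  · rw [← ZMod.natCast_eq_zero_iff_even, Finset.filter_filter, ← Finset.sum_boole]
    refine Eq.trans ?_ (h'.sum_triangle ht)
    rw [← filter_edgeFinset_subset ht, Finset.sum_filter]
    refine Finset.sum_congr rfl fun e _ => ?_
    by_cases het : e ⊆ t
    · rcases h01 (edgeValue ψ' e) with h1 | h1 <;> simp [h1, het]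
    · simp [het]
  · have h0 := hα g
    have e1 : Finsupp.linearCombination (ZMod 2) (fun f : R3 × R3 => ψ' f.1 f.2) α =
        Finsupp.linearCombination (ZMod 2) (fun f : R3 × R3 => ψ f.1 f.2) α := by
      rw [← add_zero (Finsupp.linearCombination (ZMod 2) (fun f : R3 × R3 => ψ f.1 f.2) α), ← h0]
      simp only [Finsupp.linearCombination_apply, Finsupp.sum, ← Finset.sum_add_distrib, ← smul_add,
        hψ']
    rw [← e1]
    refine linearCombination_congr fun f hf => ?_
    obtain ⟨s, hs, hp, hq⟩ := hαS f hf
    by_cases hpq : f.1 = f.2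
    · rw [if_neg, ← hpq, h'.self hs hp]
      intro hm
      have := (mem_edgeFinset.1 (Finset.mem_filter.1 hm).1).2
      rw [hpq] at this
      simp at this
    · have hmem : ({f.1, f.2} : Finset R3) ∈ edgeFinset S := by
        rw [mem_edgeFinset]
        refine ⟨S.complex.down_closed hs ?_ (by simp), Finset.card_pair hpq⟩
        intro x hx
        simp only [Finset.mem_insert, Finset.mem_singleton] at hx
        rcases hx with rfl | rfl <;> assumption
      have hval := h'.edgeValue_eq hs hp hq hpq
      have hiff : ({f.1, f.2} : Finset R3) ∈ (edgeFinset S).filter (fun e => edgeValue ψ' e = 1) ↔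
          ψ' f.1 f.2 = 1 := by
        rw [Finset.mem_filter, hval]; simp [hmem]
      rcases h01 (ψ' f.1 f.2) with h1 | h1
      · rw [if_neg (by rw [hiff, h1]; decide), h1]
      · rw [if_pos (hiff.2 h1), h1]

end Cocycles

/-! ### Non-degeneracy of the symmetrized Seifert form -/

section Nondegeneracy

variable {K : PolygonalKnot} {S : SeifertSurface K}

/-- Linking with the push-off, as a function of the chain that is pushed. -/
theorem linkTwo_pushTwo_add {ε : ℝ} (hε : IsCollarWidth S ε) {α β β' : ModTwoChain}
    (hα : IsModTwoCycle α) (hαS : IsSimplicialChain S α) (hβ : IsModTwoCycle β)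
    (hβS : IsSimplicialChain S β) (hβ' : IsModTwoCycle β') (hβS' : IsSimplicialChain S β') {τ : ℝ}
    (hτ : τ ∈ Set.Icc (-ε) ε) (hτ0 : τ ≠ 0) :
    linkTwo α (pushTwo S τ (β + β')) = linkTwo α (pushTwo S τ β) + linkTwo α (pushTwo S τ β') := by
  have hε0 : 0 ≤ ε := by linarith [hτ.1, hτ.2]
  have hd : ∀ {β : ModTwoChain}, IsSimplicialChain S β → DisjointChains α (pushTwo S τ β) := by
    intro β hβS
    have := disjointChains_pushTwo hε hαS hβS (s := 0) ⟨by linarith, hε0⟩ hτ hτ0.symm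
    rwa [pushTwo_zero] at this
  rw [← linkTwo_add_right hα (hβ.pushTwo S τ) (hβ'.pushTwo S τ) (hd hβS) (hd hβS'), pushTwo,
    Finsupp.mapDomain_add]
  rfl

/-- A function that is additive on the cycles modulo two of the surface and vanishes on the boundaries
of triangles and on the cycles of a basis of the homology vanishes. -/
theorem eq_zero_of_additive {m : ℕ} {a : Fin m → cycles1 S.complex}
    {b : Module.Basis (Fin m) ℤ (H1 S.complex)} (hb : ∀ i, b i = Submodule.Quotient.mk (a i))
    {Φ : ModTwoChain → ZMod 2} (h0 : Φ 0 = 0)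
    (hadd : ∀ β β', IsModTwoCycle β → IsSimplicialChain S β → IsModTwoCycle β' →
      IsSimplicialChain S β' → Φ (β + β') = Φ β + Φ β')
    (htri : ∀ f ∈ S.complex.faces, ∀ p ∈ f, ∀ q ∈ f, ∀ r ∈ f, Φ (triangleBdry p q r) = 0)
    (ha : ∀ j, Φ (modTwo (a j)) = 0) {β : ModTwoChain} (hβ : IsModTwoCycle β)
    (hβS : IsSimplicialChain S β) : Φ β = 0 := by
  -- The integral chains whose reductions are cycles on which Φ vanishes form a subgroup. It
  -- contains the boundaries and the basis cycles, hence all integral cycles, and every cycle modulo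
  -- two on the surface lifts to one.
  let N : Submodule ℤ Chain1 :=
    { carrier := {c | IsModTwoCycle (modTwo c) ∧ IsSimplicialChain S (modTwo c) ∧ Φ (modTwo c) = 0}
      add_mem' := by
        rintro c c' ⟨h1, h2, h3⟩ ⟨h1', h2', h3'⟩
        refine ⟨?_, ?_, ?_⟩
        · rw [map_add]; exact h1.add h1'
        · rw [map_add]; exact h2.add h2'
        · rw [map_add, hadd _ _ h1 h2 h1' h2', h3, h3', add_zero]
      zero_mem' := by
        refine ⟨?_, ?_, ?_⟩
        · rw [map_zero]; exact isModTwoCycle_zero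
        · rw [map_zero]; intro e he; simp at he
        · rw [map_zero, h0]
      smul_mem' := by
        rintro n c ⟨h1, h2, h3⟩
        refine ⟨?_, ?_, ?_⟩
        · rw [modTwo_zsmul]; exact h1.smul _
        · rw [modTwo_zsmul]; exact h2.smul _
        · rw [modTwo_zsmul]
          rcases (by decide : ∀ x : ZMod 2, x = 0 ∨ x = 1) (n : ZMod 2) with hn | hn
          · rw [hn, zero_smul, h0]
          · rw [hn, one_smul, h3] }
  have hcyc : ∀ z ∈ cycles1 S.complex, IsModTwoCycle (modTwo z) ∧ IsSimplicialChain S (modTwo z) :=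
    fun z hz => ⟨isModTwoCycle_modTwo hz.2, isSimplicialChain_modTwo hz.1⟩
  have hbd : boundaries1 S.complex ≤ N := by
    rw [boundaries1, Submodule.span_le]
    rintro _ ⟨f, hf, p, hp, q, hq, r, hr, rfl⟩
    obtain ⟨h1, h2⟩ := hcyc _ (bdry2_mem_cycles1 hf hp hq hr)
    refine ⟨h1, h2, ?_⟩
    rw [modTwo_bdry2]
    exact htri f hf p hp q hq r hr
  obtain ⟨z, hz, rfl⟩ := exists_integral_lift hβ hβS
  have hsum := b.sum_repr (Submodule.Quotient.mk ⟨z, hz⟩)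
  set n := b.repr (Submodule.Quotient.mk ⟨z, hz⟩)
  have hdiff : (⟨z, hz⟩ - ∑ i, n i • a i : cycles1 S.complex) ∈
      (boundaries1 S.complex).submoduleOf (cycles1 S.complex) := by
    rw [← Submodule.Quotient.mk_eq_zero, Submodule.Quotient.mk_sub, sub_eq_zero, ← hsum]
    simp only [hb]
    rw [← Submodule.mkQ_apply, map_sum]
    rfl
  have h1 : z - ∑ i, n i • (a i : Chain1) ∈ N := by
    have := hbd (Submodule.mem_comap.1 hdiff)
    simpa using this
  have h2 : ∑ i, n i • (a i : Chain1) ∈ N := Submodule.sum_mem _ fun i _ => Submodule.smul_mem _ _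
    ⟨(hcyc _ (a i).2).1, (hcyc _ (a i).2).2, ha i⟩
  have h3 := add_mem h1 h2
  rw [sub_add_cancel] at h3
  exact h3.2.2

/-- The symmetrized Seifert form is non-degenerate modulo two. -/
theorem det_symSeifert_modTwo_ne_zero {m : ℕ} {V : Matrix (Fin m) (Fin m) ℤ}
    (hV : S.IsSeifertMatrix V) : ((V + V.transpose).map (Int.cast : ℤ → ZMod 2)).det ≠ 0 := by
  classical
  obtain ⟨a, b, hb, hlk⟩ := hV
  -- A kernel vector x with x k = 1 yields the cycle α = ∑ xᵢ aᵢ, whose symmetrized linking with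
  -- every cycle is zero. But the k-th coordinate of α is 1, and this is its symmetrized linking
  -- with the cycle dual to that coordinate.
  intro hdet
  obtain ⟨x, hx0, hx⟩ := Matrix.exists_mulVec_eq_zero_iff.2 hdet
  obtain ⟨k, hk⟩ := Function.ne_iff.1 hx0
  have h01 : ∀ y : ZMod 2, y = 0 ∨ y = 1 := by decide
  have hxk : x k = 1 := (h01 _).resolve_left hk
  have hVx : ∀ j, ∑ i, x i * ((V i j : ZMod 2) + (V j i : ZMod 2)) = 0 := by
    intro j
    have := congrFun hx j
    simp only [Matrix.mulVec, dotProduct, Matrix.map_apply, Matrix.add_apply, Matrix.transpose_apply,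
      Pi.zero_apply, Int.cast_add] at this
    rw [← this]
    exact Finset.sum_congr rfl fun i _ => by ring
  have hc : ∀ i, IsModTwoCycle (modTwo (a i)) := fun i => isModTwoCycle_modTwo (a i).2.2
  have hs : ∀ i, IsSimplicialChain S (modTwo (a i)) := fun i => isSimplicialChain_modTwo (a i).2.1
  set I := Finset.univ.filter fun i => x i = 1 with hI
  have hxI : ∀ F : Fin m → ZMod 2, ∑ i ∈ I, F i = ∑ i, x i * F i := by
    intro F
    rw [hI, Finset.sum_filter]
    refine Finset.sum_congr rfl fun i _ => ?_
    rcases h01 (x i) with h | h <;> simp [h]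
  set α : ModTwoChain := ∑ i ∈ I, modTwo (a i) with hαdef
  have hα : IsModTwoCycle α := .sum fun i _ => hc i
  have hαS : IsSimplicialChain S α := .sum fun i _ => hs i
  -- the dual cycle
  obtain ⟨φ, hφ, hφ'⟩ := exists_cocycle S (b.coord k)
  have hψ : IsCocycle S fun p q => (φ (Finsupp.single (p, q) 1) : ZMod 2) := by
    intro f hf p hp q hq r hr
    have := congrArg (Int.cast : ℤ → ZMod 2) (hφ' f hf p hp q hq r hr)
    rw [bdry2, map_add, map_sub] at this
    push_cast at this
    rw [sub_eq_add_neg, (by decide : ∀ y : ZMod 2, -y = y)] at this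
    exact this
  obtain ⟨E, hE, hEα⟩ := hψ.exists_isDualCycle
  have hval : Finsupp.linearCombination (ZMod 2)
      (fun f : R3 × R3 => (φ (Finsupp.single (f.1, f.2) 1) : ZMod 2)) α = 1 := by
    have h1 : ∀ i, Finsupp.linearCombination (ZMod 2)
        (fun f : R3 × R3 => (φ (Finsupp.single (f.1, f.2) 1) : ZMod 2)) (modTwo (a i)) =
        if i = k then 1 else 0 := by
      intro i
      have h2 := linearCombination_modTwo (φ := φ.toAddMonoidHom) (a i : Chain1)
      have h3 : φ (a i : Chain1) = if i = k then 1 else 0 := by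
        rw [hφ _ (a i).2]
        change b.coord k (Submodule.Quotient.mk (a i)) = _
        rw [← hb, Module.Basis.coord_apply, b.repr_self, Finsupp.single_apply]
      refine h2.trans ?_
      change ((φ (a i : Chain1) : ℤ) : ZMod 2) = _
      rw [h3]
      split_ifs <;> simp
    rw [hαdef, map_sum, Finset.sum_congr rfl fun i _ => h1 i, Finset.sum_ite_eq' I k, if_pos]
    rw [hI, Finset.mem_filter]
    exact ⟨Finset.mem_univ _, hxk⟩
  obtain ⟨β, hβ, hβS, hev⟩ := exists_dual_cycle hE hα hαS
  obtain ⟨ε, hε0, hε⟩ := exists_isCollarWidth S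
  have hlk' : ∀ᶠ τ in 𝓝[>] (0 : ℝ), ∀ i j,
      IsLinkingNumber (a i) (S.pushChain τ (a j)) (V i j) :=
    Filter.eventually_all.2 fun i => Filter.eventually_all.2 fun j => hlk i j
  obtain ⟨τ, ⟨⟨h1, h2⟩, hτ0⟩, hτε⟩ := (((hev.and hlk').and self_mem_nhdsWithin).and
    ((eventually_le_nhds hε0).filter_mono nhdsWithin_le_nhds)).exists
  have hτ0 : 0 < τ := hτ0
  rw [hEα α hα hαS, hval] at h1
  have hV' : ∀ i j, linkTwo (modTwo (a i)) (pushTwo S τ (modTwo (a j))) = (V i j : ZMod 2) := by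
    intro i j
    rw [← modTwo_pushChain]
    exact (h2 i j).linkTwo_eq (a i).2.2 (bdry1_pushChain (a j).2.2 τ)
  -- the symmetrized linking form
  have hp : τ ∈ Set.Icc (-ε) ε := ⟨by linarith, hτε⟩
  have hm : -τ ∈ Set.Icc (-ε) ε := ⟨by linarith, by linarith⟩
  have hm0 : -τ ≠ 0 := by linarith
  have hsum : ∀ {γ : ModTwoChain}, IsModTwoCycle γ → IsSimplicialChain S γ →
      linkTwo γ (pushTwo S τ α) = ∑ i ∈ I, linkTwo γ (pushTwo S τ (modTwo (a i))) := by
    intro γ hγ hγS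
    rw [hαdef, pushTwo, Finsupp.mapDomain_finsetSum]
    refine linkTwo_sum_right hγ (fun i _ => (hc i).pushTwo S τ) fun i _ => ?_
    have := disjointChains_pushTwo hε hγS (hs i) (s := 0) ⟨by linarith, hε0.le⟩ hp hτ0.ne
    rwa [pushTwo_zero] at this
  have hsum' : ∀ {γ : ModTwoChain}, IsModTwoCycle γ → IsSimplicialChain S γ →
      linkTwo α (pushTwo S τ γ) = ∑ i ∈ I, linkTwo (modTwo (a i)) (pushTwo S τ γ) := by
    intro γ hγ hγS
    have hd : ∀ {δ : ModTwoChain}, IsSimplicialChain S δ → DisjointChains δ (pushTwo S τ γ) := by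
      intro δ hδS
      have := disjointChains_pushTwo hε hδS hγS (s := 0) ⟨by linarith, hε0.le⟩ hp hτ0.ne
      rwa [pushTwo_zero] at this
    rw [linkTwo_comm hα (hγ.pushTwo S τ) (hd hαS), hαdef,
      linkTwo_sum_right (hγ.pushTwo S τ) (fun i _ => hc i) fun i _ => (hd (hs i)).symm]
    exact Finset.sum_congr rfl fun i _ =>
      (linkTwo_comm (hc i) (hγ.pushTwo S τ) (hd (hs i))).symm
  -- By `linkTwo_pushTwo_neg` the second summand is the linking of γ with the push-off of α, so on
  -- the basis cycle a_j the sum is the j-th entry of (V + Vᵀ)x. Keeping α in the first slot makes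
  -- both summands additive in γ and zero on triangles.
  have hzero : linkTwo α (pushTwo S τ β) + linkTwo α (pushTwo S (-τ) β) = 0 := by
    refine eq_zero_of_additive hb
      (Φ := fun γ => linkTwo α (pushTwo S τ γ) + linkTwo α (pushTwo S (-τ) γ)) ?_ ?_ ?_ ?_ hβ hβS
    · simp [pushTwo, linkTwo_zero_right]
    · intro γ γ' hγ hγS hγ' hγS'
      rw [linkTwo_pushTwo_add hε hα hαS hγ hγS hγ' hγS' hp hτ0.ne',
        linkTwo_pushTwo_add hε hα hαS hγ hγS hγ' hγS' hm hm0]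
      ring
    · intro f hf p hp' q hq r hr
      have htri : ∀ σ, pushTwo S σ (triangleBdry p q r) = triangleBdry
          (pushPoint S.normal σ (Finsupp.single p 1)) (pushPoint S.normal σ (Finsupp.single q 1))
          (pushPoint S.normal σ (Finsupp.single r 1)) := by
        intro σ
        simp only [pushTwo, triangleBdry, Finsupp.mapDomain_add, Finsupp.mapDomain_single,
          pushPoint_single]
        rfl
      rw [htri, htri, linkTwo_pushed_triangle hε hα hαS hp hτ0.ne' hf (single_mem_weights hp')
        (single_mem_weights hq) (single_mem_weights hr),
        linkTwo_pushed_triangle hε hα hαS hm hm0 hf (single_mem_weights hp')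
        (single_mem_weights hq) (single_mem_weights hr), add_zero]
    · intro j
      rw [← linkTwo_pushTwo_neg hε (hc j) hα (hs j) hαS hτ0 hτε, hsum (hc j) (hs j),
        hsum' (hc j) (hs j), ← Finset.sum_add_distrib, hxI, ← hVx j]
      exact Finset.sum_congr rfl fun i _ => by rw [hV', hV']
  rw [linkTwo_pushTwo_neg hε hβ hα hβS hαS hτ0 hτε, hzero] at h1
  exact zero_ne_one h1

/-- The determinant is odd, and therefore not zero over ℚ. -/
theorem det_symSeifert_ne_zero {m : ℕ} {V : Matrix (Fin m) (Fin m) ℤ}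
    (hV : S.IsSeifertMatrix V) : (symSeifert V).det ≠ 0 := by
  rw [symSeifert_det]
  intro h
  have h0 : (V + V.transpose).det = 0 := by exact_mod_cast h
  apply det_symSeifert_modTwo_ne_zero hV
  have := (Int.castRingHom (ZMod 2)).map_det (V + V.transpose)
  rw [h0, map_zero] at this
  exact this.symm

end Nondegeneracy

end KnotWitt

open KnotWitt in
/-- `V` is a Seifert matrix, for an arbitrary Seifert surface `S` of the knot `K`; `W(K)`, `σ(K)`,
`det K` and `ws(K)` are those of the symmetrized Seifert form `V + Vᵀ`, which is non-degenerate. -/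
theorem theorem1p4 (K : PolygonalKnot) (S : SeifertSurface K) {m : ℕ}
    (V : Matrix (Fin m) (Fin m) ℤ) (hV : S.IsSeifertMatrix V) :
    (symSeifert V).det ≠ 0 ∧
    (knotWittSpan V ≤ 1 ↔
      ∃ d : ℤ, (d = (knotDet V : ℤ) ∨ d = -(knotDet V : ℤ)) ∧
        knotWittClass V = rankOne (d : ℚ) + (knotSignature V - d.sign) • rankOne (1 : ℚ)) ∧
    (knotWittSpan V ≤ 1 →
      (IsSquare (knotDet V) → knotWittSpan V = 0) ∧
      (¬ IsSquare (knotDet V) → knotWittSpan V = 1)) :=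
  ⟨det_symSeifert_ne_zero hV, knotWittSpan_le_one_iff V (det_symSeifert_ne_zero hV)⟩
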